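/- Setting. Let $(\mathfrak X,\mathbb P)$ be a probability space and let $H\subset L^2(\mathfrak X;\mathbb C)$ be a complex Gaussian Hilbert space: a closed complex subspace, stable under complex conjugation, all of whose elements are complex Gaussian random variables with zero mean. Let $P_n$ be the closure in $L^2$ of the polynomials of degree $\le n$ in elements of $H$, let $H^{:0:}=P_0$ and $H^{:n:}=P_{n-1}^{\perp}\cap P_n$ for $n\ge 1$, and let $\pi_n$ be the orthogonal projection of $L^2$ onto $H^{:n:}$. Let $\mathfrak H=\prod_{n\ge0}H^{:n:}$, whose elements are written $X=\sum_{n\ge 0} X^n$, with componentwise complex conjugation and the Wick product $(X\odot Y)^n=\sum_{p+q=n}\pi_n(X^pY^q)$. Limits, derivatives and (unconditional) sums in $\mathfrak H$ are taken componentwise, in $L^2$. Let $\mathbb Z^d_L=L^{-1}\mathbb Z^d$, let $(\mathfrak g_k)_{k\in\mathbb Z^d_L}$ be independent standard complex Gaussians in $H^{:1:}$, and let $\phi$ be a complex-valued Schwartz function on $\mathbb R^d\times\mathbb R^d$. Theorem. For all $d\ge1$, $\lambda>0$, $L>0$ and $\epsilon\ge0$ there is a unique family $(A_k:\mathbb R\times\mathbb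 R^d\to\mathfrak H)_{k\in\mathbb Z^d_L}$ such that (1) for all $k$ and $x$: $A_k(0,x)=\phi(x,k)\,\mathfrak g_k$ if $\epsilon>0$, and $A_k(0,x)=\phi(0,k)\,\mathfrak g_k$ if $\epsilon=0$; (2) for all $k$ and $n$, the component $A_k^n:\mathbb R\times\mathbb R^d\to H^{:n:}$ is differentiable; moreover $A_k^n(t,\cdot)$ is $C^\infty$ for every $t$ and, for all $n,j\in\mathbb N$ and $T>0$, $$\sum_{k\in\mathbb Z^d_L}\ \sup_{|t|\le T,\ x\in\mathbb R^d}\bigl\|D_x^jA_k^n(t,x)\bigr\|<\infty ;$$ (3) for all $k\in\mathbb Z^d_L$, $t\in\mathbb R$ and $x\in\mathbb R^d$, the following holds in $\mathfrak H$, including the convergence of the right-hand side: $$\Bigl(i\partial_t+i\epsilon k\cdot\nabla+\tfrac{\epsilon^2}{4\pi}\Delta\Bigr)A_k=-\frac{\lambda}{L^d}\sum_{k_1-k_2+k_3=k}e^{2\pi it\Omega(k_1,k_2,k_3)}A_{k_1}\odot\overline{A_{k_2}}\odot A_{k_3},$$ where $\Omega(k_1,k_2,k_3)=\frac12\bigl(|k_1-k_2+k_3|^2-|k_1|^2+|k_2|^2-|k_3|^2\bigr)$.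 Moreover $A_k^{2n}=0$ for all $k\in\mathbb Z^d_L$ and $n\in\mathbb N$, and if $(n,k)\ne(n',k')$ then $\mathbb E\bigl[A_k^n(t,x)\overline{A_{k'}^{n'}(t',x')}\bigr]=0$ for all $t,t'\in\mathbb R$ and $x,x'\in\mathbb R^d$. Finally, the series $$u(t,x)=L^{-d/2}\sum_{k\in\mathbb Z^d_L}A_k(t,\epsilon x)\,e^{2\pi i(k\cdot x-|k|^2t/2)}$$ converges in $\mathfrak H$ for all $(t,x)\in\mathbb R\times\mathbb R^d$, and $u$ is the unique $\mathfrak H$-valued function on $\mathbb R\times\mathbb R^d$ such that: each component $u^n$ is differentiable in $(t,x)$ and $C^\infty$ in $x$, with every $x$-derivative $D_x^ju^n$ bounded on $[-T,T]\times\mathbb R^d$ for every $T>0$; $u(0,x)=L^{-d/2}\sum_{k\in\mathbb Z^d_L}\phi(\epsilon x,k)e^{2\pi ik\cdot x}\mathfrak g_k$ for all $x$; and $i\partial_tu+\frac1{4\pi}\Delta u=-\lambda\,u\odot\overline u\odot u$ holds in $\mathfrak H$ at every point of $\mathbb R\times\mathbb R^d$. -/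

import Mathlib

open MeasureTheory ProbabilityTheory
open scoped ENNReal SchwartzMap

noncomputable section

/-- A complex Gaussian Hilbert space over the probability space `(Ω, P)`: a closed complex subspace
of `L²(Ω; ℂ)`, stable under complex conjugation (the complexification of a real Gaussian Hilbert
space), all of whose elements are complex Gaussian random variables with zero expected value. -/
structure GaussianHilbertSpace {Ω : Type*} [MeasurableSpace Ω] (P : Measure Ω) where
  /-- The underlying complex subspace of `L²`. -/
  carrier : Submodule ℂ (Lp ℂ 2 P)
  isClosed : IsClosed (carrier : Set (Lp ℂ 2 P))
  star_mem : ∀ X ∈ carrier, star X ∈ carrier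
  gaussian : ∀ X ∈ carrier, IsGaussian (P.map (X : Ω → ℂ))
  centered : ∀ X ∈ carrier, ∫ ω, X ω ∂P = 0

/-- The law of a standard complex Gaussian: independent real and imaginary parts, each centered
of variance `1/2`. -/
def stdComplexGaussian : Measure ℂ :=
  ((gaussianReal 0 (1 / 2)).prod (gaussianReal 0 (1 / 2))).map
    (fun p : ℝ × ℝ => (p.1 : ℂ) + (p.2 : ℂ) * Complex.I)

/-- The pointwise product of two elements of `L²`, when that product lies in `L²` (as it does for
elements of Wiener chaoses of finite order, which have moments of all orders). -/
def l2Mul {Ω : Type*} [MeasurableSpace Ω] {P : Measure Ω} (X Y : Lp ℂ 2 P) : Lp ℂ 2 P :=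
  open Classical in
  if h : MemLp (fun ω => X ω * Y ω) 2 P then h.toLp else 0

namespace GaussianHilbertSpace

variable {Ω : Type*} [MeasurableSpace Ω] {P : Measure Ω}

/-- The random variables in `L²` that are polynomials in `ℂ[H]` of degree at most `n`. -/
def polynomials (H : GaussianHilbertSpace P) (n : ℕ) : Submodule ℂ (Lp ℂ 2 P) where
  carrier := {X | ∃ p : MvPolynomial H.carrier ℂ, p.totalDegree ≤ n ∧
    (X : Ω → ℂ) =ᵐ[P] fun ω => MvPolynomial.eval (fun h : H.carrier => (h : Lp ℂ 2 P) ω) p}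
  add_mem' := by
    rintro X Y ⟨p, hp, hX⟩ ⟨q, hq, hY⟩
    refine ⟨p + q, (MvPolynomial.totalDegree_add p q).trans (max_le hp hq), ?_⟩
    filter_upwards [Lp.coeFn_add X Y, hX, hY] with ω h1 h2 h3
    rw [h1, Pi.add_apply, h2, h3, map_add]
  zero_mem' := by
    refine ⟨0, by simp, ?_⟩
    filter_upwards [Lp.coeFn_zero ℂ 2 P] with ω h
    rw [h, map_zero, Pi.zero_apply]
  smul_mem' := by
    rintro c X ⟨p, hp, hX⟩
    refine ⟨c • p, (MvPolynomial.totalDegree_smul_le c p).trans hp, ?_⟩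
    filter_upwards [Lp.coeFn_smul c X, hX] with ω h1 h2
    rw [h1, Pi.smul_apply, h2, MvPolynomial.smul_eval, smul_eq_mul]

/-- `Pₙ`: the closure in `L²` of the polynomials of degree at most `n`. -/
def polyClosure (H : GaussianHilbertSpace P) (n : ℕ) : Submodule ℂ (Lp ℂ 2 P) :=
  (H.polynomials n).topologicalClosure

/-- The homogeneous Wiener chaos of order `n`: `P₀` for `n = 0`, and the orthogonal complement of
`Pₙ₋₁` in `Pₙ` for `n ≥ 1`. -/
def chaos (H : GaussianHilbertSpace P) : ℕ → Submodule ℂ (Lp ℂ 2 P)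
  | 0 => H.polyClosure 0
  | n + 1 => (H.polyClosure n)ᗮ ⊓ H.polyClosure (n + 1)

theorem isClosed_polyClosure (H : GaussianHilbertSpace P) (n : ℕ) :
    IsClosed (H.polyClosure n : Set (Lp ℂ 2 P)) :=
  Submodule.isClosed_topologicalClosure _

theorem isClosed_chaos (H : GaussianHilbertSpace P) (n : ℕ) :
    IsClosed (H.chaos n : Set (Lp ℂ 2 P)) := by
  cases n with
  | zero => exact H.isClosed_polyClosure 0
  | succ n =>
    exact (Submodule.isClosed_orthogonal (H.polyClosure n)).inter (H.isClosed_polyClosure (n + 1))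

instance completeSpace_chaos (H : GaussianHilbertSpace P) (n : ℕ) :
    CompleteSpace (H.chaos n) :=
  (H.isClosed_chaos n).completeSpace_coe

/-- The chaos projection `πₙ`. -/
def chaosProj (H : GaussianHilbertSpace P) (n : ℕ) : Lp ℂ 2 P →L[ℂ] H.chaos n :=
  (H.chaos n).orthogonalProjectionOnto

theorem star_mem_polynomials (H : GaussianHilbertSpace P) {n : ℕ} {X : Lp ℂ 2 P}
    (hX : X ∈ H.polynomials n) : star X ∈ H.polynomials n := by
  obtain ⟨p, hp, hX⟩ := hX
  let s : H.carrier → H.carrier := fun h => ⟨star (h : Lp ℂ 2 P), H.star_mem _ h.2⟩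
  refine ⟨MvPolynomial.rename s (MvPolynomial.map (starRingEnd ℂ) p), ?_, ?_⟩
  · refine (MvPolynomial.totalDegree_rename_le _ _).trans (le_trans ?_ hp)
    exact Finset.sup_mono (MvPolynomial.support_map_subset _ _)
  · have hs : ∀ᵐ ω ∂P, ∀ h ∈ p.vars,
        ((s h : H.carrier) : Lp ℂ 2 P) ω = (starRingEnd ℂ) ((h : Lp ℂ 2 P) ω) := by
      rw [Filter.eventually_all_finset]
      intro h _
      filter_upwards [Lp.coeFn_star (h : Lp ℂ 2 P)] with ω hω
      simpa using hω
    filter_upwards [Lp.coeFn_star X, hX, hs] with ω h1 h2 h3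
    rw [h1, Pi.star_apply, h2, MvPolynomial.eval_rename, MvPolynomial.eval_map]
    change (starRingEnd ℂ) _ = _
    rw [← MvPolynomial.coe_eval₂Hom]
    have : ((starRingEnd ℂ).comp (MvPolynomial.eval fun h : H.carrier => (h : Lp ℂ 2 P) ω)) p
        = MvPolynomial.eval₂Hom (starRingEnd ℂ)
          (fun h : H.carrier => (starRingEnd ℂ) ((h : Lp ℂ 2 P) ω)) p := by
      congr 1
      ext <;> simp
    rw [RingHom.comp_apply] at this
    rw [this]
    refine MvPolynomial.eval₂Hom_congr' rfl ?_ rfl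
    intro h hh _
    exact (h3 h hh).symm

theorem inner_star_star (X Y : Lp ℂ 2 P) : inner ℂ (star X) (star Y) = inner ℂ Y X := by
  rw [L2.inner_def, L2.inner_def]
  refine integral_congr_ae ?_
  filter_upwards [Lp.coeFn_star X, Lp.coeFn_star Y] with ω h1 h2
  simp [h1, h2, mul_comm]

theorem continuous_star_l2 : Continuous (star : Lp ℂ 2 P → Lp ℂ 2 P) := by
  refine (Isometry.of_dist_eq fun X Y => ?_).continuous
  have h : star X - star Y = star (X - Y) := by
    refine Lp.ext ?_
    filter_upwards [Lp.coeFn_sub (star X) (star Y), Lp.coeFn_sub X Y, Lp.coeFn_star X,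
      Lp.coeFn_star Y, Lp.coeFn_star (X - Y)] with ω h1 h2 h3 h4 h5
    rw [h1, Pi.sub_apply, h3, h4, h5, Pi.star_apply, Pi.star_apply, Pi.star_apply, h2,
      Pi.sub_apply, star_sub]
  rw [dist_eq_norm, dist_eq_norm, h, Lp.norm_def, Lp.norm_def,
    eLpNorm_congr_ae (Lp.coeFn_star (X - Y)), eLpNorm_star]

theorem star_mem_polyClosure (H : GaussianHilbertSpace P) {n : ℕ} {X : Lp ℂ 2 P}
    (hX : X ∈ H.polyClosure n) : star X ∈ H.polyClosure n :=
  map_mem_closure continuous_star_l2 hX fun _ h => H.star_mem_polynomials h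

theorem star_mem_chaos (H : GaussianHilbertSpace P) {n : ℕ} {X : Lp ℂ 2 P}
    (hX : X ∈ H.chaos n) : star X ∈ H.chaos n := by
  cases n with
  | zero => exact H.star_mem_polyClosure hX
  | succ n =>
    refine ⟨(Submodule.mem_orthogonal _ _).2 fun Y hY => ?_, H.star_mem_polyClosure hX.2⟩
    have h := (Submodule.mem_orthogonal' _ _).1 hX.1 _ (H.star_mem_polyClosure hY)
    rw [← inner_star_star, star_star] at h
    exact h

/-- The direct product `𝔥 = ∏ₙ H^{:n:}` of all homogeneous chaoses (formal sums of chaos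
components), with the product topology. -/
abbrev Formal (H : GaussianHilbertSpace P) : Type _ := ∀ n : ℕ, H.chaos n

/-- Complex conjugation on `𝔥`, componentwise. -/
def conj (H : GaussianHilbertSpace P) (X : H.Formal) : H.Formal :=
  fun n => ⟨star (X n : Lp ℂ 2 P), H.star_mem_chaos (X n).2⟩

/-- The Wick product on `𝔥`: its component of order `n` is `∑_{p+q=n} πₙ (Xᵖ Y^q)`. -/
def wick (H : GaussianHilbertSpace P) (X Y : H.Formal) : H.Formal :=
  fun n => ∑ pq ∈ Finset.HasAntidiagonal.antidiagonal n,
    H.chaosProj n (l2Mul (X pq.1 : Lp ℂ 2 P) (Y pq.2 : Lp ℂ 2 P))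

/-- The embedding of the first chaos into `𝔥`. -/
def ofFirst (H : GaussianHilbertSpace P) (g : H.chaos 1) : H.Formal := Pi.single 1 g

end GaussianHilbertSpace

/-- The lattice point `k = m / L` of `ℤ^d_L = L⁻¹ ℤ^d` with integer coordinates `m`. -/
def wavenumber {d : ℕ} (L : ℝ) (m : Fin d → ℤ) : EuclideanSpace ℝ (Fin d) :=
  WithLp.toLp 2 fun i => (m i : ℝ) / L

/-- The triples `(k₁, k₂, k₃)` of lattice points with `k₁ - k₂ + k₃ = k`. -/
abbrev Triad {d : ℕ} (m : Fin d → ℤ) : Type :=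
  {q : (Fin d → ℤ) × (Fin d → ℤ) × (Fin d → ℤ) // q.1 - q.2.1 + q.2.2 = m}

/-- The resonance factor `Ω(k₁, k₂, k₃)`. -/
def resonance {d : ℕ} (k₁ k₂ k₃ : EuclideanSpace ℝ (Fin d)) : ℝ :=
  (‖k₁ - k₂ + k₃‖ ^ 2 - ‖k₁‖ ^ 2 + ‖k₂‖ ^ 2 - ‖k₃‖ ^ 2) / 2

/-- The phase `e^{2π i θ}`. -/
def phase (θ : ℝ) : ℂ := Complex.exp (2 * Real.pi * Complex.I * θ)

section Equations

variable {Ω : Type*} [MeasurableSpace Ω] {P : Measure Ω}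

open GaussianHilbertSpace

/-- `𝓛 A = i ∂ₜ A + i ε k·∇ A + (4π)⁻¹ ε² Δ A`, chaos component by chaos component. -/
def profileOp {d : ℕ} (H : GaussianHilbertSpace P) (ε : ℝ) (k : EuclideanSpace ℝ (Fin d))
    (A : ℝ → EuclideanSpace ℝ (Fin d) → H.Formal) (t : ℝ) (x : EuclideanSpace ℝ (Fin d)) :
    H.Formal := fun n =>
  Complex.I • deriv (fun s => A s x n) t
    + (Complex.I * ε) • fderiv ℝ (fun y => A t y n) x k
    + ((ε : ℂ) ^ 2 / (4 * Real.pi)) • Laplacian.laplacian (fun y => A t y n) x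

/-- The amplitude of the well-prepared data: `φ(x, k)` for `ε > 0` and `φ(0, k)` for `ε = 0`. -/
def initialAmplitude {d : ℕ} (φ : 𝓢(EuclideanSpace ℝ (Fin d) × EuclideanSpace ℝ (Fin d), ℂ))
    (ε : ℝ) (x k : EuclideanSpace ℝ (Fin d)) : ℂ :=
  open Classical in
  if ε = 0 then φ (0, k) else φ (x, k)

/-- A solution `(A_k)` of the wavepacket profile system with data `A_k(0,x) = φ(x,k) 𝔤_k`. The
last field is the function class: at each chaos order, profiles are smooth in `x`, and all their
spatial derivatives are bounded in `x`, locally uniformly in time, with bounds summable over `k`. -/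
structure IsProfileSolution {d : ℕ} (H : GaussianHilbertSpace P) (lam L ε : ℝ)
    (φ : 𝓢(EuclideanSpace ℝ (Fin d) × EuclideanSpace ℝ (Fin d), ℂ))
    (g : (Fin d → ℤ) → H.chaos 1)
    (A : (Fin d → ℤ) → ℝ → EuclideanSpace ℝ (Fin d) → H.Formal) : Prop where
  initial : ∀ m x, A m 0 x = initialAmplitude φ ε x (wavenumber L m) • H.ofFirst (g m)
  differentiable : ∀ m n,
    Differentiable ℝ (fun p : ℝ × EuclideanSpace ℝ (Fin d) => A m p.1 p.2 n)
  equation : ∀ m t x,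
    HasSum (fun q : Triad m =>
        (-(lam / L ^ d : ℂ) * phase (t * resonance (wavenumber L q.1.1) (wavenumber L q.1.2.1)
            (wavenumber L q.1.2.2))) •
          H.wick (H.wick (A q.1.1 t x) (H.conj (A q.1.2.1 t x))) (A q.1.2.2 t x))
      (profileOp H ε (wavenumber L m) (A m) t x)
  regular : ∀ n, (∀ m t, ContDiff ℝ (⊤ : ℕ∞) (fun x => A m t x n)) ∧
    ∀ (j : ℕ) (T : ℝ), ∃ b : (Fin d → ℤ) → ℝ, Summable b ∧
      ∀ m t x, |t| ≤ T → ‖iteratedFDeriv ℝ j (fun y => A m t y n) x‖ ≤ b m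

/-- `u` is the wavepacket superposition with amplitudes `A_k`. -/
def IsWavepacketSum {d : ℕ} (H : GaussianHilbertSpace P) (L ε : ℝ)
    (A : (Fin d → ℤ) → ℝ → EuclideanSpace ℝ (Fin d) → H.Formal)
    (u : ℝ → EuclideanSpace ℝ (Fin d) → H.Formal) : Prop :=
  ∀ t x, HasSum (fun m : Fin d → ℤ =>
    (((1 / L ^ ((d : ℝ) / 2) : ℝ) : ℂ) *
        phase (inner ℝ (wavenumber L m) x - ‖wavenumber L m‖ ^ 2 * t / 2)) • A m t (ε • x))
    (u t x)

/-- A pointwise solution of the Wick NLS `i ∂ₜ u + (4π)⁻¹ Δ u = -λ u ⊙ ū ⊙ u` with well-prepared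
Gaussian data. The last field is the function class: at each chaos order, `u` is smooth in `x`, and
all its spatial derivatives are bounded in `x`, locally uniformly in time. -/
structure IsWickNLSSolution {d : ℕ} (H : GaussianHilbertSpace P) (lam L ε : ℝ)
    (φ : 𝓢(EuclideanSpace ℝ (Fin d) × EuclideanSpace ℝ (Fin d), ℂ))
    (g : (Fin d → ℤ) → H.chaos 1)
    (u : ℝ → EuclideanSpace ℝ (Fin d) → H.Formal) : Prop where
  initial : ∀ x, HasSum (fun m : Fin d → ℤ =>
    (((1 / L ^ ((d : ℝ) / 2) : ℝ) : ℂ) * φ (ε • x, wavenumber L m) *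
        phase (inner ℝ (wavenumber L m) x)) • H.ofFirst (g m)) (u 0 x)
  differentiable : ∀ n, Differentiable ℝ (fun p : ℝ × EuclideanSpace ℝ (Fin d) => u p.1 p.2 n)
  equation : ∀ t x n,
    Complex.I • deriv (fun s => u s x n) t
        + (1 / (4 * Real.pi) : ℂ) • Laplacian.laplacian (fun y => u t y n) x
      = (-(lam : ℂ) • H.wick (H.wick (u t x) (H.conj (u t x))) (u t x)) n
  regular : ∀ n, (∀ t, ContDiff ℝ (⊤ : ℕ∞) (fun x => u t x n)) ∧
    ∀ (j : ℕ) (T : ℝ), ∃ C : ℝ, ∀ t x, |t| ≤ T →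
      ‖iteratedFDeriv ℝ j (fun y => u t y n) x‖ ≤ C

end Equations

end

/-!
# Wave packet expansion for the Wick nonlinear Schrödinger equation

The Wick product of chaos components of orders `p` and `q` lies in the chaos of order `p + q`. The
data have a component of order one only, so the component of order zero of a solution vanishes, and
the cubic nonlinearity at order `n` involves the components of orders less than `n` only: the
equations are linear Schrödinger equations with known sources, to be solved order by order.

**Existence.** Iterating the Duhamel formula writes the component of order `n` as a finite sum over
ternary trees with `n` leaves, so that even components vanish. The contribution of a tree is a
`Packet`: a superposition of plane waves, parametrized by a measure space, with a lattice momentum, a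
further continuous frequency, and an amplitude dominated by a weight with moments of all orders. The
initial data are such a packet (`Packet.free`), by a partial Fourier transform of `φ`, or with all
frequencies zero if `ε = 0`. The cubic interaction of three packets generates a packet
(`Packet.cubic`), parametrized by the product of the three spaces. Restricting the superposition to
one lattice momentum gives the profile `A_k`, and not restricting it gives `u`, up to normalization.
Both equations are then read off from plane waves (`Packet.hasSum_profile_cubic`,
`Packet.wave_cubic`); smoothness, boundedness and summability over `k` come from the moments of the
weight.

This uses that the Wick product is bounded on chaoses of fixed orders (`wickL`), which follows from
the comparison of the `L⁴` and `L²` norms of Gaussian polynomials of bounded degree, with a constant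
independent of the number of variables (`gaussPoly_hypercontractive`).

**Uniqueness.** The functions are bounded, with bounded derivatives, but not integrable. For linear
systems of Schrödinger equations in this class, `schrodinger_system_unique` estimates the local `L²`
norms with a weight varying at scale `1 / η`. The Laplacian produces a gradient term with a factor
`η`; the gradient is replaced by a finite difference of step `η` and of high order, so that the
estimate closes up to an error which vanishes as `η → 0`. At order zero the nonlinearity is bounded
by a linear coupling of this kind, and at order `n` two solutions that agree at lower orders have
the same source (`IsCubicFlow.unique`, which covers both the profile system and the equation for `u`).

**Orthogonality.** Components of different orders lie in orthogonal chaoses. For each character `χ`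
of the lattice there is a unitary of `H`, commuting with conjugation, that multiplies `𝔤_k` by `χ k`.
Its second quantization is an isometry of the chaoses, multiplicative for the Wick product. Every
wave of lattice momentum `k` has as amplitude an eigenvector for the eigenvalue `χ k`, and hence so
has the profile `A_k`; eigenvectors for distinct eigenvalues are orthogonal
(`inner_eq_zero_of_momentum`).
-/

set_option linter.unusedSectionVars false

/-! ### Hermite polynomials and the standard Gaussian -/

open Polynomial in
theorem integrable_eval_gaussianReal (p : ℝ[X]) :
    Integrable (fun x => p.eval x) (gaussianReal 0 1) := by
  have h : ∀ n : ℕ, Integrable (fun x : ℝ => x ^ n) (gaussianReal 0 1) := fun n => by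
    have := (memLp_id_gaussianReal (μ := 0) (v := 1) (n : NNReal))
    rcases Nat.eq_zero_or_pos n with rfl | hn
    · simp
    · have h1 : MemLp (id : ℝ → ℝ) n (gaussianReal 0 1) := by simpa using this
      have h2 := h1.integrable_norm_pow hn.ne'
      refine (integrable_norm_iff (by fun_prop)).1 (h2.congr ?_)
      filter_upwards with x
      simp
  simp_rw [Polynomial.eval_eq_sum_range]
  exact integrable_finsetSum _ fun i _ => (h i).const_mul _

/-- Stein's identity for the standard Gaussian and a polynomial. -/
theorem integral_mul_eval_gaussianReal (p : Polynomial ℝ) :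
    ∫ x, x * p.eval x ∂(gaussianReal 0 1) = ∫ x, p.derivative.eval x ∂(gaussianReal 0 1) := by
  have hint : ∀ q : Polynomial ℝ, Integrable (fun x => gaussianPDFReal 0 1 x * q.eval x) := by
    intro q
    have := integrable_eval_gaussianReal q
    rw [gaussianReal_of_var_ne_zero 0 one_ne_zero, gaussianPDF_def,
      integrable_withDensity_iff_integrable_smul' (by fun_prop) (by simp)] at this
    refine this.congr ?_
    filter_upwards with x
    rw [ENNReal.toReal_ofReal (gaussianPDFReal_nonneg _ _ _), smul_eq_mul]
  rw [integral_gaussianReal_eq_integral_smul one_ne_zero,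
    integral_gaussianReal_eq_integral_smul one_ne_zero]
  have hder : ∀ x, HasDerivAt (gaussianPDFReal 0 1) (gaussianPDFReal 0 1 x * (-x)) x := by
    intro x
    unfold gaussianPDFReal
    have h1 : HasDerivAt (fun x : ℝ => -(x - 0) ^ 2 / (2 * ((1 : NNReal) : ℝ))) (-x) x := by
      have := ((((hasDerivAt_id x).sub_const 0).pow 2).neg).div_const (2 * ((1 : NNReal) : ℝ))
      refine (this.congr_deriv ?_)
      simp
      ring
    have := (h1.exp).const_mul (Real.sqrt (2 * Real.pi * ((1 : NNReal) : ℝ)))⁻¹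
    refine this.congr_deriv ?_
    ring
  have := integral_mul_deriv_eq_deriv_mul_of_integrable (u := fun x => p.eval x)
    (v := gaussianPDFReal 0 1) (u' := fun x => p.derivative.eval x)
    (v' := fun x => gaussianPDFReal 0 1 x * (-x))
    (fun x _ => p.hasDerivAt x) (fun x _ => hder x)
    (by
      refine ((hint (p * -Polynomial.X))).congr ?_
      filter_upwards with x
      simp
      ring)
    ((hint p.derivative).congr (by filter_upwards with x; simp [mul_comm]))
    ((hint p).congr (by filter_upwards with x; simp [mul_comm]))
  simp only [smul_eq_mul]
  rw [← neg_inj, ← integral_neg]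
  calc _ = ∫ x, p.eval x * (gaussianPDFReal 0 1 x * (-x)) := by
        congr 1; ext x; ring
    _ = _ := by
        rw [this]; congr 2; ext x; ring

/-- The probabilists' Hermite polynomials with real coefficients. -/
noncomputable def realHermite (n : ℕ) : Polynomial ℝ := (Polynomial.hermite n).map (Int.castRingHom ℝ)

theorem realHermite_zero : realHermite 0 = 1 := by simp [realHermite]

theorem realHermite_succ (n : ℕ) : realHermite (n + 1) =
    Polynomial.X * realHermite n - Polynomial.derivative (realHermite n) := by
  simp [realHermite, Polynomial.hermite_succ, Polynomial.derivative_map]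

theorem derivative_realHermite_succ (n : ℕ) : Polynomial.derivative (realHermite (n + 1)) =
    ((n : Polynomial ℝ) + 1) * realHermite n := by
  induction n with
  | zero => simp [realHermite_succ, realHermite_zero]
  | succ n ih =>
    rw [realHermite_succ (n + 1), Polynomial.derivative_sub, Polynomial.derivative_mul,
      Polynomial.derivative_X, ih, Polynomial.derivative_mul]
    have : Polynomial.derivative ((n : Polynomial ℝ) + 1) = 0 := by
      simp
    rw [this, realHermite_succ n]
    push_cast
    ring

theorem derivative_realHermite (n : ℕ) : Polynomial.derivative (realHermite n) =
    (n : Polynomial ℝ) * realHermite (n - 1) := by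
  cases n with
  | zero => simp [realHermite_zero]
  | succ n => rw [derivative_realHermite_succ]; simp

/-- The three-term recurrence. -/
theorem eval_realHermite_mul (n : ℕ) (x : ℝ) : x * (realHermite n).eval x =
    (realHermite (n + 1)).eval x + n * (realHermite (n - 1)).eval x := by
  rw [realHermite_succ, derivative_realHermite]
  simp

theorem integral_realHermite_succ_mul (n : ℕ) (p : Polynomial ℝ) :
    ∫ x, (realHermite (n + 1)).eval x * p.eval x ∂(gaussianReal 0 1) =
      ∫ x, (realHermite n).eval x * p.derivative.eval x ∂(gaussianReal 0 1) := by
  have h := integral_mul_eval_gaussianReal (realHermite n * p)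
  have h1 := integrable_eval_gaussianReal (Polynomial.X * (realHermite n * p))
  have h2 := integrable_eval_gaussianReal (Polynomial.derivative (realHermite n) * p)
  have h3 := integrable_eval_gaussianReal (realHermite n * Polynomial.derivative p)
  simp only [Polynomial.derivative_mul, Polynomial.eval_mul, Polynomial.eval_add,
    Polynomial.eval_X] at h h1 h2 h3
  rw [integral_add h2 h3] at h
  rw [realHermite_succ]
  simp only [Polynomial.eval_sub, Polynomial.eval_mul, Polynomial.eval_X, sub_mul, mul_assoc]
  rw [integral_sub h1 h2, h]
  ring

theorem integral_realHermite_mul (n m : ℕ) :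
    ∫ x, (realHermite n).eval x * (realHermite m).eval x ∂(gaussianReal 0 1) =
      if n = m then (n.factorial : ℝ) else 0 := by
  induction n generalizing m with
  | zero =>
    cases m with
    | zero => simp [realHermite_zero]
    | succ m =>
      have := integral_realHermite_succ_mul m 1
      simpa [realHermite_zero] using this
  | succ n ih =>
    rw [integral_realHermite_succ_mul]
    cases m with
    | zero => simp [realHermite_zero]
    | succ m =>
      rw [derivative_realHermite_succ]
      have : ∀ x : ℝ, (realHermite n).eval x * (((m : Polynomial ℝ) + 1) * realHermite m).eval x =
          ((m : ℝ) + 1) * ((realHermite n).eval x * (realHermite m).eval x) := by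
        intro x
        simp
        ring
      simp_rw [this]
      rw [integral_const_mul, ih m]
      by_cases h : n = m
      · subst h
        simp [Nat.factorial_succ]
      · simp [h]

theorem integral_realHermite (n : ℕ) (hn : n ≠ 0) :
    ∫ x, (realHermite n).eval x ∂(gaussianReal 0 1) = 0 := by
  have := integral_realHermite_mul n 0
  simpa [realHermite_zero, hn] using this

/-! ### Hypercontractivity of Gaussian polynomials -/

/-- The functions with moments of all orders, as a subalgebra of all functions. -/
def allMoments {Ω : Type*} [MeasurableSpace Ω] (P : Measure Ω) [IsFiniteMeasure P] :
    Subalgebra ℂ (Ω → ℂ) where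
  carrier := {f | ∀ p : ℝ≥0∞, p ≠ ∞ → MemLp f p P}
  mul_mem' := by
    intro f g hf hg p hp
    have : ENNReal.HolderTriple (2 * p) (2 * p) p := ⟨by
      rw [ENNReal.mul_inv (by simp) (by simp), ← add_mul, ENNReal.inv_two_add_inv_two, one_mul]⟩
    exact (hg (2 * p) (ENNReal.mul_ne_top (by simp) hp)).mul
      (hf (2 * p) (ENNReal.mul_ne_top (by simp) hp))
  add_mem' := fun hf hg p hp => (hf p hp).add (hg p hp)
  algebraMap_mem' := fun r p _ => memLp_const r

section

variable {Ω : Type*} [MeasurableSpace Ω] {P : Measure Ω} [IsProbabilityMeasure P]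

theorem allMoments.integrable {f : Ω → ℂ} (hf : f ∈ allMoments P) : Integrable f P :=
  memLp_one_iff_integrable.1 (hf 1 (by simp))

theorem allMoments.star_mem {f : Ω → ℂ} (hf : f ∈ allMoments P) : star f ∈ allMoments P :=
  fun p hp => (hf p hp).star

theorem allMoments.integrable_norm_pow {f : Ω → ℂ} (hf : f ∈ allMoments P) (n : ℕ) :
    Integrable (fun ω => ‖f ω‖ ^ n) P := by
  rcases Nat.eq_zero_or_pos n with rfl | hn
  · simp
  · exact (hf n (by simp)).integrable_norm_pow hn.ne'

variable {ι : Type*} (e : ι → Ω → ℝ)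

/-- Polynomials of degree at most `n` in the variables `e i`, `i ∈ S`. -/
def gaussPoly (S : Finset ι) (n : ℕ) : Submodule ℂ (Ω → ℂ) :=
  (1 ⊔ Submodule.span ℂ ((fun i ω => (e i ω : ℂ)) '' (S : Set ι))) ^ n

variable {e}

theorem gaussPoly_mono {S T : Finset ι} (h : S ⊆ T) {m n : ℕ} (hmn : m ≤ n) :
    gaussPoly e S m ≤ gaussPoly e T n := by
  unfold gaussPoly
  have h1 : (1 : Submodule ℂ (Ω → ℂ)) ⊔ Submodule.span ℂ ((fun i ω => (e i ω : ℂ)) '' (S : Set ι))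
      ≤ 1 ⊔ Submodule.span ℂ ((fun i ω => (e i ω : ℂ)) '' (T : Set ι)) :=
    sup_le_sup le_rfl (Submodule.span_mono (Set.image_mono (by exact_mod_cast h)))
  refine (pow_le_pow_left' h1 m).trans ?_
  exact pow_le_pow_right' le_sup_left hmn

theorem gaussPoly_le_subalgebra {S : Finset ι} (A : Subalgebra ℂ (Ω → ℂ))
    (h : ∀ i ∈ S, (fun ω => (e i ω : ℂ)) ∈ A) (n : ℕ) :
    gaussPoly e S n ≤ Subalgebra.toSubmodule A := by
  have h1 : (1 : Submodule ℂ (Ω → ℂ)) ⊔ Submodule.span ℂ ((fun i ω => (e i ω : ℂ)) '' (S : Set ι))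
      ≤ Subalgebra.toSubmodule A := by
    refine sup_le (Submodule.one_le.2 A.one_mem) (Submodule.span_le.2 ?_)
    rintro _ ⟨i, hi, rfl⟩
    exact h i hi
  unfold gaussPoly
  induction n with
  | zero => exact Submodule.one_le.2 A.one_mem
  | succ n ih =>
    rw [pow_succ]
    refine (mul_le_mul' ih h1).trans ?_
    exact Submodule.mul_le.2 fun a ha b hb => A.mul_mem ha hb

/-- The functions that factor measurably through the variables `e i`, `i ∈ S`. -/
def factorThrough (e : ι → Ω → ℝ) (S : Finset ι) : Subalgebra ℂ (Ω → ℂ) where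
  carrier := {f | ∃ Q : (S → ℝ) → ℂ, Measurable Q ∧ f = fun ω => Q (fun i => e i ω)}
  mul_mem' := by
    rintro _ _ ⟨Q, hQ, rfl⟩ ⟨R, hR, rfl⟩
    exact ⟨Q * R, hQ.mul hR, rfl⟩
  add_mem' := by
    rintro _ _ ⟨Q, hQ, rfl⟩ ⟨R, hR, rfl⟩
    exact ⟨Q + R, hQ.add hR, rfl⟩
  algebraMap_mem' := fun r => ⟨fun _ => r, measurable_const, rfl⟩

theorem gaussPoly_le_factorThrough (S : Finset ι) (n : ℕ) :
    gaussPoly e S n ≤ Subalgebra.toSubmodule (factorThrough e S) :=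
  gaussPoly_le_subalgebra (factorThrough e S) (fun i hi => by
    refine ⟨fun x => ((x ⟨i, hi⟩ : ℝ) : ℂ), by fun_prop, rfl⟩) n

theorem ofReal_eval_mem_allMoments {X : Ω → ℝ} (hXm : Measurable X)
    (hX : P.map X = gaussianReal 0 1) (p : Polynomial ℝ) :
    (fun ω => ((p.eval (X ω) : ℝ) : ℂ)) ∈ allMoments P := by
  have hid : (fun ω => ((X ω : ℝ) : ℂ)) ∈ allMoments P := by
    intro q hq
    have h1 : MemLp id q (P.map X) := by
      rw [hX]
      exact memLp_id_gaussianReal' q hq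
    have h2 : MemLp X q P := (memLp_map_measure_iff h1.1 hXm.aemeasurable).1 h1
    exact h2.ofReal
  have : (fun ω => ((p.eval (X ω) : ℝ) : ℂ)) =
      Polynomial.aeval (fun ω => ((X ω : ℝ) : ℂ)) (p.map Complex.ofRealHom) := by
    ext ω
    have := Polynomial.aeval_algHom_apply (Pi.evalAlgHom ℂ (fun _ : Ω => ℂ) ω)
      (fun ω => ((X ω : ℝ) : ℂ)) (p.map Complex.ofRealHom)
    simp only [Pi.evalAlgHom_apply] at this
    rw [← this, Polynomial.coe_aeval_eq_eval, Polynomial.eval_map]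
    rw [← Complex.ofRealHom_eq_coe, ← Complex.ofRealHom_eq_coe, Polynomial.eval₂_hom]
  rw [this]
  exact (Algebra.adjoin_le (by simpa using hid)) (Polynomial.aeval_mem_adjoin_singleton ℂ _)

/-- Every polynomial of degree at most `n` in `insert a S` expands in Hermite polynomials of the
variable `e a`, with coefficients that are polynomials in the remaining variables. -/
theorem exists_hermite_expansion [DecidableEq ι] {S : Finset ι} {a : ι} {n : ℕ} {f : Ω → ℂ}
    (hf : f ∈ gaussPoly e (insert a S) n) :
    ∃ q : ℕ → Ω → ℂ, (∀ i ≤ n, q i ∈ gaussPoly e S (n - i)) ∧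
      f = ∑ i ∈ Finset.range (n + 1), q i * fun ω => (((realHermite i).eval (e a ω) : ℝ) : ℂ) := by
  set B : ℕ → Ω → ℂ := fun i ω => (((realHermite i).eval (e a ω) : ℝ) : ℂ) with hB
  set T : ℕ → Submodule ℂ (Ω → ℂ) := fun n => ⨆ i ∈ Finset.range (n + 1),
    gaussPoly e S (n - i) * Submodule.span ℂ {B i} with hT
  have hmem : ∀ {n i : ℕ} {q : Ω → ℂ}, i ≤ n → q ∈ gaussPoly e S (n - i) → q * B i ∈ T n := by
    intro n i q hi hq
    exact Submodule.mem_iSup_of_mem i (Submodule.mem_iSup_of_mem (by simpa [Nat.lt_succ_iff] using hi)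
      (Submodule.mul_mem_mul hq (Submodule.mem_span_singleton_self _)))
  have key : ∀ n, gaussPoly e (insert a S) n ≤ T n := by
    intro n
    induction n with
    | zero =>
      intro f hf
      have : f * B 0 ∈ T 0 := hmem le_rfl (by simpa [gaussPoly] using hf)
      have hB0 : B 0 = 1 := by ext ω; simp [hB, realHermite_zero]
      rwa [hB0, mul_one] at this
    | succ n ih =>
      have h1 : gaussPoly e (insert a S) (n + 1) = gaussPoly e (insert a S) n *
        (1 ⊔ Submodule.span ℂ ((fun i ω => (e i ω : ℂ)) '' ((insert a S : Finset ι) : Set ι))) := by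
        unfold gaussPoly
        rw [pow_succ]
      rw [h1]
      refine (mul_le_mul' ih le_rfl).trans ?_
      rw [hT, Submodule.iSup_mul]
      refine iSup_le fun i => ?_
      rw [Submodule.iSup_mul]
      refine iSup_le fun hi => ?_
      have hi' : i ≤ n := by simpa [Nat.lt_succ_iff] using hi
      rw [Submodule.mul_le]
      rintro x hx y hy
      obtain ⟨q, hq, rfl⟩ := Submodule.mem_mul_span_singleton.1 hx
      -- products with degree-one polynomials in the old variables only change the coefficient
      have hold : ∀ z ∈ (1 : Submodule ℂ (Ω → ℂ)) ⊔
          Submodule.span ℂ ((fun i ω => (e i ω : ℂ)) '' (S : Set ι)), q * B i * z ∈ T (n + 1) := by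
        intro z hz
        rw [show q * B i * z = q * z * B i by ring]
        refine hmem (by omega) ?_
        rw [show n + 1 - i = n - i + 1 by omega]
        unfold gaussPoly at hq ⊢
        rw [pow_succ]
        exact Submodule.mul_mem_mul hq hz
      have hnew : q * B i * (fun ω => (e a ω : ℂ)) ∈ T (n + 1) := by
        have h2 : q * B i * (fun ω => (e a ω : ℂ)) = q * B (i + 1) + ((i : ℂ) • q) * B (i - 1) := by
          ext ω
          have := eval_realHermite_mul i (e a ω)
          simp only [hB, Pi.mul_apply, Pi.add_apply, Pi.smul_apply, smul_eq_mul]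
          rw [mul_assoc, mul_comm _ ((e a ω : ℝ) : ℂ), ← Complex.ofReal_mul, this]
          push_cast
          ring
        rw [h2]
        refine Submodule.add_mem _ (hmem (by omega) (by rwa [Nat.add_sub_add_right])) ?_
        exact hmem (by omega) (Submodule.smul_mem _ _
          (gaussPoly_mono (Finset.Subset.refl S) (by omega) hq))
      have hle : (1 : Submodule ℂ (Ω → ℂ)) ⊔
          Submodule.span ℂ ((fun i ω => (e i ω : ℂ)) '' ((insert a S : Finset ι) : Set ι)) ≤
          (T (n + 1)).comap (LinearMap.mulLeft ℂ (q * B i)) := by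
        refine sup_le (fun z hz => hold z (Submodule.mem_sup_left hz)) (Submodule.span_le.2 ?_)
        rintro _ ⟨j, hj, rfl⟩
        rcases Finset.mem_insert.1 (by exact_mod_cast hj) with rfl | hj
        · exact hnew
        · exact hold _ (Submodule.mem_sup_right (Submodule.subset_span ⟨j, hj, rfl⟩))
      exact hle hy
  obtain ⟨μ, hμ⟩ := (Submodule.mem_iSup_finset_iff_exists_sum _ f).1 (key n hf)
  have : ∀ i, ∃ q, (i ≤ n → q ∈ gaussPoly e S (n - i) ∧ q * B i = μ i) := by
    intro i
    by_cases hi : i ≤ n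
    · obtain ⟨q, hq, h⟩ := Submodule.mem_mul_span_singleton.1 (μ i).2
      exact ⟨q, fun _ => ⟨hq, h⟩⟩
    · exact ⟨0, fun h => absurd h hi⟩
  choose q hq using this
  refine ⟨q, fun i hi => (hq i hi).1, ?_⟩
  rw [← hμ]
  refine Finset.sum_congr rfl fun i hi => ?_
  exact ((hq i (by simpa [Nat.lt_succ_iff] using hi)).2).symm

end

section

variable {Ω : Type*} [MeasurableSpace Ω] {P : Measure Ω} [IsProbabilityMeasure P]
  {ι : Type*} {e : ι → Ω → ℝ}

/-- The quartic bound that keeps the term linear in `b` exact: if `b` is centered given `a`, that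
term integrates to zero. -/
theorem norm_add_pow_four_le (a b : ℂ) : ‖a + b‖ ^ 4 ≤
    ‖a‖ ^ 4 + 4 * (‖a‖ ^ 2 * ((starRingEnd ℂ) a * b).re) + 8 * (‖a‖ ^ 2 * ‖b‖ ^ 2) + 3 * ‖b‖ ^ 4 := by
  have h : ∀ z : ℂ, ‖z‖ ^ 2 = z.re ^ 2 + z.im ^ 2 := fun z => by
    rw [Complex.sq_norm, Complex.normSq_apply]; ring
  have h1 : ‖a + b‖ ^ 2 = ‖a‖ ^ 2 + 2 * ((starRingEnd ℂ) a * b).re + ‖b‖ ^ 2 := by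
    simp only [h, Complex.mul_re, Complex.conj_re, Complex.conj_im, Complex.add_re, Complex.add_im]
    ring
  have h2 : ((starRingEnd ℂ) a * b).re ^ 2 ≤ ‖a‖ ^ 2 * ‖b‖ ^ 2 := by
    rw [← mul_pow, ← Complex.norm_conj a, ← norm_mul]
    exact sq_le_sq' ((abs_le.1 (Complex.abs_re_le_norm _)).1) (Complex.re_le_norm _)
  rw [show ‖a + b‖ ^ 4 = (‖a + b‖ ^ 2) ^ 2 by ring, h1, show ‖a‖ ^ 4 = (‖a‖ ^ 2) ^ 2 by ring,
    show ‖b‖ ^ 4 = (‖b‖ ^ 2) ^ 2 by ring]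
  nlinarith [sq_nonneg (((starRingEnd ℂ) a * b).re - ‖b‖ ^ 2)]

/-- A function of the variables `e i`, `i ∈ S`, is independent of `e a` for `a ∉ S`. -/
theorem integral_mul_eval_of_notMem [DecidableEq ι] {𝕜 : Type*} [RCLike 𝕜] (hm : ∀ i, Measurable (e i))
    (hind : iIndepFun e P) (hlaw : ∀ i, P.map (e i) = gaussianReal 0 1) {S : Finset ι} {a : ι}
    (ha : a ∉ S) (Q : (S → ℝ) → 𝕜) (hQ : Measurable Q) (p : Polynomial ℝ) :
    ∫ ω, Q (fun i => e i ω) * ((p.eval (e a ω) : ℝ) : 𝕜) ∂P =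
      (∫ ω, Q (fun i => e i ω) ∂P) * ((∫ x, p.eval x ∂(gaussianReal 0 1) : ℝ) : 𝕜) := by
  have h1 := hind.indepFun_finset S {a} (by simpa using ha) hm
  have h2 : IndepFun (fun ω => Q (fun i => e i ω)) (fun ω => ((p.eval (e a ω) : ℝ) : 𝕜)) P := by
    refine h1.comp (φ := Q) (ψ := fun x => ((p.eval (x ⟨a, by simp⟩) : ℝ) : 𝕜)) hQ ?_
    refine (RCLike.continuous_ofReal.comp ?_).measurable
    exact p.continuous.comp (continuous_apply _)
  have hme : Measurable fun ω => (fun i : S => e i ω) := measurable_pi_iff.2 fun i => hm i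
  rw [h2.integral_fun_mul_eq_mul_integral (hQ.comp hme).aestronglyMeasurable]
  · rw [← hlaw a, integral_map (hm a).aemeasurable p.continuous.aestronglyMeasurable]
    congr 1
    exact integral_ofReal
  · exact ((RCLike.continuous_ofReal.comp p.continuous).measurable.comp (hm a)).aestronglyMeasurable

/-- The dimension-free constant in `gaussPoly_hypercontractive`. -/
noncomputable def hyperConst (N : ℕ) : ℝ :=
  1 + 4 * (N + 1) + 3 * (N + 1) ^ 3 *
    ∑ i ∈ Finset.range (N + 1), ∫ x, ((realHermite i) ^ 4).eval x ∂(gaussianReal 0 1)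

theorem hermite_four_nonneg (i : ℕ) :
    0 ≤ ∫ x, ((realHermite i) ^ 4).eval x ∂(gaussianReal 0 1) :=
  integral_nonneg fun x => by simp only [Polynomial.eval_pow, Pi.zero_apply]; positivity

theorem one_le_hyperConst (N : ℕ) : 1 ≤ hyperConst N := by
  unfold hyperConst
  have := Finset.sum_nonneg fun i (_ : i ∈ Finset.range (N + 1)) => hermite_four_nonneg i
  have : 0 ≤ 3 * ((N : ℝ) + 1) ^ 3 * ∑ i ∈ Finset.range (N + 1),
    ∫ x, ((realHermite i) ^ 4).eval x ∂(gaussianReal 0 1) := by positivity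
  have : (0:ℝ) ≤ N := by positivity
  linarith

/-- The `L²` norm of a Hermite expansion in a new variable `e a`, whose coefficients depend on the
old variables only: the Hermite polynomials are orthogonal, with squared norms `i!`. -/
theorem integral_norm_sq_hermite_expansion [DecidableEq ι] (hm : ∀ i, Measurable (e i))
    (hind : iIndepFun e P) (hlaw : ∀ i, P.map (e i) = gaussianReal 0 1) {S : Finset ι} {a : ι}
    (ha : a ∉ S) {n : ℕ} {q : ℕ → Ω → ℂ} (hqm : ∀ i ≤ n, q i ∈ allMoments P)
    (hqf : ∀ i ≤ n, q i ∈ factorThrough e S) :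
    ∫ ω, ‖∑ i ∈ Finset.range (n + 1), q i ω * (((realHermite i).eval (e a ω) : ℝ) : ℂ)‖ ^ 2 ∂P =
      ∑ i ∈ Finset.range (n + 1), (i.factorial : ℝ) * ∫ ω, ‖q i ω‖ ^ 2 ∂P := by
  have hB : ∀ p : Polynomial ℝ, (fun ω => ((p.eval (e a ω) : ℝ) : ℂ)) ∈ allMoments P :=
    fun p => ofReal_eval_mem_allMoments (hm a) (hlaw a) p
  have hle : ∀ {i}, i ∈ Finset.range (n + 1) → i ≤ n := fun hi => by
    simpa [Nat.lt_succ_iff] using hi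
  apply Complex.ofReal_injective
  rw [← integral_complex_ofReal]
  calc _ = ∫ ω, ∑ i ∈ Finset.range (n + 1), ∑ j ∈ Finset.range (n + 1),
        (star (q i) * q j) ω * ((((realHermite i) * (realHermite j)).eval (e a ω) : ℝ) : ℂ) ∂P := by
        congr 1
        ext ω
        push_cast
        rw [← Complex.conj_mul', map_sum, Finset.sum_mul_sum]
        refine Finset.sum_congr rfl fun i _ => Finset.sum_congr rfl fun j _ => ?_
        simp only [map_mul, Complex.conj_ofReal, Pi.mul_apply, Pi.star_apply, RCLike.star_def,
          Polynomial.eval_mul, Complex.ofReal_mul]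
        ring
    _ = ∑ i ∈ Finset.range (n + 1), ∑ j ∈ Finset.range (n + 1),
        (∫ ω, (star (q i) * q j) ω ∂P) * (((if i = j then (i.factorial : ℝ) else 0) : ℝ) : ℂ) := by
        rw [integral_finsetSum]
        · refine Finset.sum_congr rfl fun i hi => ?_
          rw [integral_finsetSum]
          · refine Finset.sum_congr rfl fun j hj => ?_
            obtain ⟨Q, hQ, h⟩ := hqf i (hle hi)
            obtain ⟨Q', hQ', h'⟩ := hqf j (hle hj)
            have := integral_mul_eval_of_notMem (𝕜 := ℂ) hm hind hlaw ha (fun x => star (Q x) * Q' x)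
              ((continuous_star.measurable.comp hQ).mul hQ') (realHermite i * realHermite j)
            rw [h, h']
            simp only [Polynomial.eval_mul, integral_realHermite_mul] at this ⊢
            exact this
          · intro j hj
            exact allMoments.integrable ((allMoments P).mul_mem ((allMoments P).mul_mem
              (allMoments.star_mem (hqm i (hle hi))) (hqm j (hle hj))) (hB _))
        · intro i hi
          refine integrable_finsetSum _ fun j hj => ?_
          exact allMoments.integrable ((allMoments P).mul_mem ((allMoments P).mul_mem
              (allMoments.star_mem (hqm i (hle hi))) (hqm j (hle hj))) (hB _))
    _ = _ := by
        push_cast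
        refine Finset.sum_congr rfl fun i hi => ?_
        rw [Finset.sum_eq_single i (fun j _ hj => by simp [hj.symm]) (fun h => absurd hi h)]
        rw [← integral_complex_ofReal, mul_comm]
        simp only [if_true]
        congr 1
        refine integral_congr_ae (Filter.Eventually.of_forall fun ω => ?_)
        simp only [Pi.mul_apply, Pi.star_apply, RCLike.star_def]
        push_cast
        rw [Complex.conj_mul']

theorem integral_sq_mul_sq_le {f g : Ω → ℂ} (hf : f ∈ allMoments P) (hg : g ∈ allMoments P)
    {a b : ℝ} (ha : 0 ≤ a) (hb : 0 ≤ b) (hfa : ∫ ω, ‖f ω‖ ^ 4 ∂P ≤ a ^ 2)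
    (hgb : ∫ ω, ‖g ω‖ ^ 4 ∂P ≤ b ^ 2) : ∫ ω, ‖f ω‖ ^ 2 * ‖g ω‖ ^ 2 ∂P ≤ a * b := by
  have hf2 : MemLp (fun ω => ‖f ω‖ ^ 2) 2 P := by
    refine (memLp_two_iff_integrable_sq ((hf 1 (by simp)).1.norm.pow 2)).2 ?_
    refine (allMoments.integrable_norm_pow hf 4).congr ?_
    filter_upwards with ω
    simp only [Pi.pow_apply]
    ring
  have hg2 : MemLp (fun ω => ‖g ω‖ ^ 2) 2 P := by
    refine (memLp_two_iff_integrable_sq ((hg 1 (by simp)).1.norm.pow 2)).2 ?_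
    refine (allMoments.integrable_norm_pow hg 4).congr ?_
    filter_upwards with ω
    simp only [Pi.pow_apply]
    ring
  have h := integral_mul_le_Lp_mul_Lq_of_nonneg (μ := P) (p := 2) (q := 2)
    Real.HolderConjugate.two_two (f := fun ω => ‖f ω‖ ^ 2) (g := fun ω => ‖g ω‖ ^ 2)
    (Filter.Eventually.of_forall fun ω => by positivity)
    (Filter.Eventually.of_forall fun ω => by positivity) (by simpa using hf2) (by simpa using hg2)
  refine h.trans ?_
  rw [← Real.sqrt_eq_rpow, ← Real.sqrt_eq_rpow]
  have e1 : ∀ x : ℝ, (x ^ 2) ^ (2 : ℝ) = x ^ 4 := fun x => by norm_cast; ring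
  simp_rw [e1]
  exact mul_le_mul (Real.sqrt_le_iff.2 ⟨ha, hfa⟩) (Real.sqrt_le_iff.2 ⟨hb, hgb⟩)
    (Real.sqrt_nonneg _) ha

/-- Dimension-free reverse Hölder inequality for polynomials in independent standard Gaussians, by
induction on the number of variables: the new variable is integrated out, with the coefficients of
the Hermite expansion controlled by the induction hypothesis. -/
theorem gaussPoly_hypercontractive [DecidableEq ι] (hm : ∀ i, Measurable (e i))
    (hind : iIndepFun e P) (hlaw : ∀ i, P.map (e i) = gaussianReal 0 1) (N : ℕ) (S : Finset ι) :
    ∀ n ≤ N, ∀ f ∈ gaussPoly e S n,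
      ∫ ω, ‖f ω‖ ^ 4 ∂P ≤ (hyperConst N ^ n * ∫ ω, ‖f ω‖ ^ 2 ∂P) ^ 2 := by
  set R := hyperConst N with hR
  have hR1 : 1 ≤ R := one_le_hyperConst N
  induction S using Finset.induction_on with
  | empty =>
    intro n _ f hf
    have hf' := gaussPoly_le_subalgebra (e := e) (S := ∅) ⊥ (by simp) n hf
    obtain ⟨c, rfl⟩ := Algebra.mem_bot.1 hf'
    simp only [Pi.algebraMap_apply, Algebra.algebraMap_self, RingHom.id_apply, integral_const,
      probReal_univ, one_smul]
    rw [show ‖c‖ ^ 4 = (‖c‖ ^ 2) ^ 2 by ring]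
    refine pow_le_pow_left₀ (by positivity) ?_ 2
    exact le_mul_of_one_le_left (by positivity) (one_le_pow₀ hR1)
  | insert a S ha ih =>
    intro n hn f hf
    obtain ⟨q, hq, rfl⟩ := exists_hermite_expansion hf
    have hle : ∀ {i}, i ∈ Finset.range (n + 1) → i ≤ n := fun hi => by
      simpa [Nat.lt_succ_iff] using hi
    have hB : ∀ p : Polynomial ℝ, (fun ω => ((p.eval (e a ω) : ℝ) : ℂ)) ∈ allMoments P :=
      fun p => ofReal_eval_mem_allMoments (hm a) (hlaw a) p
    have he : ∀ i, (fun ω => ((e i ω : ℝ) : ℂ)) ∈ allMoments P := fun i => by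
      simpa using ofReal_eval_mem_allMoments (hm i) (hlaw i) Polynomial.X
    have hqm : ∀ i ≤ n, q i ∈ allMoments P := fun i hi =>
      gaussPoly_le_subalgebra _ (fun i _ => he i) _ (hq i hi)
    have hqf : ∀ i ≤ n, q i ∈ factorThrough e S := fun i hi => gaussPoly_le_factorThrough _ _ (hq i hi)
    set I2 : ℕ → ℝ := fun i => ∫ ω, ‖q i ω‖ ^ 2 ∂P with hI2
    have hI2n : ∀ i, 0 ≤ I2 i := fun i => integral_nonneg fun ω => by positivity
    have ih' : ∀ i ≤ n, ∫ ω, ‖q i ω‖ ^ 4 ∂P ≤ (R ^ (n - i) * I2 i) ^ 2 := fun i hi =>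
      ih (n - i) (by omega) (q i) (hq i hi)
    -- the part of positive degree in the new variable
    set g : ℕ → Ω → ℂ := fun i ω => q i ω * (((realHermite i).eval (e a ω) : ℝ) : ℂ) with hg
    have hgm : ∀ i ≤ n, g i ∈ allMoments P := fun i hi => (allMoments P).mul_mem (hqm i hi) (hB _)
    set G : Ω → ℂ := fun ω => ∑ i ∈ Finset.range n, g (i + 1) ω with hG
    have hGm : G ∈ allMoments P := by
      have : G = ∑ i ∈ Finset.range n, g (i + 1) := by ext ω; simp [hG]
      rw [this]
      exact (allMoments P).sum_mem fun i hi => hgm _ (by simpa using hi)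
    have hf0 : ∀ ω, (∑ i ∈ Finset.range (n + 1), q i * fun ω =>
        (((realHermite i).eval (e a ω) : ℝ) : ℂ)) ω = q 0 ω + G ω := by
      intro ω
      rw [Finset.sum_apply, Finset.sum_range_succ', add_comm]
      simp [hG, hg, realHermite_zero]
    have hq0 := hqm 0 (Nat.zero_le n)
    set B : ℝ := ∑ i ∈ Finset.range n, ((i + 1).factorial : ℝ) * I2 (i + 1) with hBdef
    have hBn : 0 ≤ B := Finset.sum_nonneg fun i _ => mul_nonneg (by positivity) (hI2n _)
    have hL2 : ∫ ω, ‖(∑ i ∈ Finset.range (n + 1), q i * fun ω =>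
        (((realHermite i).eval (e a ω) : ℝ) : ℂ)) ω‖ ^ 2 ∂P = I2 0 + B := by
      have := integral_norm_sq_hermite_expansion hm hind hlaw ha hqm hqf
      rw [Finset.sum_range_succ' (fun i => (i.factorial : ℝ) * _), add_comm (∑ i ∈ _, _)] at this
      simp only [Nat.factorial_zero, Nat.cast_one, one_mul] at this
      rw [← this]
      simp
    -- the coefficients of positive degree have strictly smaller degree
    have hcoef : ∀ i ∈ Finset.range n, R ^ (n - (i + 1)) ≤ R ^ (n - 1) := fun i hi =>
      pow_le_pow_right₀ hR1 (by omega)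
    -- the term linear in the new variable vanishes, as Hermite polynomials of positive
    -- degree are centered; this is what makes the constant independent of the number of
    -- variables
    have hlin : ∫ ω, ‖q 0 ω‖ ^ 2 * ((starRingEnd ℂ) (q 0 ω) * G ω).re ∂P = 0 := by
      have h1 : ∀ i ∈ Finset.range n, ∫ ω, ((‖q 0 ω‖ : ℂ) ^ 2 * (starRingEnd ℂ) (q 0 ω)) * g (i + 1) ω ∂P
          = 0 := by
        intro i hi
        obtain ⟨Q, hQ, h⟩ := hqf 0 (Nat.zero_le n)
        obtain ⟨Q', hQ', h'⟩ := hqf (i + 1) (by simpa using hi)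
        have := integral_mul_eval_of_notMem (𝕜 := ℂ) hm hind hlaw ha
          (fun x => ((‖Q x‖ : ℂ) ^ 2 * (starRingEnd ℂ) (Q x)) * Q' x)
          (by
            have h1 : Measurable fun x => (‖Q x‖ : ℂ) := Complex.measurable_ofReal.comp hQ.norm
            have h2 : Measurable fun x => (starRingEnd ℂ) (Q x) :=
              Complex.continuous_conj.measurable.comp hQ
            exact ((h1.pow_const 2).mul h2).mul hQ') (realHermite (i + 1))
        rw [integral_realHermite _ (Nat.succ_ne_zero i)] at this
        simp only [hg, h, h']
        simpa [mul_assoc] using this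
      have h2 : ∫ ω, ((‖q 0 ω‖ : ℂ) ^ 2 * (starRingEnd ℂ) (q 0 ω)) * G ω ∂P = 0 := by
        simp only [hG, Finset.mul_sum]
        rw [integral_finsetSum]
        · exact Finset.sum_eq_zero h1
        · intro i hi
          have h3 : (fun ω => ((‖q 0 ω‖ : ℂ) ^ 2 * (starRingEnd ℂ) (q 0 ω)) * g (i + 1) ω) =
              (star (q 0) * q 0) * star (q 0) * g (i + 1) := by
            ext ω
            simp [← Complex.conj_mul']
          rw [h3]
          exact allMoments.integrable ((allMoments P).mul_mem ((allMoments P).mul_mem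
            ((allMoments P).mul_mem (allMoments.star_mem hq0) hq0) (allMoments.star_mem hq0))
            (hgm _ (by simpa using hi)))
      have h4 := congrArg Complex.re h2
      have h5 : Integrable (fun ω => ((‖q 0 ω‖ : ℂ) ^ 2 * (starRingEnd ℂ) (q 0 ω)) * G ω) P := by
        have h3 : (fun ω => ((‖q 0 ω‖ : ℂ) ^ 2 * (starRingEnd ℂ) (q 0 ω)) * G ω) =
              (star (q 0) * q 0) * star (q 0) * G := by
            ext ω
            simp [← Complex.conj_mul']
        rw [h3]
        exact allMoments.integrable ((allMoments P).mul_mem ((allMoments P).mul_mem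
            ((allMoments P).mul_mem (allMoments.star_mem hq0) hq0) (allMoments.star_mem hq0)) hGm)
      have h6 := integral_re h5
      simp only [RCLike.re_to_complex] at h6
      rw [← h6, Complex.zero_re] at h4
      rw [← h4]
      congr 1
      ext ω
      rw [mul_assoc, ← Complex.ofReal_pow, Complex.re_ofReal_mul]
    have hint4 : ∀ {u : Ω → ℂ}, u ∈ allMoments P → Integrable (fun ω => ‖u ω‖ ^ 4) P :=
      fun hu => allMoments.integrable_norm_pow hu 4
    have hintsq : ∀ {u v : Ω → ℂ}, u ∈ allMoments P → v ∈ allMoments P →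
        Integrable (fun ω => ‖u ω‖ ^ 2 * ‖v ω‖ ^ 2) P := by
      intro u v hu hv
      refine (allMoments.integrable_norm_pow ((allMoments P).mul_mem hu hv) 2).congr ?_
      filter_upwards with ω
      simp [mul_pow]
    have hmix : ∫ ω, ‖q 0 ω‖ ^ 2 * ‖G ω‖ ^ 2 ∂P ≤ (N + 1) * (R ^ n * R ^ (n - 1) * (I2 0 * B)) := by
      have hpt : ∀ ω, ‖q 0 ω‖ ^ 2 * ‖G ω‖ ^ 2 ≤
          ∑ i ∈ Finset.range n, (N + 1) * (‖q 0 ω‖ ^ 2 * ‖g (i + 1) ω‖ ^ 2) := by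
        intro ω
        rw [← Finset.mul_sum, ← Finset.mul_sum]
        have h1 : ‖G ω‖ ^ 2 ≤ (∑ i ∈ Finset.range n, ‖g (i + 1) ω‖) ^ 2 :=
          pow_le_pow_left₀ (norm_nonneg _) (norm_sum_le _ _) 2
        have h2 : (∑ i ∈ Finset.range n, ‖g (i + 1) ω‖) ^ 2 ≤
            n * ∑ i ∈ Finset.range n, ‖g (i + 1) ω‖ ^ 2 := by
          simpa using sq_sum_le_card_mul_sum_sq (s := Finset.range n) (f := fun i => ‖g (i + 1) ω‖)
        have h3 : (n : ℝ) ≤ N + 1 := by exact_mod_cast hn.trans (Nat.le_succ N)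
        have h4 : 0 ≤ ∑ i ∈ Finset.range n, ‖g (i + 1) ω‖ ^ 2 :=
          Finset.sum_nonneg fun i _ => by positivity
        calc _ ≤ ‖q 0 ω‖ ^ 2 * ((N + 1) * ∑ i ∈ Finset.range n, ‖g (i + 1) ω‖ ^ 2) := by
              gcongr
              exact (h1.trans h2).trans (by gcongr)
          _ = _ := by ring
      refine (integral_mono (hintsq hq0 hGm) (integrable_finsetSum _ fun i hi =>
        (hintsq hq0 (hgm (i + 1) (by simpa using hi))).const_mul _) hpt).trans ?_
      rw [integral_finsetSum _ fun i hi =>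
        (hintsq hq0 (hgm (i + 1) (by simpa using hi))).const_mul _, hBdef, Finset.mul_sum,
        Finset.mul_sum, Finset.mul_sum]
      refine Finset.sum_le_sum fun i hi => ?_
      rw [integral_const_mul]
      have hi' : i + 1 ≤ n := by simpa using hi
      refine mul_le_mul_of_nonneg_left ?_ (by positivity)
      obtain ⟨Q, hQ, h⟩ := hqf 0 (Nat.zero_le n)
      obtain ⟨Q', hQ', h'⟩ := hqf (i + 1) hi'
      have := integral_mul_eval_of_notMem (𝕜 := ℝ) hm hind hlaw ha
          (fun x => ‖Q x‖ ^ 2 * ‖Q' x‖ ^ 2) ((hQ.norm.pow_const 2).mul (hQ'.norm.pow_const 2))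
          (realHermite (i + 1) * realHermite (i + 1))
      simp only [Polynomial.eval_mul, integral_realHermite_mul, if_true, RCLike.ofReal_real_eq_id,
        id] at this
      have h7 : ∫ ω, ‖q 0 ω‖ ^ 2 * ‖g (i + 1) ω‖ ^ 2 ∂P =
          (∫ ω, ‖q 0 ω‖ ^ 2 * ‖q (i + 1) ω‖ ^ 2 ∂P) * ((i + 1).factorial : ℝ) := by
        simp only [h, h']
        rw [← this]
        congr 1
        ext ω
        simp only [hg, norm_mul, mul_pow, Complex.norm_real, h', Real.norm_eq_abs, sq_abs]
        ring
      rw [h7]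
      have h8 := integral_sq_mul_sq_le hq0 (hqm (i + 1) hi') (mul_nonneg (by positivity) (hI2n 0))
        (mul_nonneg (by positivity) (hI2n (i + 1))) (ih' 0 (Nat.zero_le n)) (ih' (i + 1) hi')
      rw [Nat.sub_zero] at h8
      calc _ ≤ R ^ n * I2 0 * (R ^ (n - (i + 1)) * I2 (i + 1)) * ((i + 1).factorial : ℝ) := by gcongr
        _ ≤ R ^ n * I2 0 * (R ^ (n - 1) * I2 (i + 1)) * ((i + 1).factorial : ℝ) := by
            have := hcoef i hi
            have := hI2n 0
            have := hI2n (i + 1)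
            gcongr
        _ = _ := by ring
    set M : ℝ := ∑ i ∈ Finset.range (N + 1), ∫ x, ((realHermite i) ^ 4).eval x ∂(gaussianReal 0 1)
      with hM
    have hM0 : 0 ≤ M := Finset.sum_nonneg fun i _ => hermite_four_nonneg i
    have hfour : ∫ ω, ‖G ω‖ ^ 4 ∂P ≤ (N + 1) ^ 3 * (M * (R ^ (n - 1) * B) ^ 2) := by
      have hpt : ∀ ω, ‖G ω‖ ^ 4 ≤ ∑ i ∈ Finset.range n, ((N : ℝ) + 1) ^ 3 * ‖g (i + 1) ω‖ ^ 4 := by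
        intro ω
        rw [← Finset.mul_sum]
        have h1 : ‖G ω‖ ^ 4 ≤ (∑ i ∈ Finset.range n, ‖g (i + 1) ω‖) ^ 4 :=
          pow_le_pow_left₀ (norm_nonneg _) (norm_sum_le _ _) 4
        have h2 : (∑ i ∈ Finset.range n, ‖g (i + 1) ω‖) ^ 4 ≤
            (n : ℝ) ^ 3 * ∑ i ∈ Finset.range n, ‖g (i + 1) ω‖ ^ 4 := by
          simpa using pow_sum_le_card_mul_sum_pow (s := Finset.range n)
            (f := fun i => ‖g (i + 1) ω‖) (fun i _ => norm_nonneg _) 3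
        have h3 : (n : ℝ) ≤ N + 1 := by exact_mod_cast hn.trans (Nat.le_succ N)
        have h4 : 0 ≤ ∑ i ∈ Finset.range n, ‖g (i + 1) ω‖ ^ 4 :=
          Finset.sum_nonneg fun i _ => by positivity
        exact (h1.trans h2).trans (by gcongr)
      refine (integral_mono (hint4 hGm) (integrable_finsetSum _ fun i hi =>
        (hint4 (hgm (i + 1) (by simpa using hi))).const_mul _) hpt).trans ?_
      rw [integral_finsetSum _ fun i hi => (hint4 (hgm (i + 1) (by simpa using hi))).const_mul _]
      simp_rw [integral_const_mul]
      rw [← Finset.mul_sum]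
      refine mul_le_mul_of_nonneg_left ?_ (by positivity)
      have hterm : ∀ i ∈ Finset.range n, ∫ ω, ‖g (i + 1) ω‖ ^ 4 ∂P ≤
          M * (R ^ (n - 1) * (((i + 1).factorial : ℝ) * I2 (i + 1))) ^ 2 := by
        intro i hi
        have hi' : i + 1 ≤ n := by simpa using hi
        obtain ⟨Q', hQ', h'⟩ := hqf (i + 1) hi'
        have := integral_mul_eval_of_notMem (𝕜 := ℝ) hm hind hlaw ha
          (fun x => ‖Q' x‖ ^ 4) (hQ'.norm.pow_const 4) (realHermite (i + 1) ^ 4)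
        have h7 : ∫ ω, ‖g (i + 1) ω‖ ^ 4 ∂P = (∫ ω, ‖q (i + 1) ω‖ ^ 4 ∂P) *
            ∫ x, ((realHermite (i + 1)) ^ 4).eval x ∂(gaussianReal 0 1) := by
          simp only [RCLike.ofReal_real_eq_id, id] at this
          simp only [h']
          rw [← this]
          congr 1
          ext ω
          have h9 : |Polynomial.eval (e a ω) (realHermite (i + 1))| ^ 4 =
            Polynomial.eval (e a ω) (realHermite (i + 1)) ^ 4 := by
            rw [show (4 : ℕ) = 2 * 2 by norm_num, pow_mul, sq_abs, pow_mul]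
          simp only [hg, norm_mul, mul_pow, Complex.norm_real, h', Real.norm_eq_abs,
            Polynomial.eval_pow, h9]
        rw [h7, mul_comm]
        have h8 : ∫ x, ((realHermite (i + 1)) ^ 4).eval x ∂(gaussianReal 0 1) ≤ M :=
          Finset.single_le_sum (f := fun i => ∫ x, ((realHermite i) ^ 4).eval x ∂(gaussianReal 0 1))
            (fun i _ => hermite_four_nonneg i) (Finset.mem_range.2 (by omega))
        refine mul_le_mul h8 ((ih' (i + 1) hi').trans ?_) (integral_nonneg fun ω => by positivity) hM0
        have h10 : (1 : ℝ) ≤ ((i + 1).factorial : ℝ) := by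
          exact_mod_cast Nat.one_le_iff_ne_zero.2 (Nat.factorial_ne_zero _)
        have := hcoef i hi
        have h11 := hI2n (i + 1)
        refine pow_le_pow_left₀ (by positivity) ?_ 2
        exact mul_le_mul this (le_mul_of_one_le_left h11 h10) h11 (by positivity)
      refine (Finset.sum_le_sum hterm).trans ?_
      rw [← Finset.mul_sum]
      refine mul_le_mul_of_nonneg_left ?_ hM0
      rw [hBdef, Finset.mul_sum]
      exact Finset.sum_sq_le_sq_sum_of_nonneg fun i _ => by
        have := hI2n (i + 1)
        positivity
    have hq04 := ih' 0 (Nat.zero_le n)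
    rw [Nat.sub_zero] at hq04
    rw [hL2]
    simp_rw [hf0]
    have htotal : ∫ ω, ‖q 0 ω + G ω‖ ^ 4 ∂P ≤ ∫ ω, ‖q 0 ω‖ ^ 4 ∂P +
        8 * ∫ ω, ‖q 0 ω‖ ^ 2 * ‖G ω‖ ^ 2 ∂P + 3 * ∫ ω, ‖G ω‖ ^ 4 ∂P := by
      have hlinint : Integrable (fun ω => ‖q 0 ω‖ ^ 2 * ((starRingEnd ℂ) (q 0 ω) * G ω).re) P := by
        have h := allMoments.integrable ((allMoments P).mul_mem ((allMoments P).mul_mem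
            ((allMoments P).mul_mem (allMoments.star_mem hq0) hq0) (allMoments.star_mem hq0)) hGm)
        refine h.re.congr ?_
        filter_upwards with ω
        simp only [Pi.mul_apply, Pi.star_apply, RCLike.star_def, RCLike.re_to_complex]
        rw [Complex.conj_mul', mul_assoc, ← Complex.ofReal_pow, Complex.re_ofReal_mul]
      refine (integral_mono (hint4 ((allMoments P).add_mem hq0 hGm))
        ((((hint4 hq0).add (hlinint.const_mul 4)).add ((hintsq hq0 hGm).const_mul 8)).add
          ((hint4 hGm).const_mul 3)) (fun ω => norm_add_pow_four_le (q 0 ω) (G ω))).trans ?_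
      simp only [Pi.add_apply]
      rw [integral_add, integral_add, integral_add, integral_const_mul, integral_const_mul,
        integral_const_mul, hlin]
      · simp
      · exact hint4 hq0
      · exact hlinint.const_mul 4
      · exact (hint4 hq0).add (hlinint.const_mul 4)
      · exact (hintsq hq0 hGm).const_mul 8
      · exact ((hint4 hq0).add (hlinint.const_mul 4)).add ((hintsq hq0 hGm).const_mul 8)
      · exact (hint4 hGm).const_mul 3
    have hA := hI2n 0
    rcases Nat.eq_zero_or_pos n with rfl | hn0
    · have hB0 : B = 0 := by simp [hBdef]
      rw [hB0] at hmix hfour ⊢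
      simp only [mul_zero, ne_eq, OfNat.ofNat_ne_zero, not_false_eq_true, zero_pow] at hmix hfour
      rw [add_zero]
      linarith
    · obtain ⟨k, rfl⟩ := Nat.exists_eq_add_of_le' hn0
      simp only [Nat.add_sub_cancel] at hmix hfour
      have hRval : R = 1 + 4 * (N + 1) + 3 * (N + 1) ^ 3 * M := rfl
      have hX : 0 ≤ 3 * ((N : ℝ) + 1) ^ 3 * M := by positivity
      have hN0 : (0 : ℝ) ≤ N := by positivity
      have hc1 : 8 * ((N : ℝ) + 1) ≤ 2 * R := by rw [hRval]; linarith
      have hc2 : 3 * ((N : ℝ) + 1) ^ 3 * M ≤ R ^ 2 := by nlinarith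
      have e1 : 8 * ((N : ℝ) + 1) * (R ^ k * R ^ k * R * (I2 0 * B)) ≤
          2 * R * (R ^ k * R ^ k * R * (I2 0 * B)) := by gcongr
      have e2 : 3 * ((N : ℝ) + 1) ^ 3 * M * (R ^ k * B) ^ 2 ≤ R ^ 2 * (R ^ k * B) ^ 2 := by gcongr
      calc _ ≤ (R ^ (k + 1) * I2 0) ^ 2 + 8 * ((N + 1) * (R ^ (k + 1) * R ^ k * (I2 0 * B))) +
            3 * ((N + 1) ^ 3 * (M * (R ^ k * B) ^ 2)) := by linarith
        _ ≤ (R ^ (k + 1) * I2 0) ^ 2 + 2 * R * (R ^ k * R ^ k * R * (I2 0 * B)) +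
            R ^ 2 * (R ^ k * B) ^ 2 := by
            have e3 : 8 * (((N : ℝ) + 1) * (R ^ (k + 1) * R ^ k * (I2 0 * B))) =
              8 * ((N : ℝ) + 1) * (R ^ k * R ^ k * R * (I2 0 * B)) := by ring
            have e4 : 3 * (((N : ℝ) + 1) ^ 3 * (M * (R ^ k * B) ^ 2)) =
              3 * ((N : ℝ) + 1) ^ 3 * M * (R ^ k * B) ^ 2 := by ring
            rw [e3, e4]
            linarith
        _ = _ := by ring

end

/-! ### Polynomials in a Gaussian Hilbert space -/

/-- Evaluating a polynomial at elements of a subspace `V` of an algebra gives an element of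
`(1 + V) ^ n`, with `n` the total degree. -/
theorem MvPolynomial.aeval_mem_one_sup_pow {σ A : Type*} [CommRing A] [Algebra ℂ A]
    (V : Submodule ℂ A) (g : σ → A) (hg : ∀ i, g i ∈ V) (p : MvPolynomial σ ℂ) :
    MvPolynomial.aeval g p ∈ (1 ⊔ V) ^ p.totalDegree := by
  rw [MvPolynomial.aeval_def, MvPolynomial.eval₂_eq]
  refine Submodule.sum_mem _ fun s hs => ?_
  rw [← Algebra.smul_def]
  refine Submodule.smul_mem _ _ ?_
  have h : ∀ T : Finset σ, ∏ i ∈ T, g i ^ s i ∈ (1 ⊔ V) ^ (∑ i ∈ T, s i) := by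
    intro T
    classical
    induction T using Finset.induction_on with
    | empty => simpa using (⟨1, by simp⟩ : ∃ y, (algebraMap ℂ A) y = 1)
    | insert a T ha ih =>
      rw [Finset.prod_insert ha, Finset.sum_insert ha, pow_add]
      exact Submodule.mul_mem_mul (Submodule.pow_mem_pow _ (Submodule.mem_sup_right (hg a)) _) ih
  exact pow_le_pow_right' (le_sup_left : (1 : Submodule ℂ A) ≤ 1 ⊔ V)
    (MvPolynomial.le_totalDegree hs) (h s.support)

namespace GaussianHilbertSpace

variable {Ω : Type*} [MeasurableSpace Ω] {P : Measure Ω}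

/-- The real part, from complex to real `L²`. -/
noncomputable def reL (P : Measure Ω) : Lp ℂ 2 P →L[ℝ] Lp ℝ 2 P := Complex.reCLM.compLpL 2 P

/-- The inclusion of real `L²` into complex `L²`. -/
noncomputable def ofRealL (P : Measure Ω) : Lp ℝ 2 P →L[ℝ] Lp ℂ 2 P := Complex.ofRealCLM.compLpL 2 P

theorem coeFn_reL (X : Lp ℂ 2 P) : (reL P X : Ω → ℝ) =ᵐ[P] fun ω => (X ω).re :=
  ContinuousLinearMap.coeFn_compLpL _ _

theorem coeFn_ofRealL (Y : Lp ℝ 2 P) : (ofRealL P Y : Ω → ℂ) =ᵐ[P] fun ω => (Y ω : ℂ) :=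
  ContinuousLinearMap.coeFn_compLpL _ _

theorem norm_ofRealL (Y : Lp ℝ 2 P) : ‖ofRealL P Y‖ = ‖Y‖ := by
  rw [Lp.norm_def, Lp.norm_def]
  congr 1
  refine eLpNorm_congr_norm_ae ?_
  filter_upwards [coeFn_ofRealL Y] with ω h
  rw [h, Complex.norm_real]

theorem ofRealL_reL (X : Lp ℂ 2 P) : ofRealL P (reL P X) = (1 / 2 : ℂ) • (X + star X) := by
  refine Lp.ext ?_
  filter_upwards [coeFn_ofRealL (reL P X), coeFn_reL X, Lp.coeFn_smul (1 / 2 : ℂ) (X + star X),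
    Lp.coeFn_add X (star X), Lp.coeFn_star X] with ω h1 h2 h3 h4 h5
  rw [h1, h2, h3, Pi.smul_apply, h4, Pi.add_apply, h5, Pi.star_apply, RCLike.star_def,
    Complex.add_conj, smul_eq_mul]
  push_cast
  ring

/-- The underlying real Gaussian Hilbert space. -/
noncomputable def realPart (H : GaussianHilbertSpace P) : Submodule ℝ (Lp ℝ 2 P) :=
  (H.carrier.restrictScalars ℝ).comap (ofRealL P).toLinearMap

theorem mem_realPart {H : GaussianHilbertSpace P} {Y : Lp ℝ 2 P} :
    Y ∈ H.realPart ↔ ofRealL P Y ∈ H.carrier := Iff.rfl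

theorem reL_mem_realPart (H : GaussianHilbertSpace P) {X : Lp ℂ 2 P} (hX : X ∈ H.carrier) :
    reL P X ∈ H.realPart := by
  rw [mem_realPart, ofRealL_reL]
  exact H.carrier.smul_mem _ (H.carrier.add_mem hX (H.star_mem X hX))

variable [IsProbabilityMeasure P]

theorem map_realPart (H : GaussianHilbertSpace P) {Y : Lp ℝ 2 P} (hY : Y ∈ H.realPart) :
    P.map (Y : Ω → ℝ) = gaussianReal 0 (‖Y‖₊ ^ 2) := by
  have hm : Measurable (ofRealL P Y : Ω → ℂ) := (Lp.stronglyMeasurable _).measurable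
  have hmY : Measurable (Y : Ω → ℝ) := (Lp.stronglyMeasurable _).measurable
  have hg := H.gaussian (ofRealL P Y) hY
  have h1 : P.map (Y : Ω → ℝ) = (P.map (ofRealL P Y : Ω → ℂ)).map Complex.reCLM := by
    rw [Measure.map_map (by fun_prop) hm]
    refine Measure.map_congr ?_
    filter_upwards [coeFn_ofRealL Y] with ω h
    simp [h]
  have h2 : IsGaussian (P.map (Y : Ω → ℝ)) := by
    rw [h1]
    infer_instance
  have h3 := IsGaussian.eq_gaussianReal _ h2
  have h4 : ∫ ω, Y ω ∂P = 0 := by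
    have := H.centered (ofRealL P Y) hY
    rw [integral_congr_ae (coeFn_ofRealL Y), integral_complex_ofReal] at this
    exact_mod_cast this
  have h5 : ∫ x, id x ∂(P.map (Y : Ω → ℝ)) = 0 := by
    rw [integral_map hmY.aemeasurable (by fun_prop)]
    simpa using h4
  have h6 : Var[id; P.map (Y : Ω → ℝ)].toNNReal = ‖Y‖₊ ^ 2 := by
    rw [variance_map (by fun_prop) hmY.aemeasurable, Function.id_comp,
      variance_of_integral_eq_zero hmY.aemeasurable h4]
    have h7 : ∫ ω, Y ω ^ 2 ∂P = ‖Y‖ ^ 2 := by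
      rw [← real_inner_self_eq_norm_sq, L2.inner_def]
      congr 1
      ext ω
      simp [sq]
    rw [h7]
    ext
    rw [Real.coe_toNNReal _ (by positivity)]
    simp
  rw [h3, h5, h6]

theorem hasGaussianLaw_realPart (H : GaussianHilbertSpace P) {κ : Type*} [Fintype κ]
    (Y : κ → Lp ℝ 2 P) (hY : ∀ i, Y i ∈ H.realPart) :
    HasGaussianLaw (fun ω i => Y i ω) P := by
  classical
  refine ⟨isGaussian_of_map_eq_gaussianReal fun L => ?_⟩
  have hm : Measurable fun ω => (fun i => Y i ω) :=
    measurable_pi_iff.2 fun i => (Lp.stronglyMeasurable _).measurable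
  set Z : Lp ℝ 2 P := ∑ i, L (Pi.single i 1) • Y i with hZ
  have hZm : Z ∈ H.realPart := Submodule.sum_mem _ fun i _ => Submodule.smul_mem _ _ (hY i)
  refine ⟨0, ‖Z‖₊ ^ 2, ?_⟩
  rw [← H.map_realPart hZm, Measure.map_map (by fun_prop) hm]
  refine Measure.map_congr ?_
  have h1 : ∀ᵐ ω ∂P, ∀ i, (L (Pi.single i 1) • Y i : Lp ℝ 2 P) ω = L (Pi.single i 1) * Y i ω := by
    rw [ae_all_iff]
    intro i
    filter_upwards [Lp.coeFn_smul (L (Pi.single i 1)) (Y i)] with ω h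
    simp [h]
  filter_upwards [h1, Lp.coeFn_finsetSum Finset.univ fun i => L (Pi.single i 1) • Y i] with ω h2 h3
  rw [hZ, h3, Finset.sum_apply, Function.comp_apply]
  simp_rw [h2]
  conv_lhs => rw [← Finset.univ_sum_single (fun i => Y i ω), map_sum]
  refine Finset.sum_congr rfl fun i _ => ?_
  rw [show (Pi.single i (Y i ω) : κ → ℝ) = Y i ω • Pi.single i 1 by
    rw [← Pi.single_smul]; simp, map_smul, smul_eq_mul, mul_comm]

end GaussianHilbertSpace

namespace GaussianHilbertSpace

variable {Ω : Type*} [MeasurableSpace Ω] {P : Measure Ω} [IsProbabilityMeasure P]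

theorem inner_eq_integral_mul (X Y : Lp ℝ 2 P) : inner ℝ X Y = ∫ ω, X ω * Y ω ∂P := by
  rw [L2.inner_def]
  congr 1
  ext ω
  simp [mul_comm]

/-- A polynomial in elements of `H` is a polynomial of the same degree in finitely many independent
standard real Gaussians. -/
theorem exists_gaussPoly (H : GaussianHilbertSpace P) (p : MvPolynomial H.carrier ℂ) :
    ∃ (m : ℕ) (e : Fin m → Ω → ℝ), (∀ i, Measurable (e i)) ∧ iIndepFun e P ∧
      (∀ i, P.map (e i) = gaussianReal 0 1) ∧ ∃ f ∈ gaussPoly e Finset.univ p.totalDegree,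
      (fun ω => MvPolynomial.eval (fun h : H.carrier => (h : Lp ℂ 2 P) ω) p) =ᵐ[P] f := by
  classical
  -- An orthonormal basis of the real span of the real and imaginary parts of the variables
  -- of `p` consists of jointly Gaussian, uncorrelated variables, hence of independent ones.
  set s : Set (Lp ℝ 2 P) := (fun h : H.carrier => reL P (h : Lp ℂ 2 P)) '' p.vars ∪
    (fun h : H.carrier => reL P (-Complex.I • (h : Lp ℂ 2 P))) '' p.vars with hs
  have hsfin : s.Finite := ((Finset.finite_toSet _).image _).union ((Finset.finite_toSet _).image _)
  set F := Submodule.span ℝ s with hF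
  have : FiniteDimensional ℝ F := FiniteDimensional.span_of_finite ℝ hsfin
  have hFH : F ≤ H.realPart := by
    refine Submodule.span_le.2 ?_
    rintro _ (⟨h, _, rfl⟩ | ⟨h, _, rfl⟩)
    · exact H.reL_mem_realPart h.2
    · exact H.reL_mem_realPart (H.carrier.smul_mem _ h.2)
  set b := stdOrthonormalBasis ℝ F with hb
  set e : Fin (Module.finrank ℝ F) → Ω → ℝ := fun j => ((b j : F) : Lp ℝ 2 P) with he
  have hbH : ∀ j, ((b j : F) : Lp ℝ 2 P) ∈ H.realPart := fun j => hFH (b j).2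
  have hnorm : ∀ j, ‖((b j : F) : Lp ℝ 2 P)‖₊ = 1 := fun j => by
    ext
    exact b.orthonormal.1 j
  have hlaw : ∀ j, P.map (e j) = gaussianReal 0 1 := fun j => by
    rw [he, H.map_realPart (hbH j), hnorm]
    simp
  have hm : ∀ j, Measurable (e j) := fun j => (Lp.stronglyMeasurable _).measurable
  have hmean : ∀ j, ∫ ω, e j ω ∂P = 0 := fun j => by
    have : ∫ x, x ∂(P.map (e j)) = 0 := by rw [hlaw j]; simp
    rwa [integral_map (hm j).aemeasurable (by fun_prop)] at this
  have hind : iIndepFun e P := by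
    refine HasGaussianLaw.iIndepFun_of_covariance_eq_zero
      (H.hasGaussianLaw_realPart (fun j => ((b j : F) : Lp ℝ 2 P)) hbH) fun i j hij => ?_
    rw [covariance_eq_sub (Lp.memLp _) (Lp.memLp _)]
    have h1 : inner ℝ (b i) (b j) = 0 := b.orthonormal.2 hij
    rw [Submodule.coe_inner, inner_eq_integral_mul] at h1
    have h2 := hmean i
    simp only [he] at h2
    rw [h2]
    simpa using h1
  refine ⟨_, e, hm, hind, hlaw, ?_⟩
  -- every real element of the span is a combination of the `e j`
  have hexp : ∀ Y ∈ F, (Y : Ω → ℝ) =ᵐ[P] fun ω => ∑ j, (inner ℝ ((b j : F) : Lp ℝ 2 P) Y : ℝ) * e j ω := by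
    intro Y hY
    have h1 := congrArg (Submodule.subtype F) (b.sum_repr' ⟨Y, hY⟩)
    rw [map_sum] at h1
    simp only [Submodule.subtype_apply, Submodule.coe_smul, Submodule.coe_inner] at h1
    have h2 : ∀ᵐ ω ∂P, ∀ j, ((inner ℝ ((b j : F) : Lp ℝ 2 P) Y : ℝ) • ((b j : F) : Lp ℝ 2 P) : Lp ℝ 2 P) ω =
        (inner ℝ ((b j : F) : Lp ℝ 2 P) Y : ℝ) * e j ω := by
      rw [ae_all_iff]
      intro j
      filter_upwards [Lp.coeFn_smul (inner ℝ ((b j : F) : Lp ℝ 2 P) Y : ℝ) ((b j : F) : Lp ℝ 2 P)]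
        with ω h
      simp [h, he]
    filter_upwards [h2, Lp.coeFn_finsetSum Finset.univ
      fun j => (inner ℝ ((b j : F) : Lp ℝ 2 P) Y : ℝ) • ((b j : F) : Lp ℝ 2 P)] with ω h3 h4
    conv_lhs => rw [← h1, h4, Finset.sum_apply]
    exact Finset.sum_congr rfl fun j _ => h3 j
  set c : H.carrier → Fin (Module.finrank ℝ F) → ℂ := fun h j =>
    (inner ℝ ((b j : F) : Lp ℝ 2 P) (reL P (h : Lp ℂ 2 P)) : ℝ) +
      (inner ℝ ((b j : F) : Lp ℝ 2 P) (reL P (-Complex.I • (h : Lp ℂ 2 P))) : ℝ) * Complex.I with hc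
  have hh : ∀ h ∈ p.vars, ((h : Lp ℂ 2 P) : Ω → ℂ) =ᵐ[P] fun ω => ∑ j, c h j * (e j ω : ℂ) := by
    intro h hhp
    have h1 := hexp _ (Submodule.subset_span (Or.inl ⟨h, hhp, rfl⟩))
    have h2 := hexp _ (Submodule.subset_span (Or.inr ⟨h, hhp, rfl⟩))
    filter_upwards [h1, h2, coeFn_reL (h : Lp ℂ 2 P), coeFn_reL (-Complex.I • (h : Lp ℂ 2 P)),
      Lp.coeFn_smul (-Complex.I) (h : Lp ℂ 2 P)] with ω h3 h4 h5 h6 h7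
    rw [h5] at h3
    rw [h6, h7] at h4
    have h8 : (-Complex.I * (h : Lp ℂ 2 P) ω).re = ((h : Lp ℂ 2 P) ω).im := by simp
    rw [Pi.smul_apply, smul_eq_mul, h8] at h4
    rw [← Complex.re_add_im ((h : Lp ℂ 2 P) ω), h3, h4]
    push_cast
    rw [Finset.sum_mul, ← Finset.sum_add_distrib]
    refine Finset.sum_congr rfl fun j _ => ?_
    simp only [hc]
    ring
  set G : H.carrier → Ω → ℂ := fun h ω => ∑ j, c h j * (e j ω : ℂ) with hG
  refine ⟨MvPolynomial.aeval G p, ?_, ?_⟩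
  · refine MvPolynomial.aeval_mem_one_sup_pow _ G (fun h => ?_) p
    have : G h = ∑ j, c h j • fun ω => (e j ω : ℂ) := by
      ext ω
      simp [hG]
    rw [this]
    refine Submodule.sum_mem _ fun j _ => Submodule.smul_mem _ _ (Submodule.subset_span ⟨j, by simp, rfl⟩)
  · have h1 : ∀ᵐ ω ∂P, ∀ h ∈ p.vars, (h : Lp ℂ 2 P) ω = G h ω := by
      rw [Filter.eventually_all_finset]
      exact hh
    filter_upwards [h1] with ω h2
    have h3 := MvPolynomial.comp_aeval_apply G (Pi.evalAlgHom ℂ (fun _ : Ω => ℂ) ω) p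
    simp only [Pi.evalAlgHom_apply] at h3
    rw [h3, MvPolynomial.aeval_eq_eval]
    refine MvPolynomial.eval₂Hom_congr' rfl ?_ rfl
    intro h hh _
    exact h2 h hh

/-- Polynomials in `H` have all moments, and satisfy a reverse Hölder inequality depending only on
the degree. -/
theorem memLp_of_mem_polynomials (H : GaussianHilbertSpace P) {n : ℕ} {X : Lp ℂ 2 P}
    (hX : X ∈ H.polynomials n) : (X : Ω → ℂ) ∈ allMoments P ∧
      ∫ ω, ‖X ω‖ ^ 4 ∂P ≤ (hyperConst n ^ n * ∫ ω, ‖X ω‖ ^ 2 ∂P) ^ 2 := by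
  obtain ⟨p, hp, hXp⟩ := hX
  obtain ⟨m, e, hm, hind, hlaw, f, hf, hfe⟩ := H.exists_gaussPoly p
  have hXf := hXp.trans hfe
  have hf' := gaussPoly_mono (Finset.Subset.refl Finset.univ) hp hf
  have he : ∀ i, (fun ω => ((e i ω : ℝ) : ℂ)) ∈ allMoments P := fun i => by
    simpa using ofReal_eval_mem_allMoments (hm i) (hlaw i) Polynomial.X
  have hfm : f ∈ allMoments P := gaussPoly_le_subalgebra _ (fun i _ => he i) _ hf
  refine ⟨fun q hq => (memLp_congr_ae hXf).2 (hfm q hq), ?_⟩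
  have h4 : ∫ ω, ‖X ω‖ ^ 4 ∂P = ∫ ω, ‖f ω‖ ^ 4 ∂P := integral_congr_ae (by
    filter_upwards [hXf] with ω h
    rw [h])
  have h2 : ∫ ω, ‖X ω‖ ^ 2 ∂P = ∫ ω, ‖f ω‖ ^ 2 ∂P := integral_congr_ae (by
    filter_upwards [hXf] with ω h
    rw [h])
  rw [h4, h2]
  exact gaussPoly_hypercontractive hm hind hlaw n Finset.univ n le_rfl f hf'

/-- The constant comparing the `L⁴` and `L²` norms on `polyClosure n`. -/
noncomputable def l4Const (n : ℕ) : ℝ := Real.sqrt (hyperConst n ^ n)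

/-- The bound of the `L⁴` norm by the `L²` norm passes from polynomials to their `L²` limits by
Fatou along an almost everywhere convergent subsequence. -/
theorem eLpNorm_four_le_of_mem_polynomials (H : GaussianHilbertSpace P) {n : ℕ} {X : Lp ℂ 2 P}
    (hX : X ∈ H.polynomials n) : eLpNorm X 4 P ≤ ENNReal.ofReal (l4Const n * ‖X‖) := by
  obtain ⟨h1, h2⟩ := H.memLp_of_mem_polynomials hX
  have hR := one_le_hyperConst n
  have hnorm : ∫ ω, ‖X ω‖ ^ 2 ∂P = ‖X‖ ^ 2 := by
    have h3 := L2.inner_def (𝕜 := ℂ) X X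
    rw [inner_self_eq_norm_sq_to_K] at h3
    have h4 : ∀ ω, inner ℂ (X ω) (X ω) = ((‖X ω‖ ^ 2 : ℝ) : ℂ) := fun ω => by
      rw [inner_self_eq_norm_sq_to_K]
      push_cast
      rfl
    simp_rw [h4] at h3
    rw [integral_complex_ofReal] at h3
    have h5 : ((‖X‖ ^ 2 : ℝ) : ℂ) = ((∫ ω, ‖X ω‖ ^ 2 ∂P : ℝ) : ℂ) := by
      rw [← h3]
      push_cast
      rfl
    exact (Complex.ofReal_injective h5).symm
  rw [hnorm] at h2
  rw [(h1 4 (by simp)).eLpNorm_eq_integral_rpow_norm (by simp) (by simp)]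
  refine ENNReal.ofReal_le_ofReal ?_
  have h6 : ∀ ω, ‖X ω‖ ^ (ENNReal.toReal 4) = ‖X ω‖ ^ 4 := fun ω => by
    rw [← Real.rpow_natCast]
    norm_num
  simp_rw [h6]
  have h7 : 0 ≤ l4Const n * ‖X‖ := mul_nonneg (Real.sqrt_nonneg _) (norm_nonneg _)
  refine (Real.rpow_le_rpow (integral_nonneg fun ω => by positivity)
    (h2.trans (le_of_eq ?_ : _ ≤ (l4Const n * ‖X‖) ^ (4 : ℝ))) (by simp)).trans_eq ?_
  · rw [show (4 : ℝ) = ((4 : ℕ) : ℝ) by norm_num, Real.rpow_natCast, l4Const]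
    have hs := Real.sq_sqrt (pow_nonneg (zero_le_one.trans hR) n)
    rw [show ∀ x y : ℝ, (x * y) ^ 4 = (x ^ 2) ^ 2 * (y ^ 2) ^ 2 by intro x y; ring, hs]
    ring
  · rw [← Real.rpow_mul h7]
    simp

theorem eLpNorm_four_le (H : GaussianHilbertSpace P) {n : ℕ} {X : Lp ℂ 2 P}
    (hX : X ∈ H.polyClosure n) : eLpNorm X 4 P ≤ ENNReal.ofReal (l4Const n * ‖X‖) := by
  obtain ⟨u, hu, hlim⟩ := mem_closure_iff_seq_limit.1 hX
  obtain ⟨ns, hns, hae⟩ := (tendstoInMeasure_of_tendsto_Lp hlim).exists_seq_tendsto_ae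
  refine (Lp.eLpNorm_lim_le_liminf_eLpNorm (fun k => (Lp.stronglyMeasurable (u (ns k))).aestronglyMeasurable)
    (X : Ω → ℂ) hae).trans ?_
  have h1 : Filter.Tendsto (fun k => ENNReal.ofReal (l4Const n * ‖u (ns k)‖)) Filter.atTop
      (nhds (ENNReal.ofReal (l4Const n * ‖X‖))) :=
    ENNReal.tendsto_ofReal (((hlim.comp hns.tendsto_atTop).norm).const_mul _)
  rw [← h1.liminf_eq]
  exact Filter.liminf_le_liminf (Filter.Eventually.of_forall fun k =>
    H.eLpNorm_four_le_of_mem_polynomials (hu (ns k)))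

theorem memLp_four (H : GaussianHilbertSpace P) {n : ℕ} {X : Lp ℂ 2 P}
    (hX : X ∈ H.polyClosure n) : MemLp X 4 P :=
  ⟨(Lp.stronglyMeasurable X).aestronglyMeasurable,
    (H.eLpNorm_four_le hX).trans_lt ENNReal.ofReal_lt_top⟩

theorem holderTriple_four : ENNReal.HolderTriple 4 4 2 := ⟨by
  rw [show (4 : ℝ≥0∞) = 2 * 2 by norm_num, ENNReal.mul_inv (by simp) (by simp), ← add_mul,
    ENNReal.inv_two_add_inv_two, one_mul]⟩

theorem memLp_mul (H : GaussianHilbertSpace P) {m n : ℕ} {X Y : Lp ℂ 2 P}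
    (hX : X ∈ H.polyClosure m) (hY : Y ∈ H.polyClosure n) : MemLp (fun ω => X ω * Y ω) 2 P :=
  have := holderTriple_four
  (H.memLp_four hY).mul (H.memLp_four hX)

theorem coeFn_l2Mul (H : GaussianHilbertSpace P) {m n : ℕ} {X Y : Lp ℂ 2 P}
    (hX : X ∈ H.polyClosure m) (hY : Y ∈ H.polyClosure n) :
    (l2Mul X Y : Ω → ℂ) =ᵐ[P] fun ω => X ω * Y ω := by
  rw [l2Mul, dif_pos (H.memLp_mul hX hY)]
  exact MemLp.coeFn_toLp _

/-- The product is bounded from `polyClosure m × polyClosure n` to `L²`, by Hölder and the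
equivalence of the `L⁴` and `L²` norms. In particular the junk value of `l2Mul` does not occur. -/
theorem norm_l2Mul_le (H : GaussianHilbertSpace P) {m n : ℕ} {X Y : Lp ℂ 2 P}
    (hX : X ∈ H.polyClosure m) (hY : Y ∈ H.polyClosure n) :
    ‖l2Mul X Y‖ ≤ l4Const m * l4Const n * ‖X‖ * ‖Y‖ := by
  have := holderTriple_four
  have hc : ∀ k, 0 ≤ l4Const k := fun k => Real.sqrt_nonneg _
  rw [Lp.norm_def, eLpNorm_congr_ae (H.coeFn_l2Mul hX hY)]
  have h1 := eLpNorm_le_eLpNorm_mul_eLpNorm_of_nnnorm (μ := P) (p := 4) (q := 4) (r := 2)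
    (Lp.stronglyMeasurable X).aestronglyMeasurable (Lp.stronglyMeasurable Y).aestronglyMeasurable
    (fun x y : ℂ => x * y) 1 (Filter.Eventually.of_forall fun ω => by simp)
  refine ENNReal.toReal_le_of_le_ofReal (by have := hc m; have := hc n; positivity) (h1.trans ?_)
  rw [ENNReal.coe_one, one_mul]
  refine (mul_le_mul' (H.eLpNorm_four_le hX) (H.eLpNorm_four_le hY)).trans_eq ?_
  rw [← ENNReal.ofReal_mul (mul_nonneg (hc m) (norm_nonneg _))]
  congr 1
  ring

end GaussianHilbertSpace

/-! ### The Wick product as a bounded bilinear map -/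

namespace GaussianHilbertSpace

variable {Ω : Type*} [MeasurableSpace Ω] {P : Measure Ω}

theorem chaos_le_polyClosure (H : GaussianHilbertSpace P) (n : ℕ) :
    H.chaos n ≤ H.polyClosure n := by
  cases n with
  | zero => exact le_rfl
  | succ n => exact inf_le_right

theorem polynomials_mono (H : GaussianHilbertSpace P) {m n : ℕ} (h : m ≤ n) :
    H.polynomials m ≤ H.polynomials n :=
  fun _ ⟨p, hp, hX⟩ => ⟨p, hp.trans h, hX⟩

theorem polyClosure_mono (H : GaussianHilbertSpace P) {m n : ℕ} (h : m ≤ n) :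
    H.polyClosure m ≤ H.polyClosure n :=
  Submodule.topologicalClosure_mono (H.polynomials_mono h)

theorem inner_eq_zero_of_ne (H : GaussianHilbertSpace P) {m n : ℕ} (h : m ≠ n) {X Y : Lp ℂ 2 P}
    (hX : X ∈ H.chaos m) (hY : Y ∈ H.chaos n) : inner ℂ X Y = 0 := by
  wlog hmn : m < n generalizing m n X Y
  · rw [← inner_conj_symm, this h.symm hY hX (by omega), map_zero]
  obtain ⟨k, rfl⟩ : ∃ k, n = k + 1 := ⟨n - 1, by omega⟩
  exact (Submodule.mem_orthogonal _ _).1 hY.1 X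
    (H.polyClosure_mono (by omega) (H.chaos_le_polyClosure m hX))

theorem star_smul_l2 (c : ℂ) (X : Lp ℂ 2 P) : star (c • X) = star c • star X := by
  refine Lp.ext ?_
  filter_upwards [Lp.coeFn_star (c • X), Lp.coeFn_smul c X, Lp.coeFn_smul (star c) (star X),
    Lp.coeFn_star X] with ω h1 h2 h3 h4
  rw [h1, Pi.star_apply, h2, h3, Pi.smul_apply, Pi.smul_apply, h4, Pi.star_apply]
  simp

theorem norm_star_l2 (X : Lp ℂ 2 P) : ‖star X‖ = ‖X‖ := by
  rw [Lp.norm_def, Lp.norm_def, eLpNorm_congr_ae (Lp.coeFn_star X), eLpNorm_star]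

theorem star_add_l2 (X Y : Lp ℂ 2 P) : star (X + Y) = star X + star Y := by
  refine Lp.ext ?_
  filter_upwards [Lp.coeFn_star (X + Y), Lp.coeFn_add X Y, Lp.coeFn_add (star X) (star Y),
    Lp.coeFn_star X, Lp.coeFn_star Y] with ω h1 h2 h3 h4 h5
  rw [h1, Pi.star_apply, h2, h3, Pi.add_apply, Pi.add_apply, h4, h5, Pi.star_apply, Pi.star_apply,
    star_add]

/-- Complex conjugation on a chaos, as a real-linear map. -/
noncomputable def conjL (H : GaussianHilbertSpace P) (n : ℕ) : H.chaos n →L[ℝ] H.chaos n :=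
  LinearMap.mkContinuous
    { toFun := fun X => ⟨star (X : Lp ℂ 2 P), H.star_mem_chaos X.2⟩
      map_add' := fun X Y => Subtype.ext (star_add_l2 _ _)
      map_smul' := fun r X => Subtype.ext (by
        have h1 : ((r • X : H.chaos n) : Lp ℂ 2 P) = (r : ℂ) • (X : Lp ℂ 2 P) := by
          rw [Submodule.coe_smul_of_tower]
          exact (Complex.coe_smul r (X : Lp ℂ 2 P)).symm
        have h2 : ((r • (⟨star (X : Lp ℂ 2 P), H.star_mem_chaos X.2⟩ : H.chaos n) : H.chaos n) :
            Lp ℂ 2 P) = (r : ℂ) • star (X : Lp ℂ 2 P) := by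
          rw [Submodule.coe_smul_of_tower]
          exact (Complex.coe_smul r (star (X : Lp ℂ 2 P))).symm
        change star ((r • X : H.chaos n) : Lp ℂ 2 P) = _
        rw [h1, star_smul_l2, RingHom.id_apply, h2]
        simp) } 1
    (fun X => by
      rw [one_mul]
      exact (norm_star_l2 _).le)

theorem conjL_smul (H : GaussianHilbertSpace P) (n : ℕ) (c : ℂ) (X : H.chaos n) :
    H.conjL n (c • X) = (starRingEnd ℂ) c • H.conjL n X :=
  Subtype.ext (star_smul_l2 _ _)

variable [IsProbabilityMeasure P]

/-- The pointwise product, as a bounded bilinear map. -/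
noncomputable def mulL (H : GaussianHilbertSpace P) (p q : ℕ) :
    H.polyClosure p →L[ℂ] H.polyClosure q →L[ℂ] Lp ℂ 2 P :=
  LinearMap.mkContinuous₂ (LinearMap.mk₂ ℂ
    (fun (X : H.polyClosure p) (Y : H.polyClosure q) => l2Mul (X : Lp ℂ 2 P) (Y : Lp ℂ 2 P))
    (fun X X' Y => Lp.ext (by
      filter_upwards [H.coeFn_l2Mul (X + X').2 Y.2, H.coeFn_l2Mul X.2 Y.2, H.coeFn_l2Mul X'.2 Y.2,
        Lp.coeFn_add (X : Lp ℂ 2 P) X', Lp.coeFn_add (l2Mul (X : Lp ℂ 2 P) Y) (l2Mul (X' : Lp ℂ 2 P) Y)]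
        with ω h1 h2 h3 h4 h5
      rw [h1, h5, Submodule.coe_add, h4, Pi.add_apply, Pi.add_apply, h2, h3, add_mul]))
    (fun c X Y => Lp.ext (by
      filter_upwards [H.coeFn_l2Mul (c • X).2 Y.2, H.coeFn_l2Mul X.2 Y.2,
        Lp.coeFn_smul c (X : Lp ℂ 2 P), Lp.coeFn_smul c (l2Mul (X : Lp ℂ 2 P) Y)]
        with ω h1 h2 h4 h5
      rw [h1, h5, Submodule.coe_smul, h4, Pi.smul_apply, Pi.smul_apply, h2, smul_mul_assoc]))
    (fun X Y Y' => Lp.ext (by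
      filter_upwards [H.coeFn_l2Mul X.2 (Y + Y').2, H.coeFn_l2Mul X.2 Y.2, H.coeFn_l2Mul X.2 Y'.2,
        Lp.coeFn_add (Y : Lp ℂ 2 P) Y', Lp.coeFn_add (l2Mul (X : Lp ℂ 2 P) Y) (l2Mul (X : Lp ℂ 2 P) Y')]
        with ω h1 h2 h3 h4 h5
      rw [h1, h5, Submodule.coe_add, h4, Pi.add_apply, Pi.add_apply, h2, h3, mul_add]))
    (fun c X Y => Lp.ext (by
      filter_upwards [H.coeFn_l2Mul X.2 (c • Y).2, H.coeFn_l2Mul X.2 Y.2,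
        Lp.coeFn_smul c (Y : Lp ℂ 2 P), Lp.coeFn_smul c (l2Mul (X : Lp ℂ 2 P) Y)]
        with ω h1 h2 h4 h5
      rw [h1, h5, Submodule.coe_smul, h4, Pi.smul_apply, Pi.smul_apply, h2, mul_smul_comm])))
    (l4Const p * l4Const q) (fun X Y => H.norm_l2Mul_le X.2 Y.2)

theorem mulL_apply (H : GaussianHilbertSpace P) {p q : ℕ} (X : H.polyClosure p)
    (Y : H.polyClosure q) : H.mulL p q X Y = l2Mul (X : Lp ℂ 2 P) (Y : Lp ℂ 2 P) := rfl

/-- The inclusion of a chaos in the closure of the polynomials. -/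
noncomputable def inclL (H : GaussianHilbertSpace P) (n : ℕ) : H.chaos n →L[ℂ] H.polyClosure n :=
  (H.chaos n).subtypeL.codRestrict (H.polyClosure n) fun X => H.chaos_le_polyClosure n X.2

/-- The Wick product of chaos components: `(X, Y) ↦ πₙ (X Y)` on chaoses of orders `p` and `q`. -/
noncomputable def wickL (H : GaussianHilbertSpace P) (p q n : ℕ) :
    H.chaos p →L[ℂ] H.chaos q →L[ℂ] H.chaos n :=
  (ContinuousLinearMap.compL ℂ (H.chaos q) (Lp ℂ 2 P) (H.chaos n) (H.chaosProj n)).comp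
    ((H.mulL p q).bilinearComp (H.inclL p) (H.inclL q))

theorem wickL_apply (H : GaussianHilbertSpace P) {p q n : ℕ} (X : H.chaos p) (Y : H.chaos q) :
    H.wickL p q n X Y = H.chaosProj n (l2Mul (X : Lp ℂ 2 P) (Y : Lp ℂ 2 P)) := rfl

/-- The component of order `n` of the cubic nonlinearity `X ⊙ Ȳ ⊙ Z`. -/
theorem wick_wick_conj_apply (H : GaussianHilbertSpace P) (X Y Z : H.Formal) (n : ℕ) :
    H.wick (H.wick X (H.conj Y)) Z n =
      ∑ sc ∈ Finset.HasAntidiagonal.antidiagonal n,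
        ∑ ab ∈ Finset.HasAntidiagonal.antidiagonal sc.1,
          H.wickL sc.1 sc.2 n (H.wickL ab.1 ab.2 sc.1 (X ab.1) (H.conjL ab.2 (Y ab.2))) (Z sc.2) := by
  unfold wick
  refine Finset.sum_congr rfl fun sc _ => ?_
  rw [← wickL_apply, map_sum, _root_.sum_apply]
  rfl

end GaussianHilbertSpace

/-! ### Second quantization of rotations -/

namespace GaussianHilbertSpace

variable {Ω : Type*} [MeasurableSpace Ω] {P : Measure Ω}

/-- A unitary operator on `L²` that restricts to a unitary of `H` and commutes with complex
conjugation. -/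
structure Rotation (H : GaussianHilbertSpace P) where
  /-- The underlying unitary operator. -/
  U : Lp ℂ 2 P ≃ₗᵢ[ℂ] Lp ℂ 2 P
  mem : ∀ X ∈ H.carrier, U X ∈ H.carrier
  symm_mem : ∀ X ∈ H.carrier, U.symm X ∈ H.carrier
  map_star : ∀ X, U (star X) = star (U X)

variable {H : GaussianHilbertSpace P}

/-- The action of a rotation on `H`. -/
noncomputable def Rotation.act (ρ : H.Rotation) (h : H.carrier) : H.carrier := ⟨ρ.U h, ρ.mem h h.2⟩

/-- The action of the inverse of a rotation on `H`. -/
noncomputable def Rotation.actSymm (ρ : H.Rotation) (h : H.carrier) : H.carrier := ⟨ρ.U.symm h, ρ.symm_mem h h.2⟩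

theorem Rotation.act_actSymm (ρ : H.Rotation) (h : H.carrier) : ρ.act (ρ.actSymm h) = h :=
  Subtype.ext (ρ.U.apply_symm_apply h)

/-- Rotations preserve the joint laws of elements of `H`: a real-linear functional of such elements
is a centered real Gaussian, and its variance is preserved. -/
theorem Rotation.map_eq [IsProbabilityMeasure P] (ρ : H.Rotation) {κ : Type*} [Fintype κ]
    (h : κ → H.carrier) :
    P.map (fun ω i => (h i : Lp ℂ 2 P) ω) = P.map (fun ω i => (ρ.act (h i) : Lp ℂ 2 P) ω) := by
  classical
  have hm : ∀ h : κ → H.carrier, Measurable fun ω => (fun i => (h i : Lp ℂ 2 P) ω) := fun h =>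
    measurable_pi_iff.2 fun i => (Lp.stronglyMeasurable _).measurable
  have hprob : ∀ h : κ → H.carrier, IsProbabilityMeasure (P.map fun ω i => (h i : Lp ℂ 2 P) ω) :=
    fun h => Measure.isProbabilityMeasure_map (hm h).aemeasurable
  have := hprob h
  have := hprob (fun i => ρ.act (h i))
  refine Measure.ext_of_charFunDual (funext fun L => ?_)
  set a : κ → ℂ := fun i => (L (Pi.single i 1) : ℂ) - (L (Pi.single i Complex.I) : ℂ) * Complex.I
    with ha
  -- the functional `L` is the real part of a complex combination
  have hL : ∀ z : κ → ℂ, L z = (∑ i, a i * z i).re := by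
    intro z
    conv_lhs => rw [← Finset.univ_sum_single z, map_sum]
    rw [Complex.re_sum]
    refine Finset.sum_congr rfl fun i _ => ?_
    have h1 : (Pi.single i (z i) : κ → ℂ) =
        (z i).re • (Pi.single i (1 : ℂ) : κ → ℂ) + (z i).im • (Pi.single i Complex.I : κ → ℂ) := by
      rw [← Pi.single_smul, ← Pi.single_smul, ← Pi.single_add]
      congr 1
      apply Complex.ext <;> simp
    rw [h1, map_add, map_smul, map_smul]
    simp [ha]
    ring
  have key : ∀ h : κ → H.carrier, charFunDual (P.map fun ω i => (h i : Lp ℂ 2 P) ω) L =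
      charFun (gaussianReal 0 (‖reL P (∑ i, a i • (h i : Lp ℂ 2 P))‖₊ ^ 2)) 1 := by
    intro h
    have hH : ∑ i, a i • (h i : Lp ℂ 2 P) ∈ H.carrier :=
      H.carrier.sum_mem fun i _ => H.carrier.smul_mem _ (h i).2
    rw [← H.map_realPart (H.reL_mem_realPart hH), charFunDual_apply, charFun_apply_real,
      integral_map (hm h).aemeasurable (by fun_prop), integral_map
        (Lp.stronglyMeasurable _).measurable.aemeasurable (by fun_prop)]
    refine integral_congr_ae ?_
    have h1 : ∀ᵐ ω ∂P, ∀ i, (a i • (h i : Lp ℂ 2 P) : Lp ℂ 2 P) ω = a i * (h i : Lp ℂ 2 P) ω := by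
      rw [ae_all_iff]
      intro i
      filter_upwards [Lp.coeFn_smul (a i) (h i : Lp ℂ 2 P)] with ω h
      simp [h]
    filter_upwards [h1, coeFn_reL (∑ i, a i • (h i : Lp ℂ 2 P)),
      Lp.coeFn_finsetSum Finset.univ fun i => a i • (h i : Lp ℂ 2 P)] with ω h2 h3 h4
    rw [h3, h4, Finset.sum_apply, hL]
    simp_rw [h2]
    simp
  rw [key, key]
  have h1 : ∑ i, a i • (ρ.act (h i) : Lp ℂ 2 P) = ρ.U (∑ i, a i • (h i : Lp ℂ 2 P)) := by
    rw [map_sum]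
    refine Finset.sum_congr rfl fun i _ => ?_
    rw [map_smul]
    rfl
  have h2 : ∀ Z, ‖reL P (ρ.U Z)‖ = ‖reL P Z‖ := by
    intro Z
    rw [← norm_ofRealL, ← norm_ofRealL (reL P Z), ofRealL_reL, ofRealL_reL, ← ρ.map_star, ← map_add,
      ← map_smul, LinearIsometryEquiv.norm_map]
  have h3 : ‖reL P (∑ i, a i • (ρ.act (h i) : Lp ℂ 2 P))‖₊ = ‖reL P (∑ i, a i • (h i : Lp ℂ 2 P))‖₊ := by
    ext
    rw [h1]
    exact h2 _
  rw [h3]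

/-- The random variable given by a polynomial in elements of `H`. -/
noncomputable def polyEval (H : GaussianHilbertSpace P) (p : MvPolynomial H.carrier ℂ) (ω : Ω) : ℂ :=
  MvPolynomial.eval (fun h : H.carrier => (h : Lp ℂ 2 P) ω) p

/-- The random variable given by a polynomial in the rotated elements of `H`. -/
noncomputable def Rotation.polyEval (ρ : H.Rotation) (p : MvPolynomial H.carrier ℂ) (ω : Ω) : ℂ :=
  MvPolynomial.eval (fun h : H.carrier => (ρ.act h : Lp ℂ 2 P) ω) p

/-- Second quantization preserves the moments of polynomials, because a rotation preserves joint
laws. -/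
theorem Rotation.eLpNorm_polyEval [IsProbabilityMeasure P] (ρ : H.Rotation)
    (p : MvPolynomial H.carrier ℂ) :
    eLpNorm (ρ.polyEval p) 2 P = eLpNorm (H.polyEval p) 2 P := by
  obtain ⟨q, hq⟩ := MvPolynomial.exists_rename_eq_of_vars_subset_range p
    ((↑) : p.vars → H.carrier) Subtype.coe_injective (by simp)
  have hm : ∀ h : p.vars → H.carrier, Measurable fun ω => (fun i => (h i : Lp ℂ 2 P) ω) := fun h =>
    measurable_pi_iff.2 fun i => (Lp.stronglyMeasurable _).measurable
  have h1 := ρ.map_eq (fun i : p.vars => (i : H.carrier))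
  have hcont : Continuous fun x : p.vars → ℂ => MvPolynomial.eval x q := MvPolynomial.continuous_eval q
  have h2 : H.polyEval p = (fun x => MvPolynomial.eval x q) ∘
      fun ω (i : p.vars) => ((i : H.carrier) : Lp ℂ 2 P) ω := by
    ext ω
    conv_lhs => rw [GaussianHilbertSpace.polyEval, ← hq, MvPolynomial.eval_rename]
    rfl
  have h3 : ρ.polyEval p = (fun x => MvPolynomial.eval x q) ∘
      fun ω (i : p.vars) => ((ρ.act i) : Lp ℂ 2 P) ω := by
    ext ω
    conv_lhs => rw [Rotation.polyEval, ← hq, MvPolynomial.eval_rename]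
    rfl
  rw [h2, h3, ← eLpNorm_map_measure hcont.aestronglyMeasurable (hm _).aemeasurable,
    ← eLpNorm_map_measure hcont.aestronglyMeasurable (hm _).aemeasurable, h1]

/-- The graph, on polynomials of degree at most `n`, of the second quantization of a rotation: the
pairs `(p(h), p(U h))`. -/
noncomputable def Rotation.graph (ρ : H.Rotation) (n : ℕ) : Submodule ℂ (Lp ℂ 2 P × Lp ℂ 2 P) where
  carrier := {X | ∃ p : MvPolynomial H.carrier ℂ, p.totalDegree ≤ n ∧
    (X.1 : Ω → ℂ) =ᵐ[P] H.polyEval p ∧ (X.2 : Ω → ℂ) =ᵐ[P] ρ.polyEval p}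
  add_mem' := by
    rintro X Y ⟨p, hp, hX, hX'⟩ ⟨q, hq, hY, hY'⟩
    refine ⟨p + q, (MvPolynomial.totalDegree_add p q).trans (max_le hp hq), ?_, ?_⟩
    · filter_upwards [Lp.coeFn_add X.1 Y.1, hX, hY] with ω h1 h2 h3
      rw [Prod.fst_add, h1, Pi.add_apply, h2, h3, GaussianHilbertSpace.polyEval,
        GaussianHilbertSpace.polyEval, GaussianHilbertSpace.polyEval, map_add]
    · filter_upwards [Lp.coeFn_add X.2 Y.2, hX', hY'] with ω h1 h2 h3
      rw [Prod.snd_add, h1, Pi.add_apply, h2, h3, Rotation.polyEval, Rotation.polyEval,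
        Rotation.polyEval, map_add]
  zero_mem' := by
    refine ⟨0, by simp, ?_, ?_⟩
    · filter_upwards [Lp.coeFn_zero ℂ 2 P] with ω h
      rw [Prod.fst_zero, h, GaussianHilbertSpace.polyEval, map_zero, Pi.zero_apply]
    · filter_upwards [Lp.coeFn_zero ℂ 2 P] with ω h
      rw [Prod.snd_zero, h, Rotation.polyEval, map_zero, Pi.zero_apply]
  smul_mem' := by
    rintro c X ⟨p, hp, hX, hX'⟩
    refine ⟨c • p, (MvPolynomial.totalDegree_smul_le c p).trans hp, ?_, ?_⟩
    · filter_upwards [Lp.coeFn_smul c X.1, hX] with ω h1 h2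
      rw [Prod.smul_fst, h1, Pi.smul_apply, h2, GaussianHilbertSpace.polyEval,
        GaussianHilbertSpace.polyEval, MvPolynomial.smul_eval, smul_eq_mul]
    · filter_upwards [Lp.coeFn_smul c X.2, hX'] with ω h1 h2
      rw [Prod.smul_snd, h1, Pi.smul_apply, h2, Rotation.polyEval,
        Rotation.polyEval, MvPolynomial.smul_eval, smul_eq_mul]

/-- The graph of the second quantization of a rotation on `polyClosure n`. -/
noncomputable def Rotation.closedGraph (ρ : H.Rotation) (n : ℕ) : Submodule ℂ (Lp ℂ 2 P × Lp ℂ 2 P) :=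
  (ρ.graph n).topologicalClosure

theorem Rotation.closedGraph_mono (ρ : H.Rotation) {m n : ℕ} (h : m ≤ n) :
    ρ.closedGraph m ≤ ρ.closedGraph n :=
  Submodule.topologicalClosure_mono fun _ ⟨p, hp, hX⟩ => ⟨p, hp.trans h, hX⟩

theorem Rotation.mem_closedGraph_iff (ρ : H.Rotation) {n : ℕ} {X : Lp ℂ 2 P × Lp ℂ 2 P} :
    X ∈ ρ.closedGraph n ↔ ∃ u : ℕ → Lp ℂ 2 P × Lp ℂ 2 P, (∀ k, u k ∈ ρ.graph n) ∧
      Filter.Tendsto u Filter.atTop (nhds X) := mem_closure_iff_seq_limit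

theorem Rotation.polyEval_eq (ρ : H.Rotation) (p : MvPolynomial H.carrier ℂ) :
    ρ.polyEval p = H.polyEval (MvPolynomial.rename ρ.act p) := by
  ext ω
  rw [Rotation.polyEval, GaussianHilbertSpace.polyEval, MvPolynomial.eval_rename]
  rfl

theorem Rotation.fst_mem_of_graph (ρ : H.Rotation) {n : ℕ} {X : Lp ℂ 2 P × Lp ℂ 2 P}
    (hX : X ∈ ρ.graph n) : X.1 ∈ H.polynomials n := by
  obtain ⟨p, hp, h1, h2⟩ := hX
  exact ⟨p, hp, h1⟩

theorem Rotation.snd_mem_of_graph (ρ : H.Rotation) {n : ℕ} {X : Lp ℂ 2 P × Lp ℂ 2 P}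
    (hX : X ∈ ρ.graph n) : X.2 ∈ H.polynomials n := by
  obtain ⟨p, hp, h1, h2⟩ := hX
  rw [ρ.polyEval_eq] at h2
  exact ⟨_, (MvPolynomial.totalDegree_rename_le _ _).trans hp, h2⟩

theorem Rotation.fst_mem (ρ : H.Rotation) {n : ℕ} {X : Lp ℂ 2 P × Lp ℂ 2 P}
    (hX : X ∈ ρ.closedGraph n) : X.1 ∈ H.polyClosure n :=
  map_mem_closure continuous_fst hX fun _ h => ρ.fst_mem_of_graph h

theorem Rotation.snd_mem (ρ : H.Rotation) {n : ℕ} {X : Lp ℂ 2 P × Lp ℂ 2 P}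
    (hX : X ∈ ρ.closedGraph n) : X.2 ∈ H.polyClosure n :=
  map_mem_closure continuous_snd hX fun _ h => ρ.snd_mem_of_graph h

variable [IsProbabilityMeasure P]

theorem Rotation.norm_eq_of_graph (ρ : H.Rotation) {n : ℕ} {X : Lp ℂ 2 P × Lp ℂ 2 P}
    (hX : X ∈ ρ.graph n) : ‖X.2‖ = ‖X.1‖ := by
  obtain ⟨p, hp, h1, h2⟩ := hX
  rw [Lp.norm_def, Lp.norm_def, eLpNorm_congr_ae h1, eLpNorm_congr_ae h2, ρ.eLpNorm_polyEval]

theorem Rotation.norm_eq (ρ : H.Rotation) {n : ℕ} {X : Lp ℂ 2 P × Lp ℂ 2 P}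
    (hX : X ∈ ρ.closedGraph n) : ‖X.2‖ = ‖X.1‖ := by
  obtain ⟨u, hu, hlim⟩ := ρ.mem_closedGraph_iff.1 hX
  have h1 := (((continuous_fst.tendsto X).comp hlim)).norm
  have h2 := (((continuous_snd.tendsto X).comp hlim)).norm
  refine tendsto_nhds_unique h2 (h1.congr fun k => ?_)
  exact (ρ.norm_eq_of_graph (hu k)).symm

/-- Second quantization is an isometry on `polyClosure n`, by polarization. -/
theorem Rotation.inner_eq (ρ : H.Rotation) {n : ℕ} {X Y : Lp ℂ 2 P × Lp ℂ 2 P}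
    (hX : X ∈ ρ.closedGraph n) (hY : Y ∈ ρ.closedGraph n) :
    inner ℂ X.2 Y.2 = inner ℂ X.1 Y.1 := by
  have h : ∀ c : ℂ, ‖X.2 + c • Y.2‖ = ‖X.1 + c • Y.1‖ := fun c => by
    have h1 := ρ.norm_eq ((ρ.closedGraph n).add_mem hX ((ρ.closedGraph n).smul_mem c hY))
    rwa [Prod.snd_add, Prod.fst_add, Prod.smul_snd, Prod.smul_fst] at h1
  have h1 : ‖X.2 + Y.2‖ = ‖X.1 + Y.1‖ := by simpa only [one_smul] using h 1
  have h2 : ‖X.2 - Y.2‖ = ‖X.1 - Y.1‖ := by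
    simpa only [neg_smul, one_smul, ← sub_eq_add_neg] using h (-1)
  have h3 : ‖X.2 - Complex.I • Y.2‖ = ‖X.1 - Complex.I • Y.1‖ := by
    simpa only [neg_smul, ← sub_eq_add_neg] using h (-Complex.I)
  have h4 : ‖X.2 + Complex.I • Y.2‖ = ‖X.1 + Complex.I • Y.1‖ := h Complex.I
  have e1 := inner_eq_sum_norm_sq_div_four (𝕜 := ℂ) X.2 Y.2
  have e2 := inner_eq_sum_norm_sq_div_four (𝕜 := ℂ) X.1 Y.1
  simp only [RCLike.I_to_complex] at e1 e2
  rw [e1, e2, h1, h2, h3, h4]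

theorem Rotation.exists_graph_fst (ρ : H.Rotation) {n : ℕ} {X : Lp ℂ 2 P}
    (hX : X ∈ H.polynomials n) : ∃ X', (X, X') ∈ ρ.graph n := by
  obtain ⟨p, hp, h⟩ := hX
  have hmem : MemLp (H.polyEval p) 2 P := (memLp_congr_ae h).1 (Lp.memLp X)
  have hmem' : MemLp (ρ.polyEval p) 2 P := by
    refine ⟨?_, by rw [ρ.eLpNorm_polyEval]; exact hmem.2⟩
    have hrw : ρ.polyEval p = fun ω =>
        MvPolynomial.eval (fun h : H.carrier => (ρ.act h : Lp ℂ 2 P) ω) p := rfl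
    rw [hrw]
    simp_rw [MvPolynomial.eval_eq]
    refine (Finset.stronglyMeasurable_fun_sum _ fun s _ => ?_).aestronglyMeasurable
    exact (Finset.stronglyMeasurable_fun_prod _ fun i _ =>
      ((Lp.stronglyMeasurable _).pow _)).const_mul _
  exact ⟨hmem'.toLp, p, hp, h, hmem'.coeFn_toLp⟩

theorem Rotation.exists_graph_snd (ρ : H.Rotation) {n : ℕ} {X' : Lp ℂ 2 P}
    (hX : X' ∈ H.polynomials n) : ∃ X, (X, X') ∈ ρ.graph n := by
  obtain ⟨q, hq, h⟩ := hX
  set p := MvPolynomial.rename ρ.actSymm q with hp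
  have hpq : ρ.polyEval p = H.polyEval q := by
    ext ω
    rw [Rotation.polyEval, GaussianHilbertSpace.polyEval, hp, MvPolynomial.eval_rename]
    congr 1
    congr 1
    ext h
    simp [ρ.act_actSymm]
  have hmem : MemLp (ρ.polyEval p) 2 P := hpq ▸ (memLp_congr_ae h).1 (Lp.memLp X')
  have hmem' : MemLp (H.polyEval p) 2 P := by
    refine ⟨?_, by rw [← ρ.eLpNorm_polyEval]; exact hmem.2⟩
    have hrw : H.polyEval p = fun ω =>
        MvPolynomial.eval (fun h : H.carrier => (h : Lp ℂ 2 P) ω) p := rfl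
    rw [hrw]
    simp_rw [MvPolynomial.eval_eq]
    refine (Finset.stronglyMeasurable_fun_sum _ fun s _ => ?_).aestronglyMeasurable
    exact (Finset.stronglyMeasurable_fun_prod _ fun i _ =>
      ((Lp.stronglyMeasurable _).pow _)).const_mul _
  refine ⟨hmem'.toLp, p, (MvPolynomial.totalDegree_rename_le _ _).trans hq, hmem'.coeFn_toLp, ?_⟩
  rw [hpq]
  exact h

/-- Second quantization is defined on all of `polyClosure n`: a limit of polynomials is mapped to
the limit of their images, which form a Cauchy sequence by isometry. -/
theorem Rotation.exists_fst (ρ : H.Rotation) {n : ℕ} {X : Lp ℂ 2 P}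
    (hX : X ∈ H.polyClosure n) : ∃ X', (X, X') ∈ ρ.closedGraph n := by
  obtain ⟨u, hu, hlim⟩ := mem_closure_iff_seq_limit.1 hX
  choose v hv using fun k => ρ.exists_graph_fst (hu k)
  have hc : CauchySeq v := by
    rw [Metric.cauchySeq_iff']
    intro ε hε
    obtain ⟨N, hN⟩ := Metric.cauchySeq_iff'.1 hlim.cauchySeq ε hε
    refine ⟨N, fun k hk => ?_⟩
    rw [dist_eq_norm]
    have := ρ.norm_eq_of_graph ((ρ.graph n).sub_mem (hv k) (hv N))
    simp only [Prod.snd_sub, Prod.fst_sub] at this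
    rw [this, ← dist_eq_norm]
    exact hN k hk
  obtain ⟨X', hX'⟩ := cauchySeq_tendsto_of_complete hc
  exact ⟨X', ρ.mem_closedGraph_iff.2 ⟨fun k => (u k, v k), hv, hlim.prodMk_nhds hX'⟩⟩

/-- Second quantization is onto `polyClosure n`. -/
theorem Rotation.exists_snd (ρ : H.Rotation) {n : ℕ} {X' : Lp ℂ 2 P}
    (hX : X' ∈ H.polyClosure n) : ∃ X, (X, X') ∈ ρ.closedGraph n := by
  obtain ⟨u, hu, hlim⟩ := mem_closure_iff_seq_limit.1 hX
  choose v hv using fun k => ρ.exists_graph_snd (hu k)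
  have hc : CauchySeq v := by
    rw [Metric.cauchySeq_iff']
    intro ε hε
    obtain ⟨N, hN⟩ := Metric.cauchySeq_iff'.1 hlim.cauchySeq ε hε
    refine ⟨N, fun k hk => ?_⟩
    rw [dist_eq_norm]
    have := ρ.norm_eq_of_graph ((ρ.graph n).sub_mem (hv k) (hv N))
    simp only [Prod.snd_sub, Prod.fst_sub] at this
    rw [← this, ← dist_eq_norm]
    exact hN k hk
  obtain ⟨X, hX'⟩ := cauchySeq_tendsto_of_complete hc
  exact ⟨X, ρ.mem_closedGraph_iff.2 ⟨fun k => (v k, u k), hv, hX'.prodMk_nhds hlim⟩⟩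

theorem tendsto_l2Mul (H : GaussianHilbertSpace P) {p q : ℕ} {u v : ℕ → Lp ℂ 2 P} {X Y : Lp ℂ 2 P}
    (hu : ∀ k, u k ∈ H.polynomials p) (hv : ∀ k, v k ∈ H.polynomials q)
    (hX : Filter.Tendsto u Filter.atTop (nhds X)) (hY : Filter.Tendsto v Filter.atTop (nhds Y)) :
    Filter.Tendsto (fun k => l2Mul (u k) (v k)) Filter.atTop (nhds (l2Mul X Y)) := by
  have hXm : X ∈ H.polyClosure p := mem_closure_of_tendsto hX (Filter.Eventually.of_forall hu)
  have hYm : Y ∈ H.polyClosure q := mem_closure_of_tendsto hY (Filter.Eventually.of_forall hv)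
  have h1 : Filter.Tendsto (fun k => (⟨u k, Submodule.le_topologicalClosure _ (hu k)⟩ : H.polyClosure p))
    Filter.atTop (nhds ⟨X, hXm⟩) := tendsto_subtype_rng.2 hX
  have h2 : Filter.Tendsto (fun k => (⟨v k, Submodule.le_topologicalClosure _ (hv k)⟩ : H.polyClosure q))
    Filter.atTop (nhds ⟨Y, hYm⟩) := tendsto_subtype_rng.2 hY
  have h3 := (((H.mulL p q).continuous₂).tendsto (⟨X, hXm⟩, ⟨Y, hYm⟩)).comp (h1.prodMk_nhds h2)
  have h4 : H.mulL p q ⟨X, hXm⟩ ⟨Y, hYm⟩ = l2Mul X Y := H.mulL_apply _ _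
  have h5 : ∀ k, H.mulL p q ⟨u k, Submodule.le_topologicalClosure _ (hu k)⟩
      ⟨v k, Submodule.le_topologicalClosure _ (hv k)⟩ = l2Mul (u k) (v k) :=
    fun k => H.mulL_apply _ _
  rw [← h4]
  exact h3.congr h5

/-- Second quantization is multiplicative. -/
theorem Rotation.mul_mem (ρ : H.Rotation) {p q : ℕ} {X Y : Lp ℂ 2 P × Lp ℂ 2 P}
    (hX : X ∈ ρ.closedGraph p) (hY : Y ∈ ρ.closedGraph q) :
    (l2Mul X.1 Y.1, l2Mul X.2 Y.2) ∈ ρ.closedGraph (p + q) := by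
  obtain ⟨u, hu, hu'⟩ := ρ.mem_closedGraph_iff.1 hX
  obtain ⟨v, hv, hv'⟩ := ρ.mem_closedGraph_iff.1 hY
  refine ρ.mem_closedGraph_iff.2 ⟨fun k => (l2Mul (u k).1 (v k).1, l2Mul (u k).2 (v k).2), fun k => ?_,
    Filter.Tendsto.prodMk_nhds ?_ ?_⟩
  · have h1 := H.coeFn_l2Mul (Submodule.le_topologicalClosure _ (ρ.fst_mem_of_graph (hu k)))
      (Submodule.le_topologicalClosure _ (ρ.fst_mem_of_graph (hv k)))
    have h2 := H.coeFn_l2Mul (Submodule.le_topologicalClosure _ (ρ.snd_mem_of_graph (hu k)))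
      (Submodule.le_topologicalClosure _ (ρ.snd_mem_of_graph (hv k)))
    obtain ⟨a, ha, ha1, ha2⟩ := hu k
    obtain ⟨b, hb, hb1, hb2⟩ := hv k
    refine ⟨a * b, (MvPolynomial.totalDegree_mul a b).trans (add_le_add ha hb), ?_, ?_⟩
    · filter_upwards [h1, ha1, hb1] with ω h3 h4 h5
      rw [h3, h4, h5, GaussianHilbertSpace.polyEval, GaussianHilbertSpace.polyEval,
        GaussianHilbertSpace.polyEval, map_mul]
    · filter_upwards [h2, ha2, hb2] with ω h3 h4 h5
      rw [h3, h4, h5, Rotation.polyEval, Rotation.polyEval, Rotation.polyEval, map_mul]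
  · exact H.tendsto_l2Mul (fun k => ρ.fst_mem_of_graph (hu k)) (fun k => ρ.fst_mem_of_graph (hv k))
      ((continuous_fst.tendsto X).comp hu') ((continuous_fst.tendsto Y).comp hv')
  · exact H.tendsto_l2Mul (fun k => ρ.snd_mem_of_graph (hu k)) (fun k => ρ.snd_mem_of_graph (hv k))
      ((continuous_snd.tendsto X).comp hu') ((continuous_snd.tendsto Y).comp hv')

end GaussianHilbertSpace

/-! ### Eigenspaces of rotations in the chaoses -/

namespace GaussianHilbertSpace

variable {Ω : Type*} [MeasurableSpace Ω] {P : Measure Ω} {H : GaussianHilbertSpace P}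

/-- Complex conjugation as a map of `H` to itself. -/
noncomputable def starCarrier (H : GaussianHilbertSpace P) (h : H.carrier) : H.carrier :=
  ⟨star (h : Lp ℂ 2 P), H.star_mem _ h.2⟩

theorem eval_rename_starCarrier (w : H.carrier → H.carrier)
    (hw : ∀ h, w (H.starCarrier h) = H.starCarrier (w h)) (p : MvPolynomial H.carrier ℂ) :
    ∀ᵐ ω ∂P, MvPolynomial.eval (fun h : H.carrier => (w h : Lp ℂ 2 P) ω)
        (MvPolynomial.rename H.starCarrier (MvPolynomial.map (starRingEnd ℂ) p)) =
      (starRingEnd ℂ) (MvPolynomial.eval (fun h : H.carrier => (w h : Lp ℂ 2 P) ω) p) := by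
  have hs : ∀ᵐ ω ∂P, ∀ h ∈ p.vars,
      (w (H.starCarrier h) : Lp ℂ 2 P) ω = (starRingEnd ℂ) ((w h : Lp ℂ 2 P) ω) := by
    rw [Filter.eventually_all_finset]
    intro h _
    rw [hw]
    exact Lp.coeFn_star (w h : Lp ℂ 2 P)
  filter_upwards [hs] with ω h3
  rw [MvPolynomial.eval_rename, MvPolynomial.eval_map, ← MvPolynomial.coe_eval₂Hom]
  have : ((starRingEnd ℂ).comp (MvPolynomial.eval fun h : H.carrier => (w h : Lp ℂ 2 P) ω)) p
      = MvPolynomial.eval₂Hom (starRingEnd ℂ)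
        (fun h : H.carrier => (starRingEnd ℂ) ((w h : Lp ℂ 2 P) ω)) p := by
    congr 1
    ext <;> simp
  rw [RingHom.comp_apply] at this
  rw [this]
  refine MvPolynomial.eval₂Hom_congr' rfl ?_ rfl
  intro h hh _
  exact h3 h hh

theorem Rotation.star_mem_graph (ρ : H.Rotation) {n : ℕ} {X : Lp ℂ 2 P × Lp ℂ 2 P}
    (hX : X ∈ ρ.graph n) : (star X.1, star X.2) ∈ ρ.graph n := by
  obtain ⟨p, hp, h1, h2⟩ := hX
  refine ⟨MvPolynomial.rename H.starCarrier (MvPolynomial.map (starRingEnd ℂ) p), ?_, ?_, ?_⟩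
  · refine (MvPolynomial.totalDegree_rename_le _ _).trans (le_trans ?_ hp)
    exact Finset.sup_mono (MvPolynomial.support_map_subset _ _)
  · filter_upwards [h1, Lp.coeFn_star X.1, H.eval_rename_starCarrier id (fun _ => rfl) p]
      with ω h3 h4 h5
    rw [h4, Pi.star_apply, h3]
    exact h5.symm
  · filter_upwards [h2, Lp.coeFn_star X.2, H.eval_rename_starCarrier ρ.act
      (fun h => Subtype.ext (ρ.map_star h)) p] with ω h3 h4 h5
    rw [h4, Pi.star_apply, h3]
    exact h5.symm

theorem Rotation.star_mem_closedGraph (ρ : H.Rotation) {n : ℕ} {X : Lp ℂ 2 P × Lp ℂ 2 P}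
    (hX : X ∈ ρ.closedGraph n) : (star X.1, star X.2) ∈ ρ.closedGraph n :=
  map_mem_closure (f := fun X : Lp ℂ 2 P × Lp ℂ 2 P => (star X.1, star X.2))
    ((continuous_star_l2.comp continuous_fst).prodMk (continuous_star_l2.comp continuous_snd)) hX
    fun _ h => ρ.star_mem_graph h

/-- The eigenspace, in the chaos of order `n` and for the eigenvalue `c`, of the second
quantization of a rotation. -/
noncomputable def Rotation.eigenspace (ρ : H.Rotation) (n : ℕ) (c : ℂ) : Submodule ℂ (H.chaos n) :=
  (ρ.closedGraph n).comap ((H.chaos n).subtype.prod (c • (H.chaos n).subtype))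

theorem Rotation.mem_eigenspace (ρ : H.Rotation) {n : ℕ} {c : ℂ} {X : H.chaos n} :
    X ∈ ρ.eigenspace n c ↔ ((X : Lp ℂ 2 P), c • (X : Lp ℂ 2 P)) ∈ ρ.closedGraph n := Iff.rfl

theorem Rotation.isClosed_eigenspace (ρ : H.Rotation) (n : ℕ) (c : ℂ) :
    IsClosed (ρ.eigenspace n c : Set (H.chaos n)) := by
  have h : IsClosed (ρ.closedGraph n : Set (Lp ℂ 2 P × Lp ℂ 2 P)) :=
    Submodule.isClosed_topologicalClosure _
  exact h.preimage (f := fun X : H.chaos n => ((X : Lp ℂ 2 P), c • (X : Lp ℂ 2 P)))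
    (continuous_subtype_val.prodMk (continuous_subtype_val.const_smul c))

theorem Rotation.conjL_mem_eigenspace (ρ : H.Rotation) {n : ℕ} {c : ℂ} {X : H.chaos n}
    (hX : X ∈ ρ.eigenspace n c) : H.conjL n X ∈ ρ.eigenspace n ((starRingEnd ℂ) c) := by
  rw [Rotation.mem_eigenspace] at hX ⊢
  have h := ρ.star_mem_closedGraph hX
  simp only [star_smul_l2] at h
  exact h

variable [IsProbabilityMeasure P]

/-- Eigenvectors of second quantization, an isometry, for distinct eigenvalues are orthogonal. -/
theorem Rotation.inner_eq_zero (ρ : H.Rotation) {n : ℕ} {c c' : ℂ} (hc : ‖c‖ = 1)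
    (hcc : c ≠ c') {X Y : H.chaos n} (hX : X ∈ ρ.eigenspace n c)
    (hY : Y ∈ ρ.eigenspace n c') : inner ℂ (X : Lp ℂ 2 P) (Y : Lp ℂ 2 P) = 0 := by
  have h := ρ.inner_eq (ρ.mem_eigenspace.1 hX) (ρ.mem_eigenspace.1 hY)
  simp only [inner_smul_left, inner_smul_right] at h
  have h1 : (starRingEnd ℂ c * c' - 1) * inner ℂ (X : Lp ℂ 2 P) (Y : Lp ℂ 2 P) = 0 := by
    linear_combination h
  rcases mul_eq_zero.1 h1 with h2 | h2
  · exfalso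
    apply hcc
    have h3 : c * starRingEnd ℂ c = 1 := by
      rw [Complex.mul_conj, Complex.normSq_eq_norm_sq, hc]
      norm_num
    linear_combination (-c) * h2 + c' * h3
  · exact h2

/-- The orthogonal decomposition of `polyClosure (r + 1)` into `polyClosure r` and the chaos of
order `r + 1`. -/
theorem exists_chaosProj_succ (H : GaussianHilbertSpace P) {r : ℕ} {M : Lp ℂ 2 P}
    (hM : M ∈ H.polyClosure (r + 1)) :
    ∃ K ∈ H.polyClosure r, M = K + H.chaosProj (r + 1) M := by
  have : CompleteSpace (H.polyClosure r) := (H.isClosed_polyClosure r).completeSpace_coe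
  obtain ⟨K, hK, Z, hZ, hKZ⟩ := (H.polyClosure r).exists_add_mem_mem_orthogonal M
  refine ⟨K, hK, ?_⟩
  have hZc : Z ∈ H.chaos (r + 1) := by
    refine ⟨hZ, ?_⟩
    have : Z = M - K := by rw [hKZ]; abel
    rw [this]
    exact Submodule.sub_mem _ hM (H.polyClosure_mono (Nat.le_succ r) hK)
  have hproj : H.chaosProj (r + 1) M = ⟨Z, hZc⟩ := by
    rw [hKZ, map_add]
    have h1 : H.chaosProj (r + 1) K = 0 := by
      refine Submodule.orthogonalProjectionOnto_eq_zero_iff.2 ?_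
      rw [Submodule.mem_orthogonal]
      intro u hu
      exact (Submodule.mem_orthogonal' _ _).1 hu.1 K hK
    have h2 : H.chaosProj (r + 1) Z = ⟨Z, hZc⟩ :=
      Submodule.orthogonalProjectionOnto_mem_subspace_eq_self (⟨Z, hZc⟩ : H.chaos (r + 1))
    rw [h1, h2, zero_add]
  rw [hproj]
  exact hKZ

theorem l2Mul_smul_smul (H : GaussianHilbertSpace P) {p q : ℕ} (X : H.chaos p) (Y : H.chaos q)
    (c c' : ℂ) : l2Mul (c • (X : Lp ℂ 2 P)) (c' • (Y : Lp ℂ 2 P)) =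
      (c * c') • l2Mul (X : Lp ℂ 2 P) (Y : Lp ℂ 2 P) := by
  have h1 : H.mulL p q (H.inclL p X) (H.inclL q Y) = l2Mul (X : Lp ℂ 2 P) (Y : Lp ℂ 2 P) :=
    H.mulL_apply _ _
  have h2 : H.mulL p q (c • H.inclL p X) (c' • H.inclL q Y) =
    l2Mul (c • (X : Lp ℂ 2 P)) (c' • (Y : Lp ℂ 2 P)) := H.mulL_apply _ _
  rw [← h1, ← h2, map_smul, map_smul, _root_.smul_apply, smul_smul, mul_comm c c']

/-- Second quantization is multiplicative for the Wick product: eigenvalues multiply. -/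
theorem Rotation.wickL_mem_eigenspace (ρ : H.Rotation) {p q n : ℕ} (hn : p + q = n) {c c' : ℂ}
    {X : H.chaos p} {Y : H.chaos q} (hX : X ∈ ρ.eigenspace p c)
    (hY : Y ∈ ρ.eigenspace q c') : H.wickL p q n X Y ∈ ρ.eigenspace n (c * c') := by
  rw [Rotation.mem_eigenspace] at hX hY ⊢
  have hM := ρ.mul_mem hX hY
  simp only [H.l2Mul_smul_smul, hn] at hM
  set M := l2Mul (X : Lp ℂ 2 P) (Y : Lp ℂ 2 P)
  have hMn : M ∈ H.polyClosure n := ρ.fst_mem hM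
  rw [wickL_apply]
  change ((H.chaosProj n M : Lp ℂ 2 P), (c * c') • (H.chaosProj n M : Lp ℂ 2 P)) ∈ _
  rcases n with _ | r
  · have h2 : H.chaosProj 0 M = ⟨M, hMn⟩ :=
      Submodule.orthogonalProjectionOnto_mem_subspace_eq_self (⟨M, hMn⟩ : H.chaos 0)
    rw [h2]
    exact hM
  · obtain ⟨K, hK, hKM⟩ := H.exists_chaosProj_succ hMn
    set Z := H.chaosProj (r + 1) M
    obtain ⟨K', hK'⟩ := ρ.exists_fst hK
    have hK'r : K' ∈ H.polyClosure r := ρ.snd_mem hK'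
    have hZ : ((Z : Lp ℂ 2 P), (c * c') • M - K') ∈ ρ.closedGraph (r + 1) := by
      have := (ρ.closedGraph (r + 1)).sub_mem hM (ρ.closedGraph_mono (Nat.le_succ r) hK')
      rw [Prod.mk_sub_mk] at this
      have h1 : M - K = (Z : Lp ℂ 2 P) := by
        conv_lhs => rw [hKM]
        abel
      rwa [h1] at this
    -- both `c c' Z` and the image of `Z` are orthogonal to the polynomials of degree `r`
    have horth : (c * c') • M - K' ∈ (H.polyClosure r)ᗮ := by
      rw [Submodule.mem_orthogonal]
      intro V' hV'
      obtain ⟨V, hV⟩ := ρ.exists_snd hV'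
      have h1 := ρ.inner_eq (ρ.closedGraph_mono (Nat.le_succ r) hV) hZ
      simp only at h1
      rw [h1]
      exact (Submodule.mem_orthogonal _ _).1 Z.2.1 V (ρ.fst_mem hV)
    have horth2 : (c * c') • (Z : Lp ℂ 2 P) ∈ (H.polyClosure r)ᗮ :=
      Submodule.smul_mem _ _ Z.2.1
    have hdiff : (c * c') • (Z : Lp ℂ 2 P) - ((c * c') • M - K') = K' - (c * c') • K := by
      have : (c * c') • M = (c * c') • K + (c * c') • (Z : Lp ℂ 2 P) := by
        rw [← smul_add]
        exact congrArg _ hKM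
      rw [this]
      abel
    have h0 : (c * c') • (Z : Lp ℂ 2 P) - ((c * c') • M - K') = 0 := by
      have h1 := Submodule.sub_mem _ horth2 horth
      have h2 : (c * c') • (Z : Lp ℂ 2 P) - ((c * c') • M - K') ∈ H.polyClosure r := by
        rw [hdiff]
        exact Submodule.sub_mem _ hK'r (Submodule.smul_mem _ _ hK)
      exact inner_self_eq_zero.1 ((Submodule.mem_orthogonal _ _).1 h1 _ h2)
    rw [sub_eq_zero.1 h0]
    exact hZ

theorem one_mem_polynomials (H : GaussianHilbertSpace P) (n : ℕ) :
    (memLp_const (1 : ℂ) : MemLp (fun _ : Ω => (1 : ℂ)) 2 P).toLp ∈ H.polynomials n :=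
  ⟨1, by simp, by
    filter_upwards [(memLp_const (1 : ℂ) : MemLp (fun _ : Ω => (1 : ℂ)) 2 P).coeFn_toLp] with ω h
    rw [h, map_one]⟩

theorem exists_of_mem_polynomials_one (H : GaussianHilbertSpace P) {X : Lp ℂ 2 P}
    (hX : X ∈ H.polynomials 1) : ∃ c : ℂ, ∃ Y ∈ H.carrier,
      X = c • (memLp_const (1 : ℂ) : MemLp (fun _ : Ω => (1 : ℂ)) 2 P).toLp + Y := by
  obtain ⟨p, hp, hX⟩ := hX
  set V : Submodule ℂ (Ω → ℂ) :=
    Submodule.span ℂ (Set.range fun h : H.carrier => ((h : Lp ℂ 2 P) : Ω → ℂ)) with hV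
  have h1 := MvPolynomial.aeval_mem_one_sup_pow V
    (fun h : H.carrier => ((h : Lp ℂ 2 P) : Ω → ℂ)) (fun h => Submodule.subset_span ⟨h, rfl⟩) p
  have h2 : MvPolynomial.aeval (fun h : H.carrier => ((h : Lp ℂ 2 P) : Ω → ℂ)) p ∈ 1 ⊔ V := by
    have := pow_le_pow_right' (le_sup_left : (1 : Submodule ℂ (Ω → ℂ)) ≤ 1 ⊔ V) hp h1
    rwa [pow_one] at this
  obtain ⟨a, ha, v, hv, hav⟩ := Submodule.mem_sup.1 h2
  obtain ⟨c, rfl⟩ := Submodule.mem_one.1 ha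
  have h3 : ∃ Y ∈ H.carrier, (Y : Ω → ℂ) =ᵐ[P] v := by
    clear hav
    rw [hV] at hv
    induction hv using Submodule.span_induction with
    | mem x hx =>
      obtain ⟨h, rfl⟩ := hx
      exact ⟨h, h.2, Filter.EventuallyEq.rfl⟩
    | zero => exact ⟨0, H.carrier.zero_mem, Lp.coeFn_zero ℂ 2 P⟩
    | add x y _ _ hx hy =>
      obtain ⟨Y, hY, hYx⟩ := hx
      obtain ⟨Z, hZ, hZy⟩ := hy
      exact ⟨Y + Z, H.carrier.add_mem hY hZ, (Lp.coeFn_add Y Z).trans (hYx.add hZy)⟩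
    | smul c x _ hx =>
      obtain ⟨Y, hY, hYx⟩ := hx
      exact ⟨c • Y, H.carrier.smul_mem c hY, (Lp.coeFn_smul c Y).trans (hYx.const_smul c)⟩
  obtain ⟨Y, hY, hYv⟩ := h3
  refine ⟨c, Y, hY, Lp.ext ?_⟩
  filter_upwards [hX, hYv, (memLp_const (1 : ℂ) : MemLp (fun _ : Ω => (1 : ℂ)) 2 P).coeFn_toLp,
    Lp.coeFn_add (c • (memLp_const (1 : ℂ) : MemLp (fun _ : Ω => (1 : ℂ)) 2 P).toLp) Y,
    Lp.coeFn_smul c (memLp_const (1 : ℂ) : MemLp (fun _ : Ω => (1 : ℂ)) 2 P).toLp]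
    with ω e1 e2 e3 e4 e5
  have e6 := congrFun hav ω
  have e7 := MvPolynomial.comp_aeval_apply (fun h : H.carrier => ((h : Lp ℂ 2 P) : Ω → ℂ))
    (Pi.evalAlgHom ℂ (fun _ : Ω => ℂ) ω) p
  simp only [Pi.evalAlgHom_apply, MvPolynomial.aeval_eq_eval] at e7
  rw [← e6] at e7
  rw [e1, e4, Pi.add_apply, e5, Pi.smul_apply, e3, e2, smul_eq_mul, mul_one]
  refine e7.symm.trans ?_
  simp [Pi.algebraMap_apply]

/-- The first chaos consists of elements of `H`. -/
theorem chaos_one_le (H : GaussianHilbertSpace P) : H.chaos 1 ≤ H.carrier := by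
  intro X hX
  set e : Lp ℂ 2 P := (memLp_const (1 : ℂ) : MemLp (fun _ : Ω => (1 : ℂ)) 2 P).toLp with he
  have hint : ∀ Y : Lp ℂ 2 P, inner ℂ e Y = ∫ ω, Y ω ∂P := by
    intro Y
    rw [L2.inner_def]
    refine integral_congr_ae ?_
    filter_upwards [(memLp_const (1 : ℂ) : MemLp (fun _ : Ω => (1 : ℂ)) 2 P).coeFn_toLp] with ω h
    rw [he, h]
    simp
  have he1 : inner ℂ e e = (1 : ℂ) := by
    rw [hint, integral_congr_ae (memLp_const (1 : ℂ) : MemLp (fun _ : Ω => (1 : ℂ)) 2 P).coeFn_toLp]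
    simp
  have h1 : inner ℂ e X = (0 : ℂ) :=
    (Submodule.mem_orthogonal _ _).1 hX.1 e
      (Submodule.le_topologicalClosure _ (H.one_mem_polynomials 0))
  have h2 : X - (inner ℂ e X : ℂ) • e ∈ H.carrier := by
    have hcont : Continuous fun X : Lp ℂ 2 P => X - (inner ℂ e X : ℂ) • e := by fun_prop
    refine H.isClosed.closure_subset (map_mem_closure (f := fun X : Lp ℂ 2 P =>
      X - (inner ℂ e X : ℂ) • e) hcont (s := H.polynomials 1) hX.2 fun Y hY => ?_)
    obtain ⟨c, Z, hZ, rfl⟩ := H.exists_of_mem_polynomials_one hY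
    have h3 : inner ℂ e Z = (0 : ℂ) := by rw [hint, H.centered Z hZ]
    simp only [← he, inner_add_right, inner_smul_right, he1, h3]
    simpa using hZ
  rw [h1] at h2
  simpa using h2

end GaussianHilbertSpace

/-! ### Rotations diagonal on the Gaussian family, and momentum -/

/-- The diagonal unitary operator with unimodular eigenvalues `u i` on an orthonormal family `v i`,
and with eigenvalue `1` on its orthogonal complement. The series for `U z - z` involves only the `v i`,
so that closed subspaces containing the `v i` are stable under `U`. -/
theorem Orthonormal.exists_unitary {E ι : Type*} [NormedAddCommGroup E] [InnerProductSpace ℂ E]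
    [CompleteSpace E] {v : ι → E} (hv : Orthonormal ℂ v) (u : ι → ℂ) (hu : ∀ i, ‖u i‖ = 1) :
    ∃ U : E ≃ₗᵢ[ℂ] E, ∀ z, HasSum (fun i => (inner ℂ (v i) z * (u i - 1)) • v i) (U z - z) := by
  classical
  obtain ⟨w, b, hw, hb⟩ := hv.toSubtypeRange.exists_hilbertBasis_extension
  set c : w → ℂ := fun x => if h : ∃ i, v i = x then u h.choose else 1 with hc
  have hc1 : ∀ x, ‖c x‖ = 1 := by
    intro x
    simp only [hc]
    split_ifs with h
    · exact hu _
    · simp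
  have hinj : Function.Injective v := hv.linearIndependent.injective
  have hcv : ∀ i, c ⟨v i, hw ⟨i, rfl⟩⟩ = u i := by
    intro i
    have h : ∃ j, v j = v i := ⟨i, rfl⟩
    simp only [hc]
    rw [dif_pos h, hinj h.choose_spec]
  have hc0 : ∀ x : w, (x : E) ∉ Set.range v → c x = 1 := by
    intro x hx
    simp only [hc]
    rw [dif_neg (show ¬ ∃ i, v i = (x : E) from hx)]
  have horth : Orthonormal ℂ fun x => c x • b x := by
    refine ⟨fun x => ?_, fun x y hxy => ?_⟩
    · rw [norm_smul, hc1, b.orthonormal.1 x, mul_one]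
    · change inner ℂ (c x • b x) (c y • b y) = 0
      rw [inner_smul_left, inner_smul_right, b.orthonormal.2 hxy, mul_zero, mul_zero]
  have hspan : (Submodule.span ℂ (Set.range fun x => c x • b x))ᗮ = ⊥ := by
    rw [Submodule.eq_bot_iff]
    intro z hz
    have h1 : ∀ x, inner ℂ (b x) z = (0 : ℂ) := by
      intro x
      have h2 := (Submodule.mem_orthogonal _ _).1 hz _ (Submodule.subset_span ⟨x, rfl⟩)
      simp only [inner_smul_left, mul_eq_zero] at h2
      rcases h2 with h2 | h2
      · have h3 := hc1 x
        rw [(map_eq_zero _).1 h2] at h3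
        simp at h3
      · exact h2
    have h2 : b.repr z = 0 := by
      ext x
      rw [b.repr_apply_apply, h1]
      rfl
    simpa using h2
  set b' := HilbertBasis.mkOfOrthogonalEqBot horth hspan with hb'
  refine ⟨b.repr.trans b'.repr.symm, fun z => ?_⟩
  have h1 := (b'.hasSum_repr_symm (b.repr z)).sub (b.hasSum_repr z)
  have h2 : (fun x => b.repr z x • b' x - b.repr z x • b x) =
      fun x : w => (inner ℂ (x : E) z * (c x - 1)) • (x : E) := by
    ext x
    rw [hb', HilbertBasis.coe_mkOfOrthogonalEqBot, b.repr_apply_apply, hb, smul_smul, ← sub_smul]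
    congr 1
    ring
  rw [h2] at h1
  have hinj' : Function.Injective fun i => (⟨v i, hw ⟨i, rfl⟩⟩ : w) := fun i j hij =>
    hinj (congrArg Subtype.val hij)
  have h3 := (hinj'.hasSum_iff (f := fun x : w => (inner ℂ (x : E) z * (c x - 1)) • (x : E))
    (a := (b.repr.trans b'.repr.symm) z - z) (by
      intro x hx
      have : (x : E) ∉ Set.range v := by
        rintro ⟨i, hi⟩
        exact hx ⟨i, Subtype.ext hi⟩
      simp only [hc0 x this]
      simp)).2 h1
  have h4 : ((fun x : w => (inner ℂ (x : E) z * (c x - 1)) • (x : E)) ∘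
      fun i => (⟨v i, hw ⟨i, rfl⟩⟩ : w)) = fun i => (inner ℂ (v i) z * (u i - 1)) • v i := by
    ext1 i
    simp only [Function.comp_apply, hcv]
  rwa [h4] at h3

namespace GaussianHilbertSpace

variable {Ω : Type*} [MeasurableSpace Ω] {P : Measure Ω}

/-- The rotation that is diagonal on an orthonormal family of `H` stable under conjugation. It
commutes with conjugation because conjugate vectors have conjugate eigenvalues. -/
theorem exists_rotation (H : GaussianHilbertSpace P) {ι : Type*} {v : ι → Lp ℂ 2 P}
    (hv : Orthonormal ℂ v) (hvH : ∀ i, v i ∈ H.carrier) (τ : ι ≃ ι) (hτ : ∀ i, star (v i) = v (τ i))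
    (u : ι → ℂ) (hu : ∀ i, ‖u i‖ = 1) (huτ : ∀ i, u (τ i) = (starRingEnd ℂ) (u i)) :
    ∃ ρ : H.Rotation, ∀ i, ρ.U (v i) = u i • v i := by
  classical
  obtain ⟨U, hU⟩ := hv.exists_unitary u hu
  have hmem : ∀ z, U z - z ∈ H.carrier := fun z =>
    H.isClosed.mem_of_tendsto (hU z) (Filter.Eventually.of_forall fun s =>
      H.carrier.sum_mem fun i _ => H.carrier.smul_mem _ (hvH i))
  refine ⟨⟨U, fun X hX => ?_, fun X hX => ?_, fun X => ?_⟩, fun i => ?_⟩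
  · simpa using H.carrier.add_mem (hmem X) hX
  · have := H.carrier.sub_mem hX (hmem (U.symm X))
    simpa using this
  · have h1 := hU (star X)
    have h2 : HasSum (fun i => star ((inner ℂ (v i) X * (u i - 1)) • v i)) (star (U X - X)) := by
      refine (hU X).map (AddMonoidHom.mk' star star_add_l2 : Lp ℂ 2 P →+ Lp ℂ 2 P) ?_
      exact continuous_star_l2
    have h3 : (fun i => star ((inner ℂ (v i) X * (u i - 1)) • v i)) =
        (fun i => (inner ℂ (v i) (star X) * (u i - 1)) • v i) ∘ τ := by
      ext1 i
      rw [star_smul_l2, Function.comp_apply, ← hτ, inner_star_star, huτ]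
      congr 1
      simp [mul_comm]
    rw [h3, τ.hasSum_iff] at h2
    have h4 := h1.unique h2
    have h5 : star (U X - X) = star (U X) - star X := by
      rw [sub_eq_add_neg, star_add_l2, ← neg_one_smul ℂ X, star_smul_l2]
      simp [sub_eq_add_neg]
    rw [h5] at h4
    simpa using h4
  · have h1 := hU (v i)
    have h2 : HasSum (fun j => (inner ℂ (v j) (v i) * (u j - 1)) • v j)
        ((inner ℂ (v i) (v i) * (u i - 1)) • v i) := by
      refine hasSum_single i fun j hj => ?_
      rw [hv.2 hj, zero_mul, zero_smul]
    have h3 := h1.unique h2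
    rw [inner_self_eq_norm_sq_to_K, hv.1 i] at h3
    simp only [RCLike.ofReal_one, one_pow, one_mul, sub_smul, one_smul] at h3
    exact sub_left_injective h3

end GaussianHilbertSpace

theorem integrable_id_gaussianReal (v : NNReal) : Integrable (fun x : ℝ => (x : ℂ)) (gaussianReal 0 v) :=
  ((memLp_id_gaussianReal 1).integrable le_rfl).ofReal

theorem integrable_sq_gaussianReal (v : NNReal) :
    Integrable (fun x : ℝ => (x : ℂ) ^ 2) (gaussianReal 0 v) := by
  have h : Integrable (fun x : ℝ => x ^ 2) (gaussianReal 0 v) :=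
    (memLp_id_gaussianReal (μ := 0) (v := v) 2).integrable_sq
  have := h.ofReal (𝕜 := ℂ)
  simpa using this

theorem integral_id_gaussianReal_complex (v : NNReal) :
    ∫ x : ℝ, (x : ℂ) ∂(gaussianReal 0 v) = 0 := by
  rw [integral_complex_ofReal, integral_id_gaussianReal, Complex.ofReal_zero]

theorem integral_sq_gaussianReal_complex (v : NNReal) :
    ∫ x : ℝ, (x : ℂ) ^ 2 ∂(gaussianReal 0 v) = v := by
  have h1 : ∫ x : ℝ, x ^ 2 ∂(gaussianReal 0 v) = v := by
    have h2 := variance_id_gaussianReal (μ := 0) (v := v)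
    rw [variance_eq_sub (memLp_id_gaussianReal 2)] at h2
    simpa using h2
  have h3 : (fun x : ℝ => (x : ℂ) ^ 2) = fun x : ℝ => ((x ^ 2 : ℝ) : ℂ) := by
    ext x
    simp
  rw [h3, integral_complex_ofReal, h1]

/-- The second moments `E[(X + iY)(X ± iY)]` of a standard complex Gaussian. -/
theorem integral_stdComplexGaussian (s : ℂ) :
    ∫ p : ℝ × ℝ, ((p.1 : ℂ) + p.2 * Complex.I) * (p.1 + s * p.2 * Complex.I)
      ∂((gaussianReal 0 (1 / 2)).prod (gaussianReal 0 (1 / 2))) = (1 - s) / 2 := by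
  have h1 : (fun p : ℝ × ℝ => ((p.1 : ℂ) + p.2 * Complex.I) * (p.1 + s * p.2 * Complex.I)) =
      fun p : ℝ × ℝ => ((p.1 : ℂ) ^ 2 * (1 : ℂ)) + ((-s) * ((1 : ℂ) * (p.2 : ℂ) ^ 2) +
        (1 + s) * Complex.I * ((p.1 : ℂ) * (p.2 : ℂ))) := by
    ext p
    linear_combination (s * (p.2 : ℂ) ^ 2) * Complex.I_sq
  have i1 := integrable_id_gaussianReal (1 / 2)
  have i2 := integrable_sq_gaussianReal (1 / 2)
  have i0 : Integrable (fun _ : ℝ => (1 : ℂ)) (gaussianReal 0 (1 / 2)) := integrable_const _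
  have j1 := i2.mul_prod i0
  have j2 := (i0.mul_prod i2).const_mul (-s)
  have j3 := (i1.mul_prod i1).const_mul ((1 + s) * Complex.I)
  have j4 : Integrable (fun p : ℝ × ℝ => (-s) * ((1 : ℂ) * (p.2 : ℂ) ^ 2) +
      (1 + s) * Complex.I * ((p.1 : ℂ) * (p.2 : ℂ)))
      ((gaussianReal 0 (1 / 2)).prod (gaussianReal 0 (1 / 2))) := j2.add j3
  have k1 := integral_prod_mul (μ := gaussianReal 0 (1 / 2)) (ν := gaussianReal 0 (1 / 2))
    (fun x : ℝ => (x : ℂ) ^ 2) (fun _ : ℝ => (1 : ℂ))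
  have k2 := integral_prod_mul (μ := gaussianReal 0 (1 / 2)) (ν := gaussianReal 0 (1 / 2))
    (fun _ : ℝ => (1 : ℂ)) (fun x : ℝ => (x : ℂ) ^ 2)
  have k3 := integral_prod_mul (μ := gaussianReal 0 (1 / 2)) (ν := gaussianReal 0 (1 / 2))
    (fun x : ℝ => (x : ℂ)) (fun x : ℝ => (x : ℂ))
  have l1 := integral_const_mul (μ := (gaussianReal 0 (1 / 2)).prod (gaussianReal 0 (1 / 2))) (-s)
    (fun p : ℝ × ℝ => (1 : ℂ) * (p.2 : ℂ) ^ 2)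
  have l2 := integral_const_mul (μ := (gaussianReal 0 (1 / 2)).prod (gaussianReal 0 (1 / 2)))
    ((1 + s) * Complex.I) (fun p : ℝ × ℝ => (p.1 : ℂ) * (p.2 : ℂ))
  rw [h1, integral_add j1 j4, integral_add j2 j3, l1, l2, k1, k2, k3,
    integral_sq_gaussianReal_complex, integral_id_gaussianReal_complex]
  simp
  ring

theorem integral_mul_self_of_law {Ω : Type*} [MeasurableSpace Ω] {P : Measure Ω} {f : Ω → ℂ}
    (hf : AEMeasurable f P) (h : P.map f = stdComplexGaussian) :
    ∫ ω, f ω * f ω ∂P = 0 := by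
  have h1 : ∫ z, z * z ∂(P.map f) = ∫ ω, f ω * f ω ∂P := integral_map hf (by fun_prop)
  rw [← h1, h, stdComplexGaussian, integral_map (by fun_prop) (by fun_prop)]
  simpa using integral_stdComplexGaussian 1

theorem integral_mul_conj_of_law {Ω : Type*} [MeasurableSpace Ω] {P : Measure Ω} {f : Ω → ℂ}
    (hf : AEMeasurable f P) (h : P.map f = stdComplexGaussian) :
    ∫ ω, f ω * (starRingEnd ℂ) (f ω) ∂P = 1 := by
  have hc : Continuous fun z : ℂ => z * (starRingEnd ℂ) z :=
    continuous_id.mul Complex.continuous_conj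
  have h1 : ∫ z, z * (starRingEnd ℂ) z ∂(P.map f) = ∫ ω, f ω * (starRingEnd ℂ) (f ω) ∂P :=
    integral_map hf hc.aestronglyMeasurable
  rw [← h1, h, stdComplexGaussian, integral_map (by fun_prop) hc.aestronglyMeasurable]
  have := integral_stdComplexGaussian (-1)
  norm_num at this
  simpa [← sub_eq_add_neg] using this

namespace GaussianHilbertSpace

variable {Ω : Type*} [MeasurableSpace Ω] {P : Measure Ω} [IsProbabilityMeasure P]

/-- The Gaussians `g m` and their conjugates. -/
noncomputable def gaussianFamily (H : GaussianHilbertSpace P) {K : Type*} (g : K → H.chaos 1)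
    (i : K × Bool) : Lp ℂ 2 P := if i.2 then star (g i.1 : Lp ℂ 2 P) else (g i.1 : Lp ℂ 2 P)

/-- A standard complex Gaussian satisfies `𝔼 [𝔤²] = 0`, so it is orthogonal to its own conjugate.
-/
theorem orthonormal_gaussianFamily (H : GaussianHilbertSpace P) {K : Type*} (g : K → H.chaos 1)
    (hg_law : ∀ m, P.map ((g m : Lp ℂ 2 P) : Ω → ℂ) = stdComplexGaussian)
    (hg_indep : iIndepFun (fun m => ((g m : Lp ℂ 2 P) : Ω → ℂ)) P) :
    Orthonormal ℂ (H.gaussianFamily g) := by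
  classical
  have hm : ∀ m, Measurable ((g m : Lp ℂ 2 P) : Ω → ℂ) := fun m =>
    (Lp.stronglyMeasurable _).measurable
  have hmean : ∀ m, ∫ ω, (g m : Lp ℂ 2 P) ω ∂P = 0 := fun m =>
    H.centered _ (H.chaos_one_le (g m).2)
  have hI : ∀ m m', inner ℂ (g m : Lp ℂ 2 P) (g m' : Lp ℂ 2 P) = if m = m' then (1 : ℂ) else 0 := by
    intro m m'
    rw [L2.inner_def]
    simp only [RCLike.inner_apply]
    split_ifs with h
    · rw [← h]
      exact integral_mul_conj_of_law (hm m).aemeasurable (hg_law m)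
    · have hind := (hg_indep.indepFun (Ne.symm h)).comp measurable_id
        Complex.continuous_conj.measurable
      have h1 := hind.integral_fun_mul_eq_mul_integral (hm m').aestronglyMeasurable
        (Complex.continuous_conj.measurable.comp (hm m)).aestronglyMeasurable
      simp only [Function.comp_apply, id] at h1
      rw [h1, hmean, zero_mul]
  have hJ : ∀ m m', inner ℂ (star (g m : Lp ℂ 2 P)) (g m' : Lp ℂ 2 P) = (0 : ℂ) := by
    intro m m'
    rw [L2.inner_def]
    have h0 : ∫ ω, inner ℂ ((star (g m : Lp ℂ 2 P) : Lp ℂ 2 P) ω) ((g m' : Lp ℂ 2 P) ω) ∂P =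
        ∫ ω, (g m' : Lp ℂ 2 P) ω * (g m : Lp ℂ 2 P) ω ∂P := by
      refine integral_congr_ae ?_
      filter_upwards [Lp.coeFn_star (g m : Lp ℂ 2 P)] with ω h
      rw [h]
      simp
    rw [h0]
    by_cases h : m = m'
    · rw [← h]
      exact integral_mul_self_of_law (hm m).aemeasurable (hg_law m)
    · have h1 := (hg_indep.indepFun (Ne.symm h)).integral_fun_mul_eq_mul_integral
        (hm m').aestronglyMeasurable (hm m).aestronglyMeasurable
      rw [h1, hmean, zero_mul]
  have hJ' : ∀ m m', inner ℂ (g m : Lp ℂ 2 P) (star (g m' : Lp ℂ 2 P)) = (0 : ℂ) := by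
    intro m m'
    rw [← inner_conj_symm, hJ, map_zero]
  have hI' : ∀ m m', inner ℂ (star (g m : Lp ℂ 2 P)) (star (g m' : Lp ℂ 2 P)) =
      if m = m' then (1 : ℂ) else 0 := by
    intro m m'
    rw [inner_star_star, hI]
    simp only [eq_comm]
  rw [orthonormal_iff_ite]
  rintro ⟨m, b⟩ ⟨m', b'⟩
  cases b <;> cases b' <;> simp [gaussianFamily, hI, hJ, hJ', hI']

/-- The pairs of a rotation `ρ` of `H` and a unitary character `χ` of the lattice such that `g m`
is an eigenvector of `ρ` for the eigenvalue `χ m`. -/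
structure IsMomentumCharacter (H : GaussianHilbertSpace P) {K : Type*} [AddCommGroup K]
    (g : K → H.chaos 1) (ρ : H.Rotation) (χ : K → ℂ) : Prop where
  norm_eq : ∀ m, ‖χ m‖ = 1
  map_add : ∀ m m', χ (m + m') = χ m * χ m'
  map_neg : ∀ m, χ (-m) = (starRingEnd ℂ) (χ m)
  mem : ∀ m, g m ∈ ρ.eigenspace 1 (χ m)

theorem Rotation.mem_eigenspace_one {H : GaussianHilbertSpace P} (ρ : H.Rotation) {X : H.chaos 1}
    {c : ℂ} (h : ρ.U X = c • (X : Lp ℂ 2 P)) : X ∈ ρ.eigenspace 1 c := by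
  rw [Rotation.mem_eigenspace]
  refine Submodule.le_topologicalClosure _
    ⟨MvPolynomial.X ⟨X, H.chaos_one_le X.2⟩, (MvPolynomial.totalDegree_X _).le, ?_, ?_⟩
  · refine Filter.Eventually.of_forall fun ω => ?_
    simp [GaussianHilbertSpace.polyEval]
  · refine Filter.Eventually.of_forall fun ω => ?_
    simp only [Rotation.polyEval, MvPolynomial.eval_X, Rotation.act]
    rw [h]

/-- Two lattice points are separated by a momentum character. -/
theorem exists_isMomentumCharacter (H : GaussianHilbertSpace P) {d : ℕ}
    (g : (Fin d → ℤ) → H.chaos 1)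
    (hg_law : ∀ m, P.map ((g m : Lp ℂ 2 P) : Ω → ℂ) = stdComplexGaussian)
    (hg_indep : iIndepFun (fun m => ((g m : Lp ℂ 2 P) : Ω → ℂ)) P) {k k' : Fin d → ℤ}
    (hk : k ≠ k') : ∃ ρ χ, H.IsMomentumCharacter g ρ χ ∧ χ k ≠ χ k' := by
  obtain ⟨i, hi⟩ := Function.ne_iff.1 hk
  -- the angle is chosen so that `χ k / χ k' = -1`
  set θ : ℝ := Real.pi / ((k i - k' i : ℤ) : ℝ) with hθ
  set χ : (Fin d → ℤ) → ℂ := fun m => Complex.exp ((θ * m i : ℝ) * Complex.I) with hχ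
  have h1 : ∀ m, ‖χ m‖ = 1 := fun m => Complex.norm_exp_ofReal_mul_I _
  have h2 : ∀ m m', χ (m + m') = χ m * χ m' := fun m m' => by
    simp only [hχ, ← Complex.exp_add]
    congr 1
    push_cast [Pi.add_apply]
    ring
  have h3 : ∀ m, χ (-m) = (starRingEnd ℂ) (χ m) := fun m => by
    simp only [hχ, ← Complex.exp_conj]
    congr 1
    rw [map_mul, Complex.conj_I, Complex.conj_ofReal]
    push_cast [Pi.neg_apply]
    ring
  obtain ⟨ρ, hρ⟩ := H.exists_rotation (H.orthonormal_gaussianFamily g hg_law hg_indep)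
    (fun i => by
      obtain ⟨m, b⟩ := i
      cases b
      · exact H.chaos_one_le (g m).2
      · exact H.star_mem _ (H.chaos_one_le (g m).2))
    ((Equiv.refl _).prodCongr Equiv.boolNot)
    (fun i => by
      obtain ⟨m, b⟩ := i
      cases b <;> simp [gaussianFamily])
    (fun i => if i.2 then (starRingEnd ℂ) (χ i.1) else χ i.1)
    (fun i => by
      obtain ⟨m, b⟩ := i
      cases b <;> simp [h1])
    (fun i => by
      obtain ⟨m, b⟩ := i
      cases b <;> simp)
  refine ⟨ρ, χ, ⟨h1, h2, h3, fun m => ρ.mem_eigenspace_one (hρ (m, false))⟩, fun h => ?_⟩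
  have h4 : χ k = χ (k - k') * χ k' := by rw [← h2, sub_add_cancel]
  have h5 : χ (k - k') = -1 := by
    simp only [hχ]
    have : θ * ((k - k') i : ℤ) = Real.pi := by
      rw [hθ, Pi.sub_apply]
      exact div_mul_cancel₀ _ (by exact_mod_cast sub_ne_zero.2 hi)
    rw [this, Complex.exp_pi_mul_I]
  rw [h5, h] at h4
  have h6 : χ k' = 0 := by linear_combination (1 / 2 : ℂ) * h4
  have h7 := h1 k'
  rw [h6, norm_zero] at h7
  exact zero_ne_one h7

/-- The elements of momentum `m` in the chaos of order `n`: the eigenvectors, for the eigenvalue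
`χ m`, of all rotations under which every `g k` is an eigenvector for the eigenvalue `χ k`. -/
noncomputable def momentumSpace (H : GaussianHilbertSpace P) {K : Type*} [AddCommGroup K]
    (g : K → H.chaos 1) (n : ℕ) (m : K) : Submodule ℂ (H.chaos n) :=
  ⨅ (ρ : H.Rotation) (χ : K → ℂ) (_ : H.IsMomentumCharacter g ρ χ), ρ.eigenspace n (χ m)

section

variable {H : GaussianHilbertSpace P} {K : Type*} [AddCommGroup K] {g : K → H.chaos 1}

theorem mem_momentumSpace {n : ℕ} {m : K} {X : H.chaos n} : X ∈ H.momentumSpace g n m ↔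
    ∀ ρ χ, H.IsMomentumCharacter g ρ χ → X ∈ ρ.eigenspace n (χ m) := by
  simp only [momentumSpace, Submodule.mem_iInf]

theorem isClosed_momentumSpace (n : ℕ) (m : K) :
    IsClosed (H.momentumSpace g n m : Set (H.chaos n)) := by
  have : (H.momentumSpace g n m : Set (H.chaos n)) =
      ⋂ (ρ : H.Rotation) (χ : K → ℂ) (_ : H.IsMomentumCharacter g ρ χ),
        (ρ.eigenspace n (χ m) : Set (H.chaos n)) := by
    ext X
    simp [mem_momentumSpace]
  rw [this]
  exact isClosed_iInter fun ρ => isClosed_iInter fun χ => isClosed_iInter fun _ =>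
    ρ.isClosed_eigenspace n (χ m)

theorem mem_momentumSpace_one (m : K) : g m ∈ H.momentumSpace g 1 m :=
  mem_momentumSpace.2 fun _ _ h => h.mem m

theorem conjL_mem_momentumSpace {n : ℕ} {m : K} {X : H.chaos n} (hX : X ∈ H.momentumSpace g n m) :
    H.conjL n X ∈ H.momentumSpace g n (-m) :=
  mem_momentumSpace.2 fun ρ χ h => by
    rw [h.map_neg]
    exact ρ.conjL_mem_eigenspace (mem_momentumSpace.1 hX ρ χ h)

theorem wickL_mem_momentumSpace {p q n : ℕ} (hn : p + q = n) {m m' : K} {X : H.chaos p}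
    {Y : H.chaos q} (hX : X ∈ H.momentumSpace g p m) (hY : Y ∈ H.momentumSpace g q m') :
    H.wickL p q n X Y ∈ H.momentumSpace g n (m + m') :=
  mem_momentumSpace.2 fun ρ χ h => by
    rw [h.map_add]
    exact ρ.wickL_mem_eigenspace hn (mem_momentumSpace.1 hX ρ χ h) (mem_momentumSpace.1 hY ρ χ h)

end

/-- Elements of a chaos with different momenta are orthogonal: some rotation has them as
eigenvectors for distinct eigenvalues. -/
theorem inner_eq_zero_of_momentum (H : GaussianHilbertSpace P) {d : ℕ}
    (g : (Fin d → ℤ) → H.chaos 1)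
    (hg_law : ∀ m, P.map ((g m : Lp ℂ 2 P) : Ω → ℂ) = stdComplexGaussian)
    (hg_indep : iIndepFun (fun m => ((g m : Lp ℂ 2 P) : Ω → ℂ)) P) {n : ℕ} {k k' : Fin d → ℤ}
    (hk : k ≠ k') {X Y : H.chaos n} (hX : X ∈ H.momentumSpace g n k)
    (hY : Y ∈ H.momentumSpace g n k') : inner ℂ (X : Lp ℂ 2 P) (Y : Lp ℂ 2 P) = 0 := by
  obtain ⟨ρ, χ, h, hne⟩ := H.exists_isMomentumCharacter g hg_law hg_indep hk
  exact ρ.inner_eq_zero (h.norm_eq k) hne (mem_momentumSpace.1 hX ρ χ h)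
    (mem_momentumSpace.1 hY ρ χ h)

end GaussianHilbertSpace

/-! ### Localized energy estimates for the Schrödinger equation -/

section Weight

variable {d : ℕ}

/-- The weight `(1 + η² |x - x₀|²)^{-(d + 1)}`: integrable, and slowly varying at the scale
`1 / η`. -/
noncomputable def slowWeight (η : ℝ) (x₀ x : EuclideanSpace ℝ (Fin d)) : ℝ :=
  ((1 + η ^ 2 * ‖x - x₀‖ ^ 2) ^ (d + 1))⁻¹

theorem slowWeight_base_pos (η : ℝ) (x₀ x : EuclideanSpace ℝ (Fin d)) :
    0 < 1 + η ^ 2 * ‖x - x₀‖ ^ 2 := by positivity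

theorem slowWeight_pos (η : ℝ) (x₀ x : EuclideanSpace ℝ (Fin d)) : 0 < slowWeight η x₀ x :=
  inv_pos.2 (pow_pos (slowWeight_base_pos η x₀ x) _)

theorem slowWeight_add (η : ℝ) (x₀ x v : EuclideanSpace ℝ (Fin d)) :
    slowWeight η x₀ (x + v) = slowWeight η (x₀ - v) x := by
  unfold slowWeight
  rw [show x + v - x₀ = x - (x₀ - v) by abel]

theorem slowWeight_anti {η η' : ℝ} (h0 : 0 ≤ η) (h : η ≤ η') (x₀ x : EuclideanSpace ℝ (Fin d)) :
    slowWeight η' x₀ x ≤ slowWeight η x₀ x := by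
  unfold slowWeight
  have := slowWeight_base_pos η x₀ x
  gcongr

theorem contDiff_slowWeight (η : ℝ) (x₀ : EuclideanSpace ℝ (Fin d)) :
    ContDiff ℝ 1 (slowWeight η x₀) := by
  unfold slowWeight
  refine ContDiff.inv ?_ fun x => (pow_pos (slowWeight_base_pos η x₀ x) _).ne'
  have : ContDiff ℝ 1 fun x : EuclideanSpace ℝ (Fin d) => ‖x - x₀‖ ^ 2 :=
    (contDiff_id.sub contDiff_const).norm_sq ℝ
  fun_prop

theorem abs_fderiv_slowWeight_le {η : ℝ} (hη : 0 ≤ η) (x₀ x v : EuclideanSpace ℝ (Fin d)) :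
    |fderiv ℝ (slowWeight η x₀) x v| ≤ (d + 1) * η * ‖v‖ * slowWeight η x₀ x := by
  have hq := slowWeight_base_pos η x₀ x
  have h1 : HasFDerivAt (fun x : EuclideanSpace ℝ (Fin d) => ‖x - x₀‖ ^ 2)
      (2 • (innerSL ℝ (x - x₀)).comp (ContinuousLinearMap.id ℝ (EuclideanSpace ℝ (Fin d)))) x :=
    ((hasFDerivAt_id x).sub_const x₀).norm_sq
  have h2 := ((h1.const_mul (η ^ 2)).const_add 1).pow (d + 1)
  have h3 := (hasDerivAt_inv (pow_pos hq (d + 1)).ne').comp_hasFDerivAt x h2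
  have h4 : HasFDerivAt (slowWeight η x₀) _ x := h3
  rw [h4.fderiv]
  simp only [FunLike.coe_smul, Pi.smul_apply, smul_eq_mul, Nat.add_sub_cancel,
    ContinuousLinearMap.comp_id, innerSL_apply_apply]
  set q := 1 + η ^ 2 * ‖x - x₀‖ ^ 2 with hqdef
  have h5 : |inner ℝ (x - x₀) v| ≤ ‖x - x₀‖ * ‖v‖ := abs_real_inner_le_norm _ _
  have h6 : 2 * η * ‖x - x₀‖ ≤ q := by nlinarith [sq_nonneg (η * ‖x - x₀‖ - 1)]
  have h7 : slowWeight η x₀ x = (q ^ (d + 1))⁻¹ := rfl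
  rw [h7]
  have h8 : -((q ^ (d + 1)) ^ 2)⁻¹ * ((d + 1) • q ^ d * (η ^ 2 * (2 • inner ℝ (x - x₀) v))) =
      -((d + 1) * η * (q ^ (d + 1))⁻¹ * (q⁻¹ * (2 * η * inner ℝ (x - x₀) v))) := by
    simp only [nsmul_eq_mul]
    push_cast
    field_simp
    ring
  have h9 : |q⁻¹ * (2 * η * inner ℝ (x - x₀) v)| ≤ ‖v‖ := by
    rw [abs_mul, abs_of_pos (inv_pos.2 hq), abs_mul, abs_of_nonneg (by positivity : 0 ≤ 2 * η)]
    rw [inv_mul_le_iff₀ hq]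
    calc 2 * η * |inner ℝ (x - x₀) v| ≤ 2 * η * (‖x - x₀‖ * ‖v‖) := by gcongr
      _ = (2 * η * ‖x - x₀‖) * ‖v‖ := by ring
      _ ≤ q * ‖v‖ := by gcongr
  have h10 : 0 ≤ (d + 1) * η * (q ^ (d + 1))⁻¹ := by positivity
  refine le_trans (le_of_eq ?_) ((mul_le_mul_of_nonneg_left h9 h10).trans (le_of_eq ?_))
  · refine (congrArg abs h8).trans ?_
    rw [abs_neg, abs_mul, abs_of_nonneg h10]
  · ring

theorem integrable_slowWeight_one : Integrable (slowWeight (d := d) 1 0) := by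
  have h := integrable_rpow_neg_one_add_norm_sq (μ := (volume : Measure (EuclideanSpace ℝ (Fin d))))
    (r := 2 * (d + 1)) (by rw [finrank_euclideanSpace_fin]; linarith)
  refine h.congr (Filter.Eventually.of_forall fun x => ?_)
  simp only [slowWeight, one_pow, one_mul, sub_zero]
  rw [show (-(2 * ((d : ℝ) + 1)) / 2) = -((d + 1 : ℕ) : ℝ) by push_cast; ring, Real.rpow_neg (by positivity), Real.rpow_natCast]

theorem slowWeight_eq_comp (η : ℝ) (x₀ x : EuclideanSpace ℝ (Fin d)) :
    slowWeight η x₀ x = slowWeight 1 0 (η • (x - x₀)) := by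
  unfold slowWeight
  rw [sub_zero, norm_smul, Real.norm_eq_abs, mul_pow, sq_abs, one_pow, one_mul]

theorem integrable_slowWeight {η : ℝ} (hη : 0 < η) (x₀ : EuclideanSpace ℝ (Fin d)) :
    Integrable (slowWeight η x₀) := by
  have h1 := (integrable_slowWeight_one (d := d)).comp_smul hη.ne'
  have h2 := h1.comp_sub_right x₀
  refine h2.congr (Filter.Eventually.of_forall fun x => ?_)
  exact (slowWeight_eq_comp η x₀ x).symm

theorem integral_slowWeight {η : ℝ} (hη : 0 < η) (x₀ : EuclideanSpace ℝ (Fin d)) :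
    ∫ x, slowWeight η x₀ x = (η ^ d)⁻¹ * ∫ x, slowWeight (d := d) 1 0 x := by
  simp_rw [slowWeight_eq_comp η x₀]
  rw [integral_sub_right_eq_self (fun x => slowWeight 1 0 (η • x)) x₀,
    Measure.integral_comp_smul, finrank_euclideanSpace_fin, abs_of_pos (by positivity), smul_eq_mul]

theorem integrable_slowWeight_mul {η : ℝ} (hη : 0 < η) (x₀ : EuclideanSpace ℝ (Fin d))
    {F : EuclideanSpace ℝ (Fin d) → ℝ} (hF : AEStronglyMeasurable F) {C : ℝ}
    (hC : ∀ x, ‖F x‖ ≤ C) : Integrable fun x => slowWeight η x₀ x * F x :=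
  (integrable_slowWeight hη x₀).mul_bdd hF (Filter.Eventually.of_forall hC)

theorem integral_slowWeight_mul_sq_nonneg (η : ℝ) (x₀ : EuclideanSpace ℝ (Fin d))
    (F : EuclideanSpace ℝ (Fin d) → ℝ) : 0 ≤ ∫ x, slowWeight η x₀ x * F x ^ 2 :=
  integral_nonneg fun x => mul_nonneg (slowWeight_pos η x₀ x).le (sq_nonneg _)

/-- The Cauchy–Schwarz inequality for bounded functions, with a slow weight. -/
theorem integral_slowWeight_mul_mul_le {η : ℝ} (hη : 0 < η) (x₀ : EuclideanSpace ℝ (Fin d))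
    {F G : EuclideanSpace ℝ (Fin d) → ℝ} (hF : AEStronglyMeasurable F) (hG : AEStronglyMeasurable G)
    {A B : ℝ} (hA : ∀ x, ‖F x‖ ≤ A) (hB : ∀ x, ‖G x‖ ≤ B) {a b : ℝ} (ha : 0 ≤ a) (hb : 0 ≤ b)
    (hFa : ∫ x, slowWeight η x₀ x * F x ^ 2 ≤ a ^ 2)
    (hGb : ∫ x, slowWeight η x₀ x * G x ^ 2 ≤ b ^ 2) :
    ∫ x, slowWeight η x₀ x * (F x * G x) ≤ a * b := by
  have iF : Integrable fun x => slowWeight η x₀ x * F x ^ 2 :=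
    integrable_slowWeight_mul hη x₀ (hF.pow 2) (C := A ^ 2) fun x => by
      rw [norm_pow]
      exact pow_le_pow_left₀ (norm_nonneg _) (hA x) 2
  have iG : Integrable fun x => slowWeight η x₀ x * G x ^ 2 :=
    integrable_slowWeight_mul hη x₀ (hG.pow 2) (C := B ^ 2) fun x => by
      rw [norm_pow]
      exact pow_le_pow_left₀ (norm_nonneg _) (hB x) 2
  have iFG : Integrable fun x => slowWeight η x₀ x * (F x * G x) :=
    integrable_slowWeight_mul hη x₀ (hF.mul hG) (C := A * B) fun x => by
      rw [norm_mul]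
      exact mul_le_mul (hA x) (hB x) (norm_nonneg _) ((norm_nonneg _).trans (hA x))
  have key : ∀ r s : ℝ, 2 * (r * s) * ∫ x, slowWeight η x₀ x * (F x * G x) ≤
      r ^ 2 * a ^ 2 + s ^ 2 * b ^ 2 := by
    intro r s
    have h1 : ∫ x, (2 * (r * s)) * (slowWeight η x₀ x * (F x * G x)) ≤
        ∫ x, (r ^ 2 * (slowWeight η x₀ x * F x ^ 2) + s ^ 2 * (slowWeight η x₀ x * G x ^ 2)) := by
      refine integral_mono (iFG.const_mul _) ((iF.const_mul _).add (iG.const_mul _)) fun x => ?_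
      have := slowWeight_pos η x₀ x
      nlinarith [mul_nonneg this.le (sq_nonneg (r * F x - s * G x))]
    rw [integral_const_mul, integral_add (iF.const_mul _) (iG.const_mul _), integral_const_mul,
      integral_const_mul] at h1
    have h2 := mul_le_mul_of_nonneg_left hFa (sq_nonneg r)
    have h3 := mul_le_mul_of_nonneg_left hGb (sq_nonneg s)
    linarith
  refine le_of_forall_pos_le_add fun e he => ?_
  set I := ∫ x, slowWeight η x₀ x * (F x * G x) with hI
  by_contra hcon
  push Not at hcon
  rcases eq_or_lt_of_le ha with h0 | ha'
  · -- `a = 0`: the inequality with `r` large and `s = 1`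
    have hI0 : 0 < I := by rw [← h0] at hcon; linarith
    have := key ((b ^ 2 + 1) / I) 1
    rw [← h0] at this
    have h4 : (b ^ 2 + 1) / I * I = b ^ 2 + 1 := by field_simp
    nlinarith
  rcases eq_or_lt_of_le hb with h0 | hb'
  · have hI0 : 0 < I := by rw [← h0] at hcon; linarith
    have := key 1 ((a ^ 2 + 1) / I)
    rw [← h0] at this
    have h4 : (a ^ 2 + 1) / I * I = a ^ 2 + 1 := by field_simp
    nlinarith
  · have h5 := key b a
    have h6 : 0 < b * a := mul_pos hb' ha'
    nlinarith

end Weight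

section FiniteDifference

variable {V F : Type*} [NormedAddCommGroup V] [NormedSpace ℝ V] [NormedAddCommGroup F]
  [NormedSpace ℝ F]

theorem norm_iteratedFDeriv_comp_line {f : F → V} (hf : ContDiff ℝ (⊤ : ℕ∞) f) {v : F} (hv : ‖v‖ ≤ 1)
    (x : F) (n : ℕ) {M : ℝ} (hM : ∀ y, ‖iteratedFDeriv ℝ n f y‖ ≤ M) (s : ℝ) :
    ‖iteratedDeriv n (fun s : ℝ => f (x + s • v)) s‖ ≤ M := by
  set L : ℝ →L[ℝ] F := ContinuousLinearMap.toSpanSingleton ℝ v with hL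
  have h1 : (fun s : ℝ => f (x + s • v)) = (fun y => f (x + y)) ∘ L := by
    ext s
    simp [hL]
  have hg : ContDiff ℝ (⊤ : ℕ∞) fun y => f (x + y) := hf.comp (contDiff_const.add contDiff_id)
  rw [← norm_iteratedFDeriv_eq_norm_iteratedDeriv, h1,
    L.iteratedFDeriv_comp_right hg s (i := n) (by exact_mod_cast le_top)]
  refine (ContinuousMultilinearMap.norm_compContinuousLinearMap_le _ _).trans ?_
  rw [iteratedFDeriv_comp_add_left]
  have h2 : ∏ _i : Fin n, ‖L‖ ≤ 1 := by
    refine Finset.prod_le_one (fun _ _ => norm_nonneg _) fun _ _ => ?_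
    rw [hL, ContinuousLinearMap.norm_toSpanSingleton]
    exact hv
  exact (mul_le_of_le_one_right (norm_nonneg _) h2).trans (hM _)

/-- Weights on the nodes `0, …, J + 1` whose moments of order at most `J + 1` are those of the
derivative at `0`. -/
theorem exists_vandermonde (J : ℕ) : ∃ c : Fin (J + 2) → ℝ, ∀ j : Fin (J + 2),
    ∑ m, c m * (m : ℝ) ^ (j : ℕ) = if (j : ℕ) = 1 then 1 else 0 := by
  set A := Matrix.vandermonde fun m : Fin (J + 2) => ((m : ℕ) : ℝ) with hA
  have hdet : IsUnit A.det := by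
    rw [isUnit_iff_ne_zero, Matrix.det_vandermonde_ne_zero_iff]
    intro i j hij
    exact Fin.ext (Nat.cast_injective (R := ℝ) hij)
  refine ⟨Matrix.vecMul (fun j : Fin (J + 2) => if (j : ℕ) = 1 then (1 : ℝ) else 0) A⁻¹, fun j => ?_⟩
  have h := congrFun (Matrix.vecMul_vecMul (fun j : Fin (J + 2) => if (j : ℕ) = 1 then (1 : ℝ) else 0)
    A⁻¹ A) j
  rw [Matrix.nonsing_inv_mul _ hdet, Matrix.vecMul_one] at h
  rw [← h]
  simp [Matrix.vecMul, dotProduct, hA, Matrix.vandermonde_apply]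

end FiniteDifference

/-- Coefficients of a finite difference that approximates the first derivative to order `J`. -/
noncomputable def differenceCoeff (J : ℕ) : Fin (J + 2) → ℝ := (exists_vandermonde J).choose

/-- The constant in the error bound of the finite difference of order `J`. -/
noncomputable def differenceConst (J : ℕ) : ℝ :=
  ∑ m, |differenceCoeff J m| * ((m : ℝ) ^ (J + 2) / (J + 1).factorial)

/-- The error of the finite difference of step `δ`: by Taylor expansion it is of order `δ ^ (J +
1)`. -/
theorem norm_fderiv_sub_difference_le {V F : Type*} [NormedAddCommGroup V] [NormedSpace ℝ V]
    [NormedAddCommGroup F] [NormedSpace ℝ F] (J : ℕ) {f : F → V} (hf : ContDiff ℝ (⊤ : ℕ∞) f) {v : F}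
    (hv : ‖v‖ ≤ 1) (x : F) {M : ℝ} (hM : ∀ y, ‖iteratedFDeriv ℝ (J + 2) f y‖ ≤ M) {δ : ℝ}
    (hδ : 0 < δ) :
    ‖fderiv ℝ f x v - δ⁻¹ • ∑ m, differenceCoeff J m • f (x + ((m : ℝ) * δ) • v)‖ ≤
      differenceConst J * M * δ ^ (J + 1) := by
  set φ : ℝ → V := fun s => f (x + s • v) with hφ
  have hφd : ContDiff ℝ (⊤ : ℕ∞) φ := hf.comp (by fun_prop)
  set b : ℝ := (J + 2) * δ with hb
  have hb0 : 0 < b := by positivity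
  have hM0 : 0 ≤ M := (norm_nonneg _).trans (hM 0)
  have hu : UniqueDiffOn ℝ (Set.Icc 0 b) := uniqueDiffOn_Icc hb0
  have hwithin : ∀ k, ∀ y ∈ Set.Icc 0 b, iteratedDerivWithin k φ (Set.Icc 0 b) y = iteratedDeriv k φ y :=
    fun k y hy => iteratedDerivWithin_eq_iteratedDeriv hu
      ((hφd.of_le (by exact_mod_cast le_top)).contDiffAt) hy
  have h0 : (0 : ℝ) ∈ Set.Icc 0 b := ⟨le_rfl, hb0.le⟩
  have hR : ∀ m : Fin (J + 2), ‖φ (m * δ) - ∑ k ∈ Finset.range (J + 2),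
      (((k.factorial : ℝ)⁻¹ * (m * δ) ^ k) • iteratedDeriv k φ 0)‖ ≤
        M * (m * δ) ^ (J + 2) / (J + 1).factorial := by
    intro m
    have hm : (m : ℝ) * δ ∈ Set.Icc 0 b := by
      refine ⟨by positivity, ?_⟩
      rw [hb]
      gcongr
      have := m.2.le
      exact_mod_cast this
    have h1 := taylor_mean_remainder_bound (n := J + 1) hb0.le
      ((hφd.of_le (by exact_mod_cast le_top)).contDiffOn) hm (C := M) fun y hy => by
        rw [hwithin _ y hy]
        exact norm_iteratedFDeriv_comp_line hf hv x _ hM y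
    rw [taylor_within_apply] at h1
    simp only [sub_zero] at h1
    refine le_trans (le_of_eq ?_) h1
    congr 2
    refine Finset.sum_congr rfl fun k _ => ?_
    rw [hwithin k 0 h0]
  have h1 : fderiv ℝ f x v = iteratedDeriv 1 φ 0 := by
    rw [iteratedDeriv_one]
    have hd : HasFDerivAt f (fderiv ℝ f x) (x + (0 : ℝ) • v) := by
      rw [zero_smul, add_zero]
      exact (hf.differentiable (by simp)).differentiableAt.hasFDerivAt
    have h2 : HasDerivAt (fun s : ℝ => x + s • v) v 0 := by
      simpa using ((hasDerivAt_id (0 : ℝ)).smul_const v).const_add x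
    exact (hd.comp_hasDerivAt (0 : ℝ) h2).deriv.symm
  have hsum : ∑ m, differenceCoeff J m • ∑ k ∈ Finset.range (J + 2),
      (((k.factorial : ℝ)⁻¹ * (m * δ) ^ k) • iteratedDeriv k φ 0) = δ • iteratedDeriv 1 φ 0 := by
    simp_rw [Finset.smul_sum, smul_smul]
    rw [Finset.sum_comm]
    simp_rw [← Finset.sum_smul]
    have h3 : ∀ k ∈ Finset.range (J + 2), ∑ m, differenceCoeff J m * ((k.factorial : ℝ)⁻¹ * (m * δ) ^ k)
        = if k = 1 then δ else 0 := by
      intro k hk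
      have h4 := (exists_vandermonde J).choose_spec ⟨k, Finset.mem_range.1 hk⟩
      have h5 : ∑ m, differenceCoeff J m * ((k.factorial : ℝ)⁻¹ * (m * δ) ^ k) =
          ((k.factorial : ℝ)⁻¹ * δ ^ k) * ∑ m, differenceCoeff J m * (m : ℝ) ^ k := by
        rw [Finset.mul_sum]
        refine Finset.sum_congr rfl fun m _ => ?_
        rw [mul_pow]
        ring
      rw [h5]
      change _ * ∑ m, (exists_vandermonde J).choose m * (m : ℝ) ^ k = _
      rw [h4]
      split_ifs with h6
      · subst h6
        simp
      · simp
    rw [Finset.sum_congr rfl fun k hk => by rw [h3 k hk]]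
    simp only [ite_smul, zero_smul]
    rw [Finset.sum_ite_eq']
    simp
  have h4 : fderiv ℝ f x v - δ⁻¹ • ∑ m, differenceCoeff J m • f (x + ((m : ℝ) * δ) • v) =
      -(δ⁻¹ • ∑ m, differenceCoeff J m • (φ (m * δ) - ∑ k ∈ Finset.range (J + 2),
      (((k.factorial : ℝ)⁻¹ * (m * δ) ^ k) • iteratedDeriv k φ 0))) := by
    simp_rw [smul_sub, Finset.sum_sub_distrib, hsum, smul_sub, smul_smul, inv_mul_cancel₀ hδ.ne',
      one_smul, h1, neg_sub]
    rfl
  rw [h4, norm_neg, norm_smul, Real.norm_of_nonneg (inv_pos.2 hδ).le, inv_mul_le_iff₀ hδ]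
  refine (norm_sum_le _ _).trans ?_
  have h5 : δ * (differenceConst J * M * δ ^ (J + 1)) =
      ∑ m, |differenceCoeff J m| * (M * (m * δ) ^ (J + 2) / (J + 1).factorial) := by
    rw [differenceConst, Finset.sum_mul, Finset.sum_mul, Finset.mul_sum]
    refine Finset.sum_congr rfl fun m _ => ?_
    rw [mul_pow]
    ring
  rw [h5]
  refine Finset.sum_le_sum fun m _ => ?_
  rw [norm_smul, Real.norm_eq_abs]
  exact mul_le_mul_of_nonneg_left (hR m) (abs_nonneg _)

section Energy

variable {d : ℕ} {V : Type*} [NormedAddCommGroup V] [InnerProductSpace ℂ V] [NormedSpace ℝ V]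
  [IsScalarTower ℝ ℂ V]

theorem laplacian_eq_sum {d : ℕ} {V : Type*} [NormedAddCommGroup V] [NormedSpace ℝ V]
    (f : EuclideanSpace ℝ (Fin d) → V) (x : EuclideanSpace ℝ (Fin d)) :
    Laplacian.laplacian f x = ∑ i, fderiv ℝ (fderiv ℝ f) x (EuclideanSpace.basisFun (Fin d) ℝ i)
      (EuclideanSpace.basisFun (Fin d) ℝ i) := by
  rw [InnerProductSpace.laplacian_eq_iteratedFDeriv_orthonormalBasis f
    (EuclideanSpace.basisFun (Fin d) ℝ)]
  refine Finset.sum_congr rfl fun i _ => ?_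
  rw [iteratedFDeriv_two_apply]
  rfl

theorem norm_fderiv_fderiv_apply_le {F W : Type*} [NormedAddCommGroup F] [NormedSpace ℝ F]
    [NormedAddCommGroup W] [NormedSpace ℝ W] (f : F → W) (x v w : F) (hv : ‖v‖ ≤ 1) (hw : ‖w‖ ≤ 1) :
    ‖fderiv ℝ (fderiv ℝ f) x v w‖ ≤ ‖iteratedFDeriv ℝ 2 f x‖ := by
  have h1 := iteratedFDeriv_two_apply (𝕜 := ℝ) f x ![v, w]
  simp only [Matrix.cons_val_zero, Matrix.cons_val_one] at h1
  rw [← h1]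
  refine (ContinuousMultilinearMap.le_opNorm _ _).trans ?_
  refine mul_le_of_le_one_right (norm_nonneg _) ?_
  rw [Fin.prod_univ_two]
  exact mul_le_one₀ hv (norm_nonneg _) hw

theorem norm_fderiv_apply_le {F W : Type*} [NormedAddCommGroup F] [NormedSpace ℝ F]
    [NormedAddCommGroup W] [NormedSpace ℝ W] (f : F → W) (x v : F) (hv : ‖v‖ ≤ 1) :
    ‖fderiv ℝ f x v‖ ≤ ‖iteratedFDeriv ℝ 1 f x‖ := by
  rw [norm_iteratedFDeriv_one]
  exact ((fderiv ℝ f x).le_opNorm v).trans (mul_le_of_le_one_right (norm_nonneg _) hv)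

theorem norm_basisFun_le (i : Fin d) : ‖EuclideanSpace.basisFun (Fin d) ℝ i‖ ≤ 1 :=
  ((EuclideanSpace.basisFun (Fin d) ℝ).orthonormal.1 i).le

theorem norm_laplacian_le {V : Type*} [NormedAddCommGroup V] [NormedSpace ℝ V]
    (f : EuclideanSpace ℝ (Fin d) → V) (x : EuclideanSpace ℝ (Fin d)) :
    ‖Laplacian.laplacian f x‖ ≤ d * ‖iteratedFDeriv ℝ 2 f x‖ := by
  rw [laplacian_eq_sum]
  refine (norm_sum_le _ _).trans ?_
  refine (Finset.sum_le_sum fun i _ =>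
    norm_fderiv_fderiv_apply_le f x _ _ (norm_basisFun_le i) (norm_basisFun_le i)).trans ?_
  simp

theorem norm_im_inner_le (a b : V) : |(inner ℂ a b).im| ≤ ‖a‖ * ‖b‖ :=
  (Complex.abs_im_le_norm _).trans (norm_inner_le_norm a b)

theorem norm_re_inner_le (a b : V) : |(inner ℂ a b).re| ≤ ‖a‖ * ‖b‖ :=
  (Complex.abs_re_le_norm _).trans (norm_inner_le_norm a b)

/-- The commutator of the weight with the Laplacian only involves first derivatives. -/
theorem integral_slowWeight_mul_im_inner_laplacian {η : ℝ} (hη : 0 < η)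
    (x₀ : EuclideanSpace ℝ (Fin d)) {f : EuclideanSpace ℝ (Fin d) → V}
    (hf : ContDiff ℝ (⊤ : ℕ∞) f) {B : ℝ} (hB : ∀ j ≤ 2, ∀ x, ‖iteratedFDeriv ℝ j f x‖ ≤ B) :
    ∫ x, slowWeight η x₀ x * (inner ℂ (f x) (Laplacian.laplacian f x)).im =
      -∑ i, ∫ x, fderiv ℝ (slowWeight η x₀) x (EuclideanSpace.basisFun (Fin d) ℝ i) *
        (inner ℂ (f x) (fderiv ℝ f x (EuclideanSpace.basisFun (Fin d) ℝ i))).im := by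
  set e := EuclideanSpace.basisFun (Fin d) ℝ with he
  have hB0 : ∀ x, ‖f x‖ ≤ B := fun x => by simpa using hB 0 (by norm_num) x
  have hB1 : ∀ x i, ‖fderiv ℝ f x (e i)‖ ≤ B := fun x i =>
    (norm_fderiv_apply_le f x _ (norm_basisFun_le i)).trans (hB 1 (by norm_num) x)
  have hB2 : ∀ x i, ‖fderiv ℝ (fderiv ℝ f) x (e i) (e i)‖ ≤ B := fun x i =>
    (norm_fderiv_fderiv_apply_le f x _ _ (norm_basisFun_le i) (norm_basisFun_le i)).trans
      (hB 2 le_rfl x)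
  have hBnn : 0 ≤ B := (norm_nonneg _).trans (hB0 0)
  have hc0 : Continuous f := hf.continuous
  have hd1 : ContDiff ℝ (⊤ : ℕ∞) (fderiv ℝ f) := hf.fderiv_right (by norm_cast)
  have hd2 : ContDiff ℝ (⊤ : ℕ∞) (fderiv ℝ (fderiv ℝ f)) := hd1.fderiv_right (by norm_cast)
  have hc1 : ∀ i, Continuous fun x => fderiv ℝ f x (e i) := fun i =>
    hd1.continuous.clm_apply continuous_const
  have hc2 : ∀ i, Continuous fun x => fderiv ℝ (fderiv ℝ f) x (e i) (e i) := fun i =>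
    (hd2.continuous.clm_apply continuous_const).clm_apply continuous_const
  have hg : ∀ i x, HasFDerivAt (fun x => (inner ℂ (f x) (fderiv ℝ f x (e i))).im)
      (Complex.imCLM.comp ((fderivInnerCLM ℂ (f x, fderiv ℝ f x (e i))).comp
        ((fderiv ℝ f x).prod ((fderiv ℝ (fderiv ℝ f) x).flip (e i))))) x := by
    intro i x
    have h1 : HasFDerivAt f (fderiv ℝ f x) x := (hf.differentiable (by simp)).differentiableAt.hasFDerivAt
    have h2 : HasFDerivAt (fun x => fderiv ℝ f x (e i)) ((fderiv ℝ (fderiv ℝ f) x).flip (e i)) x := by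
      have h3 : HasFDerivAt (fderiv ℝ f) (fderiv ℝ (fderiv ℝ f) x) x :=
        (hd1.differentiable (by simp)).differentiableAt.hasFDerivAt
      have := h3.clm_apply (hasFDerivAt_const (e i) x)
      simpa using this
    exact Complex.imCLM.hasFDerivAt.comp x (h1.inner ℂ h2)
  have hg' : ∀ i x, fderiv ℝ (fun x => (inner ℂ (f x) (fderiv ℝ f x (e i))).im) x (e i) =
      (inner ℂ (f x) (fderiv ℝ (fderiv ℝ f) x (e i) (e i))).im := by
    intro i x
    rw [(hg i x).fderiv]
    simp only [ContinuousLinearMap.comp_apply, ContinuousLinearMap.prod_apply, fderivInnerCLM_apply,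
      ContinuousLinearMap.flip_apply, Complex.imCLM_apply, Complex.add_im]
    have h0 : (inner ℂ (fderiv ℝ f x (e i)) (fderiv ℝ f x (e i))).im = 0 :=
      inner_self_im (𝕜 := ℂ) (fderiv ℝ f x (e i))
    rw [h0, add_zero]
  have hibp : ∀ i, ∫ x, slowWeight η x₀ x * (inner ℂ (f x) (fderiv ℝ (fderiv ℝ f) x (e i) (e i))).im =
      -∫ x, fderiv ℝ (slowWeight η x₀) x (e i) * (inner ℂ (f x) (fderiv ℝ f x (e i))).im := by
    intro i
    have hcg : Continuous fun x => (inner ℂ (f x) (fderiv ℝ f x (e i))).im :=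
      Complex.continuous_im.comp (hc0.inner (hc1 i))
    have hcg2 : Continuous fun x => (inner ℂ (f x) (fderiv ℝ (fderiv ℝ f) x (e i) (e i))).im :=
      Complex.continuous_im.comp (hc0.inner (hc2 i))
    have hbg : ∀ x, ‖(inner ℂ (f x) (fderiv ℝ f x (e i))).im‖ ≤ B * B := fun x =>
      (norm_im_inner_le _ _).trans (mul_le_mul (hB0 x) (hB1 x i) (norm_nonneg _) hBnn)
    have hbg2 : ∀ x, ‖(inner ℂ (f x) (fderiv ℝ (fderiv ℝ f) x (e i) (e i))).im‖ ≤ B * B := fun x =>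
      (norm_im_inner_le _ _).trans (mul_le_mul (hB0 x) (hB2 x i) (norm_nonneg _) hBnn)
    have h1 := integral_mul_fderiv_eq_neg_fderiv_mul_of_integrable
      (μ := (volume : Measure (EuclideanSpace ℝ (Fin d)))) (f := slowWeight η x₀)
      (g := fun x => (inner ℂ (f x) (fderiv ℝ f x (e i))).im) (v := e i) ?_ ?_ ?_ ?_ ?_
    · simp_rw [hg'] at h1
      exact h1
    · have hw := ((contDiff_slowWeight η x₀).continuous_fderiv (by norm_num)).clm_apply
        (continuous_const (y := e i))
      refine ((integrable_slowWeight hη x₀).const_mul ((d + 1) * η * (B * B))).mono'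
        (hw.mul hcg).aestronglyMeasurable (Filter.Eventually.of_forall fun x => ?_)
      rw [norm_mul]
      have h2 := abs_fderiv_slowWeight_le hη.le x₀ x (e i)
      have h3 := slowWeight_pos η x₀ x
      have h4 : |fderiv ℝ (slowWeight η x₀) x (e i)| ≤ (d + 1) * η * slowWeight η x₀ x := by
        refine h2.trans ?_
        have := mul_le_of_le_one_right (by positivity : 0 ≤ (d + 1) * η) (norm_basisFun_le i)
        exact mul_le_mul_of_nonneg_right this h3.le
      calc _ ≤ ((d + 1) * η * slowWeight η x₀ x) * (B * B) :=
            mul_le_mul h4 (hbg x) (norm_nonneg _) (by positivity)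
        _ = _ := by ring
    · simp_rw [hg']
      exact integrable_slowWeight_mul hη x₀ hcg2.aestronglyMeasurable hbg2
    · exact integrable_slowWeight_mul hη x₀ hcg.aestronglyMeasurable hbg
    · exact fun x _ => ((contDiff_slowWeight η x₀).differentiable (by norm_num)).differentiableAt
    · exact fun x _ => (hg i x).differentiableAt
  rw [← Finset.sum_neg_distrib]
  simp_rw [← hibp]
  rw [← integral_finsetSum]
  · refine integral_congr_ae (Filter.Eventually.of_forall fun x => ?_)
    simp only [laplacian_eq_sum, inner_sum, Complex.im_sum, Finset.mul_sum, ← he]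
  · intro i _
    exact integrable_slowWeight_mul hη x₀
      (Complex.continuous_im.comp (hc0.inner (hc2 i))).aestronglyMeasurable (C := B * B) fun x =>
      (norm_im_inner_le _ _).trans (mul_le_mul (hB0 x) (hB2 x i) (norm_nonneg _) hBnn)

theorem aestronglyMeasurable_time_deriv [CompleteSpace V] {f : ℝ → EuclideanSpace ℝ (Fin d) → V}
    (hf : Differentiable ℝ fun p : ℝ × EuclideanSpace ℝ (Fin d) => f p.1 p.2) (t : ℝ) :
    AEStronglyMeasurable (fun x => deriv (fun s => f s x) t)
      (volume : Measure (EuclideanSpace ℝ (Fin d))) := by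
  have h1 : Continuous (Function.uncurry fun (x : EuclideanSpace ℝ (Fin d)) (s : ℝ) => f s x) :=
    hf.continuous.comp continuous_swap
  exact ((stronglyMeasurable_deriv_with_param h1).comp_measurable
    (measurable_id.prodMk measurable_const)).aestronglyMeasurable

/-- The time derivative of the localized energy. -/
theorem hasDerivAt_integral_slowWeight_norm_sq [CompleteSpace V] {η : ℝ} (hη : 0 < η) (x₀ : EuclideanSpace ℝ (Fin d))
    {f : ℝ → EuclideanSpace ℝ (Fin d) → V}
    (hf : Differentiable ℝ fun p : ℝ × EuclideanSpace ℝ (Fin d) => f p.1 p.2) {T B : ℝ}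
    (hB : ∀ t, |t| < T → ∀ x, ‖f t x‖ ≤ B) (hB' : ∀ t, |t| < T → ∀ x, ‖deriv (fun s => f s x) t‖ ≤ B)
    {t : ℝ} (ht : |t| < T) :
    HasDerivAt (fun t => ∫ x, slowWeight η x₀ x * ‖f t x‖ ^ 2)
      (∫ x, slowWeight η x₀ x * (2 * (inner ℂ (f t x) (deriv (fun s => f s x) t)).re)) t := by
  have hBnn : 0 ≤ B := (norm_nonneg _).trans (hB t ht 0)
  have hc : Continuous fun p : ℝ × EuclideanSpace ℝ (Fin d) => f p.1 p.2 := hf.continuous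
  have hct : ∀ t, Continuous (f t) := fun t => hc.comp (continuous_const.prodMk continuous_id)
  have hdt : ∀ t x, HasDerivAt (fun s => f s x) (deriv (fun s => f s x) t) t := fun t x =>
    ((hf.differentiableAt (x := (t, x))).comp t
      (f := fun s : ℝ => (s, x)) (by fun_prop)).hasDerivAt
  have hmeas := aestronglyMeasurable_time_deriv hf t
  have hnhds : {s : ℝ | |s| < T} ∈ nhds t := (isOpen_lt continuous_abs continuous_const).mem_nhds ht
  refine (hasDerivAt_integral_of_dominated_loc_of_deriv_le (μ := volume)
    (F := fun t x => slowWeight η x₀ x * ‖f t x‖ ^ 2)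
    (F' := fun t x => slowWeight η x₀ x * (2 * (inner ℂ (f t x) (deriv (fun s => f s x) t)).re))
    (bound := fun x => slowWeight η x₀ x * (2 * (B * B))) hnhds ?_ ?_ ?_ ?_ ?_ ?_).2
  · refine Filter.Eventually.of_forall fun s => ?_
    exact ((contDiff_slowWeight η x₀).continuous.mul ((hct s).norm.pow 2)).aestronglyMeasurable
  · refine integrable_slowWeight_mul hη x₀ ((hct t).norm.pow 2).aestronglyMeasurable (C := B ^ 2)
      fun x => ?_
    rw [norm_pow, norm_norm]
    exact pow_le_pow_left₀ (norm_nonneg _) (hB t ht x) 2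
  · refine (contDiff_slowWeight η x₀).continuous.aestronglyMeasurable.mul ?_
    exact (Complex.continuous_re.comp_aestronglyMeasurable
      ((hct t).aestronglyMeasurable.inner hmeas)).const_mul 2
  · refine Filter.Eventually.of_forall fun x s hs => ?_
    rw [norm_mul, Real.norm_of_nonneg (slowWeight_pos η x₀ x).le]
    refine mul_le_mul_of_nonneg_left ?_ (slowWeight_pos η x₀ x).le
    rw [norm_mul, Real.norm_of_nonneg (by norm_num : (0 : ℝ) ≤ 2)]
    refine mul_le_mul_of_nonneg_left ?_ (by norm_num)
    exact (norm_re_inner_le _ _).trans (mul_le_mul (hB s hs x) (hB' s hs x) (norm_nonneg _) hBnn)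
  · exact (integrable_slowWeight hη x₀).mul_const _
  · refine Filter.Eventually.of_forall fun x s hs => ?_
    have h1 : HasDerivAt (fun s => ‖f s x‖ ^ 2)
        (2 * (inner ℂ (f s x) (deriv (fun s => f s x) s)).re) s := by
      have h2 := Complex.reCLM.hasFDerivAt.comp_hasDerivAt s ((hdt s x).inner ℂ (hdt s x))
      have h3 : (fun s => ‖f s x‖ ^ 2) = fun s => Complex.reCLM (inner ℂ (f s x) (f s x)) := by
        ext s
        rw [Complex.reCLM_apply]
        exact norm_sq_eq_re_inner (𝕜 := ℂ) _
      rw [h3]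
      convert! h2 using 1
      rw [map_add, Complex.reCLM_apply, Complex.reCLM_apply, two_mul]
      congr 1
      rw [← inner_conj_symm, Complex.conj_re]
    exact h1.const_mul _

end Energy

/-- The constant in the localized energy estimate. -/
noncomputable def energyConst (d : ℕ) (c : ℝ) : ℝ :=
  |c| * (d * (d + 1)) * ((∑ m, |differenceCoeff d m|) +
    differenceConst d * Real.sqrt (∫ x, slowWeight (d := d) 1 0 x))

theorem differenceConst_nonneg (J : ℕ) : 0 ≤ differenceConst J :=
  Finset.sum_nonneg fun _ _ => by positivity

theorem energyConst_nonneg (d : ℕ) (c : ℝ) : 0 ≤ energyConst d c := by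
  have h1 := differenceConst_nonneg d
  have h2 : 0 ≤ ∑ m, |differenceCoeff d m| := Finset.sum_nonneg fun _ _ => abs_nonneg _
  unfold energyConst
  positivity

section Energy

variable {d : ℕ} {V : Type*} [NormedAddCommGroup V] [InnerProductSpace ℂ V] [NormedSpace ℝ V]
  [IsScalarTower ℝ ℂ V]

/-- The gradient term in the energy identity, estimated by finite differences of step `η`. The loss
`1 / η` of the difference quotient is compensated by the factor `η` which a derivative of the weight
brings. With differences of order `d`, the Taylor error `η ^ (d + 1)`, times the factor `η` and
the square root of the mass `η⁻ᵈ` of the weight, is at most of order `η ^ 2`. -/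
theorem integral_slowWeight_mul_norm_mul_norm_fderiv_le {η : ℝ} (hη : 0 < η) (hη1 : η ≤ 1)
    {f : EuclideanSpace ℝ (Fin d) → V} (hf : ContDiff ℝ (⊤ : ℕ∞) f) {B a : ℝ}
    (hB : ∀ j ≤ d + 2, ∀ x, ‖iteratedFDeriv ℝ j f x‖ ≤ B) (ha : 0 ≤ a)
    (hfa : ∀ x₀, ∫ x, slowWeight η x₀ x * ‖f x‖ ^ 2 ≤ a ^ 2) {v : EuclideanSpace ℝ (Fin d)}
    (hv : ‖v‖ ≤ 1) (x₀ : EuclideanSpace ℝ (Fin d)) :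
    η * ∫ x, slowWeight η x₀ x * (‖f x‖ * ‖fderiv ℝ f x v‖) ≤
      (∑ m, |differenceCoeff d m|) * a ^ 2 +
        differenceConst d * Real.sqrt (∫ x, slowWeight (d := d) 1 0 x) * (B * η ^ 2) * a := by
  have hc : Continuous f := hf.continuous
  have hB0 : ∀ x, ‖f x‖ ≤ B := fun x => by simpa using hB 0 (by omega) x
  have hBnn : 0 ≤ B := (norm_nonneg _).trans (hB0 0)
  have hC := differenceConst_nonneg d
  set I := ∫ x, slowWeight (d := d) 1 0 x with hI
  have hd1 : ContDiff ℝ (⊤ : ℕ∞) (fderiv ℝ f) := hf.fderiv_right (by norm_cast)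
  have hnn : ∀ x, ‖‖f x‖‖ ≤ B := fun x => by rw [norm_norm]; exact hB0 x
  -- pointwise, the derivative is a difference quotient up to the Taylor error
  have hpt : ∀ x, slowWeight η x₀ x * (‖f x‖ * ‖fderiv ℝ f x v‖) ≤
      (∑ m : Fin (d + 2), (η⁻¹ * |differenceCoeff d m|) *
        (slowWeight η x₀ x * (‖f x‖ * ‖f (x + ((m : ℝ) * η) • v)‖))) +
        (differenceConst d * B * η ^ (d + 1)) * (slowWeight η x₀ x * (‖f x‖ * 1)) := by
    intro x
    have h1 := norm_fderiv_sub_difference_le d hf hv x (hB (d + 2) le_rfl) hη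
    have h2 : ‖fderiv ℝ f x v‖ ≤ η⁻¹ * ∑ m : Fin (d + 2), |differenceCoeff d m| *
        ‖f (x + ((m : ℝ) * η) • v)‖ + differenceConst d * B * η ^ (d + 1) := by
      have h3 : ‖fderiv ℝ f x v‖ ≤ ‖η⁻¹ • ∑ m : Fin (d + 2), differenceCoeff d m •
          f (x + ((m : ℝ) * η) • v)‖ + differenceConst d * B * η ^ (d + 1) := by
        have := norm_le_norm_add_norm_sub' (fderiv ℝ f x v)
          (η⁻¹ • ∑ m : Fin (d + 2), differenceCoeff d m • f (x + ((m : ℝ) * η) • v))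
        linarith
      refine h3.trans (add_le_add ?_ le_rfl)
      rw [norm_smul, Real.norm_of_nonneg (inv_pos.2 hη).le]
      refine mul_le_mul_of_nonneg_left ((norm_sum_le _ _).trans (le_of_eq ?_)) (inv_pos.2 hη).le
      exact Finset.sum_congr rfl fun m _ => by rw [norm_smul, Real.norm_eq_abs]
    have hw := (slowWeight_pos η x₀ x).le
    calc slowWeight η x₀ x * (‖f x‖ * ‖fderiv ℝ f x v‖)
        ≤ slowWeight η x₀ x * (‖f x‖ * (η⁻¹ * ∑ m : Fin (d + 2), |differenceCoeff d m| *
        ‖f (x + ((m : ℝ) * η) • v)‖ + differenceConst d * B * η ^ (d + 1))) := by gcongr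
      _ = _ := by
        rw [mul_add, mul_add, Finset.mul_sum, Finset.mul_sum, Finset.mul_sum]
        congr 1
        · exact Finset.sum_congr rfl fun m _ => by ring
        · ring
  have hi1 : ∀ m : Fin (d + 2),
      Integrable fun x => slowWeight η x₀ x * (‖f x‖ * ‖f (x + ((m : ℝ) * η) • v)‖) := fun m =>
    integrable_slowWeight_mul hη x₀
      (hc.norm.mul (hc.comp (by fun_prop)).norm).aestronglyMeasurable (C := B * B) fun x => by
      rw [norm_mul, norm_norm, norm_norm]
      exact mul_le_mul (hB0 _) (hB0 _) (norm_nonneg _) hBnn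
  have hi2 : Integrable fun x => slowWeight η x₀ x * (‖f x‖ * 1) :=
    integrable_slowWeight_mul hη x₀ (hc.norm.mul continuous_const).aestronglyMeasurable (C := B)
      fun x => by
      rw [mul_one]
      exact hnn x
  have hi3 : Integrable fun x => slowWeight η x₀ x * (‖f x‖ * ‖fderiv ℝ f x v‖) :=
    integrable_slowWeight_mul hη x₀
      (hc.norm.mul (hd1.continuous.clm_apply continuous_const).norm).aestronglyMeasurable
      (C := B * B) fun x => by
      rw [norm_mul, norm_norm, norm_norm]
      exact mul_le_mul (hB0 _) ((norm_fderiv_apply_le f x _ hv).trans (hB 1 (by omega) x))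
        (norm_nonneg _) hBnn
  have h1 := integral_mono hi3 ((integrable_finsetSum Finset.univ fun m _ =>
    (hi1 m).const_mul (η⁻¹ * |differenceCoeff d m|)).add
      (hi2.const_mul (differenceConst d * B * η ^ (d + 1)))) hpt
  have h2 : ∫ x, ((∑ m : Fin (d + 2), (η⁻¹ * |differenceCoeff d m|) *
        (slowWeight η x₀ x * (‖f x‖ * ‖f (x + ((m : ℝ) * η) • v)‖))) +
        (differenceConst d * B * η ^ (d + 1)) * (slowWeight η x₀ x * (‖f x‖ * 1))) =
      (∑ m : Fin (d + 2), (η⁻¹ * |differenceCoeff d m|) *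
        ∫ x, slowWeight η x₀ x * (‖f x‖ * ‖f (x + ((m : ℝ) * η) • v)‖)) +
        (differenceConst d * B * η ^ (d + 1)) * ∫ x, slowWeight η x₀ x * (‖f x‖ * 1) := by
    rw [integral_add (integrable_finsetSum Finset.univ fun m _ =>
      (hi1 m).const_mul (η⁻¹ * |differenceCoeff d m|))
      (hi2.const_mul (differenceConst d * B * η ^ (d + 1))), integral_const_mul,
      integral_finsetSum Finset.univ fun m _ => (hi1 m).const_mul (η⁻¹ * |differenceCoeff d m|)]
    congr 1
    exact Finset.sum_congr rfl fun m _ => integral_const_mul _ _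
  have h3 : ∀ m : Fin (d + 2),
      ∫ x, slowWeight η x₀ x * (‖f x‖ * ‖f (x + ((m : ℝ) * η) • v)‖) ≤ a * a := by
    intro m
    refine integral_slowWeight_mul_mul_le hη x₀ hc.norm.aestronglyMeasurable
      (hc.comp (by fun_prop : Continuous fun x => x + ((m : ℝ) * η) • v)).norm.aestronglyMeasurable
      hnn (fun x => hnn (x + ((m : ℝ) * η) • v)) ha ha (hfa x₀) ?_
    -- a translation of the function is a translation of the weight
    have h4 := integral_add_right_eq_self (μ := (volume : Measure (EuclideanSpace ℝ (Fin d))))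
      (fun x => slowWeight η (x₀ + ((m : ℝ) * η) • v) x * ‖f x‖ ^ 2) (((m : ℝ) * η) • v)
    simp only [slowWeight_add, add_sub_cancel_right] at h4
    exact h4.le.trans (hfa _)
  have hw : ∫ x, slowWeight η x₀ x * (1 : ℝ) ^ 2 ≤ ((η ^ d)⁻¹ * Real.sqrt I) ^ 2 := by
    simp only [one_pow, mul_one]
    rw [integral_slowWeight hη, mul_pow, Real.sq_sqrt
      (integral_nonneg fun x => (slowWeight_pos 1 0 x).le)]
    refine mul_le_mul_of_nonneg_right ?_ (integral_nonneg fun x => (slowWeight_pos 1 0 x).le)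
    have h5 : 1 ≤ (η ^ d)⁻¹ := (one_le_inv₀ (by positivity)).2 (pow_le_one₀ hη.le hη1)
    nlinarith
  have h4 : ∫ x, slowWeight η x₀ x * (‖f x‖ * 1) ≤ a * ((η ^ d)⁻¹ * Real.sqrt I) :=
    integral_slowWeight_mul_mul_le hη x₀ hc.norm.aestronglyMeasurable
      (continuous_const (y := (1 : ℝ))).aestronglyMeasurable (B := 1) hnn (fun x => by simp) ha
      (by positivity) (hfa x₀) hw
  have h5 : ∫ x, slowWeight η x₀ x * (‖f x‖ * ‖fderiv ℝ f x v‖) ≤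
      (∑ m : Fin (d + 2), (η⁻¹ * |differenceCoeff d m|) * (a * a)) +
        (differenceConst d * B * η ^ (d + 1)) * (a * ((η ^ d)⁻¹ * Real.sqrt I)) := by
    refine (h1.trans h2.le).trans (add_le_add (Finset.sum_le_sum fun m _ => ?_) ?_)
    · exact mul_le_mul_of_nonneg_left (h3 m) (by positivity)
    · exact mul_le_mul_of_nonneg_left h4 (by positivity)
  refine (mul_le_mul_of_nonneg_left h5 hη.le).trans (le_of_eq ?_)
  rw [← Finset.sum_mul, ← Finset.mul_sum]
  field_simp
  ring

/-- The localized energy estimate for `i ∂ₜ h + c Δ h = G`: if the local `L²` norms of `h` at scale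
`1 / η` are at most `S e^{Λ t}`, then they satisfy an improved bound. -/
theorem energy_bound [CompleteSpace V] {η : ℝ} (hη : 0 < η) (hη1 : η ≤ 1) {c Λ T B B' S g : ℝ}
    (hΛ : 0 < Λ) (hS : 0 ≤ S) {h G : ℝ → EuclideanSpace ℝ (Fin d) → V}
    (hdiff : Differentiable ℝ fun p : ℝ × EuclideanSpace ℝ (Fin d) => h p.1 p.2)
    (hsmooth : ∀ t, ContDiff ℝ (⊤ : ℕ∞) (h t))
    (hB : ∀ j ≤ d + 2, ∀ t, |t| < T → ∀ x, ‖iteratedFDeriv ℝ j (h t) x‖ ≤ B)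
    (hB' : ∀ t, |t| < T → ∀ x, ‖deriv (fun s => h s x) t‖ ≤ B') (h0 : ∀ x, h 0 x = 0)
    (heq : ∀ t x, Complex.I • deriv (fun s => h s x) t + (c : ℂ) • Laplacian.laplacian (h t) x =
      G t x)
    (hSb : ∀ t, 0 ≤ t → t < T → ∀ x₀,
      ∫ x, slowWeight η x₀ x * ‖h t x‖ ^ 2 ≤ (S * Real.exp (Λ * t)) ^ 2)
    (hg : 0 ≤ g)
    (hG : ∀ t, 0 ≤ t → t < T → ∀ x₀, ∫⁻ x, ENNReal.ofReal (slowWeight η x₀ x) * (‖h t x‖ₑ * ‖G t x‖ₑ) ≤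
      ENNReal.ofReal (S * g * Real.exp (Λ * t) ^ 2))
    {t : ℝ} (ht : 0 ≤ t) (htT : t < T) (x₀ : EuclideanSpace ℝ (Fin d)) :
    ∫ x, slowWeight η x₀ x * ‖h t x‖ ^ 2 ≤
      S * (g + energyConst d c * (S + B * η ^ 2)) / Λ * Real.exp (Λ * t) ^ 2 := by
  have hB0 : ∀ t, |t| < T → ∀ x, ‖h t x‖ ≤ B := fun t ht x => by simpa using hB 0 (by omega) t ht x
  have hBnn : 0 ≤ B := (norm_nonneg _).trans (hB0 t (by rwa [abs_of_nonneg ht]) 0)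
  set M := g + energyConst d c * (S + B * η ^ 2) with hM
  set y : ℝ → ℝ := fun t => ∫ x, slowWeight η x₀ x * ‖h t x‖ ^ 2 with hy
  have hderiv : ∀ s, |s| < T → HasDerivAt y
      (∫ x, slowWeight η x₀ x * (2 * (inner ℂ (h s x) (deriv (fun s => h s x) s)).re)) s :=
    fun s hs => hasDerivAt_integral_slowWeight_norm_sq hη x₀ hdiff (B := max B B')
      (fun t ht x => (hB0 t ht x).trans (le_max_left _ _))
      (fun t ht x => (hB' t ht x).trans (le_max_right _ _)) hs
  have hbound : ∀ s, 0 ≤ s → s < T →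
      ∫ x, slowWeight η x₀ x * (2 * (inner ℂ (h s x) (deriv (fun s => h s x) s)).re) ≤
        2 * (S * M) * Real.exp (Λ * s) ^ 2 := by
    intro s hs0 hsT
    have hs : |s| < T := by rwa [abs_of_nonneg hs0]
    set E := Real.exp (Λ * s) with hE
    have hE1 : 1 ≤ E := Real.one_le_exp (by positivity)
    have hcs : Continuous (h s) := (hsmooth s).continuous
    have hcΔ : Continuous (Laplacian.laplacian (h s)) := by
      have h1 : Laplacian.laplacian (h s) = fun x => ∑ i, fderiv ℝ (fderiv ℝ (h s)) x
          (EuclideanSpace.basisFun (Fin d) ℝ i) (EuclideanSpace.basisFun (Fin d) ℝ i) :=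
        funext fun x => laplacian_eq_sum (h s) x
      rw [h1]
      have hd1 : ContDiff ℝ (⊤ : ℕ∞) (fderiv ℝ (h s)) := (hsmooth s).fderiv_right (by norm_cast)
      have hd2 : ContDiff ℝ (⊤ : ℕ∞) (fderiv ℝ (fderiv ℝ (h s))) := hd1.fderiv_right (by norm_cast)
      exact continuous_finsetSum _ fun i _ =>
        (hd2.continuous.clm_apply continuous_const).clm_apply continuous_const
    -- the equation turns the time derivative of the energy into a source term and a
    -- Laplacian term
    have hpt : ∀ x, (inner ℂ (h s x) (deriv (fun s => h s x) s)).re =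
        (inner ℂ (h s x) (G s x)).im - c * (inner ℂ (h s x) (Laplacian.laplacian (h s) x)).im := by
      intro x
      rw [← heq s x, inner_add_right, inner_smul_right, inner_smul_right]
      simp
    have hmeas := aestronglyMeasurable_time_deriv hdiff s
    have hi1 : Integrable fun x => slowWeight η x₀ x *
        (inner ℂ (h s x) (deriv (fun s => h s x) s)).re :=
      integrable_slowWeight_mul hη x₀ (Complex.continuous_re.comp_aestronglyMeasurable
        (hcs.aestronglyMeasurable.inner hmeas)) (C := B * B') fun x =>
        (norm_re_inner_le _ _).trans (mul_le_mul (hB0 s hs x) (hB' s hs x) (norm_nonneg _) hBnn)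
    have hi2 : Integrable fun x => slowWeight η x₀ x *
        (inner ℂ (h s x) (Laplacian.laplacian (h s) x)).im :=
      integrable_slowWeight_mul hη x₀ (Complex.continuous_im.comp
        (hcs.inner hcΔ)).aestronglyMeasurable (C := B * (d * B)) fun x =>
        (norm_im_inner_le _ _).trans (mul_le_mul (hB0 s hs x) ((norm_laplacian_le _ _).trans
          (mul_le_mul_of_nonneg_left (hB 2 (by omega) s hs x) (by positivity))) (norm_nonneg _) hBnn)
    have hi3 : Integrable fun x => slowWeight η x₀ x * (inner ℂ (h s x) (G s x)).im := by
      refine (hi1.add (hi2.const_mul c)).congr (Filter.Eventually.of_forall fun x => ?_)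
      simp only [Pi.add_apply, hpt]
      ring
    have hsplit : ∫ x, slowWeight η x₀ x * (2 * (inner ℂ (h s x) (deriv (fun s => h s x) s)).re) =
        2 * (∫ x, slowWeight η x₀ x * (inner ℂ (h s x) (G s x)).im) -
        2 * c * ∫ x, slowWeight η x₀ x * (inner ℂ (h s x) (Laplacian.laplacian (h s) x)).im := by
      rw [← integral_const_mul, ← integral_const_mul, ← integral_sub (hi3.const_mul _)
        (hi2.const_mul _)]
      refine integral_congr_ae (Filter.Eventually.of_forall fun x => ?_)
      simp only [hpt]
      ring
    have hG1 : |∫ x, slowWeight η x₀ x * (inner ℂ (h s x) (G s x)).im| ≤ S * g * E ^ 2 := by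
      have h1 := (enorm_integral_le_lintegral_enorm
        (fun x => slowWeight η x₀ x * (inner ℂ (h s x) (G s x)).im)).trans
        ((lintegral_mono fun x => ?_).trans (hG s hs0 hsT x₀))
      · rw [Real.enorm_eq_ofReal_abs, ENNReal.ofReal_le_ofReal_iff (by positivity)] at h1
        exact h1
      · rw [enorm_mul, Real.enorm_of_nonneg (slowWeight_pos η x₀ x).le]
        gcongr
        rw [Real.enorm_eq_ofReal_abs, ← ofReal_norm, ← ofReal_norm,
          ← ENNReal.ofReal_mul (norm_nonneg _)]
        exact ENNReal.ofReal_le_ofReal (norm_im_inner_le _ _)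
    set R := (∑ m, |differenceCoeff d m|) * (S * E) ^ 2 +
        differenceConst d * Real.sqrt (∫ x, slowWeight (d := d) 1 0 x) * (B * η ^ 2) * (S * E) with hR
    -- after an integration by parts, the Laplacian pairs with a derivative of the weight
    -- only
    have hL1 : |∫ x, slowWeight η x₀ x * (inner ℂ (h s x) (Laplacian.laplacian (h s) x)).im| ≤
        d * ((d + 1) * R) := by
      rw [integral_slowWeight_mul_im_inner_laplacian hη x₀ (hsmooth s)
        (fun j hj x => hB j (by omega) s hs x), abs_neg]
      refine (Finset.abs_sum_le_sum_abs _ _).trans ?_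
      have h2 : ∀ i ∈ (Finset.univ : Finset (Fin d)),
          |∫ x, fderiv ℝ (slowWeight η x₀) x (EuclideanSpace.basisFun (Fin d) ℝ i) *
        (inner ℂ (h s x) (fderiv ℝ (h s) x (EuclideanSpace.basisFun (Fin d) ℝ i))).im| ≤
          (d + 1) * R := by
        intro i _
        have h3 := integral_slowWeight_mul_norm_mul_norm_fderiv_le hη hη1 (hsmooth s)
          (fun j hj x => hB j hj s hs x) (by positivity) (hSb s hs0 hsT) (norm_basisFun_le i) x₀
        set e := EuclideanSpace.basisFun (Fin d) ℝ i with he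
        have hd1 : ContDiff ℝ (⊤ : ℕ∞) (fderiv ℝ (h s)) := (hsmooth s).fderiv_right (by norm_cast)
        have hi4 : Integrable fun x => slowWeight η x₀ x * (‖h s x‖ * ‖fderiv ℝ (h s) x e‖) :=
          integrable_slowWeight_mul hη x₀
            (hcs.norm.mul (hd1.continuous.clm_apply continuous_const).norm).aestronglyMeasurable
            (C := B * B) fun x => by
            rw [norm_mul, norm_norm, norm_norm]
            exact mul_le_mul (hB0 s hs _) ((norm_fderiv_apply_le (h s) x _ (norm_basisFun_le i)).trans
              (hB 1 (by omega) s hs x)) (norm_nonneg _) hBnn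
        have h4 : |∫ x, fderiv ℝ (slowWeight η x₀) x e * (inner ℂ (h s x) (fderiv ℝ (h s) x e)).im| ≤
            ∫ x, ((d + 1) * η) * (slowWeight η x₀ x * (‖h s x‖ * ‖fderiv ℝ (h s) x e‖)) := by
          rw [← Real.norm_eq_abs]
          refine norm_integral_le_of_norm_le (hi4.const_mul _) (Filter.Eventually.of_forall fun x => ?_)
          rw [norm_mul, Real.norm_eq_abs, Real.norm_eq_abs]
          have h5 := abs_fderiv_slowWeight_le hη.le x₀ x e
          have h6 : |fderiv ℝ (slowWeight η x₀) x e| ≤ (d + 1) * η * slowWeight η x₀ x := by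
            refine h5.trans ?_
            exact mul_le_mul_of_nonneg_right (mul_le_of_le_one_right (by positivity)
              (norm_basisFun_le i)) (slowWeight_pos η x₀ x).le
          calc _ ≤ ((d + 1) * η * slowWeight η x₀ x) * (‖h s x‖ * ‖fderiv ℝ (h s) x e‖) :=
                mul_le_mul h6 (norm_im_inner_le _ _) (abs_nonneg _)
                  (mul_nonneg (by positivity) (slowWeight_pos η x₀ x).le)
            _ = _ := by ring
        rw [integral_const_mul, mul_assoc] at h4
        exact h4.trans (mul_le_mul_of_nonneg_left h3 (by positivity))
      refine (Finset.sum_le_sum h2).trans ?_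
      simp
    have hRle : R ≤ ((∑ m, |differenceCoeff d m|) +
        differenceConst d * Real.sqrt (∫ x, slowWeight (d := d) 1 0 x)) * (S * E ^ 2) *
          (S + B * η ^ 2) := by
      have hA : 0 ≤ ∑ m, |differenceCoeff d m| := Finset.sum_nonneg fun _ _ => abs_nonneg _
      have hC : 0 ≤ differenceConst d * Real.sqrt (∫ x, slowWeight (d := d) 1 0 x) :=
        mul_nonneg (differenceConst_nonneg d) (Real.sqrt_nonneg _)
      generalize (∑ m, |differenceCoeff d m|) = A at *
      generalize differenceConst d * Real.sqrt (∫ x, slowWeight (d := d) 1 0 x) = C at *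
      have hEE : S * E ≤ S * E ^ 2 := by nlinarith [mul_nonneg hS (sub_nonneg.2 hE1)]
      have hBη : 0 ≤ B * η ^ 2 := by positivity
      have e1 : C * (B * η ^ 2) * (S * E) ≤ C * (B * η ^ 2) * (S * E ^ 2) :=
        mul_le_mul_of_nonneg_left hEE (by positivity)
      have e2 : 0 ≤ A * (S * E ^ 2) * (B * η ^ 2) := by positivity
      have e3 : 0 ≤ C * (S * E ^ 2) * S := by positivity
      rw [hR]
      nlinarith
    rw [hsplit]
    have h5 := (abs_le.1 hG1).2
    have h6 : -(2 * c * ∫ x, slowWeight η x₀ x * (inner ℂ (h s x) (Laplacian.laplacian (h s) x)).im) ≤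
        2 * (|c| * (d * ((d + 1) * R))) := by
      have h7 := neg_le_abs (c * ∫ x, slowWeight η x₀ x *
        (inner ℂ (h s x) (Laplacian.laplacian (h s) x)).im)
      rw [abs_mul] at h7
      have h8 := mul_le_mul_of_nonneg_left hL1 (abs_nonneg c)
      linarith
    have h7 : |c| * (d * ((d + 1) * R)) ≤ energyConst d c * (S + B * η ^ 2) * (S * E ^ 2) := by
      have h8 := mul_le_mul_of_nonneg_left hRle (by positivity : 0 ≤ |c| * (d * ((d : ℝ) + 1)))
      refine le_trans (le_of_eq (by ring)) (h8.trans (le_of_eq ?_))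
      rw [energyConst]
      ring
    rw [hM]
    linarith
  -- integrate the differential inequality
  have hy0 : y 0 = 0 := by simp [hy, h0]
  set z : ℝ → ℝ := fun s => S * M / Λ * Real.exp (Λ * s) ^ 2 - y s with hz
  have hzd : ∀ s, |s| < T → HasDerivAt z (2 * (S * M) * Real.exp (Λ * s) ^ 2 -
      ∫ x, slowWeight η x₀ x * (2 * (inner ℂ (h s x) (deriv (fun s => h s x) s)).re)) s := by
    intro s hs
    have h1 : HasDerivAt (fun s => Λ * s) Λ s := by simpa using (hasDerivAt_id s).const_mul Λ
    refine HasDerivAt.sub ?_ (hderiv s hs)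
    convert! ((h1.exp).pow 2).const_mul (S * M / Λ) using 1
    field_simp
    simp
    ring
  have hmono : MonotoneOn z (Set.Icc 0 t) := by
    refine monotoneOn_of_deriv_nonneg (convex_Icc 0 t) (fun s hs => ?_) (fun s hs => ?_) fun s hs => ?_
    · refine (hzd s ?_).continuousAt.continuousWithinAt
      rw [abs_of_nonneg hs.1]
      exact hs.2.trans_lt htT
    · rw [interior_Icc] at hs
      refine (hzd s ?_).differentiableAt.differentiableWithinAt
      rw [abs_of_pos hs.1]
      exact hs.2.trans htT
    · rw [interior_Icc] at hs
      rw [(hzd s (by rw [abs_of_pos hs.1]; exact hs.2.trans htT)).deriv]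
      exact sub_nonneg.2 (hbound s hs.1.le (hs.2.trans htT))
  have hM0 : 0 ≤ M := by
    have := energyConst_nonneg d c
    positivity
  have h1 := hmono ⟨le_rfl, ht⟩ ⟨ht, le_rfl⟩ ht
  simp only [hz, hy0] at h1
  have h2 : 0 ≤ S * M / Λ * Real.exp (Λ * 0) ^ 2 - 0 := by
    rw [sub_zero]
    positivity
  linarith

end Energy

/-! ### Uniqueness for systems of Schrödinger equations -/

section Uniqueness

variable {d : ℕ} {V : Type*} [NormedAddCommGroup V] [InnerProductSpace ℂ V] [NormedSpace ℝ V]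
  [IsScalarTower ℝ ℂ V]

theorem integral_slowWeight_comp_add (η : ℝ) (x₀ v : EuclideanSpace ℝ (Fin d))
    (F : EuclideanSpace ℝ (Fin d) → ℝ) :
    ∫ x, slowWeight η x₀ x * F (x + v) = ∫ x, slowWeight η (x₀ + v) x * F x := by
  have h := integral_add_right_eq_self (μ := (volume : Measure (EuclideanSpace ℝ (Fin d))))
    (fun x => slowWeight η (x₀ + v) x * F x) v
  simpa only [slowWeight_add, add_sub_cancel_right] using h

theorem hasDerivAt_time {W F : Type*} [NormedAddCommGroup W] [NormedSpace ℝ W] [NormedAddCommGroup F]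
    [NormedSpace ℝ F] {f : ℝ → F → W} (hf : Differentiable ℝ fun p : ℝ × F => f p.1 p.2) (t : ℝ)
    (x : F) : HasDerivAt (fun s => f s x) (deriv (fun s => f s x) t) t :=
  ((hf.differentiableAt (x := (t, x))).comp t (f := fun s : ℝ => (s, x)) (by fun_prop)).hasDerivAt

/-- The time derivative in a moving frame. -/
theorem hasDerivAt_moving_frame {W F : Type*} [NormedAddCommGroup W] [NormedSpace ℝ W]
    [NormedAddCommGroup F] [NormedSpace ℝ F] {f : ℝ → F → W}
    (hf : Differentiable ℝ fun p : ℝ × F => f p.1 p.2) (b : F) (t : ℝ) (x : F) :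
    HasDerivAt (fun s => f s (x + s • b))
      (deriv (fun s => f s (x + t • b)) t + fderiv ℝ (f t) (x + t • b) b) t := by
  set y := x + t • b with hy
  have h0 : HasFDerivAt (fun p : ℝ × F => f p.1 p.2) (fderiv ℝ (fun p : ℝ × F => f p.1 p.2) (t, y))
      (t, y) := hf.differentiableAt.hasFDerivAt
  set D := fderiv ℝ (fun p : ℝ × F => f p.1 p.2) (t, y) with hD
  have h1 : deriv (fun s => f s y) t = D (1, 0) := by
    have h3 : HasDerivAt (fun s : ℝ => (s, y)) ((1 : ℝ), (0 : F)) t :=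
      (hasDerivAt_id t).prodMk (hasDerivAt_const t y)
    exact (h0.comp_hasDerivAt t h3).deriv
  have h2 : fderiv ℝ (f t) y b = D (0, b) := by
    have h3 := (h0.comp y ((hasFDerivAt_const t y).prodMk (hasFDerivAt_id y))).fderiv
    have h4 : fderiv ℝ (f t) y = _ := h3
    rw [h4]
    simp
  have h5 : HasDerivAt (fun s : ℝ => (s, x + s • b)) ((1 : ℝ), b) t := by
    have h6 : HasDerivAt (fun s : ℝ => x + s • b) b t := by
      simpa using ((hasDerivAt_id t).smul_const b).const_add x
    exact (hasDerivAt_id t).prodMk h6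
  have h7 := h0.comp_hasDerivAt t h5
  rw [h1, h2, ← map_add, Prod.mk_add_mk, add_zero, zero_add]
  exact h7

theorem laplacian_comp_add {W : Type*} [NormedAddCommGroup W] [NormedSpace ℝ W]
    (f : EuclideanSpace ℝ (Fin d) → W) (a x : EuclideanSpace ℝ (Fin d)) :
    Laplacian.laplacian (fun y => f (y + a)) x = Laplacian.laplacian f (x + a) := by
  simp only [InnerProductSpace.laplacian_eq_iteratedFDeriv_orthonormalBasis _
    (EuclideanSpace.basisFun (Fin d) ℝ), iteratedFDeriv_comp_add_right]

/-- Uniqueness forward in time for a system of Schrödinger equations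
`i ∂ₜ f_k + i b_k · ∇ f_k + c Δ f_k = G_k` with zero data, in the class of functions with bounded
derivatives, when `G` is dominated by a kernel bounded on `ℓ¹`.

Bounded functions have no finite energy, and their derivatives are not controlled by their size. The
local `L²` norms at scale `1 / η` nevertheless satisfy an energy estimate that closes up to an error
of order `η ^ 2`, and the scale is arbitrary. -/
theorem schrodinger_system_unique_forward [CompleteSpace V] {K : Type*} {Q : K → Type*}
    [∀ k, Countable (Q k)] {f G : K → ℝ → EuclideanSpace ℝ (Fin d) → V}
    {b : K → EuclideanSpace ℝ (Fin d)} {c : ℝ} {r : ∀ k, Q k → K}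
    (hinit : ∀ k x, f k 0 x = 0)
    (hdiff : ∀ k, Differentiable ℝ fun p : ℝ × EuclideanSpace ℝ (Fin d) => f k p.1 p.2)
    (hsmooth : ∀ k t, ContDiff ℝ (⊤ : ℕ∞) (f k t))
    (hbound : ∀ (j : ℕ) (T : ℝ), ∃ B : K → ℝ, Summable B ∧
      ∀ k t x, |t| ≤ T → ‖iteratedFDeriv ℝ j (f k t) x‖ ≤ B k)
    (heq : ∀ k t x, Complex.I • deriv (fun s => f k s x) t + Complex.I • fderiv ℝ (f k t) x (b k) +
      (c : ℂ) • Laplacian.laplacian (f k t) x = G k t x)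
    (hG : ∀ T : ℝ, ∃ (C : NNReal) (a : ∀ k, Q k → ℝ≥0∞),
      (∀ k t x, |t| ≤ T → ‖G k t x‖ₑ ≤ ∑' q, a k q * ‖f (r k q) t x‖ₑ) ∧
      ∀ s : K → ℝ≥0∞, ∑' k, ∑' q, a k q * s (r k q) ≤ C * ∑' k, s k)
    (k : K) {t : ℝ} (ht : 0 ≤ t) (x : EuclideanSpace ℝ (Fin d)) : f k t x = 0 := by
  set T : ℝ := t + 1 with hT
  have hT0 : 0 < T := by positivity
  obtain ⟨B, hBsum, hB⟩ : ∃ B : K → ℝ, Summable B ∧ ∀ k, ∀ j ≤ d + 2, ∀ t, |t| ≤ T → ∀ x,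
      ‖iteratedFDeriv ℝ j (f k t) x‖ ≤ B k := by
    choose B hB1 hB2 using fun j => hbound j T
    refine ⟨fun k => ∑ j ∈ Finset.range (d + 3), B j k, summable_sum fun j _ => hB1 j,
      fun k j hj t ht x => (hB2 j k t x ht).trans ?_⟩
    have hnn : ∀ j k, 0 ≤ B j k := fun j k => (norm_nonneg _).trans (hB2 j k 0 0 (by simpa using hT0.le))
    exact Finset.single_le_sum (f := fun j => B j k) (fun j _ => hnn j k)
      (Finset.mem_range.2 (by omega))
  have hB0 : ∀ k t, |t| ≤ T → ∀ x, ‖f k t x‖ ≤ B k := fun k t ht x => by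
    simpa using hB k 0 (by omega) t ht x
  have hBnn : ∀ k, 0 ≤ B k := fun k => (norm_nonneg _).trans (hB0 k 0 (by simpa using hT0.le) 0)
  obtain ⟨C, a, hGa, hCa⟩ := hG T
  have hcont : ∀ k t, Continuous (f k t) := fun k t => (hsmooth k t).continuous
  -- the rate exceeds by `1` the total growth rate of the coupling and the gradient terms, so
  -- that these are absorbed when the bounds are summed over `k`
  set Λ : ℝ := C + energyConst d c + 1 with hΛ
  have hCe := energyConst_nonneg d c
  have hΛ0 : 0 < Λ := by positivity
  have hsumB : ∑' k, ENNReal.ofReal (B k) ≠ ⊤ := by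
    rw [← ENNReal.ofReal_tsum_of_nonneg hBnn hBsum]
    exact ENNReal.ofReal_ne_top
  -- a bound of the local energy at each scale
  have main : ∀ η : ℝ, 0 < η → η ≤ 1 → ∀ k t, 0 ≤ t → t < T → ∀ x₀,
      ∫ x, slowWeight η x₀ x * ‖f k t x‖ ^ 2 ≤
        (energyConst d c * η ^ 2 * (∑' k, B k) * Real.exp (Λ * t)) ^ 2 := by
    intro η hη hη1
    set P := {t : ℝ // 0 ≤ t ∧ t < T} × EuclideanSpace ℝ (Fin d) with hP
    have : Nonempty P := ⟨(⟨0, le_rfl, hT0⟩, 0)⟩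
    -- local `L²` norms at scale `1 / η`, discounted exponentially in time, and their
    -- suprema `S k`
    set N : K → P → ℝ := fun k p =>
      Real.exp (-(Λ * p.1.1)) * Real.sqrt (∫ x, slowWeight η p.2 x * ‖f k p.1.1 x‖ ^ 2) with hN
    set A := Real.sqrt ((η ^ d)⁻¹ * ∫ x, slowWeight (d := d) 1 0 x) with hA
    have habs : ∀ p : P, |p.1.1| ≤ T := fun p => by rw [abs_of_nonneg p.1.2.1]; exact p.1.2.2.le
    have hNB : ∀ k p, N k p ≤ B k * A := by
      intro k p
      have h1 : ∫ x, slowWeight η p.2 x * ‖f k p.1.1 x‖ ^ 2 ≤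
          B k ^ 2 * ((η ^ d)⁻¹ * ∫ x, slowWeight (d := d) 1 0 x) := by
        rw [← integral_slowWeight hη p.2, ← integral_const_mul]
        refine integral_mono (integrable_slowWeight_mul hη _
          ((hcont k _).norm.pow 2).aestronglyMeasurable (C := B k ^ 2) fun x => ?_)
          ((integrable_slowWeight hη _).const_mul _) fun x => ?_
        · rw [norm_pow, norm_norm]
          exact pow_le_pow_left₀ (norm_nonneg _) (hB0 k _ (habs p) x) 2
        · rw [mul_comm]
          exact mul_le_mul_of_nonneg_right (pow_le_pow_left₀ (norm_nonneg _) (hB0 k _ (habs p) x) 2)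
            (slowWeight_pos _ _ _).le
      have h2 : Real.sqrt (∫ x, slowWeight η p.2 x * ‖f k p.1.1 x‖ ^ 2) ≤ B k * A := by
        refine (Real.sqrt_le_sqrt h1).trans (le_of_eq ?_)
        rw [Real.sqrt_mul (sq_nonneg _), Real.sqrt_sq (hBnn k)]
      have h3 : Real.exp (-(Λ * p.1.1)) ≤ 1 :=
        Real.exp_le_one_iff.2 (neg_nonpos.2 (mul_nonneg hΛ0.le p.1.2.1))
      exact (mul_le_of_le_one_left (Real.sqrt_nonneg _) h3).trans h2
    have hN0 : ∀ k p, 0 ≤ N k p := fun k p => mul_nonneg (Real.exp_pos _).le (Real.sqrt_nonneg _)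
    set S : K → ℝ := fun k => ⨆ p, N k p with hS
    have hbdd : ∀ k, BddAbove (Set.range (N k)) := fun k => ⟨B k * A, by
      rintro _ ⟨p, rfl⟩
      exact hNB k p⟩
    have hS0 : ∀ k, 0 ≤ S k := fun k => Real.iSup_nonneg (hN0 k)
    have hSB : ∀ k, S k ≤ B k * A := fun k => ciSup_le (hNB k)
    have hvalid : ∀ k t, 0 ≤ t → t < T → ∀ x₀,
        ∫ x, slowWeight η x₀ x * ‖f k t x‖ ^ 2 ≤ (S k * Real.exp (Λ * t)) ^ 2 := by
      intro k t ht0 htT x₀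
      have h1 : N k (⟨t, ht0, htT⟩, x₀) ≤ S k := le_ciSup (hbdd k) _
      simp only [hN, Real.exp_neg] at h1
      rw [inv_mul_le_iff₀ (Real.exp_pos _)] at h1
      rw [← Real.sq_sqrt (integral_slowWeight_mul_sq_nonneg η x₀ fun x => ‖f k t x‖), mul_comm (S k)]
      exact pow_le_pow_left₀ (Real.sqrt_nonneg _) h1 2
    have hSsum : ∑' k, ENNReal.ofReal (S k) ≠ ⊤ := by
      refine ne_top_of_le_ne_top (b := (∑' k, ENNReal.ofReal (B k)) * ENNReal.ofReal A)
        (ENNReal.mul_ne_top hsumB ENNReal.ofReal_ne_top) ?_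
      rw [← ENNReal.tsum_mul_right]
      refine ENNReal.tsum_le_tsum fun k => ?_
      rw [← ENNReal.ofReal_mul (hBnn k)]
      exact ENNReal.ofReal_le_ofReal (hSB k)
    have hgfin : ∀ s : K → ℝ≥0∞, ∑' k, s k ≠ ⊤ → ∀ k, ∑' q, a k q * s (r k q) ≠ ⊤ := fun s hs k =>
      ne_top_of_le_ne_top (ENNReal.mul_ne_top ENNReal.coe_ne_top hs)
        ((ENNReal.le_tsum k).trans (hCa s))
    set γ : K → ℝ := fun k => (∑' q, a k q * ENNReal.ofReal (S (r k q))).toReal with hγ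
    have hγ0 : ∀ k, 0 ≤ γ k := fun k => ENNReal.toReal_nonneg
    have hγe : ∀ k, ENNReal.ofReal (γ k) = ∑' q, a k q * ENNReal.ofReal (S (r k q)) := fun k =>
      ENNReal.ofReal_toReal (hgfin _ hSsum k)
    -- the improved bound
    have himp : ∀ k, Λ * S k ≤ γ k + energyConst d c * (S k + B k * η ^ 2) := by
      intro k
      set M := γ k + energyConst d c * (S k + B k * η ^ 2) with hM
      have hM0 : 0 ≤ M := by
        have := hγ0 k
        have := hS0 k
        have := hBnn k
        positivity
      -- in the frame moving with velocity `b k`, the transport term disappears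
      set h : ℝ → EuclideanSpace ℝ (Fin d) → V := fun t x => f k t (x + t • b k) with hh
      have hshift : ∀ t, h t = fun x => f k t (x + t • b k) := fun t => rfl
      have hderiv : ∀ t x, deriv (fun s => h s x) t =
          deriv (fun s => f k s (x + t • b k)) t + fderiv ℝ (f k t) (x + t • b k) (b k) :=
        fun t x => (hasDerivAt_moving_frame (hdiff k) (b k) t x).deriv
      have heq' : ∀ t x, Complex.I • deriv (fun s => h s x) t +
          (c : ℂ) • Laplacian.laplacian (h t) x = G k t (x + t • b k) := by
        intro t x
        rw [hderiv, hshift, laplacian_comp_add, smul_add, heq]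
      have hBh : ∀ j ≤ d + 2, ∀ t, |t| < T → ∀ x, ‖iteratedFDeriv ℝ j (h t) x‖ ≤ B k := by
        intro j hj t ht x
        rw [hshift, iteratedFDeriv_comp_add_right]
        exact hB k j hj t ht.le _
      set B' : ℝ := (∑' q, a k q * ENNReal.ofReal (B (r k q))).toReal + |c| * (d * B k) with hB'
      have hBd : ∀ t, |t| < T → ∀ x, ‖deriv (fun s => h s x) t‖ ≤ B' := by
        intro t ht x
        have h1 : ‖deriv (fun s => h s x) t‖ =
            ‖G k t (x + t • b k) - (c : ℂ) • Laplacian.laplacian (h t) x‖ := by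
          rw [← heq' t x, add_sub_cancel_right, norm_smul, Complex.norm_I, one_mul]
        rw [h1]
        refine (norm_sub_le _ _).trans (add_le_add ?_ ?_)
        · have h2 := (hGa k t (x + t • b k) ht.le).trans (ENNReal.tsum_le_tsum fun q =>
            mul_le_mul_right ((ofReal_norm (f (r k q) t (x + t • b k))).symm.le.trans
              (ENNReal.ofReal_le_ofReal (hB0 (r k q) t ht.le _))) (a k q))
          rw [← ofReal_norm] at h2
          exact (ENNReal.ofReal_le_iff_le_toReal (hgfin (fun k => ENNReal.ofReal (B k)) hsumB k)).1 h2
        · rw [norm_smul, Complex.norm_real, Real.norm_eq_abs]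
          refine mul_le_mul_of_nonneg_left ?_ (abs_nonneg _)
          exact (norm_laplacian_le _ _).trans
            (mul_le_mul_of_nonneg_left (hBh 2 (by omega) t ht x) (by positivity))
      have hSh : ∀ k' t, 0 ≤ t → t < T → ∀ x₀,
          ∫ x, slowWeight η x₀ x * ‖f k' t (x + t • b k)‖ ^ 2 ≤ (S k' * Real.exp (Λ * t)) ^ 2 := by
        intro k' t ht0 htT x₀
        rw [integral_slowWeight_comp_add η x₀ (t • b k) fun x => ‖f k' t x‖ ^ 2]
        exact hvalid k' t ht0 htT _
      have hGh : ∀ t, 0 ≤ t → t < T → ∀ x₀, ∫⁻ x, ENNReal.ofReal (slowWeight η x₀ x) *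
          (‖h t x‖ₑ * ‖G k t (x + t • b k)‖ₑ) ≤
          ENNReal.ofReal (S k * γ k * Real.exp (Λ * t) ^ 2) := by
        intro t ht0 htT x₀
        have htT' : |t| ≤ T := by rw [abs_of_nonneg ht0]; exact htT.le
        have hcf : ∀ k', Continuous fun x => f k' t (x + t • b k) := fun k' =>
          (hcont k' t).comp (by fun_prop)
        have h1 : ∀ k', ∫⁻ x, ENNReal.ofReal (slowWeight η x₀ x) *
            (‖h t x‖ₑ * ‖f k' t (x + t • b k)‖ₑ) ≤
            ENNReal.ofReal (S k * Real.exp (Λ * t) ^ 2) * ENNReal.ofReal (S k') := by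
          intro k'
          have h2 : ∀ x, ENNReal.ofReal (slowWeight η x₀ x) * (‖h t x‖ₑ * ‖f k' t (x + t • b k)‖ₑ) =
              ENNReal.ofReal (slowWeight η x₀ x * (‖h t x‖ * ‖f k' t (x + t • b k)‖)) := by
            intro x
            rw [ENNReal.ofReal_mul (slowWeight_pos _ _ _).le, ENNReal.ofReal_mul (norm_nonneg _),
              ofReal_norm, ofReal_norm]
          simp_rw [h2]
          rw [← ofReal_integral_eq_lintegral_ofReal, ← ENNReal.ofReal_mul
            (mul_nonneg (hS0 k) (sq_nonneg _))]
          · refine ENNReal.ofReal_le_ofReal ?_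
            have h3 := integral_slowWeight_mul_mul_le hη x₀ (hcf k).norm.aestronglyMeasurable
              (hcf k').norm.aestronglyMeasurable (A := B k) (B := B k')
              (fun x => by rw [norm_norm]; exact hB0 k t htT' _)
              (fun x => by rw [norm_norm]; exact hB0 k' t htT' _)
              (mul_nonneg (hS0 k) (Real.exp_pos (Λ * t)).le)
              (mul_nonneg (hS0 k') (Real.exp_pos (Λ * t)).le)
              (hSh k t ht0 htT x₀) (hSh k' t ht0 htT x₀)
            exact h3.trans (le_of_eq (by ring))
          · refine integrable_slowWeight_mul hη x₀
              ((hcf k).norm.mul (hcf k').norm).aestronglyMeasurable (C := B k * B k') fun x => ?_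
            rw [norm_mul, norm_norm, norm_norm]
            exact mul_le_mul (hB0 k t htT' _) (hB0 k' t htT' _) (norm_nonneg _) (hBnn k)
          · exact Filter.Eventually.of_forall fun x => mul_nonneg (slowWeight_pos _ _ _).le
              (mul_nonneg (norm_nonneg _) (norm_nonneg _))
        have hmeas : ∀ k', Measurable fun x => ENNReal.ofReal (slowWeight η x₀ x) *
            (‖h t x‖ₑ * ‖f k' t (x + t • b k)‖ₑ) := fun k' =>
          (ENNReal.continuous_ofReal.comp (contDiff_slowWeight η x₀).continuous).measurable.mul
            ((hcf k).enorm.measurable.mul (hcf k').enorm.measurable)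
        calc ∫⁻ x, ENNReal.ofReal (slowWeight η x₀ x) * (‖h t x‖ₑ * ‖G k t (x + t • b k)‖ₑ)
            ≤ ∫⁻ x, ∑' q, a k q * (ENNReal.ofReal (slowWeight η x₀ x) *
                (‖h t x‖ₑ * ‖f (r k q) t (x + t • b k)‖ₑ)) := by
              refine lintegral_mono fun x => ?_
              calc _ ≤ ENNReal.ofReal (slowWeight η x₀ x) * (‖h t x‖ₑ *
                    ∑' q, a k q * ‖f (r k q) t (x + t • b k)‖ₑ) := by
                    gcongr
                    exact hGa k t _ htT'
                _ = _ := by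
                  rw [← ENNReal.tsum_mul_left, ← ENNReal.tsum_mul_left]
                  exact tsum_congr fun q => by ring
          _ = ∑' q, ∫⁻ x, a k q * (ENNReal.ofReal (slowWeight η x₀ x) *
                (‖h t x‖ₑ * ‖f (r k q) t (x + t • b k)‖ₑ)) := by
              exact lintegral_tsum fun q => ((hmeas (r k q)).const_mul (a k q)).aemeasurable
          _ ≤ ∑' q, a k q * (ENNReal.ofReal (S k * Real.exp (Λ * t) ^ 2) *
                ENNReal.ofReal (S (r k q))) := by
              refine ENNReal.tsum_le_tsum fun q => ?_
              rw [lintegral_const_mul _ (hmeas (r k q))]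
              gcongr
              exact h1 (r k q)
          _ = ENNReal.ofReal (S k * γ k * Real.exp (Λ * t) ^ 2) := by
              rw [show S k * γ k * Real.exp (Λ * t) ^ 2 = (S k * Real.exp (Λ * t) ^ 2) * γ k by ring,
                ENNReal.ofReal_mul (mul_nonneg (hS0 k) (sq_nonneg _)), hγe, ← ENNReal.tsum_mul_left]
              exact tsum_congr fun q => by ring
      have hE : ∀ t, 0 ≤ t → t < T → ∀ x₀, ∫ x, slowWeight η x₀ x * ‖f k t x‖ ^ 2 ≤
          S k * M / Λ * Real.exp (Λ * t) ^ 2 := by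
        intro t ht0 htT x₀
        have h1 := energy_bound hη hη1 hΛ0 (hS0 k) (h := h) (G := fun t x => G k t (x + t • b k))
          ((hdiff k).comp (by fun_prop : Differentiable ℝ fun p : ℝ × EuclideanSpace ℝ (Fin d) =>
            (p.1, p.2 + p.1 • b k))) (fun t => (hsmooth k t).comp (by fun_prop)) hBh hBd
          (fun x => hinit k _) heq' (hSh k) (hγ0 k) hGh ht0 htT (x₀ - t • b k)
        have h2 := integral_slowWeight_comp_add η (x₀ - t • b k) (t • b k) fun x => ‖f k t x‖ ^ 2
        rw [sub_add_cancel] at h2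
        rw [← h2]
        exact h1
      have hN2 : ∀ p, N k p ≤ Real.sqrt (S k * M / Λ) := by
        intro p
        have h1 := hE p.1.1 p.1.2.1 p.1.2.2 p.2
        have h2 : Real.sqrt (∫ x, slowWeight η p.2 x * ‖f k p.1.1 x‖ ^ 2) ≤
            Real.sqrt (S k * M / Λ) * Real.exp (Λ * p.1.1) := by
          refine (Real.sqrt_le_sqrt h1).trans (le_of_eq ?_)
          rw [Real.sqrt_mul (div_nonneg (mul_nonneg (hS0 k) hM0) hΛ0.le), Real.sqrt_sq (Real.exp_pos _).le]
        simp only [hN, Real.exp_neg]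
        rw [inv_mul_le_iff₀ (Real.exp_pos _), mul_comm]
        exact h2
      have h3 : S k ≤ Real.sqrt (S k * M / Λ) := ciSup_le hN2
      have h4 : S k ^ 2 ≤ S k * M / Λ := by
        rw [← Real.sq_sqrt (div_nonneg (mul_nonneg (hS0 k) hM0) hΛ0.le)]
        exact pow_le_pow_left₀ (hS0 k) h3 2
      rw [le_div_iff₀ hΛ0] at h4
      rcases eq_or_lt_of_le (hS0 k) with h5 | h5
      · rw [← h5, mul_zero]
        exact hM0
      · nlinarith
    -- summation over `k`
    have hsumS : ∑' k, ENNReal.ofReal (S k) ≤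
        ENNReal.ofReal (energyConst d c * η ^ 2 * ∑' k, B k) := by
      have h1 : ENNReal.ofReal Λ * ∑' k, ENNReal.ofReal (S k) ≤
          C * ∑' k, ENNReal.ofReal (S k) + (ENNReal.ofReal (energyConst d c) *
            ∑' k, ENNReal.ofReal (S k) + ENNReal.ofReal (energyConst d c * η ^ 2) *
              ∑' k, ENNReal.ofReal (B k)) := by
        calc ENNReal.ofReal Λ * ∑' k, ENNReal.ofReal (S k)
            = ∑' k, ENNReal.ofReal (Λ * S k) := by
              rw [← ENNReal.tsum_mul_left]
              exact tsum_congr fun k => (ENNReal.ofReal_mul hΛ0.le).symm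
          _ ≤ ∑' k, (∑' q, a k q * ENNReal.ofReal (S (r k q)) +
              (ENNReal.ofReal (energyConst d c) * ENNReal.ofReal (S k) +
                ENNReal.ofReal (energyConst d c * η ^ 2) * ENNReal.ofReal (B k))) := by
              refine ENNReal.tsum_le_tsum fun k => ?_
              rw [← hγe, ← ENNReal.ofReal_mul hCe, ← ENNReal.ofReal_mul (by positivity),
                ← ENNReal.ofReal_add (mul_nonneg hCe (hS0 k)) (mul_nonneg (by positivity) (hBnn k)),
                ← ENNReal.ofReal_add (hγ0 k) (add_nonneg (mul_nonneg hCe (hS0 k))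
                  (mul_nonneg (by positivity) (hBnn k)))]
              refine ENNReal.ofReal_le_ofReal ((himp k).trans (le_of_eq (by ring)))
          _ ≤ _ := by
              rw [ENNReal.tsum_add, ENNReal.tsum_add, ENNReal.tsum_mul_left, ENNReal.tsum_mul_left]
              gcongr
              exact hCa _
      have hX := ENNReal.ofReal_toReal hSsum
      set X := (∑' k, ENNReal.ofReal (S k)).toReal with hXdef
      have hX0 : 0 ≤ X := ENNReal.toReal_nonneg
      have hβ0 : 0 ≤ ∑' k, B k := tsum_nonneg hBnn
      rw [← hX, ← ENNReal.ofReal_tsum_of_nonneg hBnn hBsum, ← ENNReal.ofReal_coe_nnreal,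
        ← ENNReal.ofReal_mul hΛ0.le, ← ENNReal.ofReal_mul (NNReal.coe_nonneg C), ← ENNReal.ofReal_mul hCe,
        ← ENNReal.ofReal_mul (by positivity), ← ENNReal.ofReal_add (by positivity) (by positivity),
        ← ENNReal.ofReal_add (by positivity) (by positivity),
        ENNReal.ofReal_le_ofReal_iff (by positivity)] at h1
      rw [← hX]
      refine ENNReal.ofReal_le_ofReal ?_
      rw [hΛ] at h1
      linarith
    intro k t ht0 htT x₀
    have h1 : S k ≤ energyConst d c * η ^ 2 * ∑' k, B k := by
      have h2 := (ENNReal.le_tsum k).trans hsumS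
      rwa [ENNReal.ofReal_le_ofReal_iff
        (mul_nonneg (by positivity) (tsum_nonneg hBnn))] at h2
    refine (hvalid k t ht0 htT x₀).trans (pow_le_pow_left₀ (mul_nonneg (hS0 k) (Real.exp_pos _).le) ?_ 2)
    exact mul_le_mul_of_nonneg_right h1 (Real.exp_pos _).le
  -- let the scale tend to infinity
  have htT : t < T := by linarith
  have htabs : |t| ≤ T := by rw [abs_of_nonneg ht]; exact htT.le
  have hint : ∀ η : ℝ, 0 < η → Integrable fun y => slowWeight η x y * ‖f k t y‖ ^ 2 := fun η hη =>
    integrable_slowWeight_mul hη _ ((hcont k t).norm.pow 2).aestronglyMeasurable (C := B k ^ 2)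
      fun y => by
      rw [norm_pow, norm_norm]
      exact pow_le_pow_left₀ (norm_nonneg _) (hB0 k t htabs y) 2
  have h1 : ∀ η : ℝ, 0 < η → η ≤ 1 → ∫ y, slowWeight 1 x y * ‖f k t y‖ ^ 2 ≤
      (energyConst d c * η ^ 2 * (∑' k, B k) * Real.exp (Λ * t)) ^ 2 := fun η hη hη1 =>
    (integral_mono (hint 1 one_pos) (hint η hη) fun y => mul_le_mul_of_nonneg_right
      (slowWeight_anti hη.le hη1 x y) (sq_nonneg _)).trans (main η hη hη1 k t ht htT x)
  have h2 : ∫ y, slowWeight 1 x y * ‖f k t y‖ ^ 2 ≤ 0 := by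
    have h3 : Filter.Tendsto (fun η : ℝ =>
        (energyConst d c * η ^ 2 * (∑' k, B k) * Real.exp (Λ * t)) ^ 2) (nhdsWithin 0 (Set.Ioi 0))
        (nhds 0) := by
      have h4 : Continuous fun η : ℝ =>
        (energyConst d c * η ^ 2 * (∑' k, B k) * Real.exp (Λ * t)) ^ 2 := by fun_prop
      have h5 := (h4.tendsto 0).mono_left (nhdsWithin_le_nhds (s := Set.Ioi (0 : ℝ)))
      simpa using h5
    refine ge_of_tendsto h3 ?_
    filter_upwards [Ioc_mem_nhdsGT (zero_lt_one (α := ℝ))] with η hη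
    exact h1 η hη.1 hη.2
  have hnn : ∀ y, 0 ≤ slowWeight 1 x y * ‖f k t y‖ ^ 2 := fun y =>
    mul_nonneg (slowWeight_pos _ _ _).le (sq_nonneg _)
  have h3 := (integral_eq_zero_iff_of_nonneg hnn (hint 1 one_pos)).1
    (le_antisymm h2 (integral_nonneg hnn))
  have h4 : (fun y => slowWeight 1 x y * ‖f k t y‖ ^ 2) = 0 :=
    (Continuous.ae_eq_iff_eq (volume : Measure (EuclideanSpace ℝ (Fin d)))
      ((contDiff_slowWeight 1 x).continuous.mul ((hcont k t).norm.pow 2)) continuous_const).1 h3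
  have h5 := congrFun h4 x
  simp only [Pi.zero_apply, mul_eq_zero, (slowWeight_pos 1 x x).ne', false_or] at h5
  simpa using h5

/-- Uniqueness for a system of Schrödinger equations, in both time directions. -/
theorem schrodinger_system_unique [CompleteSpace V] {K : Type*} {Q : K → Type*}
    [∀ k, Countable (Q k)] {f G : K → ℝ → EuclideanSpace ℝ (Fin d) → V}
    {b : K → EuclideanSpace ℝ (Fin d)} {c : ℝ} {r : ∀ k, Q k → K}
    (hinit : ∀ k x, f k 0 x = 0)
    (hdiff : ∀ k, Differentiable ℝ fun p : ℝ × EuclideanSpace ℝ (Fin d) => f k p.1 p.2)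
    (hsmooth : ∀ k t, ContDiff ℝ (⊤ : ℕ∞) (f k t))
    (hbound : ∀ (j : ℕ) (T : ℝ), ∃ B : K → ℝ, Summable B ∧
      ∀ k t x, |t| ≤ T → ‖iteratedFDeriv ℝ j (f k t) x‖ ≤ B k)
    (heq : ∀ k t x, Complex.I • deriv (fun s => f k s x) t + Complex.I • fderiv ℝ (f k t) x (b k) +
      (c : ℂ) • Laplacian.laplacian (f k t) x = G k t x)
    (hG : ∀ T : ℝ, ∃ (C : NNReal) (a : ∀ k, Q k → ℝ≥0∞),
      (∀ k t x, |t| ≤ T → ‖G k t x‖ₑ ≤ ∑' q, a k q * ‖f (r k q) t x‖ₑ) ∧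
      ∀ s : K → ℝ≥0∞, ∑' k, ∑' q, a k q * s (r k q) ≤ C * ∑' k, s k)
    (k : K) (t : ℝ) (x : EuclideanSpace ℝ (Fin d)) : f k t x = 0 := by
  rcases le_total 0 t with ht | ht
  · exact schrodinger_system_unique_forward hinit hdiff hsmooth hbound heq hG k ht x
  · -- time reversal
    have h := schrodinger_system_unique_forward (f := fun k t x => f k (-t) x)
      (G := fun k t x => -G k (-t) x) (b := fun k => -b k) (c := -c) (r := r)
      (fun k x => by simpa using hinit k x)
      (fun k => (hdiff k).comp (by fun_prop : Differentiable ℝ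
        fun p : ℝ × EuclideanSpace ℝ (Fin d) => (-p.1, p.2)))
      (fun k t => hsmooth k (-t))
      (fun j T => by
        obtain ⟨B, hB, hB'⟩ := hbound j T
        exact ⟨B, hB, fun k t x ht => hB' k (-t) x (by rwa [abs_neg])⟩)
      (fun k t x => by
        have h1 : deriv (fun s => f k (-s) x) t = -deriv (fun s => f k s x) (-t) :=
          deriv_comp_neg (f := fun s => f k s x) t
        simp only [h1, map_neg, ← heq k (-t) x, Complex.ofReal_neg, smul_neg, neg_smul]
        abel)
      (fun T => by
        obtain ⟨C, a, h1, h2⟩ := hG T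
        refine ⟨C, a, fun k t x ht => ?_, h2⟩
        rw [enorm_neg]
        exact h1 k (-t) x (by rwa [abs_neg]))
      k (neg_nonneg.2 ht) x
    simpa using h

end Uniqueness

/-! ### Superpositions of plane waves -/

theorem norm_phase (θ : ℝ) : ‖phase θ‖ = 1 := by
  have : (2 * Real.pi * Complex.I * θ : ℂ) = ((2 * Real.pi * θ : ℝ) : ℂ) * Complex.I := by
    push_cast; ring
  rw [phase, this, Complex.norm_exp_ofReal_mul_I]

theorem phase_zero : phase 0 = 1 := by simp [phase]

theorem phase_add (a b : ℝ) : phase (a + b) = phase a * phase b := by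
  rw [phase, phase, phase, ← Complex.exp_add]
  push_cast
  ring_nf

theorem conj_phase (a : ℝ) : (starRingEnd ℂ) (phase a) = phase (-a) := by
  rw [phase, phase, ← Complex.exp_conj]
  simp only [map_mul, Complex.conj_ofReal, Complex.conj_I, Complex.ofReal_neg, map_ofNat]
  ring_nf

theorem hasDerivAt_phase (a : ℝ) :
    HasDerivAt phase ((2 * Real.pi * Complex.I) * phase a) a := by
  have h1 : HasDerivAt (fun θ : ℝ => (2 * Real.pi * Complex.I * θ : ℂ)) (2 * Real.pi * Complex.I) a := by
    simpa using (Complex.ofRealCLM.hasDerivAt (x := a)).const_mul (2 * Real.pi * Complex.I)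
  refine h1.cexp.congr_deriv ?_
  rw [phase, mul_comm]

@[fun_prop]
theorem continuous_phase : Continuous phase := by
  unfold phase
  fun_prop

@[fun_prop]
theorem measurable_phase : Measurable phase := continuous_phase.measurable

section Waves

variable {d : ℕ} {Y : Type*} [MeasurableSpace Y]
  {W : Type*} [NormedAddCommGroup W] [NormedSpace ℂ W] [NormedSpace ℝ W] [IsScalarTower ℝ ℂ W]
  [SMulCommClass ℝ ℂ W]

/-- The superposition `∫ e^{2πi ζ(y)·x} a(y) dσ(y)` of plane waves. -/
noncomputable def waveInt (σ : Measure Y) (ζ : Y → EuclideanSpace ℝ (Fin d)) (a : Y → W)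
    (x : EuclideanSpace ℝ (Fin d)) : W :=
  ∫ y, phase (inner ℝ (ζ y) x) • a y ∂σ

/-- The amplitude `a` is measurable and integrable against all powers of the frequency `ζ`. -/
structure HasMoments (σ : Measure Y) (ζ : Y → EuclideanSpace ℝ (Fin d)) (a : Y → W) : Prop where
  aestronglyMeasurable : AEStronglyMeasurable a σ
  integrable : ∀ N : ℕ, Integrable (fun y => ‖ζ y‖ ^ N * ‖a y‖) σ

/-- The amplitude of the gradient of a superposition of plane waves. -/
noncomputable def waveGrad (ζ : Y → EuclideanSpace ℝ (Fin d)) (a : Y → W) (y : Y) :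
    EuclideanSpace ℝ (Fin d) →L[ℝ] W :=
  (2 * Real.pi * Complex.I : ℂ) • (innerSL ℝ (ζ y)).smulRight (a y)

theorem norm_waveGrad (ζ : Y → EuclideanSpace ℝ (Fin d)) (a : Y → W) (y : Y) :
    ‖waveGrad ζ a y‖ = 2 * Real.pi * (‖ζ y‖ * ‖a y‖) := by
  rw [waveGrad, norm_smul, ContinuousLinearMap.norm_smulRight_apply, innerSL_apply_norm]
  simp [abs_of_pos Real.pi_pos]

theorem complex_coe_smul (r : ℝ) (w : W) : (r : ℂ) • w = r • w := algebraMap_smul ℂ r w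

theorem waveGrad_apply (ζ : Y → EuclideanSpace ℝ (Fin d)) (a : Y → W) (y : Y)
    (v : EuclideanSpace ℝ (Fin d)) :
    waveGrad ζ a y v = (2 * Real.pi * Complex.I * (inner ℝ (ζ y) v : ℝ) : ℂ) • a y := by
  simp only [waveGrad, _root_.smul_apply, ContinuousLinearMap.smulRight_apply, innerSL_apply_apply]
  rw [← complex_coe_smul (inner ℝ (ζ y) v), smul_smul]

variable {σ : Measure Y} {ζ : Y → EuclideanSpace ℝ (Fin d)} {a : Y → W}

theorem HasMoments.waveGrad (h : HasMoments σ ζ a) (hζ : Measurable ζ) :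
    HasMoments σ ζ (waveGrad ζ a) where
  aestronglyMeasurable := by
    have h1 : AEStronglyMeasurable (fun y => innerSL ℝ (ζ y)) σ :=
      (innerSL ℝ).continuous.comp_aestronglyMeasurable hζ.aestronglyMeasurable
    have h2 := (ContinuousLinearMap.smulRightL ℝ (EuclideanSpace ℝ (Fin d)) W).continuous₂
      |>.comp_aestronglyMeasurable₂ h1 h.aestronglyMeasurable
    exact h2.const_smul (2 * Real.pi * Complex.I : ℂ)
  integrable N := by
    refine ((h.integrable (N + 1)).const_mul (2 * Real.pi)).congr (Filter.Eventually.of_forall ?_)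
    intro y
    simp only [norm_waveGrad]
    ring

theorem HasMoments.norm_integrable (h : HasMoments σ ζ a) : Integrable (fun y => ‖a y‖) σ := by
  simpa using h.integrable 0

theorem aestronglyMeasurable_phase_smul (ha : AEStronglyMeasurable a σ) {θ : Y → ℝ}
    (hθ : Measurable θ) : AEStronglyMeasurable (fun y => phase (θ y) • a y) σ :=
  (measurable_phase.comp hθ).aestronglyMeasurable.smul ha

theorem norm_phase_smul (θ : ℝ) (w : W) : ‖phase θ • w‖ = ‖w‖ := by
  rw [norm_smul, norm_phase, one_mul]

theorem HasMoments.integrable_phase_smul (h : HasMoments σ ζ a) {θ : Y → ℝ} (hθ : Measurable θ) :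
    Integrable (fun y => phase (θ y) • a y) σ := by
  refine Integrable.mono' (g := fun y => ‖a y‖) (by simpa using h.integrable 0)
    (aestronglyMeasurable_phase_smul h.aestronglyMeasurable hθ)
    (Filter.Eventually.of_forall fun y => ?_)
  rw [norm_phase_smul]

theorem measurable_inner_left (hζ : Measurable ζ) (x : EuclideanSpace ℝ (Fin d)) :
    Measurable fun y => (inner ℝ (ζ y) x : ℝ) := hζ.inner measurable_const

theorem HasFDerivAt.phase_smul {X : Type*} [NormedAddCommGroup X] [NormedSpace ℝ X] {f : X → ℝ}
    {f' : X →L[ℝ] ℝ} {b : X → W} {b' : X →L[ℝ] W} {x : X} (hf : HasFDerivAt f f' x)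
    (hb : HasFDerivAt b b' x) :
    HasFDerivAt (fun x => phase (f x) • b x)
      (phase (f x) • (b' + (2 * Real.pi * Complex.I : ℂ) • f'.smulRight (b x))) x := by
  have h1 : HasFDerivAt (fun x => phase (f x)) _ x :=
    (hasDerivAt_phase (f x)).hasFDerivAt.comp x hf
  refine (h1.smul hb).congr_fderiv ?_
  ext v
  simp only [ContinuousLinearMap.smulRight_apply, _root_.smul_apply, _root_.add_apply,
    ContinuousLinearMap.comp_apply, ContinuousLinearMap.toSpanSingleton_apply]
  rw [← complex_coe_smul (f' v) (b x), smul_add, smul_smul, smul_smul, ← complex_coe_smul,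
    smul_eq_mul]
  congr 2
  ring

variable [CompleteSpace W]

theorem HasMoments.hasFDerivAt (h : HasMoments σ ζ a) (hζ : Measurable ζ)
    (x : EuclideanSpace ℝ (Fin d)) :
    HasFDerivAt (waveInt σ ζ a) (waveInt σ ζ (_root_.waveGrad ζ a) x) x := by
  have h' := h.waveGrad hζ
  refine hasFDerivAt_integral_of_dominated_of_fderiv_le
    (F' := fun x y => phase (inner ℝ (ζ y) x) • _root_.waveGrad ζ a y)
    (bound := fun y => ‖_root_.waveGrad ζ a y‖) Filter.univ_mem
    (Filter.Eventually.of_forall fun x => (h.integrable_phase_smul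
      (measurable_inner_left hζ x)).aestronglyMeasurable)
    (h.integrable_phase_smul (measurable_inner_left hζ x))
    (h'.integrable_phase_smul (measurable_inner_left hζ x)).aestronglyMeasurable
    (Filter.Eventually.of_forall fun y x _ =>
      (norm_phase_smul (W := EuclideanSpace ℝ (Fin d) →L[ℝ] W) _ _).le)
    h'.norm_integrable (Filter.Eventually.of_forall fun y x _ => ?_)
  have h1 := (innerSL ℝ (ζ y)).hasFDerivAt (x := x) |>.phase_smul (hasFDerivAt_const (a y) x)
  rw [zero_add] at h1
  exact h1

theorem HasMoments.norm_waveInt_le (h : HasMoments σ ζ a) (x : EuclideanSpace ℝ (Fin d)) :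
    ‖waveInt σ ζ a x‖ ≤ ∫ y, ‖a y‖ ∂σ :=
  norm_integral_le_of_norm_le h.norm_integrable
    (Filter.Eventually.of_forall fun _ => (norm_phase_smul _ _).le)

/-- A superposition of plane waves is smooth: its gradient is again such a superposition, with an
amplitude in a space of linear maps. -/
theorem HasMoments.contDiff_nat (hζ : Measurable ζ) (n : ℕ) : ∀ {W : Type _} [NormedAddCommGroup W]
    [NormedSpace ℂ W] [NormedSpace ℝ W] [IsScalarTower ℝ ℂ W] [SMulCommClass ℝ ℂ W]
    [CompleteSpace W] {a : Y → W} (_ : HasMoments σ ζ a), ContDiff ℝ n (waveInt σ ζ a) := by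
  induction n with
  | zero =>
    intro W _ _ _ _ _ _ a h
    refine contDiff_zero.2 ?_
    exact continuous_iff_continuousAt.2 fun x => (h.hasFDerivAt hζ x).continuousAt
  | succ n ih =>
    intro W _ _ _ _ _ _ a h
    push_cast
    refine contDiff_succ_iff_hasFDerivAt.2 ⟨_, ih (h.waveGrad hζ), fun x => h.hasFDerivAt hζ x⟩

theorem HasMoments.contDiff (h : HasMoments σ ζ a) (hζ : Measurable ζ) :
    ContDiff ℝ (⊤ : ℕ∞) (waveInt σ ζ a) :=
  contDiff_infty.2 fun n => HasMoments.contDiff_nat hζ n h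

theorem HasMoments.fderiv_eq (h : HasMoments σ ζ a) (hζ : Measurable ζ) :
    fderiv ℝ (waveInt σ ζ a) = waveInt σ ζ (_root_.waveGrad ζ a) :=
  funext fun x => (h.hasFDerivAt hζ x).fderiv

theorem HasMoments.norm_iteratedFDeriv_le (hζ : Measurable ζ) (n : ℕ) : ∀ {W : Type _}
    [NormedAddCommGroup W] [NormedSpace ℂ W] [NormedSpace ℝ W] [IsScalarTower ℝ ℂ W]
    [SMulCommClass ℝ ℂ W] [CompleteSpace W] {a : Y → W} (_ : HasMoments σ ζ a)
    (x : EuclideanSpace ℝ (Fin d)),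
    ‖iteratedFDeriv ℝ n (waveInt σ ζ a) x‖ ≤ ∫ y, (2 * Real.pi * ‖ζ y‖) ^ n * ‖a y‖ ∂σ := by
  induction n with
  | zero =>
    intro W _ _ _ _ _ _ a h x
    simpa using h.norm_waveInt_le x
  | succ n ih =>
    intro W _ _ _ _ _ _ a h x
    rw [← norm_iteratedFDeriv_fderiv, h.fderiv_eq hζ]
    refine (ih (h.waveGrad hζ) x).trans (le_of_eq ?_)
    refine integral_congr_ae (Filter.Eventually.of_forall fun y => ?_)
    simp only [norm_waveGrad]
    ring

theorem HasMoments.fderiv_apply (h : HasMoments σ ζ a) (hζ : Measurable ζ)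
    (x v : EuclideanSpace ℝ (Fin d)) :
    fderiv ℝ (waveInt σ ζ a) x v =
      ∫ y, phase (inner ℝ (ζ y) x) • (2 * Real.pi * Complex.I * (inner ℝ (ζ y) v : ℝ) : ℂ) • a y ∂σ := by
  rw [h.fderiv_eq hζ, waveInt, ContinuousLinearMap.integral_apply
    ((h.waveGrad hζ).integrable_phase_smul (measurable_inner_left hζ x))]
  refine integral_congr_ae (Filter.Eventually.of_forall fun y => ?_)
  simp only [_root_.smul_apply, waveGrad_apply]

theorem HasMoments.laplacian_eq (h : HasMoments σ ζ a) (hζ : Measurable ζ)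
    (x : EuclideanSpace ℝ (Fin d)) :
    Laplacian.laplacian (waveInt σ ζ a) x =
      ∫ y, phase (inner ℝ (ζ y) x) • (-(4 * Real.pi ^ 2 * ‖ζ y‖ ^ 2 : ℝ) : ℂ) • a y ∂σ := by
  have h1 := h.waveGrad hζ
  have h2 := h1.waveGrad hζ
  have key : ∀ v : EuclideanSpace ℝ (Fin d), Integrable (fun y => phase (inner ℝ (ζ y) x) •
      _root_.waveGrad ζ (_root_.waveGrad ζ a) y v v) σ ∧
      fderiv ℝ (fderiv ℝ (waveInt σ ζ a)) x v v =
        ∫ y, phase (inner ℝ (ζ y) x) • _root_.waveGrad ζ (_root_.waveGrad ζ a) y v v ∂σ := by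
    intro v
    have i1 := h2.integrable_phase_smul (measurable_inner_left hζ x)
    have i2 := i1.apply_continuousLinearMap v
    have i3 := i2.apply_continuousLinearMap v
    refine ⟨i3, ?_⟩
    rw [h.fderiv_eq hζ, h1.fderiv_eq hζ, waveInt, ContinuousLinearMap.integral_apply i1,
      ContinuousLinearMap.integral_apply i2]
    rfl
  rw [laplacian_eq_sum (waveInt σ ζ a) x]
  rw [Finset.sum_congr rfl fun i _ => (key _).2, ← integral_finsetSum _ fun i _ => (key _).1]
  refine integral_congr_ae (Filter.Eventually.of_forall fun y => ?_)
  simp only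
  rw [← Finset.smul_sum]
  congr 1
  simp only [waveGrad_apply, _root_.smul_apply, smul_smul]
  rw [← Finset.sum_smul]
  congr 1
  have e : ‖ζ y‖ ^ 2 = ∑ i, (inner ℝ (ζ y) (EuclideanSpace.basisFun (Fin d) ℝ i)) ^ 2 := by
    rw [← (EuclideanSpace.basisFun (Fin d) ℝ).sum_sq_inner_right (ζ y)]
    simp only [real_inner_comm]
  rw [e]
  push_cast
  rw [Finset.mul_sum, ← Finset.sum_neg_distrib]
  refine Finset.sum_congr rfl fun i _ => ?_
  ring_nf
  rw [Complex.I_sq]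
  ring

end Waves

/-! ### Travelling waves -/

section TimeDependentWaves

variable {d : ℕ} {Y : Type*} [MeasurableSpace Y]
  {W : Type*} [NormedAddCommGroup W] [NormedSpace ℂ W] [NormedSpace ℝ W] [IsScalarTower ℝ ℂ W]
  [SMulCommClass ℝ ℂ W]

/-- `α` is a time-dependent amplitude on `Y`, continuously differentiable in time with derivative
`α'`, and both are dominated by a multiple of the weight `w`, locally uniformly in time. -/
structure IsAmplitude (w : Y → ℝ) (α α' : ℝ → Y → W) : Prop where
  stronglyMeasurable : ∀ t, StronglyMeasurable (α t)
  stronglyMeasurable_deriv : ∀ t, StronglyMeasurable (α' t)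
  hasDerivAt : ∀ t y, HasDerivAt (fun s => α s y) (α' t y) t
  continuous_deriv : ∀ y, Continuous fun t => α' t y
  bound : ∀ T : ℝ, ∃ C : ℝ, 0 ≤ C ∧ ∀ t y, |t| ≤ T → ‖α t y‖ ≤ C * w y ∧ ‖α' t y‖ ≤ C * w y

/-- `ζ` and `θ` are spatial and temporal frequencies on `Y`, with `θ` of at most quadratic growth in
`ζ`, and `w` is a weight integrable against all powers of the frequencies. -/
structure IsFrequency (σ : Measure Y) (w : Y → ℝ) (ζ : Y → EuclideanSpace ℝ (Fin d))
    (θ : Y → ℝ) : Prop where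
  measurable_space : Measurable ζ
  measurable_time : Measurable θ
  nonneg : ∀ y, 0 ≤ w y
  integrable : ∀ N : ℕ, Integrable (fun y => (1 + ‖ζ y‖) ^ N * w y) σ
  growth : ∃ C : ℝ, 0 ≤ C ∧ ∀ y, |θ y| ≤ C * (1 + ‖ζ y‖) ^ 2

/-- The superposition `∫ e^{2πi (ζ·x + tθ)} α(t) dσ` of travelling plane waves. -/
noncomputable def wave (σ : Measure Y) (ζ : Y → EuclideanSpace ℝ (Fin d)) (θ : Y → ℝ)
    (α : ℝ → Y → W) (t : ℝ) (x : EuclideanSpace ℝ (Fin d)) : W :=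
  ∫ y, phase (inner ℝ (ζ y) x + t * θ y) • α t y ∂σ

variable {σ : Measure Y} {w : Y → ℝ} {ζ : Y → EuclideanSpace ℝ (Fin d)} {θ : Y → ℝ}
  {α α' : ℝ → Y → W}

theorem wave_eq_waveInt (t : ℝ) :
    wave σ ζ θ α t = waveInt σ ζ fun y => phase (t * θ y) • α t y := by
  funext x
  simp only [wave, waveInt, phase_add, smul_smul]

theorem IsFrequency.integrable_pow_mul (hf : IsFrequency σ w ζ θ) {b : Y → W} {C : ℝ}
    (hb : AEStronglyMeasurable b σ) (hle : ∀ y, ‖b y‖ ≤ C * w y) (N : ℕ) :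
    Integrable (fun y => ‖ζ y‖ ^ N * ‖b y‖) σ := by
  refine Integrable.mono' ((hf.integrable N).const_mul C)
    ((hf.measurable_space.norm.pow_const N).aestronglyMeasurable.mul hb.norm)
    (Filter.Eventually.of_forall fun y => ?_)
  rw [Real.norm_of_nonneg (by positivity)]
  have h1 : ‖ζ y‖ ^ N ≤ (1 + ‖ζ y‖) ^ N := pow_le_pow_left₀ (norm_nonneg _) (by linarith) N
  calc ‖ζ y‖ ^ N * ‖b y‖ ≤ (1 + ‖ζ y‖) ^ N * (C * w y) :=
        mul_le_mul h1 (hle y) (norm_nonneg _) (by positivity)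
    _ = C * ((1 + ‖ζ y‖) ^ N * w y) := by ring

theorem IsFrequency.hasMoments_phase_smul (hf : IsFrequency σ w ζ θ) {b : Y → W} {C : ℝ}
    (hb : AEStronglyMeasurable b σ) (hle : ∀ y, ‖b y‖ ≤ C * w y) (t : ℝ) :
    HasMoments σ ζ fun y => phase (t * θ y) • b y where
  aestronglyMeasurable := aestronglyMeasurable_phase_smul hb (hf.measurable_time.const_mul t)
  integrable N := by
    simp only [norm_phase_smul]
    exact hf.integrable_pow_mul hb hle N

theorem IsFrequency.measurable_phase_arg (hf : IsFrequency σ w ζ θ) (t : ℝ)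
    (x : EuclideanSpace ℝ (Fin d)) : Measurable fun y => (inner ℝ (ζ y) x : ℝ) + t * θ y :=
  (measurable_inner_left hf.measurable_space x).add (hf.measurable_time.const_mul t)

theorem IsFrequency.hasMoments (hf : IsFrequency σ w ζ θ) (ha : IsAmplitude w α α') (t : ℝ) :
    HasMoments σ ζ fun y => phase (t * θ y) • α t y := by
  obtain ⟨C, -, hC⟩ := ha.bound |t|
  exact hf.hasMoments_phase_smul (ha.stronglyMeasurable t).aestronglyMeasurable
    (fun y => (hC t y le_rfl).1) t

/-- The space-time frequency, as a linear form on space-time. -/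
noncomputable def frequencyForm (ζ : EuclideanSpace ℝ (Fin d)) (θ : ℝ) :
    ℝ × EuclideanSpace ℝ (Fin d) →L[ℝ] ℝ :=
  (innerSL ℝ ζ).comp (ContinuousLinearMap.snd ℝ ℝ _) + θ • ContinuousLinearMap.fst ℝ ℝ _

theorem frequencyForm_apply (ζ : EuclideanSpace ℝ (Fin d)) (θ : ℝ)
    (p : ℝ × EuclideanSpace ℝ (Fin d)) : frequencyForm ζ θ p = inner ℝ ζ p.2 + θ * p.1 := by
  simp [frequencyForm]

theorem norm_frequencyForm_le (ζ : EuclideanSpace ℝ (Fin d)) (θ : ℝ) :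
    ‖frequencyForm ζ θ‖ ≤ ‖ζ‖ + |θ| := by
  refine ContinuousLinearMap.opNorm_le_bound _ (by positivity) fun p => ?_
  rw [frequencyForm_apply]
  refine (norm_add_le _ _).trans ?_
  rw [add_mul]
  refine add_le_add ((norm_inner_le_norm _ _).trans ?_) ?_
  · gcongr
    exact norm_snd_le p
  · rw [norm_mul, Real.norm_eq_abs]
    gcongr
    exact norm_fst_le p

/-- The amplitude of the space-time derivative of a superposition of travelling waves. -/
noncomputable def travelGrad (ζ : Y → EuclideanSpace ℝ (Fin d)) (θ : Y → ℝ) (α α' : ℝ → Y → W)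
    (t : ℝ) (y : Y) : ℝ × EuclideanSpace ℝ (Fin d) →L[ℝ] W :=
  (ContinuousLinearMap.fst ℝ ℝ (EuclideanSpace ℝ (Fin d))).smulRight (α' t y) +
    (2 * Real.pi * Complex.I : ℂ) • (frequencyForm (ζ y) (θ y)).smulRight (α t y)

theorem IsFrequency.aestronglyMeasurable_travelGrad (hf : IsFrequency σ w ζ θ)
    (ha : IsAmplitude w α α') (t : ℝ) :
    AEStronglyMeasurable (travelGrad ζ θ α α' t) σ := by
  have h1 : AEStronglyMeasurable (fun y => innerSL ℝ (ζ y)) σ :=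
    (innerSL ℝ).continuous.comp_aestronglyMeasurable hf.measurable_space.aestronglyMeasurable
  have h2 : AEStronglyMeasurable (fun y => frequencyForm (ζ y) (θ y)) σ := by
    refine AEStronglyMeasurable.add ?_ ?_
    · exact ((ContinuousLinearMap.compL ℝ (ℝ × EuclideanSpace ℝ (Fin d)) (EuclideanSpace ℝ (Fin d))
        ℝ).flip (ContinuousLinearMap.snd ℝ ℝ _)).continuous.comp_aestronglyMeasurable h1
    · exact hf.measurable_time.aestronglyMeasurable.smul_const _
  have h3 := (ContinuousLinearMap.smulRightL ℝ (ℝ × EuclideanSpace ℝ (Fin d)) W).continuous₂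
      |>.comp_aestronglyMeasurable₂ h2 (ha.stronglyMeasurable t).aestronglyMeasurable
  have h4 := (ContinuousLinearMap.smulRightL ℝ (ℝ × EuclideanSpace ℝ (Fin d)) W
    (ContinuousLinearMap.fst ℝ ℝ _)).continuous.comp_aestronglyMeasurable
      ((ha.stronglyMeasurable_deriv t).aestronglyMeasurable (μ := σ))
  exact h4.add (h3.const_smul (2 * Real.pi * Complex.I : ℂ))

theorem norm_travelGrad_le (t : ℝ) (y : Y) :
    ‖travelGrad ζ θ α α' t y‖ ≤ ‖α' t y‖ + 2 * Real.pi * ((‖ζ y‖ + |θ y|) * ‖α t y‖) := by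
  refine (norm_add_le _ _).trans ?_
  rw [norm_smul, ContinuousLinearMap.norm_smulRight_apply, ContinuousLinearMap.norm_smulRight_apply]
  refine add_le_add ?_ ?_
  · exact mul_le_of_le_one_left (norm_nonneg _) (ContinuousLinearMap.norm_fst_le ℝ ℝ _)
  · have : ‖(2 * Real.pi * Complex.I : ℂ)‖ = 2 * Real.pi := by simp [abs_of_pos Real.pi_pos]
    rw [this]
    gcongr
    exact norm_frequencyForm_le _ _

variable [CompleteSpace W]

theorem IsFrequency.hasFDerivAt_wave (hf : IsFrequency σ w ζ θ) (ha : IsAmplitude w α α')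
    (p : ℝ × EuclideanSpace ℝ (Fin d)) :
    Integrable (fun y => phase (inner ℝ (ζ y) p.2 + p.1 * θ y) • travelGrad ζ θ α α' p.1 y) σ ∧
    HasFDerivAt (fun p : ℝ × EuclideanSpace ℝ (Fin d) => wave σ ζ θ α p.1 p.2)
      (∫ y, phase (inner ℝ (ζ y) p.2 + p.1 * θ y) • travelGrad ζ θ α α' p.1 y ∂σ) p := by
  obtain ⟨C, hC0, hC⟩ := ha.bound (|p.1| + 1)
  obtain ⟨D, hD0, hD⟩ := hf.growth
  let bound : Y → ℝ := fun y =>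
    (C * (1 + 2 * Real.pi * (1 + D))) * ((1 + ‖ζ y‖) ^ 2 * w y)
  have hbi : Integrable bound σ := (hf.integrable 2).const_mul _
  have hmeas : ∀ q : ℝ × EuclideanSpace ℝ (Fin d), AEStronglyMeasurable
      (fun y => phase (inner ℝ (ζ y) q.2 + q.1 * θ y) • travelGrad ζ θ α α' q.1 y) σ := fun q =>
    aestronglyMeasurable_phase_smul (hf.aestronglyMeasurable_travelGrad ha q.1)
      (hf.measurable_phase_arg q.1 q.2)
  have hle : ∀ y (q : ℝ × EuclideanSpace ℝ (Fin d)), |q.1| ≤ |p.1| + 1 →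
      ‖phase (inner ℝ (ζ y) q.2 + q.1 * θ y) • travelGrad ζ θ α α' q.1 y‖ ≤ bound y := by
    intro y q hq
    rw [norm_phase_smul (W := ℝ × EuclideanSpace ℝ (Fin d) →L[ℝ] W)]
    refine (norm_travelGrad_le _ _).trans ?_
    have hw := hf.nonneg y
    obtain ⟨h1, h2⟩ := hC q.1 y hq
    have hz := norm_nonneg (ζ y)
    have h3 : ‖ζ y‖ + |θ y| ≤ (1 + D) * (1 + ‖ζ y‖) ^ 2 := by
      have := hD y
      nlinarith
    have h4 : (‖ζ y‖ + |θ y|) * ‖α q.1 y‖ ≤ ((1 + D) * (1 + ‖ζ y‖) ^ 2) * (C * w y) := by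
      gcongr
    have h5 : C * w y ≤ C * w y * (1 + ‖ζ y‖) ^ 2 :=
      le_mul_of_one_le_right (by positivity) (one_le_pow₀ (by linarith))
    calc ‖α' q.1 y‖ + 2 * Real.pi * ((‖ζ y‖ + |θ y|) * ‖α q.1 y‖)
        ≤ C * w y * (1 + ‖ζ y‖) ^ 2
          + 2 * Real.pi * (((1 + D) * (1 + ‖ζ y‖) ^ 2) * (C * w y)) :=
          add_le_add (h2.trans h5) (by gcongr)
      _ = bound y := by simp only [bound]; ring
  refine ⟨hbi.mono' (hmeas p) (Filter.Eventually.of_forall fun y => hle y p (by linarith)), ?_⟩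
  refine hasFDerivAt_integral_of_dominated_of_fderiv_le
    (F := fun (p : ℝ × EuclideanSpace ℝ (Fin d)) y =>
      phase (inner ℝ (ζ y) p.2 + p.1 * θ y) • α p.1 y)
    (F' := fun p y => phase (inner ℝ (ζ y) p.2 + p.1 * θ y) • travelGrad ζ θ α α' p.1 y)
    (bound := bound) (Metric.ball_mem_nhds p one_pos)
    (Filter.Eventually.of_forall fun q => aestronglyMeasurable_phase_smul
      (ha.stronglyMeasurable q.1).aestronglyMeasurable (hf.measurable_phase_arg q.1 q.2)) ?_
    (hmeas p) (Filter.Eventually.of_forall fun y q hq => hle y q ?_) hbi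
    (Filter.Eventually.of_forall fun y q _ => ?_)
  · have := (hf.hasMoments ha p.1).integrable_phase_smul
      (measurable_inner_left hf.measurable_space p.2)
    simpa only [phase_add, smul_smul] using this
  · have h1 : ‖q - p‖ < 1 := by simpa [dist_eq_norm] using hq
    have h2 := norm_fst_le (q - p)
    have h3 : |q.1 - p.1| ≤ 1 := by
      rw [← Real.norm_eq_abs]
      exact h2.trans h1.le
    have h4 := abs_sub_abs_le_abs_sub q.1 p.1
    linarith
  · have h1 : HasFDerivAt (fun q : ℝ × EuclideanSpace ℝ (Fin d) =>
        inner ℝ (ζ y) q.2 + q.1 * θ y) (frequencyForm (ζ y) (θ y)) q := by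
      refine (frequencyForm (ζ y) (θ y)).hasFDerivAt.congr_of_eventuallyEq
        (Filter.Eventually.of_forall fun p => ?_)
      simp only [frequencyForm_apply, mul_comm]
    have h2 : HasFDerivAt (fun q : ℝ × EuclideanSpace ℝ (Fin d) => α q.1 y)
        ((ContinuousLinearMap.fst ℝ ℝ (EuclideanSpace ℝ (Fin d))).smulRight (α' q.1 y)) q := by
      refine ((ha.hasDerivAt q.1 y).hasFDerivAt.comp q
        (hasFDerivAt_fst (𝕜 := ℝ) (p := q))).congr_fderiv ?_
      ext v <;> simp
    exact h1.phase_smul h2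

theorem IsFrequency.differentiable_wave (hf : IsFrequency σ w ζ θ) (ha : IsAmplitude w α α') :
    Differentiable ℝ fun p : ℝ × EuclideanSpace ℝ (Fin d) => wave σ ζ θ α p.1 p.2 :=
  fun p => (hf.hasFDerivAt_wave ha p).2.differentiableAt

theorem IsFrequency.deriv_wave (hf : IsFrequency σ w ζ θ) (ha : IsAmplitude w α α') (t : ℝ)
    (x : EuclideanSpace ℝ (Fin d)) :
    deriv (fun s => wave σ ζ θ α s x) t = ∫ y, phase (inner ℝ (ζ y) x + t * θ y) •
      (α' t y + (2 * Real.pi * Complex.I * θ y : ℂ) • α t y) ∂σ := by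
  obtain ⟨h0, h1⟩ := hf.hasFDerivAt_wave ha (t, x)
  have h2 : HasDerivAt (fun s : ℝ => (s, x)) ((1 : ℝ), (0 : EuclideanSpace ℝ (Fin d))) t :=
    (hasDerivAt_id t).prodMk (hasDerivAt_const t x)
  refine (h1.comp_hasDerivAt t h2).deriv.trans ?_
  rw [ContinuousLinearMap.integral_apply h0]
  refine integral_congr_ae (Filter.Eventually.of_forall fun y => ?_)
  simp only [travelGrad, _root_.smul_apply, _root_.add_apply, ContinuousLinearMap.smulRight_apply,
    frequencyForm_apply, ContinuousLinearMap.coe_fst', inner_zero_right, mul_one, zero_add, one_smul]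
  rw [← complex_coe_smul (θ y), smul_smul (2 * Real.pi * Complex.I : ℂ)]

theorem IsFrequency.contDiff_wave (hf : IsFrequency σ w ζ θ) (ha : IsAmplitude w α α') (t : ℝ) :
    ContDiff ℝ (⊤ : ℕ∞) (wave σ ζ θ α t) := by
  rw [wave_eq_waveInt]
  exact (hf.hasMoments ha t).contDiff hf.measurable_space

theorem IsFrequency.norm_iteratedFDeriv_wave_le (hf : IsFrequency σ w ζ θ) (ha : IsAmplitude w α α')
    {C T : ℝ} (hC : ∀ t y, |t| ≤ T → ‖α t y‖ ≤ C * w y) (n : ℕ) {t : ℝ} (ht : |t| ≤ T)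
    (x : EuclideanSpace ℝ (Fin d)) :
    ‖iteratedFDeriv ℝ n (wave σ ζ θ α t) x‖ ≤
      C * (2 * Real.pi) ^ n * ∫ y, (1 + ‖ζ y‖) ^ n * w y ∂σ := by
  rw [wave_eq_waveInt]
  refine (HasMoments.norm_iteratedFDeriv_le hf.measurable_space n (hf.hasMoments ha t) x).trans ?_
  rw [← integral_const_mul]
  refine integral_mono_of_nonneg (Filter.Eventually.of_forall fun y => ?_)
    ((hf.integrable n).const_mul _) (Filter.Eventually.of_forall fun y => ?_)
  · simp only [Pi.zero_apply]; positivity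
  · simp only [norm_phase_smul]
    have h1 := hC t y ht
    have hw := hf.nonneg y
    have h2 : (2 * Real.pi * ‖ζ y‖) ^ n ≤ (2 * Real.pi) ^ n * (1 + ‖ζ y‖) ^ n := by
      rw [mul_pow]
      gcongr
      linarith
    calc (2 * Real.pi * ‖ζ y‖) ^ n * ‖α t y‖
        ≤ (2 * Real.pi) ^ n * (1 + ‖ζ y‖) ^ n * (C * w y) :=
          mul_le_mul h2 h1 (norm_nonneg _) (by positivity)
      _ = C * (2 * Real.pi) ^ n * ((1 + ‖ζ y‖) ^ n * w y) := by ring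

theorem smul_integral_add {f g h : Y → W} (hf : Integrable f σ) (hg : Integrable g σ)
    (hh : Integrable h σ) {r s u : ℂ} : r • ∫ y, f y ∂σ + s • ∫ y, g y ∂σ + u • ∫ y, h y ∂σ =
      ∫ y, r • f y + s • g y + u • h y ∂σ := by
  have h1 : Integrable (fun y => r • f y + s • g y) σ := (hf.smul r).add (hg.smul s)
  have h2 : Integrable (fun y => r • f y) σ := hf.smul r
  have h3 : Integrable (fun y => s • g y) σ := hg.smul s
  have h4 : Integrable (fun y => u • h y) σ := hh.smul u
  rw [integral_add h1 h4, integral_add h2 h3, integral_smul, integral_smul, integral_smul]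

/-- Under the dispersion relation, the Schrödinger operator acts on a superposition of travelling
waves through the time derivative of the amplitude alone. -/
theorem IsFrequency.schrodinger_wave (hf : IsFrequency σ w ζ θ) (ha : IsAmplitude w α α')
    (b : EuclideanSpace ℝ (Fin d)) (c : ℝ)
    (hdisp : ∀ᵐ y ∂σ, θ y + inner ℝ (ζ y) b + 2 * Real.pi * c * ‖ζ y‖ ^ 2 = 0) (t : ℝ)
    (x : EuclideanSpace ℝ (Fin d)) :
    Complex.I • deriv (fun s => wave σ ζ θ α s x) t
      + Complex.I • fderiv ℝ (wave σ ζ θ α t) x b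
      + (c : ℂ) • Laplacian.laplacian (wave σ ζ θ α t) x
      = Complex.I • wave σ ζ θ α' t x := by
  have hm := hf.hasMoments ha t
  have hζ := hf.measurable_space
  obtain ⟨i0, -⟩ := hf.hasFDerivAt_wave ha (t, x)
  have i1 : Integrable (fun y => phase (inner ℝ (ζ y) x + t * θ y) •
      (α' t y + (2 * Real.pi * Complex.I * θ y : ℂ) • α t y)) σ := by
    refine (i0.apply_continuousLinearMap (1, 0)).congr (Filter.Eventually.of_forall fun y => ?_)
    simp only [travelGrad, _root_.smul_apply, _root_.add_apply,
      ContinuousLinearMap.smulRight_apply, frequencyForm_apply, ContinuousLinearMap.coe_fst',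
      inner_zero_right, mul_one, zero_add, one_smul]
    rw [← complex_coe_smul (θ y), smul_smul (2 * Real.pi * Complex.I : ℂ)]
  have i2 : Integrable (fun y => phase (inner ℝ (ζ y) x) •
      (2 * Real.pi * Complex.I * (inner ℝ (ζ y) b : ℝ) : ℂ) • phase (t * θ y) • α t y) σ := by
    refine (((hm.waveGrad hζ).integrable_phase_smul
      (measurable_inner_left hζ x)).apply_continuousLinearMap b).congr
      (Filter.Eventually.of_forall fun y => ?_)
    simp only [_root_.smul_apply, waveGrad_apply]
  have i3 : Integrable (fun y => phase (inner ℝ (ζ y) x) •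
      (-(4 * Real.pi ^ 2 * ‖ζ y‖ ^ 2 : ℝ) : ℂ) • phase (t * θ y) • α t y) σ := by
    refine (((hm.integrable 2).const_mul (4 * Real.pi ^ 2))).mono' ?_
      (Filter.Eventually.of_forall fun y => ?_)
    · refine aestronglyMeasurable_phase_smul (AEStronglyMeasurable.smul ?_ hm.aestronglyMeasurable)
        (measurable_inner_left hζ x)
      exact (Complex.measurable_ofReal.comp
        ((hζ.norm.pow_const 2).const_mul (4 * Real.pi ^ 2))).neg.aestronglyMeasurable
    · rw [norm_phase_smul, norm_smul, norm_neg, Complex.norm_real,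
        Real.norm_of_nonneg (by positivity)]
      exact (mul_assoc _ _ _).le
  rw [hf.deriv_wave ha, wave_eq_waveInt (α := α) t, hm.fderiv_apply hζ, hm.laplacian_eq hζ,
    smul_integral_add i1 i2 i3, wave, ← integral_smul]
  refine integral_congr_ae ?_
  filter_upwards [hdisp] with y hy
  rw [phase_add, smul_add, smul_add]
  simp only [smul_smul]
  have h1 : (θ y : ℂ) + (inner ℝ (ζ y) b : ℝ) + 2 * Real.pi * c * ‖ζ y‖ ^ 2 = 0 := by
    exact_mod_cast hy
  have h2 : ∀ (r s u v : ℂ) (A B : W), r = u → s + v = 0 → r • A + s • B + v • B = u • A := by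
    intro r s u v A B h h'
    rw [h, add_assoc, ← add_smul, h', zero_smul, add_zero]
  rw [add_assoc (_ • α' t y), ← add_smul]
  refine h2 _ _ _ _ _ _ rfl ?_
  push_cast
  linear_combination (-2 * Real.pi * phase (inner ℝ (ζ y) x) * phase (t * θ y)) * h1 +
    (phase (inner ℝ (ζ y) x) * phase (t * θ y) * 2 * Real.pi *
      (θ y + (inner ℝ (ζ y) b : ℝ))) * Complex.I_sq

end TimeDependentWaves

/-! ### Wave packets -/

section Amplitudes

variable {Y : Type*} [MeasurableSpace Y]
  {W : Type*} [NormedAddCommGroup W] [NormedSpace ℂ W] [NormedSpace ℝ W] [IsScalarTower ℝ ℂ W]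
  [SMulCommClass ℝ ℂ W] [CompleteSpace W]

/-- The primitive in time of a continuous family dominated by `w` is an amplitude. -/
theorem isAmplitude_integral {w : Y → ℝ} (hw : ∀ y, 0 ≤ w y) {β : ℝ → Y → W}
    (hm : ∀ t, StronglyMeasurable (β t)) (hc : ∀ y, Continuous fun t => β t y)
    (hb : ∀ T : ℝ, ∃ C : ℝ, 0 ≤ C ∧ ∀ t y, |t| ≤ T → ‖β t y‖ ≤ C * w y) :
    IsAmplitude w (fun t y => ∫ s in (0 : ℝ)..t, β s y) β where
  stronglyMeasurable t := by
    have h1 : StronglyMeasurable (Function.uncurry fun y s => β s y) :=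
      (stronglyMeasurable_uncurry_of_continuous_of_stronglyMeasurable hc hm).comp_measurable
        measurable_swap
    simp only [intervalIntegral]
    exact h1.integral_prod_right.sub h1.integral_prod_right
  stronglyMeasurable_deriv := hm
  hasDerivAt t y := intervalIntegral.integral_hasDerivAt_right ((hc y).intervalIntegrable _ _)
    ((hc y).stronglyMeasurableAtFilter _ _) (hc y).continuousAt
  continuous_deriv := hc
  bound T := by
    obtain ⟨C, hC0, hC⟩ := hb T
    refine ⟨C * (1 + |T|), by positivity, fun t y ht => ?_⟩
    have hCw : 0 ≤ C * w y := mul_nonneg hC0 (hw y)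
    have hT : |t| ≤ |T| := ht.trans (le_abs_self T)
    refine ⟨?_, (hC t y ht).trans ?_⟩
    · have h1 : ‖∫ s in (0 : ℝ)..t, β s y‖ ≤ (C * w y) * |t - 0| := by
        refine intervalIntegral.norm_integral_le_of_norm_le_const fun s hs => hC s y ?_
        rw [Set.mem_uIoc] at hs
        rcases hs with hs | hs
        · rw [abs_of_pos hs.1]
          exact (hs.2.trans (le_abs_self t)).trans ht
        · rw [abs_of_nonpos hs.2]
          exact (by linarith [neg_abs_le t] : -s ≤ |t|).trans ht
      rw [sub_zero] at h1
      nlinarith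
    · nlinarith [abs_nonneg T]

end Amplitudes

/-- A wave packet: a family of plane waves, parametrized by a measure space `Y`, with lattice
momentum `label`, a continuous frequency `freq` on top of it, and an amplitude dominated by a weight
having moments of all orders. -/
structure Packet (d : ℕ) (L : ℝ) (V : Type*) [NormedAddCommGroup V] [NormedSpace ℝ V] where
  /-- The parameter space of the waves. -/
  Y : Type
  [measurableSpace : MeasurableSpace Y]
  /-- The measure against which the waves are superposed. -/
  σ : Measure Y
  [sFinite : SFinite σ]
  /-- The integer coordinates of the lattice momentum. -/
  label : Y → Fin d → ℤ
  /-- The frequency of the profile. -/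
  freq : Y → EuclideanSpace ℝ (Fin d)
  /-- The dominating weight. -/
  weight : Y → ℝ
  /-- The amplitude as a function of time. -/
  amp : ℝ → Y → V
  /-- The time derivative of the amplitude. -/
  ampDeriv : ℝ → Y → V
  measurable_label : Measurable label
  measurable_freq : Measurable freq
  nonneg : ∀ y, 0 ≤ weight y
  integrable : ∀ N : ℕ,
    Integrable (fun y => (1 + ‖wavenumber L (label y)‖ + ‖freq y‖) ^ N * weight y) σ
  stronglyMeasurable : ∀ t, StronglyMeasurable (amp t)
  stronglyMeasurable_deriv : ∀ t, StronglyMeasurable (ampDeriv t)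
  hasDerivAt : ∀ t y, HasDerivAt (fun s => amp s y) (ampDeriv t y) t
  continuous_deriv : ∀ y, Continuous fun t => ampDeriv t y
  bound : ∀ T : ℝ, ∃ C : ℝ, 0 ≤ C ∧ ∀ t y, |t| ≤ T →
    ‖amp t y‖ ≤ C * weight y ∧ ‖ampDeriv t y‖ ≤ C * weight y

attribute [instance] Packet.measurableSpace Packet.sFinite

namespace Packet

variable {d : ℕ} {L : ℝ} {V : Type*} [NormedAddCommGroup V] [NormedSpace ℝ V]

theorem measurable_wavenumber : Measurable (wavenumber L : (Fin d → ℤ) → EuclideanSpace ℝ (Fin d)) :=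
  measurable_of_countable _

variable (p : Packet d L V) (ε : ℝ)

/-- The total frequency `k + ε ξ`. -/
noncomputable def kappa (y : p.Y) : EuclideanSpace ℝ (Fin d) := wavenumber L (p.label y) + ε • p.freq y

/-- The waves of lattice momentum `m`. -/
def fiber (m : Fin d → ℤ) : Set p.Y := {y | p.label y = m}

/-- The time frequency of the wave `ξ` in the profile of momentum `k`. -/
noncomputable def profileTime (k : EuclideanSpace ℝ (Fin d)) (y : p.Y) : ℝ :=
  (‖k‖ ^ 2 - ‖k + ε • p.freq y‖ ^ 2) / 2

theorem measurable_kappa : Measurable (p.kappa ε) :=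
  (measurable_wavenumber.comp p.measurable_label).add (p.measurable_freq.const_smul ε)

theorem measurableSet_fiber (m : Fin d → ℤ) : MeasurableSet (p.fiber m) :=
  p.measurable_label (measurableSet_singleton m)

theorem pairwise_disjoint_fiber : Pairwise (Function.onFun Disjoint p.fiber) := by
  intro m m' hm
  refine Set.disjoint_left.2 fun y hy hy' => hm ?_
  rw [← show p.label y = m from hy]
  exact hy'

theorem iUnion_fiber : ⋃ m, p.fiber m = Set.univ :=
  Set.eq_univ_of_forall fun y => Set.mem_iUnion.2 ⟨p.label y, rfl⟩

theorem integrable_freq (N : ℕ) : Integrable (fun y => (1 + ‖p.freq y‖) ^ N * p.weight y) p.σ := by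
  have hw : AEStronglyMeasurable p.weight p.σ := by
    simpa using (p.integrable 0).aestronglyMeasurable
  refine (p.integrable N).mono' (((p.measurable_freq.norm.const_add 1).pow_const
    N).aestronglyMeasurable.mul hw) (Filter.Eventually.of_forall fun y => ?_)
  have h := p.nonneg y
  rw [Real.norm_of_nonneg (by positivity)]
  gcongr
  linarith [norm_nonneg (wavenumber L (p.label y))]

theorem isFrequency_profile (m : Fin d → ℤ) :
    IsFrequency (p.σ.restrict (p.fiber m)) p.weight p.freq (p.profileTime ε (wavenumber L m)) where
  measurable_space := p.measurable_freq
  measurable_time := by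
    unfold profileTime
    exact ((((p.measurable_freq.const_smul ε).const_add _).norm.pow_const 2).const_sub _).div_const 2
  nonneg := p.nonneg
  integrable N := (p.integrable_freq N).restrict
  growth := by
    set k := wavenumber L m
    refine ⟨‖k‖ ^ 2 + |ε| ^ 2 + ‖k‖ ^ 2, by positivity, fun y => ?_⟩
    have h1 : ‖k + ε • p.freq y‖ ≤ ‖k‖ + |ε| * ‖p.freq y‖ := by
      refine (norm_add_le _ _).trans ?_
      rw [norm_smul, Real.norm_eq_abs]
    have h2 : ‖k + ε • p.freq y‖ ^ 2 ≤ (‖k‖ + |ε| * ‖p.freq y‖) ^ 2 := by gcongr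
    have h3 := norm_nonneg (p.freq y)
    have h4 := norm_nonneg k
    have h5 := abs_nonneg ε
    have h6 : 0 ≤ ‖k + ε • p.freq y‖ ^ 2 := by positivity
    have h7 : (‖k‖ + |ε| * ‖p.freq y‖) ^ 2 ≤ 2 * (‖k‖ ^ 2 + |ε| ^ 2 * ‖p.freq y‖ ^ 2) := by
      nlinarith [sq_nonneg (‖k‖ - |ε| * ‖p.freq y‖)]
    have h8 : ‖p.freq y‖ ^ 2 ≤ (1 + ‖p.freq y‖) ^ 2 := by gcongr; linarith
    have h9 : 1 ≤ (1 + ‖p.freq y‖) ^ 2 := one_le_pow₀ (by linarith)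
    have h10 : |ε| ^ 2 * ‖p.freq y‖ ^ 2 ≤ |ε| ^ 2 * (1 + ‖p.freq y‖) ^ 2 := by gcongr
    have h11 : ‖k‖ ^ 2 * 1 ≤ ‖k‖ ^ 2 * (1 + ‖p.freq y‖) ^ 2 := by gcongr
    rw [profileTime, abs_le]
    constructor <;> nlinarith

theorem isFrequency_field :
    IsFrequency p.σ p.weight (p.kappa ε) (fun y => -‖p.kappa ε y‖ ^ 2 / 2) where
  measurable_space := p.measurable_kappa ε
  measurable_time := ((p.measurable_kappa ε).norm.pow_const 2).neg.div_const 2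
  nonneg := p.nonneg
  integrable N := by
    have hw : AEStronglyMeasurable p.weight p.σ := by
      simpa using (p.integrable 0).aestronglyMeasurable
    refine ((p.integrable N).const_mul ((1 + |ε|) ^ N)).mono' ((((p.measurable_kappa
      ε).norm.const_add 1).pow_const N).aestronglyMeasurable.mul hw)
      (Filter.Eventually.of_forall fun y => ?_)
    have h := p.nonneg y
    rw [Real.norm_of_nonneg (by positivity), ← mul_assoc, ← mul_pow]
    gcongr
    have h1 : ‖p.kappa ε y‖ ≤ ‖wavenumber L (p.label y)‖ + |ε| * ‖p.freq y‖ := by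
      refine (norm_add_le _ _).trans ?_
      rw [norm_smul, Real.norm_eq_abs]
    nlinarith [norm_nonneg (p.freq y), norm_nonneg (wavenumber L (p.label y)), abs_nonneg ε,
      mul_nonneg (abs_nonneg ε) (norm_nonneg (wavenumber L (p.label y)))]
  growth := by
    refine ⟨1, zero_le_one, fun y => ?_⟩
    have h := norm_nonneg (p.kappa ε y)
    rw [abs_div, abs_neg, abs_of_nonneg (by positivity), abs_of_pos two_pos]
    nlinarith

variable [NormedSpace ℂ V] [IsScalarTower ℝ ℂ V] [SMulCommClass ℝ ℂ V]

theorem isAmplitude : IsAmplitude p.weight p.amp p.ampDeriv :=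
  ⟨p.stronglyMeasurable, p.stronglyMeasurable_deriv, p.hasDerivAt, p.continuous_deriv, p.bound⟩

/-- The profile of lattice momentum `m` carried by a wave packet. -/
noncomputable def profile (m : Fin d → ℤ) (t : ℝ) (x : EuclideanSpace ℝ (Fin d)) : V :=
  wave (p.σ.restrict (p.fiber m)) p.freq (p.profileTime ε (wavenumber L m)) p.amp t x

/-- The sum of all the waves of a packet, in the original variables. -/
noncomputable def field (t : ℝ) (x : EuclideanSpace ℝ (Fin d)) : V :=
  wave p.σ (p.kappa ε) (fun y => -‖p.kappa ε y‖ ^ 2 / 2) p.amp t x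

variable [CompleteSpace V]

/-- The temporal frequency `profileTime` is the one for which plane waves are annihilated by the
operator, so that only the time derivative of the amplitude remains. -/
theorem schrodinger_profile (m : Fin d → ℤ) (t : ℝ) (x : EuclideanSpace ℝ (Fin d)) :
    Complex.I • deriv (fun s => p.profile ε m s x) t
      + Complex.I • fderiv ℝ (p.profile ε m t) x (ε • wavenumber L m)
      + ((ε ^ 2 / (4 * Real.pi) : ℝ) : ℂ) • Laplacian.laplacian (p.profile ε m t) x
      = Complex.I • wave (p.σ.restrict (p.fiber m)) p.freq
          (p.profileTime ε (wavenumber L m)) p.ampDeriv t x := by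
  refine (p.isFrequency_profile ε m).schrodinger_wave p.isAmplitude _ _
    (Filter.Eventually.of_forall fun y => ?_) t x
  rw [profileTime, inner_smul_right, norm_add_sq_real, inner_smul_right, norm_smul, mul_pow,
    Real.norm_eq_abs, sq_abs, real_inner_comm]
  field_simp
  ring

theorem schrodinger_field (t : ℝ) (x : EuclideanSpace ℝ (Fin d)) :
    Complex.I • deriv (fun s => p.field ε s x) t
      + ((1 / (4 * Real.pi) : ℝ) : ℂ) • Laplacian.laplacian (p.field ε t) x
      = Complex.I • wave p.σ (p.kappa ε) (fun y => -‖p.kappa ε y‖ ^ 2 / 2) p.ampDeriv t x := by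
  have h := (p.isFrequency_field ε).schrodinger_wave p.isAmplitude 0 (1 / (4 * Real.pi))
    (Filter.Eventually.of_forall fun y => ?_) t x
  · rw [map_zero, smul_zero, add_zero] at h
    exact h
  · rw [inner_zero_right]
    field_simp
    ring

theorem differentiable_profile (m : Fin d → ℤ) :
    Differentiable ℝ fun q : ℝ × EuclideanSpace ℝ (Fin d) => p.profile ε m q.1 q.2 :=
  (p.isFrequency_profile ε m).differentiable_wave p.isAmplitude

theorem differentiable_field :
    Differentiable ℝ fun q : ℝ × EuclideanSpace ℝ (Fin d) => p.field ε q.1 q.2 :=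
  (p.isFrequency_field ε).differentiable_wave p.isAmplitude

theorem contDiff_profile (m : Fin d → ℤ) (t : ℝ) : ContDiff ℝ (⊤ : ℕ∞) (p.profile ε m t) :=
  (p.isFrequency_profile ε m).contDiff_wave p.isAmplitude t

theorem contDiff_field (t : ℝ) : ContDiff ℝ (⊤ : ℕ∞) (p.field ε t) :=
  (p.isFrequency_field ε).contDiff_wave p.isAmplitude t

/-- The derivatives of the profiles are bounded by the moments of the weight over the fibers of
`label`, and these add up to a moment of the whole weight. -/
theorem exists_summable_bound (j : ℕ) (T : ℝ) : ∃ b : (Fin d → ℤ) → ℝ, Summable b ∧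
    ∀ m t x, |t| ≤ T → ‖iteratedFDeriv ℝ j (p.profile ε m t) x‖ ≤ b m := by
  obtain ⟨C, -, hC⟩ := p.bound T
  refine ⟨fun m => C * (2 * Real.pi) ^ j * ∫ y in p.fiber m, (1 + ‖p.freq y‖) ^ j * p.weight y ∂p.σ,
    ?_, fun m t x ht => (p.isFrequency_profile ε m).norm_iteratedFDeriv_wave_le p.isAmplitude
      (fun t y ht => (hC t y ht).1) j ht x⟩
  exact (hasSum_integral_iUnion p.measurableSet_fiber p.pairwise_disjoint_fiber
    (p.integrable_freq j).integrableOn).summable.mul_left _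

theorem exists_bound_field (j : ℕ) (T : ℝ) : ∃ C : ℝ, ∀ t x, |t| ≤ T →
    ‖iteratedFDeriv ℝ j (p.field ε t) x‖ ≤ C := by
  obtain ⟨C, -, hC⟩ := p.bound T
  exact ⟨_, fun t x ht => (p.isFrequency_field ε).norm_iteratedFDeriv_wave_le p.isAmplitude
      (fun t y ht => (hC t y ht).1) j ht x⟩

theorem integrable_field (t : ℝ) (x : EuclideanSpace ℝ (Fin d)) :
    Integrable (fun y => phase (inner ℝ (p.kappa ε y) x + t * (-‖p.kappa ε y‖ ^ 2 / 2)) •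
      p.amp t y) p.σ := by
  have := ((p.isFrequency_field ε).hasMoments p.isAmplitude t).integrable_phase_smul
    (measurable_inner_left (p.measurable_kappa ε) x)
  simpa only [smul_smul, ← phase_add] using this

/-- The field is the superposition of its modulated profiles, each evaluated at the slow variable
`ε • x`. -/
theorem hasSum_field (t : ℝ) (x : EuclideanSpace ℝ (Fin d)) :
    HasSum (fun m : Fin d → ℤ => phase (inner ℝ (wavenumber L m) x - ‖wavenumber L m‖ ^ 2 * t / 2) •
      p.profile ε m t (ε • x)) (p.field ε t x) := by
  have h := hasSum_integral_iUnion p.measurableSet_fiber p.pairwise_disjoint_fiber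
    (p.integrable_field ε t x).integrableOn
  rw [p.iUnion_fiber, Measure.restrict_univ] at h
  refine h.congr_fun ?_
  intro m
  rw [profile, wave, ← integral_smul]
  refine setIntegral_congr_fun (p.measurableSet_fiber m) fun y hy => ?_
  have hy' : p.label y = m := hy
  simp only [smul_smul, ← phase_add]
  congr 2
  rw [profileTime, kappa, hy', inner_add_left, inner_smul_left, inner_smul_right]
  simp only [conj_trivial]
  ring

end Packet

/-! ### Cubic interaction of wave packets -/

section Trilinear

variable {Y₁ Y₂ Y₃ : Type*} [MeasurableSpace Y₁] [MeasurableSpace Y₂] [MeasurableSpace Y₃]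
  {μ₁ : Measure Y₁} {μ₂ : Measure Y₂} {μ₃ : Measure Y₃} [SFinite μ₁] [SFinite μ₂] [SFinite μ₃]
  {V₁ V₂ V₃ V₁₂ V : Type*}
  [NormedAddCommGroup V₁] [NormedSpace ℝ V₁]
  [NormedAddCommGroup V₂] [NormedSpace ℝ V₂]
  [NormedAddCommGroup V₃] [NormedSpace ℝ V₃]
  [NormedAddCommGroup V₁₂] [NormedSpace ℝ V₁₂]
  [NormedAddCommGroup V] [NormedSpace ℝ V]
  (B : V₁ →L[ℝ] V₂ →L[ℝ] V₁₂) (N : V₁₂ →L[ℝ] V₃ →L[ℝ] V)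

theorem integral_trilinear [CompleteSpace V₁] [CompleteSpace V₂] [CompleteSpace V₃]
    [CompleteSpace V₁₂] [CompleteSpace V] {f₁ : Y₁ → V₁} {f₂ : Y₂ → V₂} {f₃ : Y₃ → V₃}
    (h₁ : Integrable f₁ μ₁) (h₂ : Integrable f₂ μ₂) (h₃ : Integrable f₃ μ₃) :
    ∫ z, N (B (f₁ z.1.1) (f₂ z.1.2)) (f₃ z.2) ∂(μ₁.prod μ₂).prod μ₃ =
      N (B (∫ y, f₁ y ∂μ₁) (∫ y, f₂ y ∂μ₂)) (∫ y, f₃ y ∂μ₃) := by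
  have h : Integrable (fun z : Y₁ × Y₂ => B (f₁ z.1) (f₂ z.2)) (μ₁.prod μ₂) :=
    h₁.op_fst_snd (op := fun a b => B a b) (by fun_prop) ⟨‖B‖, B.le_opNorm₂⟩ h₂
  rw [← integral_prod_bilin B h₁ h₂, ← integral_prod_bilin N h h₃]

end Trilinear

theorem wavenumber_add {d : ℕ} (L : ℝ) (m m' : Fin d → ℤ) :
    wavenumber L (m + m') = wavenumber L m + wavenumber L m' := by
  ext i
  simp [wavenumber, add_div]

theorem wavenumber_sub {d : ℕ} (L : ℝ) (m m' : Fin d → ℤ) :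
    wavenumber L (m - m') = wavenumber L m - wavenumber L m' := by
  ext i
  simp [wavenumber, sub_div]

theorem continuous_resonance {d : ℕ} : Continuous fun p : (EuclideanSpace ℝ (Fin d) ×
    EuclideanSpace ℝ (Fin d)) × EuclideanSpace ℝ (Fin d) => resonance p.1.1 p.1.2 p.2 := by
  unfold resonance
  fun_prop

namespace Packet

variable {d : ℕ} {L : ℝ} {V₁ V₂ V₃ V₁₂ V : Type*}
  [NormedAddCommGroup V₁] [NormedSpace ℝ V₁]
  [NormedAddCommGroup V₂] [NormedSpace ℝ V₂]
  [NormedAddCommGroup V₃] [NormedSpace ℝ V₃]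
  [NormedAddCommGroup V₁₂] [NormedSpace ℝ V₁₂]
  [NormedAddCommGroup V] [NormedSpace ℝ V] [NormedSpace ℂ V]
  [IsScalarTower ℝ ℂ V] [SMulCommClass ℝ ℂ V]
  (p₁ : Packet d L V₁) (p₂ : Packet d L V₂) (p₃ : Packet d L V₃) (ε : ℝ) (c : ℂ)
  (B : V₁ →L[ℝ] V₂ →L[ℝ] V₁₂) (N : V₁₂ →L[ℝ] V₃ →L[ℝ] V)

/-- The time derivative of the amplitude of a cubic interaction. -/
noncomputable def cubicDeriv (t : ℝ) (y : (p₁.Y × p₂.Y) × p₃.Y) : V :=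
  (c * phase (t * resonance (p₁.kappa ε y.1.1) (p₂.kappa ε y.1.2) (p₃.kappa ε y.2))) •
    N (B (p₁.amp t y.1.1) (p₂.amp t y.1.2)) (p₃.amp t y.2)

theorem measurable_resonance : Measurable fun y : (p₁.Y × p₂.Y) × p₃.Y =>
    resonance (p₁.kappa ε y.1.1) (p₂.kappa ε y.1.2) (p₃.kappa ε y.2) := by
  refine continuous_resonance.measurable.comp (f := fun y : (p₁.Y × p₂.Y) × p₃.Y =>
    ((p₁.kappa ε y.1.1, p₂.kappa ε y.1.2), p₃.kappa ε y.2)) ?_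
  exact (((p₁.measurable_kappa ε).comp (measurable_fst.comp measurable_fst)).prodMk
    ((p₂.measurable_kappa ε).comp (measurable_snd.comp measurable_fst))).prodMk
      ((p₃.measurable_kappa ε).comp measurable_snd)

theorem stronglyMeasurable_cubicDeriv (t : ℝ) :
    StronglyMeasurable (cubicDeriv p₁ p₂ p₃ ε c B N t) := by
  have h1 : StronglyMeasurable fun y : (p₁.Y × p₂.Y) × p₃.Y =>
      N (B (p₁.amp t y.1.1) (p₂.amp t y.1.2)) (p₃.amp t y.2) := by
    have hc : Continuous fun q : (V₁ × V₂) × V₃ => N (B q.1.1 q.1.2) q.2 := by fun_prop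
    exact hc.comp_stronglyMeasurable ((((p₁.stronglyMeasurable t).comp_measurable
      (measurable_fst.comp measurable_fst)).prodMk ((p₂.stronglyMeasurable t).comp_measurable
      (measurable_snd.comp measurable_fst))).prodMk
      ((p₃.stronglyMeasurable t).comp_measurable measurable_snd))
  refine StronglyMeasurable.smul (Measurable.stronglyMeasurable ?_) h1
  exact (measurable_phase.comp ((measurable_resonance p₁ p₂ p₃ ε).const_mul t)).const_mul c

theorem continuous_amp {V : Type*} [NormedAddCommGroup V] [NormedSpace ℝ V] (p : Packet d L V)
    (y : p.Y) : Continuous fun t => p.amp t y :=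
  continuous_iff_continuousAt.2 fun t => (p.hasDerivAt t y).continuousAt

theorem continuous_cubicDeriv (y : (p₁.Y × p₂.Y) × p₃.Y) :
    Continuous fun t => cubicDeriv p₁ p₂ p₃ ε c B N t y := by
  have h1 := p₁.continuous_amp y.1.1
  have h2 := p₂.continuous_amp y.1.2
  have h3 := p₃.continuous_amp y.2
  unfold cubicDeriv
  fun_prop

theorem cubicDeriv_bound (T : ℝ) : ∃ C : ℝ, 0 ≤ C ∧ ∀ t y, |t| ≤ T →
    ‖cubicDeriv p₁ p₂ p₃ ε c B N t y‖ ≤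
      C * (p₁.weight y.1.1 * p₂.weight y.1.2 * p₃.weight y.2) := by
  obtain ⟨C₁, h₁, hC₁⟩ := p₁.bound T
  obtain ⟨C₂, h₂, hC₂⟩ := p₂.bound T
  obtain ⟨C₃, h₃, hC₃⟩ := p₃.bound T
  refine ⟨‖c‖ * (‖N‖ * (‖B‖ * C₁ * C₂) * C₃), by positivity, fun t y ht => ?_⟩
  have hw₁ := p₁.nonneg y.1.1
  have hw₂ := p₂.nonneg y.1.2
  have hw₃ := p₃.nonneg y.2
  rw [cubicDeriv, norm_smul, norm_mul, norm_phase, mul_one]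
  calc ‖c‖ * ‖N (B (p₁.amp t y.1.1) (p₂.amp t y.1.2)) (p₃.amp t y.2)‖
      ≤ ‖c‖ * (‖N‖ * (‖B‖ * ‖p₁.amp t y.1.1‖ * ‖p₂.amp t y.1.2‖) * ‖p₃.amp t y.2‖) := by
        gcongr
        refine (N.le_opNorm₂ _ _).trans ?_
        gcongr
        exact B.le_opNorm₂ _ _
    _ ≤ ‖c‖ * (‖N‖ * (‖B‖ * (C₁ * p₁.weight y.1.1) * (C₂ * p₂.weight y.1.2)) *
          (C₃ * p₃.weight y.2)) := by
        gcongr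
        · exact (hC₁ t _ ht).1
        · exact (hC₂ t _ ht).1
        · exact (hC₃ t _ ht).1
    _ = _ := by ring

theorem integrable_cubic_weight (n : ℕ) :
    Integrable (fun y : (p₁.Y × p₂.Y) × p₃.Y =>
      (1 + ‖wavenumber L (p₁.label y.1.1 - p₂.label y.1.2 + p₃.label y.2)‖ +
        ‖p₁.freq y.1.1 - p₂.freq y.1.2 + p₃.freq y.2‖) ^ n *
        (p₁.weight y.1.1 * p₂.weight y.1.2 * p₃.weight y.2)) ((p₁.σ.prod p₂.σ).prod p₃.σ) := by
  have hi := ((p₁.integrable n).mul_prod (p₂.integrable n)).mul_prod (p₃.integrable n)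
  have hw : AEStronglyMeasurable (fun y : (p₁.Y × p₂.Y) × p₃.Y =>
      p₁.weight y.1.1 * p₂.weight y.1.2 * p₃.weight y.2) ((p₁.σ.prod p₂.σ).prod p₃.σ) := by
    have := (((p₁.integrable 0).mul_prod (p₂.integrable 0)).mul_prod
      (p₃.integrable 0)).aestronglyMeasurable
    simpa using this
  have hl : Measurable fun y : (p₁.Y × p₂.Y) × p₃.Y =>
      p₁.label y.1.1 - p₂.label y.1.2 + p₃.label y.2 :=
    ((p₁.measurable_label.comp (measurable_fst.comp measurable_fst)).sub
      (p₂.measurable_label.comp (measurable_snd.comp measurable_fst))).add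
      (p₃.measurable_label.comp measurable_snd)
  have hf : Measurable fun y : (p₁.Y × p₂.Y) × p₃.Y =>
      p₁.freq y.1.1 - p₂.freq y.1.2 + p₃.freq y.2 :=
    ((p₁.measurable_freq.comp (measurable_fst.comp measurable_fst)).sub
      (p₂.measurable_freq.comp (measurable_snd.comp measurable_fst))).add
      (p₃.measurable_freq.comp measurable_snd)
  refine hi.mono' ((((((measurable_wavenumber.comp hl).norm.const_add 1).add
    hf.norm).pow_const n).aestronglyMeasurable).mul hw) (Filter.Eventually.of_forall fun y => ?_)
  have hw₁ := p₁.nonneg y.1.1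
  have hw₂ := p₂.nonneg y.1.2
  have hw₃ := p₃.nonneg y.2
  rw [Real.norm_of_nonneg (by positivity)]
  set a₁ := ‖wavenumber L (p₁.label y.1.1)‖ with ha₁
  set a₂ := ‖wavenumber L (p₂.label y.1.2)‖ with ha₂
  set a₃ := ‖wavenumber L (p₃.label y.2)‖ with ha₃
  set b₁ := ‖p₁.freq y.1.1‖ with hb₁
  set b₂ := ‖p₂.freq y.1.2‖ with hb₂
  set b₃ := ‖p₃.freq y.2‖ with hb₃
  have h1 : ‖wavenumber L (p₁.label y.1.1 - p₂.label y.1.2 + p₃.label y.2)‖ ≤ a₁ + a₂ + a₃ := by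
    rw [wavenumber_add, wavenumber_sub]
    exact (norm_add_le _ _).trans (add_le_add_left (norm_sub_le _ _) _)
  have h2 : ‖p₁.freq y.1.1 - p₂.freq y.1.2 + p₃.freq y.2‖ ≤ b₁ + b₂ + b₃ :=
    (norm_add_le _ _).trans (add_le_add_left (norm_sub_le _ _) _)
  have hx₁ : 0 ≤ a₁ + b₁ := add_nonneg (norm_nonneg _) (norm_nonneg _)
  have hx₂ : 0 ≤ a₂ + b₂ := add_nonneg (norm_nonneg _) (norm_nonneg _)
  have hx₃ : 0 ≤ a₃ + b₃ := add_nonneg (norm_nonneg _) (norm_nonneg _)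
  have h3 : 1 + ‖wavenumber L (p₁.label y.1.1 - p₂.label y.1.2 + p₃.label y.2)‖ +
      ‖p₁.freq y.1.1 - p₂.freq y.1.2 + p₃.freq y.2‖ ≤
      (1 + a₁ + b₁) * (1 + a₂ + b₂) * (1 + a₃ + b₃) := by
    have e : (1 + a₁ + b₁) * (1 + a₂ + b₂) * (1 + a₃ + b₃) =
        1 + (a₁ + b₁) + (a₂ + b₂) + (a₃ + b₃) + ((a₁ + b₁) * (a₂ + b₂) + (a₁ + b₁) * (a₃ + b₃) +
          (a₂ + b₂) * (a₃ + b₃) + (a₁ + b₁) * (a₂ + b₂) * (a₃ + b₃)) := by ring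
    rw [e]
    have : 0 ≤ (a₁ + b₁) * (a₂ + b₂) + (a₁ + b₁) * (a₃ + b₃) +
          (a₂ + b₂) * (a₃ + b₃) + (a₁ + b₁) * (a₂ + b₂) * (a₃ + b₃) := by positivity
    linarith
  calc _ ≤ ((1 + a₁ + b₁) * (1 + a₂ + b₂) * (1 + a₃ + b₃)) ^ n *
        (p₁.weight y.1.1 * p₂.weight y.1.2 * p₃.weight y.2) := by gcongr
    _ = _ := by
        rw [mul_pow, mul_pow]
        ring

variable [CompleteSpace V]

/-- The packet generated, from zero initial data, by the cubic interaction of three packets: its waves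
are parametrized by triples of waves, and their amplitudes are given by the Duhamel formula. -/
noncomputable def cubic : Packet d L V where
  Y := (p₁.Y × p₂.Y) × p₃.Y
  σ := (p₁.σ.prod p₂.σ).prod p₃.σ
  label y := p₁.label y.1.1 - p₂.label y.1.2 + p₃.label y.2
  freq y := p₁.freq y.1.1 - p₂.freq y.1.2 + p₃.freq y.2
  weight y := p₁.weight y.1.1 * p₂.weight y.1.2 * p₃.weight y.2
  amp t y := ∫ s in (0 : ℝ)..t, cubicDeriv p₁ p₂ p₃ ε c B N s y
  ampDeriv := cubicDeriv p₁ p₂ p₃ ε c B N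
  measurable_label := ((p₁.measurable_label.comp (measurable_fst.comp measurable_fst)).sub
      (p₂.measurable_label.comp (measurable_snd.comp measurable_fst))).add
      (p₃.measurable_label.comp measurable_snd)
  measurable_freq := ((p₁.measurable_freq.comp (measurable_fst.comp measurable_fst)).sub
      (p₂.measurable_freq.comp (measurable_snd.comp measurable_fst))).add
      (p₃.measurable_freq.comp measurable_snd)
  nonneg y := mul_nonneg (mul_nonneg (p₁.nonneg _) (p₂.nonneg _)) (p₃.nonneg _)
  integrable := integrable_cubic_weight p₁ p₂ p₃
  __ := isAmplitude_integral
    (fun y => mul_nonneg (mul_nonneg (p₁.nonneg _) (p₂.nonneg _)) (p₃.nonneg _))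
    (stronglyMeasurable_cubicDeriv p₁ p₂ p₃ ε c B N) (continuous_cubicDeriv p₁ p₂ p₃ ε c B N)
    (cubicDeriv_bound p₁ p₂ p₃ ε c B N)

theorem cubic_profile_zero (m : Fin d → ℤ) (x : EuclideanSpace ℝ (Fin d)) :
    (cubic p₁ p₂ p₃ ε c B N).profile ε m 0 x = 0 := by
  refine integral_eq_zero_of_ae (Filter.Eventually.of_forall fun y => ?_)
  have h : (cubic p₁ p₂ p₃ ε c B N).amp 0 y = 0 := intervalIntegral.integral_same
  simp only [h, smul_zero, Pi.zero_apply]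

theorem kappa_cubic (y : (cubic p₁ p₂ p₃ ε c B N).Y) : (cubic p₁ p₂ p₃ ε c B N).kappa ε y =
    p₁.kappa ε y.1.1 - p₂.kappa ε y.1.2 + p₃.kappa ε y.2 := by
  simp only [kappa, cubic, wavenumber_add, wavenumber_sub, smul_add, smul_sub]
  abel

theorem integrable_profile {V : Type*} [NormedAddCommGroup V] [NormedSpace ℝ V] [NormedSpace ℂ V]
    [IsScalarTower ℝ ℂ V] [SMulCommClass ℝ ℂ V] (p : Packet d L V) (m : Fin d → ℤ) (t : ℝ)
    (x : EuclideanSpace ℝ (Fin d)) :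
    Integrable (fun y => phase (inner ℝ (p.freq y) x + t * p.profileTime ε (wavenumber L m) y) •
      p.amp t y) (p.σ.restrict (p.fiber m)) := by
  have := ((p.isFrequency_profile ε m).hasMoments p.isAmplitude t).integrable_phase_smul
    (measurable_inner_left p.measurable_freq x)
  simpa only [smul_smul, ← phase_add] using this

variable [NormedSpace ℂ V₁] [IsScalarTower ℝ ℂ V₁] [SMulCommClass ℝ ℂ V₁] [CompleteSpace V₁]
  [NormedSpace ℂ V₂] [IsScalarTower ℝ ℂ V₂] [SMulCommClass ℝ ℂ V₂] [CompleteSpace V₂]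
  [NormedSpace ℂ V₃] [IsScalarTower ℝ ℂ V₃] [SMulCommClass ℝ ℂ V₃] [CompleteSpace V₃]
  [NormedSpace ℂ V₁₂] [CompleteSpace V₁₂]

variable {B N}

/-- The source of the cubic packet is the cubic nonlinearity of the three fields: the resonance
phase in the amplitude makes the temporal frequencies of the three waves add up to that of their
product. -/
theorem wave_cubic (hBN : ∀ (z₁ z₂ z₃ : ℂ) a₁ a₂ a₃, N (B (z₁ • a₁) (z₂ • a₂)) (z₃ • a₃) =
      (z₁ * (starRingEnd ℂ) z₂ * z₃) • N (B a₁ a₂) a₃) (t : ℝ) (x : EuclideanSpace ℝ (Fin d)) :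
    wave (cubic p₁ p₂ p₃ ε c B N).σ ((cubic p₁ p₂ p₃ ε c B N).kappa ε)
      (fun y => -‖(cubic p₁ p₂ p₃ ε c B N).kappa ε y‖ ^ 2 / 2)
      (cubic p₁ p₂ p₃ ε c B N).ampDeriv t x =
    c • N (B (p₁.field ε t x) (p₂.field ε t x)) (p₃.field ε t x) := by
  simp only [field, wave]
  rw [← integral_trilinear B N (p₁.integrable_field ε t x)
    (p₂.integrable_field ε t x) (p₃.integrable_field ε t x), ← integral_smul]
  refine integral_congr_ae (Filter.Eventually.of_forall fun y => ?_)
  beta_reduce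
  rw [hBN, conj_phase, smul_smul]
  have e : (cubic p₁ p₂ p₃ ε c B N).ampDeriv t y =
    (c * phase (t * resonance (p₁.kappa ε y.1.1) (p₂.kappa ε y.1.2) (p₃.kappa ε y.2))) •
      N (B (p₁.amp t y.1.1) (p₂.amp t y.1.2)) (p₃.amp t y.2) := rfl
  rw [e, smul_smul, kappa_cubic]
  congr 1
  rw [← phase_add, ← phase_add, mul_left_comm, ← phase_add]
  congr 2
  rw [resonance, inner_add_left, inner_sub_left]
  ring

/-- The interaction sum over the triads of momentum `m`. -/
theorem hasSum_profile_cubic (hBN : ∀ (z₁ z₂ z₃ : ℂ) a₁ a₂ a₃,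
      N (B (z₁ • a₁) (z₂ • a₂)) (z₃ • a₃) = (z₁ * (starRingEnd ℂ) z₂ * z₃) • N (B a₁ a₂) a₃)
    (m : Fin d → ℤ) (t : ℝ) (x : EuclideanSpace ℝ (Fin d)) :
    HasSum (fun q : Triad m => (c * phase (t * resonance (wavenumber L q.1.1)
        (wavenumber L q.1.2.1) (wavenumber L q.1.2.2))) •
        N (B (p₁.profile ε q.1.1 t x) (p₂.profile ε q.1.2.1 t x)) (p₃.profile ε q.1.2.2 t x))
      (wave ((cubic p₁ p₂ p₃ ε c B N).σ.restrict ((cubic p₁ p₂ p₃ ε c B N).fiber m))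
        (cubic p₁ p₂ p₃ ε c B N).freq
        ((cubic p₁ p₂ p₃ ε c B N).profileTime ε (wavenumber L m))
        (cubic p₁ p₂ p₃ ε c B N).ampDeriv t x) := by
  set p := cubic p₁ p₂ p₃ ε c B N with hp
  let S : Triad m → Set p.Y := fun q =>
    ((p₁.fiber q.1.1 ×ˢ p₂.fiber q.1.2.1) ×ˢ p₃.fiber q.1.2.2 : Set ((p₁.Y × p₂.Y) × p₃.Y))
  have hS : ⋃ q, S q = p.fiber m := by
    ext y
    simp only [Set.mem_iUnion]
    constructor
    · rintro ⟨⟨q, hq⟩, ⟨h1, h2⟩, h3⟩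
      have h1' : p₁.label y.1.1 = q.1 := h1
      have h2' : p₂.label y.1.2 = q.2.1 := h2
      have h3' : p₃.label y.2 = q.2.2 := h3
      change p₁.label y.1.1 - p₂.label y.1.2 + p₃.label y.2 = m
      rw [h1', h2', h3', hq]
    · intro h
      exact ⟨⟨(p₁.label y.1.1, p₂.label y.1.2, p₃.label y.2), h⟩, ⟨rfl, rfl⟩, rfl⟩
  have hSm : ∀ q, MeasurableSet (S q) := fun q =>
    ((p₁.measurableSet_fiber _).prod (p₂.measurableSet_fiber _)).prod (p₃.measurableSet_fiber _)
  have hSd : Pairwise (Function.onFun Disjoint S) := by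
    intro q q' hq
    refine Set.disjoint_left.2 fun y hy hy' => hq ?_
    obtain ⟨⟨h1, h2⟩, h3⟩ := hy
    obtain ⟨⟨h1', h2'⟩, h3'⟩ := hy'
    have e1 : q.1.1 = q'.1.1 := Eq.trans (Eq.symm h1) h1'
    have e2 : q.1.2.1 = q'.1.2.1 := Eq.trans (Eq.symm h2) h2'
    have e3 : q.1.2.2 = q'.1.2.2 := Eq.trans (Eq.symm h3) h3'
    exact Subtype.ext (Prod.ext e1 (Prod.ext e2 e3))
  have hi : IntegrableOn (fun y => phase (inner ℝ (p.freq y) x +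
      t * p.profileTime ε (wavenumber L m) y) • p.ampDeriv t y) (⋃ q, S q) p.σ := by
    rw [hS, IntegrableOn]
    obtain ⟨C, -, hC⟩ := p.bound |t|
    have := ((p.isFrequency_profile ε m).hasMoments_phase_smul
      ((p.stronglyMeasurable_deriv t).aestronglyMeasurable)
      (fun y => (hC t y le_rfl).2) t).integrable_phase_smul
      (measurable_inner_left p.measurable_freq x)
    simpa only [smul_smul, ← phase_add] using this
  have h := hasSum_integral_iUnion hSm hSd hi
  rw [hS] at h
  refine h.congr_fun ?_
  intro q
  have hr : p.σ.restrict (S q) = ((p₁.σ.restrict (p₁.fiber q.1.1)).prod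
      (p₂.σ.restrict (p₂.fiber q.1.2.1))).prod (p₃.σ.restrict (p₃.fiber q.1.2.2)) := by
    rw [Measure.prod_restrict, Measure.prod_restrict]
    rfl
  simp only [profile, wave]
  rw [← integral_trilinear B N
    (p₁.integrable_profile ε _ t x) (p₂.integrable_profile ε _ t x)
    (p₃.integrable_profile ε _ t x), ← integral_smul, ← hr]
  refine setIntegral_congr_fun (hSm q) fun y hy => ?_
  obtain ⟨⟨h1, h2⟩, h3⟩ := hy
  have h1' : p₁.label y.1.1 = q.1.1 := h1
  have h2' : p₂.label y.1.2 = q.1.2.1 := h2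
  have h3' : p₃.label y.2 = q.1.2.2 := h3
  rw [hBN, conj_phase, smul_smul]
  have e : p.ampDeriv t y =
    (c * phase (t * resonance (p₁.kappa ε y.1.1) (p₂.kappa ε y.1.2) (p₃.kappa ε y.2))) •
      N (B (p₁.amp t y.1.1) (p₂.amp t y.1.2)) (p₃.amp t y.2) := rfl
  rw [e, smul_smul]
  congr 1
  rw [← phase_add, ← phase_add, mul_left_comm, mul_assoc, ← phase_add, ← phase_add]
  congr 2
  have hm : wavenumber L m = wavenumber L q.1.1 - wavenumber L q.1.2.1 + wavenumber L q.1.2.2 := by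
    rw [← wavenumber_sub, ← wavenumber_add, q.2]
  have hk : wavenumber L m + ε • p.freq y =
      p₁.kappa ε y.1.1 - p₂.kappa ε y.1.2 + p₃.kappa ε y.2 := by
    refine Eq.trans ?_ (kappa_cubic p₁ p₂ p₃ ε c B N y)
    change _ = wavenumber L (p.label y) + ε • p.freq y
    congr 2
    change m = p₁.label y.1.1 - p₂.label y.1.2 + p₃.label y.2
    rw [h1', h2', h3', q.2]
  have hx : (inner ℝ (p.freq y) x : ℝ) = inner ℝ (p₁.freq y.1.1) x - inner ℝ (p₂.freq y.1.2) x +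
      inner ℝ (p₃.freq y.2) x := by
    rw [← inner_sub_left, ← inner_add_left]
    rfl
  have ht : p.profileTime ε (wavenumber L m) y =
      (‖wavenumber L m‖ ^ 2 - ‖wavenumber L m + ε • p.freq y‖ ^ 2) / 2 := rfl
  have ht₁ : p₁.profileTime ε (wavenumber L q.1.1) y.1.1 =
      (‖wavenumber L q.1.1‖ ^ 2 - ‖p₁.kappa ε y.1.1‖ ^ 2) / 2 := by
    rw [kappa, h1', profileTime]
  have ht₂ : p₂.profileTime ε (wavenumber L q.1.2.1) y.1.2 =
      (‖wavenumber L q.1.2.1‖ ^ 2 - ‖p₂.kappa ε y.1.2‖ ^ 2) / 2 := by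
    rw [kappa, h2', profileTime]
  have ht₃ : p₃.profileTime ε (wavenumber L q.1.2.2) y.2 =
      (‖wavenumber L q.1.2.2‖ ^ 2 - ‖p₃.kappa ε y.2‖ ^ 2) / 2 := by
    rw [kappa, h3', profileTime]
  rw [ht, ht₁, ht₂, ht₃, hk, hx, hm, resonance, resonance]
  ring

end Packet

/-! ### Free packets and the initial data -/

section LatticeSum

/-- Powers of the wavenumber beyond `2d` are summable over the lattice. -/
theorem integrable_wavenumber {d : ℕ} {L : ℝ} (hL : 0 < L) :
    Integrable (fun m : Fin d → ℤ => ((1 + ‖wavenumber L m‖) ^ (2 * d))⁻¹)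
      (Measure.pi fun _ => Measure.count) := by
  have h1 : Integrable (fun n : ℤ => ((1 + |(n : ℝ)|) ^ 2)⁻¹) Measure.count := by
    rw [integrable_count_iff]
    have h0 : Summable fun n : ℤ => 4 * (1 / (n : ℝ) ^ 2) + if n = 0 then 1 else 0 :=
      ((Real.summable_one_div_int_pow.2 one_lt_two).mul_left 4).add
        (summable_of_ne_finset_zero (s := {0}) fun n hn => by simp at hn; simp [hn])
    refine h0.of_nonneg_of_le (fun n => norm_nonneg _) fun n => ?_
    rw [Real.norm_of_nonneg (by positivity)]
    by_cases hn : n = 0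
    · simp [hn]
    · have hn' : 0 < |(n : ℝ)| := abs_pos.2 (by exact_mod_cast hn)
      rw [if_neg hn, add_zero, ← sq_abs (n : ℝ), ← one_div]
      have : 1 / (1 + |(n : ℝ)|) ^ 2 ≤ 1 / |(n : ℝ)| ^ 2 := by
        gcongr
        linarith
      have h4 : 0 ≤ 1 / |(n : ℝ)| ^ 2 := by positivity
      linarith
  have h2 := Integrable.fintype_prod (ι := Fin d) (fun _ => h1)
  refine (h2.const_mul ((1 + L) ^ (2 * d))).mono'
    (Measurable.aestronglyMeasurable (measurable_of_countable _)) (Filter.Eventually.of_forall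
      fun m => ?_)
  rw [Real.norm_of_nonneg (by positivity), Finset.prod_inv_distrib, ← one_div, ← div_eq_mul_inv,
    div_le_div_iff₀ (by positivity) (Finset.prod_pos fun i _ => by positivity), one_mul]
  have h3 : ∀ i ∈ (Finset.univ : Finset (Fin d)),
      (1 + |(m i : ℝ)|) ^ 2 ≤ ((1 + L) * (1 + ‖wavenumber L m‖)) ^ 2 := by
    intro i _
    have h4 : |(m i : ℝ) / L| ≤ ‖wavenumber L m‖ := PiLp.norm_apply_le (wavenumber L m) i
    rw [abs_div, abs_of_pos hL, div_le_iff₀ hL] at h4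
    gcongr
    nlinarith [norm_nonneg (wavenumber L m)]
  calc _ ≤ ∏ _i : Fin d, ((1 + L) * (1 + ‖wavenumber L m‖)) ^ 2 :=
        Finset.prod_le_prod (fun i _ => by positivity) h3
    _ = _ := by
        rw [Finset.prod_const, Finset.card_univ, Fintype.card_fin, ← pow_mul, mul_pow]

end LatticeSum

namespace Packet

variable {d : ℕ} {L : ℝ} {V : Type*} [NormedAddCommGroup V] [NormedSpace ℝ V] [NormedSpace ℂ V]
  [IsScalarTower ℝ ℂ V] [SMulCommClass ℝ ℂ V]

theorem integrable_free_weight (hL : 0 < L) {ν : Measure (EuclideanSpace ℝ (Fin d))} [SFinite ν]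
    {r : ℕ} (hν : Integrable (fun ξ => ((1 + ‖ξ‖) ^ r)⁻¹) ν)
    {a : (Fin d → ℤ) → EuclideanSpace ℝ (Fin d) → ℂ} (ha : ∀ m, Measurable (a m))
    (hdecay : ∀ N : ℕ, ∃ C, ∀ m ξ, (1 + ‖wavenumber L m‖) ^ N * (1 + ‖ξ‖) ^ N * ‖a m ξ‖ ≤ C)
    (N : ℕ) : Integrable (fun y : (Fin d → ℤ) × EuclideanSpace ℝ (Fin d) =>
      (1 + ‖wavenumber L y.1‖ + ‖y.2‖) ^ N * ‖a y.1 y.2‖)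
      ((Measure.pi fun _ => Measure.count).prod ν) := by
  obtain ⟨C, hC⟩ := hdecay (N + 2 * d + r)
  refine (((integrable_wavenumber hL).mul_prod hν).const_mul C).mono' ?_
    (Filter.Eventually.of_forall fun y => ?_)
  · refine Measurable.aestronglyMeasurable (Measurable.mul ?_ ?_)
    · exact (((measurable_wavenumber.comp measurable_fst).norm.const_add 1).add
        measurable_snd.norm).pow_const N
    · exact (measurable_from_prod_countable_right (f := fun y : (Fin d → ℤ) ×
        EuclideanSpace ℝ (Fin d) => a y.1 y.2) ha).norm
  · rw [Real.norm_of_nonneg (by positivity), ← mul_inv, ← div_eq_mul_inv, le_div_iff₀ (by positivity)]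
    refine le_trans ?_ (hC y.1 y.2)
    set A := ‖wavenumber L y.1‖
    set X := ‖y.2‖
    have hA : 0 ≤ A := norm_nonneg _
    have hX : 0 ≤ X := norm_nonneg _
    have h1 : (1 + A + X) ^ N ≤ (1 + A) ^ N * (1 + X) ^ N := by
      rw [← mul_pow]
      gcongr
      nlinarith
    have h2 : (1 + A) ^ (2 * d) * (1 + X) ^ r ≤
        (1 + A) ^ (2 * d + r) * (1 + X) ^ (2 * d + r) := by
      gcongr
      · linarith
      · omega
      · linarith
      · omega
    calc (1 + A + X) ^ N * ‖a y.1 y.2‖ * ((1 + A) ^ (2 * d) * (1 + X) ^ r)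
        ≤ (1 + A) ^ N * (1 + X) ^ N * ‖a y.1 y.2‖ *
            ((1 + A) ^ (2 * d + r) * (1 + X) ^ (2 * d + r)) := by gcongr
      _ = _ := by ring

/-- The packet of free waves with amplitudes `a m ξ • v m`, constant in time. -/
noncomputable def free (hL : 0 < L) {ν : Measure (EuclideanSpace ℝ (Fin d))} [SFinite ν]
    {r : ℕ} (hν : Integrable (fun ξ => ((1 + ‖ξ‖) ^ r)⁻¹) ν)
    {a : (Fin d → ℤ) → EuclideanSpace ℝ (Fin d) → ℂ} (ha : ∀ m, Measurable (a m))
    (hdecay : ∀ N : ℕ, ∃ C, ∀ m ξ, (1 + ‖wavenumber L m‖) ^ N * (1 + ‖ξ‖) ^ N * ‖a m ξ‖ ≤ C)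
    {v : (Fin d → ℤ) → V} {R : ℝ} (hv : ∀ m, ‖v m‖ ≤ R) : Packet d L V where
  Y := (Fin d → ℤ) × EuclideanSpace ℝ (Fin d)
  σ := (Measure.pi fun _ => Measure.count).prod ν
  label := Prod.fst
  freq := Prod.snd
  weight y := ‖a y.1 y.2‖
  amp _ y := a y.1 y.2 • v y.1
  ampDeriv _ _ := 0
  measurable_label := measurable_fst
  measurable_freq := measurable_snd
  nonneg _ := norm_nonneg _
  integrable := integrable_free_weight hL hν ha hdecay
  stronglyMeasurable _ := by
    refine StronglyMeasurable.smul ?_ ?_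
    · exact (measurable_from_prod_countable_right (f := fun y : (Fin d → ℤ) ×
        EuclideanSpace ℝ (Fin d) => a y.1 y.2) ha).stronglyMeasurable
    · exact StronglyMeasurable.comp_measurable (f := v) StronglyMeasurable.of_discrete
        measurable_fst
  stronglyMeasurable_deriv _ := stronglyMeasurable_zero
  hasDerivAt _ _ := hasDerivAt_const _ _
  continuous_deriv _ := continuous_const
  bound T := by
    have hR : 0 ≤ R := (norm_nonneg _).trans (hv 0)
    refine ⟨R, hR, fun t y _ => ⟨?_, ?_⟩⟩
    · rw [norm_smul, mul_comm]
      gcongr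
      exact hv _
    · rw [norm_zero]
      positivity

variable [CompleteSpace V]

theorem free_profile_zero (hL : 0 < L) {ν : Measure (EuclideanSpace ℝ (Fin d))} [SFinite ν]
    {r : ℕ} (hν : Integrable (fun ξ => ((1 + ‖ξ‖) ^ r)⁻¹) ν)
    {a : (Fin d → ℤ) → EuclideanSpace ℝ (Fin d) → ℂ} (ha : ∀ m, Measurable (a m))
    (hdecay : ∀ N : ℕ, ∃ C, ∀ m ξ, (1 + ‖wavenumber L m‖) ^ N * (1 + ‖ξ‖) ^ N * ‖a m ξ‖ ≤ C)
    {v : (Fin d → ℤ) → V} {R : ℝ} (hv : ∀ m, ‖v m‖ ≤ R) (ε : ℝ) (m : Fin d → ℤ)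
    (x : EuclideanSpace ℝ (Fin d)) :
    (free hL hν ha hdecay hv).profile ε m 0 x =
      (∫ ξ, phase (inner ℝ ξ x) * a m ξ ∂ν) • v m := by
  have h1 : ((free hL hν ha hdecay hv).σ.restrict ((free hL hν ha hdecay hv).fiber m)) =
      ν.map (Prod.mk m) := by
    have e : (free hL hν ha hdecay hv).fiber m = {m} ×ˢ Set.univ := by
      ext y
      exact (and_iff_left trivial).symm
    rw [e]
    change ((Measure.pi fun _ : Fin d => (Measure.count : Measure ℤ)).prod ν).restrict _ = _
    rw [← Measure.prod_restrict, Measure.restrict_singleton, Measure.restrict_univ,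
      Measure.pi_singleton]
    simp only [Measure.count_singleton, Finset.prod_const_one, one_smul]
    exact Measure.dirac_prod m
  have hm : MeasurableEmbedding (Prod.mk m : EuclideanSpace ℝ (Fin d) → _) :=
    measurableEmbedding_prodMk_left m
  rw [profile, wave, h1]
  refine (hm.integral_map _).trans ?_
  rw [← integral_smul_const]
  refine integral_congr_ae (Filter.Eventually.of_forall fun ξ => ?_)
  change phase (inner ℝ ξ x + 0 * _) • a m ξ • v m = _
  rw [zero_mul, add_zero, smul_smul]

theorem free_ampDeriv_wave (hL : 0 < L) {ν : Measure (EuclideanSpace ℝ (Fin d))} [SFinite ν]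
    {r : ℕ} (hν : Integrable (fun ξ => ((1 + ‖ξ‖) ^ r)⁻¹) ν)
    {a : (Fin d → ℤ) → EuclideanSpace ℝ (Fin d) → ℂ} (ha : ∀ m, Measurable (a m))
    (hdecay : ∀ N : ℕ, ∃ C, ∀ m ξ, (1 + ‖wavenumber L m‖) ^ N * (1 + ‖ξ‖) ^ N * ‖a m ξ‖ ≤ C)
    {v : (Fin d → ℤ) → V} {R : ℝ} (hv : ∀ m, ‖v m‖ ≤ R)
    (σ : Measure (free hL hν ha hdecay hv).Y)
    (ζ : (free hL hν ha hdecay hv).Y → EuclideanSpace ℝ (Fin d))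
    (θ : (free hL hν ha hdecay hv).Y → ℝ) (t : ℝ) (x : EuclideanSpace ℝ (Fin d)) :
    wave σ ζ θ (free hL hν ha hdecay hv).ampDeriv t x = 0 := by
  refine integral_eq_zero_of_ae (Filter.Eventually.of_forall fun y => ?_)
  have h : (free hL hν ha hdecay hv).ampDeriv t y = 0 := rfl
  simp only [h, smul_zero, Pi.zero_apply]

end Packet

section SchwartzSlices

open FourierTransform

variable {E F : Type*} [NormedAddCommGroup E] [NormedSpace ℝ E] [NormedAddCommGroup F]
  [NormedSpace ℝ F]

theorem norm_iteratedFDeriv_slice_le (φ : 𝓢(E × F, ℂ)) (k : F) (n : ℕ) (x : E) :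
    ‖iteratedFDeriv ℝ n (fun x => φ (x, k)) x‖ ≤ ‖iteratedFDeriv ℝ n φ (x, k)‖ := by
  have h1 : (fun x => φ (x, k)) =
      (fun p : E × F => φ (p + (0, k))) ∘ ContinuousLinearMap.inl ℝ E F := by
    funext x
    simp
  have h2 : ContDiff ℝ n fun p : E × F => φ (p + (0, k)) :=
    (φ.smooth n).comp (contDiff_id.add contDiff_const)
  rw [h1, ContinuousLinearMap.iteratedFDeriv_comp_right _ h2 _ le_rfl, iteratedFDeriv_comp_add_right]
  refine (ContinuousMultilinearMap.norm_compContinuousLinearMap_le _ _).trans ?_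
  have h3 : (ContinuousLinearMap.inl ℝ E F x + (0, k)) = (x, k) := by simp
  rw [h3]
  refine mul_le_of_le_one_right (norm_nonneg _) (Finset.prod_le_one (fun _ _ => norm_nonneg _)
    fun _ _ => ContinuousLinearMap.norm_inl_le_one ℝ E F)

/-- The slices of a Schwartz function decay rapidly, together with their derivatives, jointly in
the variable and the parameter. -/
theorem exists_slice_decay (φ : 𝓢(E × F, ℂ)) (N l n : ℕ) : ∃ C : ℝ, 0 ≤ C ∧ ∀ (x : E) (k : F),
    (1 + ‖k‖) ^ N * (‖x‖ ^ l * ‖iteratedFDeriv ℝ n (fun x => φ (x, k)) x‖) ≤ C := by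
  refine ⟨_, by positivity, fun x k => le_trans ?_ (SchwartzMap.one_add_le_sup_seminorm_apply
    (𝕜 := ℝ) (m := (N + l, n)) le_rfl le_rfl φ (x, k))⟩
  have hx : ‖x‖ ≤ 1 + ‖(x, k)‖ := by
    have := norm_fst_le (x, k)
    simp only at this
    linarith
  have hk : 1 + ‖k‖ ≤ 1 + ‖(x, k)‖ := by
    have := norm_snd_le (x, k)
    simp only at this
    linarith
  calc _ ≤ (1 + ‖(x, k)‖) ^ N * ((1 + ‖(x, k)‖) ^ l * ‖iteratedFDeriv ℝ n φ (x, k)‖) := by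
        gcongr
        exact norm_iteratedFDeriv_slice_le φ k n x
    _ = _ := by rw [pow_add]; ring

/-- The Schwartz function `x ↦ φ(x, k)`. -/
noncomputable def schwartzSlice (φ : 𝓢(E × F, ℂ)) (k : F) : 𝓢(E, ℂ) where
  toFun x := φ (x, k)
  smooth' := (φ.smooth _).comp (contDiff_id.prodMk contDiff_const)
  decay' l n := by
    obtain ⟨C, -, hC⟩ := exists_slice_decay φ 0 l n
    exact ⟨C, fun x => by simpa using hC x k⟩

variable {d : ℕ}

/-- The partial Fourier transform of a Schwartz function decays rapidly in both variables. -/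
theorem exists_fourier_slice_decay (φ : 𝓢(EuclideanSpace ℝ (Fin d) × F, ℂ)) (N : ℕ) :
    ∃ C : ℝ, ∀ (k : F) (ξ : EuclideanSpace ℝ (Fin d)),
      (1 + ‖k‖) ^ N * (1 + ‖ξ‖) ^ N * ‖𝓕 (schwartzSlice φ k) ξ‖ ≤ C := by
  let S := 𝓢(EuclideanSpace ℝ (Fin d), ℂ)
  -- The Fourier transform is continuous on Schwartz space, so a seminorm of the transform is
  -- bounded by finitely many seminorms of the slice, which decay in the parameter.
  let Q : Seminorm ℂ S := ((Finset.Iic (N, 0)).sup fun m => SchwartzMap.seminorm ℂ m.1 m.2).comp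
    (fourierCLM ℂ S : S →L[ℂ] S).toLinearMap
  have hQ : Continuous Q := by
    have h1 : Continuous ((Finset.Iic ((N, 0) : ℕ × ℕ)).sup
        fun m => SchwartzMap.seminorm ℂ m.1 m.2 : Seminorm ℂ S) := by
      refine Seminorm.continuous_of_le (q := (Finset.Iic ((N, 0) : ℕ × ℕ)).sup
        (schwartzSeminormFamily ℂ (EuclideanSpace ℝ (Fin d)) ℂ)) ?_ le_rfl
      refine (Finset.sup_induction (p := fun q : Seminorm ℂ S => Continuous q) ?_ ?_ ?_)
      · exact continuous_const
      · intro a ha b hb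
        exact ha.sup hb
      · intro i _
        exact (schwartz_withSeminorms ℂ _ _).continuous_seminorm i
    exact h1.comp (fourierCLM ℂ S).continuous
  obtain ⟨s, C, -, hC⟩ := Seminorm.bound_of_continuous (schwartz_withSeminorms ℂ _ _) Q hQ
  choose D hD0 hD using fun i : ℕ × ℕ => exists_slice_decay φ N i.1 i.2
  refine ⟨2 ^ N * (C * ∑ i ∈ s, D i), fun k ξ => ?_⟩
  have h1 := SchwartzMap.one_add_le_sup_seminorm_apply (𝕜 := ℂ) (m := (N, 0)) le_rfl le_rfl
    (𝓕 (schwartzSlice φ k)) ξ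
  rw [norm_iteratedFDeriv_zero] at h1
  have h2 : ((Finset.Iic ((N, 0) : ℕ × ℕ)).sup fun m => SchwartzMap.seminorm ℂ m.1 m.2)
      (𝓕 (schwartzSlice φ k)) ≤ C * (s.sup (schwartzSeminormFamily ℂ _ ℂ)) (schwartzSlice φ k) :=
    hC (schwartzSlice φ k)
  have hk : 0 < (1 + ‖k‖) ^ N := by positivity
  have h3 : (s.sup (schwartzSeminormFamily ℂ _ ℂ)) (schwartzSlice φ k) ≤
      (∑ i ∈ s, D i) / (1 + ‖k‖) ^ N := by
    refine Seminorm.finset_sup_apply_le (div_nonneg (Finset.sum_nonneg fun i _ => hD0 i) hk.le)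
      fun i hi => ?_
    refine SchwartzMap.seminorm_le_bound ℂ i.1 i.2 _
      (div_nonneg (Finset.sum_nonneg fun i _ => hD0 i) hk.le) fun x => ?_
    rw [le_div_iff₀ hk, mul_comm]
    exact (hD i x k).trans (Finset.single_le_sum (fun i _ => hD0 i) hi)
  have hC0 : (0 : ℝ) ≤ C := C.2
  have h4 : (1 + ‖ξ‖) ^ N * ‖𝓕 (schwartzSlice φ k) ξ‖ ≤
      2 ^ N * (C * ((∑ i ∈ s, D i) / (1 + ‖k‖) ^ N)) :=
    h1.trans (mul_le_mul_of_nonneg_left (h2.trans (mul_le_mul_of_nonneg_left h3 hC0))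
      (by positivity))
  calc _ = (1 + ‖k‖) ^ N * ((1 + ‖ξ‖) ^ N * ‖𝓕 (schwartzSlice φ k) ξ‖) := by ring
    _ ≤ (1 + ‖k‖) ^ N * (2 ^ N * (C * ((∑ i ∈ s, D i) / (1 + ‖k‖) ^ N))) := by gcongr
    _ = _ := by field_simp

end SchwartzSlices

section InitialData

open FourierTransform

variable {d : ℕ}

/-- The amplitudes of the plane waves making up the initial data: a partial Fourier transform
if `ε ≠ 0`, the value at `x = 0` carried by the zero frequency if `ε = 0`. -/
noncomputable def initialWave
    (φ : 𝓢(EuclideanSpace ℝ (Fin d) × EuclideanSpace ℝ (Fin d), ℂ)) (ε : ℝ)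
    (k ξ : EuclideanSpace ℝ (Fin d)) : ℂ :=
  open Classical in
  if ε = 0 then if ξ = 0 then φ (0, k) else 0 else 𝓕 (schwartzSlice φ k) ξ

/-- The measure on the frequencies of the initial data. -/
noncomputable def initialMeasure (d : ℕ) (ε : ℝ) : Measure (EuclideanSpace ℝ (Fin d)) :=
  open Classical in
  if ε = 0 then Measure.dirac 0 else volume

instance (d : ℕ) (ε : ℝ) : SFinite (initialMeasure d ε) := by
  unfold initialMeasure
  split_ifs <;> infer_instance

theorem integrable_initialMeasure (d : ℕ) (ε : ℝ) :
    Integrable (fun ξ => ((1 + ‖ξ‖) ^ (d + 1))⁻¹) (initialMeasure d ε) := by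
  unfold initialMeasure
  split_ifs
  · refine integrable_dirac ?_
    simp
  · refine (integrable_one_add_norm (E := EuclideanSpace ℝ (Fin d)) (r := (d + 1 : ℕ))
      (by simp)).congr (Filter.Eventually.of_forall fun ξ => ?_)
    simp only [Real.rpow_neg (by positivity : (0 : ℝ) ≤ 1 + ‖ξ‖), Real.rpow_natCast]

variable (φ : 𝓢(EuclideanSpace ℝ (Fin d) × EuclideanSpace ℝ (Fin d), ℂ)) (ε : ℝ)

theorem measurable_initialWave (k : EuclideanSpace ℝ (Fin d)) : Measurable (initialWave φ ε k) := by
  unfold initialWave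
  split_ifs
  · exact Measurable.ite (measurableSet_singleton 0) measurable_const measurable_const
  · exact (𝓕 (schwartzSlice φ k)).continuous.measurable

theorem exists_initialWave_decay (N : ℕ) : ∃ C : ℝ, ∀ k ξ : EuclideanSpace ℝ (Fin d),
    (1 + ‖k‖) ^ N * (1 + ‖ξ‖) ^ N * ‖initialWave φ ε k ξ‖ ≤ C := by
  unfold initialWave
  split_ifs
  · obtain ⟨C, hC0, hC⟩ := exists_slice_decay φ N 0 0
    refine ⟨C, fun k ξ => ?_⟩
    split_ifs with h
    · simpa [h] using hC 0 k
    · simpa using hC0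
  · exact exists_fourier_slice_decay φ N

/-- Fourier inversion if `ε ≠ 0`; the evaluation of a Dirac mass if `ε = 0`. -/
theorem integral_initialWave (x k : EuclideanSpace ℝ (Fin d)) :
    ∫ ξ, phase (inner ℝ ξ x) * initialWave φ ε k ξ ∂initialMeasure d ε =
      initialAmplitude φ ε x k := by
  unfold initialWave initialMeasure initialAmplitude
  split_ifs
  · rw [integral_dirac]
    simp [phase_zero]
  · have h : 𝓕⁻ (𝓕 (schwartzSlice φ k)) x = φ (x, k) := by
      rw [fourierInv_fourier_eq]
      rfl
    rw [← h, SchwartzMap.fourierInv_coe, Real.fourierInv_eq']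
    refine integral_congr_ae (Filter.Eventually.of_forall fun ξ => ?_)
    simp only [smul_eq_mul, phase]
    congr 2
    push_cast
    ring

end InitialData

/-! ### The Schrödinger operator and interaction trees -/

section SchrodingerOperator

variable {d : ℕ} {W : Type*} [NormedAddCommGroup W] [NormedSpace ℂ W] [NormedSpace ℝ W]
  [IsScalarTower ℝ ℂ W] [SMulCommClass ℝ ℂ W]

/-- The operator `i ∂ₜ + i b·∇ + c Δ`. -/
noncomputable def schrodingerOp (b : EuclideanSpace ℝ (Fin d)) (c : ℝ)
    (f : ℝ → EuclideanSpace ℝ (Fin d) → W) (t : ℝ) (x : EuclideanSpace ℝ (Fin d)) : W :=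
  Complex.I • deriv (fun s => f s x) t + Complex.I • fderiv ℝ (f t) x b
    + (c : ℂ) • Laplacian.laplacian (f t) x

/-- Functions of `(t, x)` that are differentiable, and smooth in `x`. -/
structure IsSmoothField (f : ℝ → EuclideanSpace ℝ (Fin d) → W) : Prop where
  differentiable : Differentiable ℝ fun p : ℝ × EuclideanSpace ℝ (Fin d) => f p.1 p.2
  contDiff : ∀ t, ContDiff ℝ (⊤ : ℕ∞) (f t)

namespace IsSmoothField

variable {f f' : ℝ → EuclideanSpace ℝ (Fin d) → W} {b : EuclideanSpace ℝ (Fin d)} {c : ℝ}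

theorem differentiableAt_space (hf : IsSmoothField f) (t : ℝ) (x : EuclideanSpace ℝ (Fin d)) :
    DifferentiableAt ℝ (f t) x := (hf.contDiff t).differentiable (by simp) x

theorem differentiableAt_time (hf : IsSmoothField f) (t : ℝ) (x : EuclideanSpace ℝ (Fin d)) :
    DifferentiableAt ℝ (fun s => f s x) t := (hasDerivAt_time hf.differentiable t x).differentiableAt

theorem contDiffAt_two (hf : IsSmoothField f) (t : ℝ) (x : EuclideanSpace ℝ (Fin d)) :
    ContDiffAt ℝ 2 (f t) x := ((contDiff_infty.1 (hf.contDiff t)) 2).contDiffAt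

theorem zero : IsSmoothField fun (_ : ℝ) (_ : EuclideanSpace ℝ (Fin d)) => (0 : W) :=
  ⟨differentiable_const _, fun _ => contDiff_const⟩

theorem sub (hf : IsSmoothField f) (hf' : IsSmoothField f') :
    IsSmoothField fun t x => f t x - f' t x :=
  ⟨hf.differentiable.sub hf'.differentiable, fun t => (hf.contDiff t).sub (hf'.contDiff t)⟩

theorem smul (hf : IsSmoothField f) (z : ℂ) : IsSmoothField fun t x => z • f t x :=
  ⟨hf.differentiable.const_smul z, fun t => (hf.contDiff t).const_smul z⟩

theorem sum {ι : Type*} {s : Finset ι} {f : ι → ℝ → EuclideanSpace ℝ (Fin d) → W}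
    (hf : ∀ i ∈ s, IsSmoothField (f i)) : IsSmoothField fun t x => ∑ i ∈ s, f i t x :=
  ⟨Differentiable.fun_sum fun i hi => (hf i hi).differentiable,
    fun t => ContDiff.sum fun i hi => (hf i hi).contDiff t⟩

theorem schrodingerOp_add (hf : IsSmoothField f) (hf' : IsSmoothField f') (t : ℝ)
    (x : EuclideanSpace ℝ (Fin d)) : schrodingerOp b c (fun t x => f t x + f' t x) t x =
      schrodingerOp b c f t x + schrodingerOp b c f' t x := by
  have h3 : Laplacian.laplacian (fun x => f t x + f' t x) x =
      Laplacian.laplacian (f t) x + Laplacian.laplacian (f' t) x :=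
    (hf.contDiffAt_two t x).laplacian_add (hf'.contDiffAt_two t x)
  rw [schrodingerOp, schrodingerOp, schrodingerOp, deriv_fun_add (hf.differentiableAt_time t x)
    (hf'.differentiableAt_time t x), fderiv_fun_add (hf.differentiableAt_space t x)
    (hf'.differentiableAt_space t x), h3, _root_.add_apply]
  simp only [smul_add]
  abel

theorem schrodingerOp_smul (hf : IsSmoothField f) (z : ℂ) (t : ℝ)
    (x : EuclideanSpace ℝ (Fin d)) : schrodingerOp b c (fun t x => z • f t x) t x =
      z • schrodingerOp b c f t x := by
  have h3 : Laplacian.laplacian (fun x => z • f t x) x = z • Laplacian.laplacian (f t) x :=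
    (hf.contDiffAt_two t x).laplacian_CLM_comp_left
      (l := z • ContinuousLinearMap.id ℝ W)
  rw [schrodingerOp, schrodingerOp, deriv_fun_const_smul z (hf.differentiableAt_time t x),
    fderiv_fun_const_smul (hf.differentiableAt_space t x), h3, _root_.smul_apply]
  simp only [smul_add, smul_smul, mul_comm]

theorem schrodingerOp_sub (hf : IsSmoothField f) (hf' : IsSmoothField f') (t : ℝ)
    (x : EuclideanSpace ℝ (Fin d)) : schrodingerOp b c (fun t x => f t x - f' t x) t x =
      schrodingerOp b c f t x - schrodingerOp b c f' t x := by
  have h := hf.schrodingerOp_add (b := b) (c := c) (hf'.smul (-1)) t x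
  rw [hf'.schrodingerOp_smul] at h
  simpa only [neg_smul, one_smul, ← sub_eq_add_neg] using h

theorem schrodingerOp_sum {ι : Type*} {s : Finset ι} {f : ι → ℝ → EuclideanSpace ℝ (Fin d) → W}
    (hf : ∀ i ∈ s, IsSmoothField (f i)) (t : ℝ) (x : EuclideanSpace ℝ (Fin d)) :
    schrodingerOp b c (fun t x => ∑ i ∈ s, f i t x) t x = ∑ i ∈ s, schrodingerOp b c (f i) t x := by
  classical
  induction s using Finset.induction_on with
  | empty =>
    have h := (zero (d := d) (W := W)).schrodingerOp_smul (b := b) (c := c) 0 t x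
    simpa using h
  | insert i s hi ih =>
    simp only [Finset.sum_insert hi]
    rw [schrodingerOp_add (hf i (Finset.mem_insert_self i s))
      (sum fun j hj => hf j (Finset.mem_insert_of_mem hj)),
      ih fun j hj => hf j (Finset.mem_insert_of_mem hj)]

end IsSmoothField

end SchrodingerOperator

namespace Packet

variable {d : ℕ} {L : ℝ} {V : Type*} [NormedAddCommGroup V] [NormedSpace ℝ V] [NormedSpace ℂ V]
  [IsScalarTower ℝ ℂ V] [SMulCommClass ℝ ℂ V] [CompleteSpace V] (p : Packet d L V) (ε : ℝ)

theorem isSmoothField_profile (m : Fin d → ℤ) : IsSmoothField (p.profile ε m) :=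
  ⟨p.differentiable_profile ε m, p.contDiff_profile ε m⟩

theorem isSmoothField_field : IsSmoothField (p.field ε) :=
  ⟨p.differentiable_field ε, p.contDiff_field ε⟩

theorem schrodingerOp_profile (m : Fin d → ℤ) (t : ℝ) (x : EuclideanSpace ℝ (Fin d)) :
    schrodingerOp (ε • wavenumber L m) (ε ^ 2 / (4 * Real.pi)) (p.profile ε m) t x =
      Complex.I • wave (p.σ.restrict (p.fiber m)) p.freq
        (p.profileTime ε (wavenumber L m)) p.ampDeriv t x :=
  p.schrodinger_profile ε m t x

theorem schrodingerOp_field (t : ℝ) (x : EuclideanSpace ℝ (Fin d)) :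
    schrodingerOp 0 (1 / (4 * Real.pi)) (p.field ε) t x =
      Complex.I • wave p.σ (p.kappa ε) (fun y => -‖p.kappa ε y‖ ^ 2 / 2) p.ampDeriv t x := by
  rw [schrodingerOp, map_zero, smul_zero, add_zero]
  exact p.schrodinger_field ε t x

end Packet

section ClosedSubspace

variable {V : Type*} [NormedAddCommGroup V] [InnerProductSpace ℂ V] [NormedSpace ℝ V]
  [IsScalarTower ℝ ℂ V] [CompleteSpace V] {K : Submodule ℂ V}

/-- No integrability is needed: otherwise the integral is zero. -/
theorem integral_mem_of_isClosed (hK : IsClosed (K : Set V)) {Y : Type*} [MeasurableSpace Y]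
    {μ : Measure Y} {f : Y → V} (hf : ∀ᵐ y ∂μ, f y ∈ K) : ∫ y, f y ∂μ ∈ K := by
  have : CompleteSpace K := hK.completeSpace_coe
  by_cases hi : Integrable f μ
  · rw [← Submodule.starProjection_eq_self_iff, ← ContinuousLinearMap.integral_comp_comm _ hi]
    refine integral_congr_ae ?_
    filter_upwards [hf] with y hy
    exact Submodule.starProjection_eq_self_iff.2 hy
  · rw [integral_undef hi]
    exact K.zero_mem

end ClosedSubspace

/-- Ternary trees: the histories of successive cubic interactions of linear waves. -/
inductive InteractionTree : Type
  | leaf : InteractionTree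
  | node : InteractionTree → InteractionTree → InteractionTree → InteractionTree

namespace InteractionTree

/-- The number of leaves: the order of the chaos in which the interaction takes place. -/
def leaves : InteractionTree → ℕ
  | leaf => 1
  | node x y z => x.leaves + y.leaves + z.leaves

theorem odd_leaves (τ : InteractionTree) : Odd τ.leaves := by
  induction τ with
  | leaf => exact odd_one
  | node x y z hx hy hz => exact (hx.add_odd hy).add_odd hz

theorem finite_setOf_leaves_le (n : ℕ) : {τ : InteractionTree | τ.leaves ≤ n}.Finite := by
  induction n with
  | zero =>
    refine Set.Finite.subset Set.finite_empty fun τ hτ => ?_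
    have h : τ.leaves ≤ 0 := hτ
    have := τ.odd_leaves.pos
    omega
  | succ n ih =>
    refine ((Set.finite_singleton leaf).union ((ih.prod (ih.prod ih)).image
      fun p => node p.1 p.2.1 p.2.2)).subset fun τ hτ => ?_
    cases τ with
    | leaf => exact Or.inl rfl
    | node x y z =>
      have hx := x.odd_leaves.pos
      have hy := y.odd_leaves.pos
      have hz := z.odd_leaves.pos
      have h : x.leaves + y.leaves + z.leaves ≤ n + 1 := hτ
      refine Or.inr ⟨(x, y, z), ⟨?_, ?_, ?_⟩, rfl⟩
      · exact (by omega : x.leaves ≤ n)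
      · exact (by omega : y.leaves ≤ n)
      · exact (by omega : z.leaves ≤ n)

/-- The trees with `n` leaves. -/
noncomputable def trees (n : ℕ) : Finset InteractionTree :=
  ((finite_setOf_leaves_le n).subset (t := {τ | τ.leaves = n}) fun τ (h : τ.leaves = n) =>
    (le_of_eq h : τ.leaves ≤ n)).toFinset

theorem mem_trees {n : ℕ} {τ : InteractionTree} : τ ∈ trees n ↔ τ.leaves = n := by
  simp [trees]

theorem trees_eq_empty (n : ℕ) : trees (2 * n) = ∅ := by
  refine Finset.eq_empty_of_forall_notMem fun τ hτ => ?_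
  have h := τ.odd_leaves
  rw [mem_trees.1 hτ] at h
  exact Nat.not_odd_iff_even.2 (even_two_mul n) h

/-- Sums over trees, split according to the three branches at the root. -/
theorem sum_trees {M : Type*} [AddCommMonoid M] (n : ℕ) (f : InteractionTree → M) :
    ∑ τ ∈ trees n, f τ = (if n = 1 then f leaf else 0) +
      ∑ sc ∈ Finset.HasAntidiagonal.antidiagonal n,
        ∑ ab ∈ Finset.HasAntidiagonal.antidiagonal sc.1,
          ∑ x ∈ trees ab.1, ∑ y ∈ trees ab.2, ∑ z ∈ trees sc.2, f (node x y z) := by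
  classical
  have h1 : ∑ sc ∈ Finset.HasAntidiagonal.antidiagonal n,
        ∑ ab ∈ Finset.HasAntidiagonal.antidiagonal sc.1,
          ∑ x ∈ trees ab.1, ∑ y ∈ trees ab.2, ∑ z ∈ trees sc.2, f (node x y z) =
      ∑ τ ∈ (trees n).filter (· ≠ leaf), f τ := by
    simp only [Finset.sum_sigma']
    refine Finset.sum_bij' (fun q _ => node q.2.2.1 q.2.2.2.1 q.2.2.2.2)
      (fun τ _ => match τ with
        | leaf => ⟨(0, 0), (0, 0), leaf, leaf, leaf⟩
        | node x y z => ⟨(x.leaves + y.leaves, z.leaves), (x.leaves, y.leaves), x, y, z⟩)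
      ?_ ?_ ?_ ?_ ?_
    · rintro ⟨⟨s, c⟩, ⟨a, b⟩, x, y, z⟩ h
      simp only [Finset.mem_sigma, Finset.HasAntidiagonal.mem_antidiagonal, mem_trees] at h
      simp only [Finset.mem_filter, mem_trees, leaves, ne_eq, reduceCtorEq, not_false_eq_true,
        and_true]
      omega
    · rintro τ h
      cases τ with
      | leaf => simp at h
      | node x y z =>
        simp only [Finset.mem_filter, mem_trees, leaves] at h
        simp only [Finset.mem_sigma, Finset.HasAntidiagonal.mem_antidiagonal, mem_trees, and_self, and_true]
        exact h.1
    · rintro ⟨⟨s, c⟩, ⟨a, b⟩, x, y, z⟩ h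
      simp only [Finset.mem_sigma, Finset.HasAntidiagonal.mem_antidiagonal, mem_trees] at h
      obtain ⟨h1, h2, rfl, rfl, rfl⟩ := h
      change x.leaves + y.leaves = s at h2
      subst h2
      rfl
    · rintro τ h
      cases τ with
      | leaf => simp at h
      | node x y z => rfl
    · intros
      rfl
  rw [h1, ← Finset.sum_filter_add_sum_filter_not (trees n) (· = leaf)]
  congr 1
  rw [Finset.sum_filter, Finset.sum_ite_eq' (trees n) leaf f]
  simp only [mem_trees, leaves, eq_comm]

end InteractionTree

/-! ### The tree expansion of the solution -/

namespace GaussianHilbertSpace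

variable {Ω : Type*} [MeasurableSpace Ω] {P : Measure Ω} [IsProbabilityMeasure P]

/-- The map `(X, Y) ↦ πₙ (X Ȳ)` on chaoses of orders `p` and `q`, as a real bilinear map. -/
noncomputable def wickConjL (H : GaussianHilbertSpace P) (p q n : ℕ) :
    H.chaos p →L[ℝ] H.chaos q →L[ℝ] H.chaos n :=
  ((H.wickL p q n).bilinearRestrictScalars ℝ).bilinearComp (ContinuousLinearMap.id ℝ _) (H.conjL q)

theorem wickConjL_apply (H : GaussianHilbertSpace P) {p q n : ℕ} (X : H.chaos p) (Y : H.chaos q) :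
    H.wickConjL p q n X Y = H.wickL p q n X (H.conjL q Y) := rfl

/-- The Wick product of chaos components as a real bilinear map. -/
noncomputable def wickRealL (H : GaussianHilbertSpace P) (p q n : ℕ) :
    H.chaos p →L[ℝ] H.chaos q →L[ℝ] H.chaos n :=
  (H.wickL p q n).bilinearRestrictScalars ℝ

theorem wickRealL_apply (H : GaussianHilbertSpace P) {p q n : ℕ} (X : H.chaos p) (Y : H.chaos q) :
    H.wickRealL p q n X Y = H.wickL p q n X Y := rfl

theorem wickRealL_wickConjL_smul (H : GaussianHilbertSpace P) {a b c s n : ℕ} (z₁ z₂ z₃ : ℂ)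
    (X : H.chaos a) (Y : H.chaos b) (Z : H.chaos c) :
    H.wickRealL s c n (H.wickConjL a b s (z₁ • X) (z₂ • Y)) (z₃ • Z) =
      (z₁ * (starRingEnd ℂ) z₂ * z₃) • H.wickRealL s c n (H.wickConjL a b s X Y) Z := by
  simp only [wickRealL_apply, wickConjL_apply, conjL_smul, map_smul, _root_.smul_apply, smul_smul]
  congr 1
  ring

theorem norm_ofFirst_le (H : GaussianHilbertSpace P) {K : Type*} {g : K → H.chaos 1} {R : ℝ}
    (hR : 0 ≤ R) (hg : ∀ m, ‖g m‖ ≤ R) (n : ℕ) (m : K) : ‖H.ofFirst (g m) n‖ ≤ R := by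
  by_cases hn : n = 1
  · subst hn
    simpa [ofFirst] using hg m
  · simpa [ofFirst, hn] using hR

variable (H : GaussianHilbertSpace P) {d : ℕ} {L : ℝ} (hL : 0 < L) (lam ε : ℝ)
  (φ : 𝓢(EuclideanSpace ℝ (Fin d) × EuclideanSpace ℝ (Fin d), ℂ))
  {g : (Fin d → ℤ) → H.chaos 1} (hg : ∀ m, ‖g m‖ ≤ 1)

/-- The wave packet generated by a tree of interactions. For `n = τ.leaves` it lives in the chaos
of order `n`. -/
noncomputable def treePacket : InteractionTree → (n : ℕ) → Packet d L (H.chaos n)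
  | .leaf, n => Packet.free hL (integrable_initialMeasure d ε)
      (fun m => measurable_initialWave φ ε (wavenumber L m))
      (fun N => (exists_initialWave_decay φ ε N).imp fun _ h m ξ => h (wavenumber L m) ξ)
      (H.norm_ofFirst_le zero_le_one hg n)
  | .node x y z, n => Packet.cubic (treePacket x x.leaves) (treePacket y y.leaves)
      (treePacket z z.leaves) ε (Complex.I * (lam / L ^ d))
      (H.wickConjL x.leaves y.leaves (x.leaves + y.leaves))
      (H.wickRealL (x.leaves + y.leaves) z.leaves n)

/-- The solution of the profile system: in the chaos of order `n`, the sum over all interaction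
trees with `n` leaves. -/
noncomputable def profileSolution (m : Fin d → ℤ) (t : ℝ) (x : EuclideanSpace ℝ (Fin d)) :
    H.Formal := fun n =>
  ∑ τ ∈ InteractionTree.trees n, (H.treePacket hL lam ε φ hg τ n).profile ε m t x

/-- The sum of all the waves of all interaction trees. -/
noncomputable def fieldSolution (t : ℝ) (x : EuclideanSpace ℝ (Fin d)) : H.Formal := fun n =>
  ∑ τ ∈ InteractionTree.trees n, (H.treePacket hL lam ε φ hg τ n).field ε t x

/-- The nonlinearity of a sum over trees is the sum over the trees with at least two branches. -/
theorem cubic_sum_trees (F₁ F₂ F₃ : (n : ℕ) → InteractionTree → H.chaos n) (n : ℕ) :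
    (H.wick (H.wick (fun n => ∑ τ ∈ InteractionTree.trees n, F₁ n τ)
        (H.conj fun n => ∑ τ ∈ InteractionTree.trees n, F₂ n τ))
        (fun n => ∑ τ ∈ InteractionTree.trees n, F₃ n τ)) n =
      ∑ sc ∈ Finset.HasAntidiagonal.antidiagonal n,
        ∑ ab ∈ Finset.HasAntidiagonal.antidiagonal sc.1,
          ∑ x ∈ InteractionTree.trees ab.1, ∑ y ∈ InteractionTree.trees ab.2,
            ∑ z ∈ InteractionTree.trees sc.2,
              H.wickRealL (x.leaves + y.leaves) z.leaves n
                (H.wickConjL x.leaves y.leaves (x.leaves + y.leaves) (F₁ x.leaves x)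
                  (F₂ y.leaves y)) (F₃ z.leaves z) := by
  rw [wick_wick_conj_apply]
  refine Finset.sum_congr rfl fun sc _ => Finset.sum_congr rfl fun ab hab => ?_
  obtain ⟨s, c⟩ := sc
  obtain ⟨a, b⟩ := ab
  rw [Finset.HasAntidiagonal.mem_antidiagonal] at hab
  change a + b = s at hab
  subst hab
  simp only [map_sum, _root_.sum_apply]
  rw [Finset.sum_congr rfl fun _ _ => Finset.sum_comm, Finset.sum_comm]
  refine Finset.sum_congr rfl fun x hx => ?_
  rw [Finset.sum_comm]
  refine Finset.sum_congr rfl fun y hy => Finset.sum_congr rfl fun z hz => ?_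
  rw [InteractionTree.mem_trees] at hx hy hz
  subst hx hy hz
  rfl

theorem isSmoothField_profileSolution (m : Fin d → ℤ) (n : ℕ) :
    IsSmoothField fun t x => H.profileSolution hL lam ε φ hg m t x n :=
  IsSmoothField.sum fun τ _ => (H.treePacket hL lam ε φ hg τ n).isSmoothField_profile ε m

theorem isSmoothField_fieldSolution (n : ℕ) :
    IsSmoothField fun t x => H.fieldSolution hL lam ε φ hg t x n :=
  IsSmoothField.sum fun τ _ => (H.treePacket hL lam ε φ hg τ n).isSmoothField_field ε

theorem profileOp_apply {A : ℝ → EuclideanSpace ℝ (Fin d) → H.Formal}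
    (k : EuclideanSpace ℝ (Fin d)) (t : ℝ) (x : EuclideanSpace ℝ (Fin d)) (n : ℕ) :
    profileOp H ε k A t x n =
      schrodingerOp (ε • k) (ε ^ 2 / (4 * Real.pi)) (fun t x => A t x n) t x := by
  simp only [profileOp, schrodingerOp, map_smul]
  rw [← complex_coe_smul (W := H.chaos n) ε ((fderiv ℝ (fun y => A t y n) x) k), smul_smul]
  push_cast
  rfl

theorem schrodingerOp_leaf (n : ℕ) (m : Fin d → ℤ) (t : ℝ) (x : EuclideanSpace ℝ (Fin d)) :
    schrodingerOp (ε • wavenumber L m) (ε ^ 2 / (4 * Real.pi))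
      ((H.treePacket hL lam ε φ hg .leaf n).profile ε m) t x = 0 := by
  rw [Packet.schrodingerOp_profile]
  refine (congrArg _ ?_).trans (smul_zero _)
  exact Packet.free_ampDeriv_wave ..

/-- The profiles of a tree are driven by the cubic interactions of the profiles of its three
branches. -/
theorem hasSum_schrodingerOp_node (τ₁ τ₂ τ₃ : InteractionTree) (n : ℕ) (m : Fin d → ℤ) (t : ℝ)
    (x : EuclideanSpace ℝ (Fin d)) :
    HasSum (fun q : Triad m =>
        (-(lam / L ^ d : ℂ) * phase (t * resonance (wavenumber L q.1.1) (wavenumber L q.1.2.1)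
            (wavenumber L q.1.2.2))) •
          H.wickRealL (τ₁.leaves + τ₂.leaves) τ₃.leaves n
            (H.wickConjL τ₁.leaves τ₂.leaves (τ₁.leaves + τ₂.leaves)
              ((H.treePacket hL lam ε φ hg τ₁ τ₁.leaves).profile ε q.1.1 t x)
              ((H.treePacket hL lam ε φ hg τ₂ τ₂.leaves).profile ε q.1.2.1 t x))
            ((H.treePacket hL lam ε φ hg τ₃ τ₃.leaves).profile ε q.1.2.2 t x))
      (schrodingerOp (ε • wavenumber L m) (ε ^ 2 / (4 * Real.pi))
        ((H.treePacket hL lam ε φ hg (.node τ₁ τ₂ τ₃) n).profile ε m) t x) := by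
  rw [Packet.schrodingerOp_profile]
  have h := (Packet.hasSum_profile_cubic (H.treePacket hL lam ε φ hg τ₁ τ₁.leaves)
    (H.treePacket hL lam ε φ hg τ₂ τ₂.leaves) (H.treePacket hL lam ε φ hg τ₃ τ₃.leaves) ε
    (Complex.I * (lam / L ^ d)) (fun z₁ z₂ z₃ X Y Z => H.wickRealL_wickConjL_smul (n := n)
      (s := τ₁.leaves + τ₂.leaves) z₁ z₂ z₃ X Y Z) m t x).const_smul Complex.I
  refine h.congr_fun fun q => ?_
  rw [smul_smul]
  congr 1
  linear_combination (-(lam / L ^ d : ℂ) * phase (t * resonance (wavenumber L q.1.1)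
    (wavenumber L q.1.2.1) (wavenumber L q.1.2.2))) * Complex.I_sq

/-- The profiles solve the profile system. -/
theorem hasSum_profileSolution (m : Fin d → ℤ) (t : ℝ) (x : EuclideanSpace ℝ (Fin d)) :
    HasSum (fun q : Triad m =>
        (-(lam / L ^ d : ℂ) * phase (t * resonance (wavenumber L q.1.1) (wavenumber L q.1.2.1)
            (wavenumber L q.1.2.2))) •
          H.wick (H.wick (H.profileSolution hL lam ε φ hg q.1.1 t x)
            (H.conj (H.profileSolution hL lam ε φ hg q.1.2.1 t x)))
            (H.profileSolution hL lam ε φ hg q.1.2.2 t x))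
      (profileOp H ε (wavenumber L m) (H.profileSolution hL lam ε φ hg m) t x) := by
  rw [Pi.hasSum]
  intro n
  rw [profileOp_apply]
  have h1 := IsSmoothField.schrodingerOp_sum (b := ε • wavenumber L m)
    (c := ε ^ 2 / (4 * Real.pi)) (s := InteractionTree.trees n)
    (fun τ _ => (H.treePacket hL lam ε φ hg τ n).isSmoothField_profile ε m) t x
  rw [InteractionTree.sum_trees, schrodingerOp_leaf, ite_self, zero_add] at h1
  change HasSum _ (schrodingerOp (ε • wavenumber L m) (ε ^ 2 / (4 * Real.pi))
    (fun t x => ∑ τ ∈ InteractionTree.trees n, (H.treePacket hL lam ε φ hg τ n).profile ε m t x)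
    t x)
  rw [h1]
  have h2 := hasSum_sum (f := fun (sc : ℕ × ℕ) (q : Triad m) => _)
    (s := Finset.HasAntidiagonal.antidiagonal n) fun sc _ => hasSum_sum
      (s := Finset.HasAntidiagonal.antidiagonal sc.1) fun ab _ => hasSum_sum
      (s := InteractionTree.trees ab.1) fun τ₁ _ => hasSum_sum
      (s := InteractionTree.trees ab.2) fun τ₂ _ => hasSum_sum
      (s := InteractionTree.trees sc.2) fun τ₃ _ =>
        H.hasSum_schrodingerOp_node hL lam ε φ hg τ₁ τ₂ τ₃ n m t x
  refine h2.congr_fun fun q => ?_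
  rw [Pi.smul_apply]
  have h3 := H.cubic_sum_trees
    (fun n τ => (H.treePacket hL lam ε φ hg τ n).profile ε q.1.1 t x)
    (fun n τ => (H.treePacket hL lam ε φ hg τ n).profile ε q.1.2.1 t x)
    (fun n τ => (H.treePacket hL lam ε φ hg τ n).profile ε q.1.2.2 t x) n
  refine (congrArg _ h3).trans ?_
  simp only [Finset.smul_sum]

end GaussianHilbertSpace

/-! ### Uniqueness for cubic hierarchies -/

theorem exists_bilinear_bound {E F G : Type*} [NormedAddCommGroup E] [NormedSpace ℂ E]
    [NormedAddCommGroup F] [NormedSpace ℂ F] [NormedAddCommGroup G] [NormedSpace ℂ G]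
    (B : E →L[ℂ] F →L[ℂ] G) : ∃ C : ℝ, 0 ≤ C ∧ ∀ x y, ‖B x y‖ ≤ C * ‖x‖ * ‖y‖ :=
  ⟨‖B‖, norm_nonneg B, B.le_opNorm₂⟩

theorem IsSmoothField.norm_iteratedFDeriv_sub_le {d : ℕ} {V : Type*} [NormedAddCommGroup V]
    [NormedSpace ℂ V] {f f' : ℝ → EuclideanSpace ℝ (Fin d) → V} (hf : IsSmoothField f)
    (hf' : IsSmoothField f') (j : ℕ) (t : ℝ) (x : EuclideanSpace ℝ (Fin d)) :
    ‖iteratedFDeriv ℝ j (fun x => f t x - f' t x) x‖ ≤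
      ‖iteratedFDeriv ℝ j (f t) x‖ + ‖iteratedFDeriv ℝ j (f' t) x‖ := by
  have h1 : iteratedFDeriv ℝ j (fun x => f t x - f' t x) x =
      iteratedFDeriv ℝ j (f t) x - iteratedFDeriv ℝ j (f' t) x :=
    iteratedFDeriv_sub_apply (contDiff_infty.1 (hf.contDiff t) j).contDiffAt
      (contDiff_infty.1 (hf'.contDiff t) j).contDiffAt
  rw [h1]
  exact norm_sub_le _ _

theorem IsSmoothField.norm_iteratedFDeriv_smul_le {d : ℕ} {V : Type*} [NormedAddCommGroup V]
    [NormedSpace ℂ V] {f : ℝ → EuclideanSpace ℝ (Fin d) → V} (hf : IsSmoothField f) (z : ℂ)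
    (j : ℕ) (t : ℝ) (x : EuclideanSpace ℝ (Fin d)) :
    ‖iteratedFDeriv ℝ j (fun x => z • f t x) x‖ ≤ ‖z‖ * ‖iteratedFDeriv ℝ j (f t) x‖ := by
  have h1 : iteratedFDeriv ℝ j (fun x => z • f t x) x = z • iteratedFDeriv ℝ j (f t) x :=
    iteratedFDeriv_const_smul_apply (contDiff_infty.1 (hf.contDiff t) j).contDiffAt
  rw [h1]
  exact norm_smul_le _ _

theorem IsSmoothField.norm_iteratedFDeriv_sum_le {d : ℕ} {V ι : Type*} [NormedAddCommGroup V]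
    [NormedSpace ℂ V] {f : ι → ℝ → EuclideanSpace ℝ (Fin d) → V} {s : Finset ι}
    (hf : ∀ i ∈ s, IsSmoothField (f i)) (j : ℕ) (t : ℝ) (x : EuclideanSpace ℝ (Fin d)) :
    ‖iteratedFDeriv ℝ j (fun x => ∑ i ∈ s, f i t x) x‖ ≤
      ∑ i ∈ s, ‖iteratedFDeriv ℝ j (f i t) x‖ := by
  have h1 : iteratedFDeriv ℝ j (fun x => ∑ i ∈ s, f i t x) x =
      ∑ i ∈ s, iteratedFDeriv ℝ j (f i t) x :=
    iteratedFDeriv_fun_sum_apply fun i hi =>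
      (contDiff_infty.1 ((hf i hi).contDiff t) j).contDiffAt
  rw [h1]
  exact norm_sum_le _ _

namespace GaussianHilbertSpace

variable {Ω : Type*} [MeasurableSpace Ω] {P : Measure Ω} [IsProbabilityMeasure P]

theorem wick_wick_conj_apply_zero (H : GaussianHilbertSpace P) (X Y Z : H.Formal) :
    H.wick (H.wick X (H.conj Y)) Z 0 = H.wickL 0 0 0 (H.wickL 0 0 0 (X 0) (H.conjL 0 (Y 0))) (Z 0) := by
  have e : Finset.HasAntidiagonal.antidiagonal (0 : ℕ) = {(0, 0)} := rfl
  rw [wick_wick_conj_apply, e, Finset.sum_singleton]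
  exact Finset.sum_singleton (fun ab : ℕ × ℕ =>
    H.wickL 0 0 0 (H.wickL ab.1 ab.2 0 (X ab.1) (H.conjL ab.2 (Y ab.2))) (Z 0)) (0, 0)

theorem norm_conjL (H : GaussianHilbertSpace P) (n : ℕ) (X : H.chaos n) : ‖H.conjL n X‖ = ‖X‖ :=
  norm_star_l2 _

theorem exists_norm_wick_wick_conj_le (H : GaussianHilbertSpace P) (n : ℕ) :
    ∃ C : ℝ, 0 ≤ C ∧ ∀ (z : ℂ) (X Y Z : H.chaos n),
      ‖z • H.wickL n n n (H.wickL n n n X (H.conjL n Y)) Z‖ ≤ ‖z‖ * (C * ‖X‖ * ‖Y‖ * ‖Z‖) := by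
  obtain ⟨C, hC, h⟩ := exists_bilinear_bound (H.wickL n n n)
  refine ⟨C * C, mul_nonneg hC hC, fun z X Y Z => ?_⟩
  rw [norm_smul]
  refine mul_le_mul_of_nonneg_left ?_ (norm_nonneg z)
  have h1 := h X (H.conjL n Y)
  rw [norm_conjL] at h1
  calc _ ≤ C * (C * ‖X‖ * ‖Y‖) * ‖Z‖ := (h _ _).trans
        (mul_le_mul_of_nonneg_right (mul_le_mul_of_nonneg_left h1 hC) (norm_nonneg Z))
    _ = _ := by ring

theorem wickL_zero_left (H : GaussianHilbertSpace P) {p q n : ℕ} (Y : H.chaos q) :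
    H.wickL p q n 0 Y = 0 := (H.wickL p q n).map_zero₂ Y

theorem wickL_zero_right (H : GaussianHilbertSpace P) {p q n : ℕ} (X : H.chaos p) :
    H.wickL p q n X 0 = 0 := (H.wickL p q n X).map_zero

theorem conjL_zero (H : GaussianHilbertSpace P) (n : ℕ) : H.conjL n 0 = 0 := (H.conjL n).map_zero

/-- If the components of order `0` vanish, the cubic nonlinearity at order `n` depends only on the
components of order less than `n`. -/
theorem wick_wick_conj_congr (H : GaussianHilbertSpace P) {X Y Z X' Y' Z' : H.Formal} {n : ℕ}
    (hX : X 0 = 0) (hY : Y 0 = 0) (hZ : Z 0 = 0) (hX' : ∀ k < n, X k = X' k)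
    (hY' : ∀ k < n, Y k = Y' k) (hZ' : ∀ k < n, Z k = Z' k) (h0 : X' 0 = 0) (h0' : Y' 0 = 0)
    (h0'' : Z' 0 = 0) :
    H.wick (H.wick X (H.conj Y)) Z n = H.wick (H.wick X' (H.conj Y')) Z' n := by
  rw [wick_wick_conj_apply, wick_wick_conj_apply]
  refine Finset.sum_congr rfl fun sc hsc => Finset.sum_congr rfl fun ab hab => ?_
  obtain ⟨s, c⟩ := sc
  obtain ⟨a, b⟩ := ab
  rw [Finset.HasAntidiagonal.mem_antidiagonal] at hsc hab
  change s + c = n at hsc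
  change a + b = s at hab
  change H.wickL s c n (H.wickL a b s (X a) (H.conjL b (Y b))) (Z c) =
    H.wickL s c n (H.wickL a b s (X' a) (H.conjL b (Y' b))) (Z' c)
  have hv : ∀ {X : H.Formal}, X 0 = 0 → ∀ {a : ℕ}, a = 0 → X a = 0 := by
    rintro X h _ rfl
    exact h
  rcases Nat.eq_zero_or_pos a with ha | ha
  · simp only [hv hX ha, hv h0 ha, wickL_zero_left]
  rcases Nat.eq_zero_or_pos b with hb | hb
  · simp only [hv hY hb, hv h0' hb, conjL_zero, wickL_zero_left, wickL_zero_right]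
  rcases Nat.eq_zero_or_pos c with hc | hc
  · simp only [hv hZ hc, hv h0'' hc, wickL_zero_right]
  rw [hX' a (by omega), hY' b (by omega), hZ' c (by omega)]

/-- A solution of the hierarchy of chaos components of a system of Schrödinger equations coupled by
Wick cubic interactions, in the class of functions with bounded derivatives. -/
structure IsCubicFlow (H : GaussianHilbertSpace P) {d : ℕ} {K : Type*} {Q : K → Type*}
    (r₁ r₂ r₃ : ∀ k, Q k → K) (γ : ∀ k, Q k → ℝ → ℂ) (b : K → EuclideanSpace ℝ (Fin d)) (c : ℝ)
    (X : K → ℝ → EuclideanSpace ℝ (Fin d) → H.Formal) : Prop where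
  smooth : ∀ k n, IsSmoothField fun t x => X k t x n
  bounded : ∀ (n j : ℕ) (T : ℝ), ∃ B : K → ℝ, Summable B ∧
    ∀ k t x, |t| ≤ T → ‖iteratedFDeriv ℝ j (fun x => X k t x n) x‖ ≤ B k
  equation : ∀ k t x n, HasSum (fun q => γ k q t • H.wick (H.wick (X (r₁ k q) t x)
    (H.conj (X (r₂ k q) t x))) (X (r₃ k q) t x) n)
      (schrodingerOp (b k) c (fun t x => X k t x n) t x)

variable {H : GaussianHilbertSpace P} {d : ℕ} {K : Type*} {Q : K → Type*} [∀ k, Countable (Q k)]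
  {r₁ r₂ r₃ : ∀ k, Q k → K} {γ : ∀ k, Q k → ℝ → ℂ} {b : K → EuclideanSpace ℝ (Fin d)} {c : ℝ}
  {X X' : K → ℝ → EuclideanSpace ℝ (Fin d) → H.Formal}

/-- With centered data, the component of order zero vanishes: the equation which it satisfies is
dominated by a linear one, with bounded coefficients. -/
theorem IsCubicFlow.apply_zero (hX : H.IsCubicFlow r₁ r₂ r₃ γ b c X)
    (h0 : ∀ k x, X k 0 x 0 = 0) {M : ℝ} (hγ : ∀ k q t, ‖γ k q t‖ ≤ M)
    (hinj : Function.Injective fun p : Σ k, Q k => (r₁ p.1 p.2, r₂ p.1 p.2, r₃ p.1 p.2))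
    (k : K) (t : ℝ) (x : EuclideanSpace ℝ (Fin d)) : X k t x 0 = 0 := by
  refine schrodinger_system_unique (f := fun k t x => X k t x 0) (r := r₃)
    (G := fun k => schrodingerOp (b k) c (fun t x => X k t x 0)) (b := b) (c := c) h0
    (fun k => (hX.smooth k 0).differentiable) (fun k => (hX.smooth k 0).contDiff)
    (hX.bounded 0) (fun k t x => rfl) (fun T => ?_) k t x
  obtain ⟨B, hBs, hB⟩ := hX.bounded 0 0 T
  obtain ⟨N, hN0, hN⟩ := H.exists_norm_wick_wick_conj_le 0
  simp only [norm_iteratedFDeriv_zero] at hB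
  -- In order zero the equation is cubic and closed; two of the three factors are bounded,
  -- and the third is kept as the unknown of a linear system.
  -- the coefficients of the dominating kernel
  let β : K → ℝ≥0∞ := fun k => ENNReal.ofReal (B k)
  let D : ℝ≥0∞ := ENNReal.ofReal (M * N)
  have hβ : ∑' k, β k ≠ ⊤ := hBs.tsum_ofReal_ne_top
  refine ⟨(D * ((∑' k, β k) * ∑' k, β k)).toNNReal,
    fun k q => D * (β (r₁ k q) * β (r₂ k q)), fun k t x ht => ?_, fun s => ?_⟩
  · have h1 := hX.equation k t x 0
    rw [← h1.tsum_eq]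
    refine enorm_tsum_le_tsum_enorm.trans (ENNReal.tsum_le_tsum fun q => ?_)
    rw [wick_wick_conj_apply_zero]
    have hM : 0 ≤ M := (norm_nonneg _).trans (hγ k q t)
    have b1 := hB (r₁ k q) t x ht
    have b2 := hB (r₂ k q) t x ht
    have n1 : 0 ≤ B (r₁ k q) := (norm_nonneg _).trans b1
    have n2 : 0 ≤ B (r₂ k q) := (norm_nonneg _).trans b2
    simp only [β, D]
    rw [← ENNReal.ofReal_mul n1, ← ENNReal.ofReal_mul (mul_nonneg hM hN0), ← ofReal_norm,
      ← ofReal_norm, ← ENNReal.ofReal_mul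
        (mul_nonneg (mul_nonneg hM hN0) (mul_nonneg n1 n2))]
    refine ENNReal.ofReal_le_ofReal ((hN _ _ _ _).trans ?_)
    have n3 : 0 ≤ ‖X (r₃ k q) t x 0‖ := norm_nonneg _
    have n4 : 0 ≤ ‖X (r₁ k q) t x 0‖ := norm_nonneg _
    have n5 : 0 ≤ ‖X (r₂ k q) t x 0‖ := norm_nonneg _
    calc _ ≤ M * (N * B (r₁ k q) * B (r₂ k q) * ‖X (r₃ k q) t x 0‖) :=
          mul_le_mul (hγ k q t) (mul_le_mul_of_nonneg_right (mul_le_mul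
            (mul_le_mul_of_nonneg_left b1 hN0) b2 n5 (mul_nonneg hN0 n1)) n3)
            (mul_nonneg (mul_nonneg (mul_nonneg hN0 n4) n5) n3) hM
      _ = _ := by ring
  · rw [ENNReal.coe_toNNReal (ENNReal.mul_ne_top ENNReal.ofReal_ne_top (ENNReal.mul_ne_top hβ hβ))]
    calc ∑' k, ∑' q, D * (β (r₁ k q) * β (r₂ k q)) * s (r₃ k q)
        = ∑' p : Σ k, Q k, D * (β (r₁ p.1 p.2) * β (r₂ p.1 p.2)) * s (r₃ p.1 p.2) :=
          (ENNReal.tsum_sigma' (fun p : Σ k, Q k =>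
            D * (β (r₁ p.1 p.2) * β (r₂ p.1 p.2)) * s (r₃ p.1 p.2))).symm
      _ ≤ ∑' p : K × K × K, D * (β p.1 * β p.2.1) * s p.2.2 :=
          ENNReal.tsum_comp_le_tsum_of_injective hinj
            fun p : K × K × K => D * (β p.1 * β p.2.1) * s p.2.2
      _ = _ := by
          simp only [ENNReal.tsum_prod', mul_assoc, ENNReal.tsum_mul_left, ENNReal.tsum_mul_right]
          rfl

/-- Uniqueness for the cubic hierarchy with centered data: order by order, the nonlinearity is
determined by the lower orders. -/
theorem IsCubicFlow.unique (hX : H.IsCubicFlow r₁ r₂ r₃ γ b c X)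
    (hX' : H.IsCubicFlow r₁ r₂ r₃ γ b c X')
    (h0 : ∀ k x, X k 0 x 0 = 0) (hinit : ∀ k x, X k 0 x = X' k 0 x) {M : ℝ}
    (hγ : ∀ k q t, ‖γ k q t‖ ≤ M)
    (hinj : Function.Injective fun p : Σ k, Q k => (r₁ p.1 p.2, r₂ p.1 p.2, r₃ p.1 p.2)) :
    X = X' := by
  have z := hX.apply_zero h0 hγ hinj
  have z' := hX'.apply_zero (fun k x => by rw [← hinit, h0]) hγ hinj
  have key : ∀ n k t x, X k t x n = X' k t x n := by
    intro n
    induction n using Nat.strong_induction_on with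
    | _ n ih =>
      intro k t x
      rw [← sub_eq_zero]
      refine schrodinger_system_unique (Q := fun _ => Empty)
        (f := fun k t x => X k t x n - X' k t x n) (r := fun _ q => q.elim)
        (G := fun _ _ _ => 0) (b := b) (c := c) (fun k x => by rw [hinit, sub_self])
        (fun k => ((hX.smooth k n).sub (hX'.smooth k n)).differentiable)
        (fun k => ((hX.smooth k n).sub (hX'.smooth k n)).contDiff) (fun j T => ?_)
        (fun k t x => ?_) (fun T => ⟨0, fun _ _ => 0, fun _ _ _ _ => (enorm_zero (E := H.chaos n)).trans_le zero_le,
          fun s => by simp⟩)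
        k t x
      · obtain ⟨B, hBs, hB⟩ := hX.bounded n j T
        obtain ⟨B', hBs', hB'⟩ := hX'.bounded n j T
        refine ⟨fun k => B k + B' k, hBs.add hBs', fun k t x ht => ?_⟩
        exact ((hX.smooth k n).norm_iteratedFDeriv_sub_le (hX'.smooth k n) j t x).trans
          (add_le_add (hB k t x ht) (hB' k t x ht))
      · change schrodingerOp (b k) c (fun t x => X k t x n - X' k t x n) t x = 0
        rw [(hX.smooth k n).schrodingerOp_sub (hX'.smooth k n), sub_eq_zero]
        refine (hX.equation k t x n).unique ((hX'.equation k t x n).congr_fun fun q => ?_)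
        rw [H.wick_wick_conj_congr (z _ t x) (z _ t x) (z _ t x) (fun j hj => ih j hj _ t x)
          (fun j hj => ih j hj _ t x) (fun j hj => ih j hj _ t x) (z' _ t x) (z' _ t x) (z' _ t x)]
  funext k t x n
  exact key n k t x

end GaussianHilbertSpace

/-! ### The profile system -/

namespace GaussianHilbertSpace

variable {Ω : Type*} [MeasurableSpace Ω] {P : Measure Ω} [IsProbabilityMeasure P]

variable (H : GaussianHilbertSpace P) {d : ℕ} {L : ℝ} (hL : 0 < L) (lam ε : ℝ)
  (φ : 𝓢(EuclideanSpace ℝ (Fin d) × EuclideanSpace ℝ (Fin d), ℂ))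
  {g : (Fin d → ℤ) → H.chaos 1} (hg : ∀ m, ‖g m‖ ≤ 1)

/-- At time zero only the tree without interactions contributes. -/
theorem profileSolution_zero (m : Fin d → ℤ) (x : EuclideanSpace ℝ (Fin d)) :
    H.profileSolution hL lam ε φ hg m 0 x =
      initialAmplitude φ ε x (wavenumber L m) • H.ofFirst (g m) := by
  funext n
  have h1 : (H.treePacket hL lam ε φ hg .leaf n).profile ε m 0 x =
      initialAmplitude φ ε x (wavenumber L m) • H.ofFirst (g m) n := by
    rw [← integral_initialWave]
    exact Packet.free_profile_zero ..
  have h2 : ∀ τ₁ τ₂ τ₃, (H.treePacket hL lam ε φ hg (.node τ₁ τ₂ τ₃) n).profile ε m 0 x = 0 :=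
    fun τ₁ τ₂ τ₃ => Packet.cubic_profile_zero ..
  rw [profileSolution, InteractionTree.sum_trees, h1]
  simp only [h2, Finset.sum_const_zero, add_zero, Pi.smul_apply]
  split_ifs with hn
  · rfl
  · rw [ofFirst, Pi.single_eq_of_ne hn, smul_zero]

theorem exists_summable_bound_profileSolution (n j : ℕ) (T : ℝ) :
    ∃ b : (Fin d → ℤ) → ℝ, Summable b ∧ ∀ m t x, |t| ≤ T →
      ‖iteratedFDeriv ℝ j (fun x => H.profileSolution hL lam ε φ hg m t x n) x‖ ≤ b m := by
  choose b hbs hb using fun τ => (H.treePacket hL lam ε φ hg τ n).exists_summable_bound ε j T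
  refine ⟨fun m => ∑ τ ∈ InteractionTree.trees n, b τ m, summable_sum fun τ _ => hbs τ,
    fun m t x ht => ?_⟩
  exact (IsSmoothField.norm_iteratedFDeriv_sum_le (s := InteractionTree.trees n) (fun τ _ =>
    (H.treePacket hL lam ε φ hg τ n).isSmoothField_profile ε m) j t x).trans
      (Finset.sum_le_sum fun τ _ => hb τ m t x ht)

theorem isProfileSolution_profileSolution :
    IsProfileSolution H lam L ε φ g (H.profileSolution hL lam ε φ hg) where
  initial := H.profileSolution_zero hL lam ε φ hg
  differentiable m n := (H.isSmoothField_profileSolution hL lam ε φ hg m n).differentiable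
  equation := H.hasSum_profileSolution hL lam ε φ hg
  regular n := ⟨fun m => (H.isSmoothField_profileSolution hL lam ε φ hg m n).contDiff,
    H.exists_summable_bound_profileSolution hL lam ε φ hg n⟩

theorem profileSolution_even (m : Fin d → ℤ) (n : ℕ) (t : ℝ) (x : EuclideanSpace ℝ (Fin d)) :
    H.profileSolution hL lam ε φ hg m t x (2 * n) = 0 := by
  rw [profileSolution, InteractionTree.trees_eq_empty, Finset.sum_empty]

/-- The waves of a packet generated by a tree have, as random variables, the momentum by which they
are labelled. -/
theorem treePacket_amp_mem_momentumSpace (τ : InteractionTree) {n : ℕ} (hn : τ.leaves = n) (t : ℝ)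
    (y : (H.treePacket hL lam ε φ hg τ n).Y) :
    (H.treePacket hL lam ε φ hg τ n).amp t y ∈
      H.momentumSpace g n ((H.treePacket hL lam ε φ hg τ n).label y) := by
  induction τ generalizing n t with
  | leaf =>
    subst hn
    refine Submodule.smul_mem _ _ ?_
    have h : H.ofFirst (g y.1) 1 = g y.1 := Pi.single_eq_same ..
    change H.ofFirst (g y.1) 1 ∈ _
    rw [h]
    exact mem_momentumSpace_one _
  | node τ₁ τ₂ τ₃ ih₁ ih₂ ih₃ =>
    have key : ∀ s, Packet.cubicDeriv (H.treePacket hL lam ε φ hg τ₁ τ₁.leaves)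
        (H.treePacket hL lam ε φ hg τ₂ τ₂.leaves) (H.treePacket hL lam ε φ hg τ₃ τ₃.leaves) ε
        (Complex.I * (lam / L ^ d)) (H.wickConjL τ₁.leaves τ₂.leaves (τ₁.leaves + τ₂.leaves))
        (H.wickRealL (τ₁.leaves + τ₂.leaves) τ₃.leaves n) s y ∈ H.momentumSpace g n
          ((H.treePacket hL lam ε φ hg (.node τ₁ τ₂ τ₃) n).label y) := by
      intro s
      refine Submodule.smul_mem _ _ ?_
      rw [wickRealL_apply, wickConjL_apply]
      refine wickL_mem_momentumSpace hn ?_ (ih₃ rfl s _)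
      rw [sub_eq_add_neg]
      exact wickL_mem_momentumSpace rfl (ih₁ rfl s _) (conjL_mem_momentumSpace (ih₂ rfl s _))
    change (∫ s in (0 : ℝ)..t, _) ∈ _
    rw [intervalIntegral]
    exact Submodule.sub_mem _
      (integral_mem_of_isClosed (isClosed_momentumSpace n _) (Filter.Eventually.of_forall key))
      (integral_mem_of_isClosed (isClosed_momentumSpace n _) (Filter.Eventually.of_forall key))

theorem profileSolution_mem_momentumSpace (m : Fin d → ℤ) (t : ℝ) (x : EuclideanSpace ℝ (Fin d))
    (n : ℕ) : H.profileSolution hL lam ε φ hg m t x n ∈ H.momentumSpace g n m := by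
  refine Submodule.sum_mem _ fun τ hτ => ?_
  refine integral_mem_of_isClosed (isClosed_momentumSpace n _) ?_
  filter_upwards [ae_restrict_mem ((H.treePacket hL lam ε φ hg τ n).measurableSet_fiber m)]
    with y hy
  refine Submodule.smul_mem _ _ ?_
  have h := H.treePacket_amp_mem_momentumSpace hL lam ε φ hg τ (InteractionTree.mem_trees.1 hτ) t y
  rwa [show (H.treePacket hL lam ε φ hg τ n).label y = m from hy] at h

/-- Components of different orders lie in orthogonal chaoses, and profiles of different labels
have different momenta. -/
theorem integral_profileSolution_mul_conj_eq_zero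
    (hg_law : ∀ m, P.map ((g m : Lp ℂ 2 P) : Ω → ℂ) = stdComplexGaussian)
    (hg_indep : iIndepFun (fun m => ((g m : Lp ℂ 2 P) : Ω → ℂ)) P) {n n' : ℕ} {m m' : Fin d → ℤ}
    (h : (n, m) ≠ (n', m')) (t t' : ℝ) (x x' : EuclideanSpace ℝ (Fin d)) :
    ∫ ω, (H.profileSolution hL lam ε φ hg m t x n : Lp ℂ 2 P) ω *
      (starRingEnd ℂ) ((H.profileSolution hL lam ε φ hg m' t' x' n' : Lp ℂ 2 P) ω) ∂P = 0 := by
  have h1 : inner ℂ (H.profileSolution hL lam ε φ hg m' t' x' n' : Lp ℂ 2 P)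
      (H.profileSolution hL lam ε φ hg m t x n : Lp ℂ 2 P) = 0 := by
    by_cases hn : n' = n
    · subst hn
      have hm : m' ≠ m := fun e => h (by rw [e])
      exact H.inner_eq_zero_of_momentum g hg_law hg_indep hm
        (H.profileSolution_mem_momentumSpace hL lam ε φ hg m' t' x' n')
        (H.profileSolution_mem_momentumSpace hL lam ε φ hg m t x n')
    · exact H.inner_eq_zero_of_ne hn (Subtype.coe_prop _) (Subtype.coe_prop _)
  rw [L2.inner_def] at h1
  exact h1

theorem _root_.IsProfileSolution.isCubicFlow {A : (Fin d → ℤ) → ℝ → EuclideanSpace ℝ (Fin d) → H.Formal}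
    (hA : IsProfileSolution H lam L ε φ g A) :
    H.IsCubicFlow (Q := Triad) (fun _ q => q.1.1) (fun _ q => q.1.2.1) (fun _ q => q.1.2.2)
      (fun _ q t => -(lam / L ^ d : ℂ) * phase (t * resonance (wavenumber L q.1.1)
        (wavenumber L q.1.2.1) (wavenumber L q.1.2.2)))
      (fun m => ε • wavenumber L m) (ε ^ 2 / (4 * Real.pi)) A where
  smooth m n := ⟨hA.differentiable m n, (hA.regular n).1 m⟩
  bounded n := (hA.regular n).2
  equation m t x n := by
    rw [← profileOp_apply]
    exact Pi.hasSum.1 (hA.equation m t x) n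

/-- The order-zero data vanish because the `g m` are centered, and a triad is determined by its
three lattice points, so uniqueness for cubic hierarchies applies. -/
theorem _root_.IsProfileSolution.unique {A B : (Fin d → ℤ) → ℝ → EuclideanSpace ℝ (Fin d) → H.Formal}
    (hA : IsProfileSolution H lam L ε φ g A) (hB : IsProfileSolution H lam L ε φ g B) : A = B := by
  refine (hA.isCubicFlow H lam ε φ).unique (hB.isCubicFlow H lam ε φ) (fun m x => ?_)
    (fun m x => by rw [hA.initial, hB.initial]) (M := ‖(lam / L ^ d : ℂ)‖) (fun m q t => ?_) ?_
  · rw [hA.initial, Pi.smul_apply, ofFirst, Pi.single_eq_of_ne zero_ne_one, smul_zero]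
  · rw [norm_mul, norm_phase, mul_one, norm_neg]
  · rintro ⟨m, q, hq⟩ ⟨m', q', hq'⟩ h
    obtain rfl : q = q' := h
    subst hq hq'
    rfl

end GaussianHilbertSpace

/-! ### The Wick nonlinear Schrödinger equation -/

namespace GaussianHilbertSpace

variable {Ω : Type*} [MeasurableSpace Ω] {P : Measure Ω} [IsProbabilityMeasure P]

variable (H : GaussianHilbertSpace P) {d : ℕ} {L : ℝ} (hL : 0 < L) (lam ε : ℝ)
  (φ : 𝓢(EuclideanSpace ℝ (Fin d) × EuclideanSpace ℝ (Fin d), ℂ))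
  {g : (Fin d → ℤ) → H.chaos 1} (hg : ∀ m, ‖g m‖ ≤ 1)

/-- The field is the wavepacket superposition of the profiles, up to the factor `L ^ (-d / 2)`. -/
theorem hasSum_fieldSolution (t : ℝ) (x : EuclideanSpace ℝ (Fin d)) :
    HasSum (fun m : Fin d → ℤ =>
      phase (inner ℝ (wavenumber L m) x - ‖wavenumber L m‖ ^ 2 * t / 2) •
        H.profileSolution hL lam ε φ hg m t (ε • x)) (H.fieldSolution hL lam ε φ hg t x) := by
  rw [Pi.hasSum]
  intro n
  have h := hasSum_sum (s := InteractionTree.trees n) fun τ _ =>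
    (H.treePacket hL lam ε φ hg τ n).hasSum_field ε t x
  refine h.congr_fun fun m => ?_
  rw [Pi.smul_apply, profileSolution, Finset.smul_sum]

theorem exists_bound_fieldSolution (n j : ℕ) (T : ℝ) : ∃ C : ℝ, ∀ t x, |t| ≤ T →
    ‖iteratedFDeriv ℝ j (fun x => H.fieldSolution hL lam ε φ hg t x n) x‖ ≤ C := by
  choose C hC using fun τ => (H.treePacket hL lam ε φ hg τ n).exists_bound_field ε j T
  refine ⟨∑ τ ∈ InteractionTree.trees n, C τ, fun t x ht => ?_⟩
  exact (IsSmoothField.norm_iteratedFDeriv_sum_le (s := InteractionTree.trees n) (fun τ _ =>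
    (H.treePacket hL lam ε φ hg τ n).isSmoothField_field ε) j t x).trans
      (Finset.sum_le_sum fun τ _ => hC τ t x ht)

theorem schrodingerOp_field_leaf (n : ℕ) (t : ℝ) (x : EuclideanSpace ℝ (Fin d)) :
    schrodingerOp 0 (1 / (4 * Real.pi)) ((H.treePacket hL lam ε φ hg .leaf n).field ε) t x = 0 := by
  rw [Packet.schrodingerOp_field]
  refine (congrArg _ ?_).trans (smul_zero _)
  exact Packet.free_ampDeriv_wave ..

theorem schrodingerOp_field_node (τ₁ τ₂ τ₃ : InteractionTree) (n : ℕ) (t : ℝ)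
    (x : EuclideanSpace ℝ (Fin d)) :
    schrodingerOp 0 (1 / (4 * Real.pi)) ((H.treePacket hL lam ε φ hg (.node τ₁ τ₂ τ₃) n).field ε)
        t x =
      (-(lam / L ^ d : ℂ)) • H.wickRealL (τ₁.leaves + τ₂.leaves) τ₃.leaves n
        (H.wickConjL τ₁.leaves τ₂.leaves (τ₁.leaves + τ₂.leaves)
          ((H.treePacket hL lam ε φ hg τ₁ τ₁.leaves).field ε t x)
          ((H.treePacket hL lam ε φ hg τ₂ τ₂.leaves).field ε t x))
        ((H.treePacket hL lam ε φ hg τ₃ τ₃.leaves).field ε t x) := by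
  rw [Packet.schrodingerOp_field]
  have h := Packet.wave_cubic (H.treePacket hL lam ε φ hg τ₁ τ₁.leaves)
    (H.treePacket hL lam ε φ hg τ₂ τ₂.leaves) (H.treePacket hL lam ε φ hg τ₃ τ₃.leaves) ε
    (Complex.I * (lam / L ^ d)) (fun z₁ z₂ z₃ X Y Z => H.wickRealL_wickConjL_smul (n := n)
      (s := τ₁.leaves + τ₂.leaves) z₁ z₂ z₃ X Y Z) t x
  refine (congrArg _ h).trans ?_
  rw [smul_smul]
  congr 1
  linear_combination (lam / L ^ d : ℂ) * Complex.I_sq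

theorem schrodingerOp_fieldSolution (n : ℕ) (t : ℝ) (x : EuclideanSpace ℝ (Fin d)) :
    schrodingerOp 0 (1 / (4 * Real.pi)) (fun t x => H.fieldSolution hL lam ε φ hg t x n) t x =
      (-(lam / L ^ d : ℂ)) • H.wick (H.wick (H.fieldSolution hL lam ε φ hg t x)
        (H.conj (H.fieldSolution hL lam ε φ hg t x))) (H.fieldSolution hL lam ε φ hg t x) n := by
  have h1 := IsSmoothField.schrodingerOp_sum (b := 0)
    (c := 1 / (4 * Real.pi)) (s := InteractionTree.trees n)
    (fun τ _ => (H.treePacket hL lam ε φ hg τ n).isSmoothField_field ε) t x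
  rw [InteractionTree.sum_trees, schrodingerOp_field_leaf, ite_self, zero_add] at h1
  have h3 := H.cubic_sum_trees
    (fun n τ => (H.treePacket hL lam ε φ hg τ n).field ε t x)
    (fun n τ => (H.treePacket hL lam ε φ hg τ n).field ε t x)
    (fun n τ => (H.treePacket hL lam ε φ hg τ n).field ε t x) n
  refine h1.trans ((congrArg _ h3).trans ?_).symm
  simp only [Finset.smul_sum, schrodingerOp_field_node]

/-- Homogeneity of the Wick cubic nonlinearity. -/
theorem wick_wick_conj_smul (z : ℂ) (X : H.Formal) :
    H.wick (H.wick (z • X) (H.conj (z • X))) (z • X) =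
      (z * (starRingEnd ℂ) z * z) • H.wick (H.wick X (H.conj X)) X := by
  funext n
  rw [Pi.smul_apply, wick_wick_conj_apply, wick_wick_conj_apply, Finset.smul_sum]
  refine Finset.sum_congr rfl fun sc _ => ?_
  rw [Finset.smul_sum]
  refine Finset.sum_congr rfl fun ab _ => ?_
  exact H.wickRealL_wickConjL_smul z z z (X ab.1) (X ab.2) (X sc.2)

/-- The solution of the Wick NLS: the normalized superposition of all waves. -/
noncomputable def nlsSolution (t : ℝ) (x : EuclideanSpace ℝ (Fin d)) : H.Formal :=
  ((1 / L ^ ((d : ℝ) / 2) : ℝ) : ℂ) • H.fieldSolution hL lam ε φ hg t x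

theorem isWavepacketSum_nlsSolution :
    IsWavepacketSum H L ε (H.profileSolution hL lam ε φ hg) (H.nlsSolution hL lam ε φ hg) := by
  intro t x
  have h := (H.hasSum_fieldSolution hL lam ε φ hg t x).const_smul
    ((1 / L ^ ((d : ℝ) / 2) : ℝ) : ℂ)
  simp only [smul_smul] at h
  exact h

theorem isWickNLSSolution_nlsSolution :
    IsWickNLSSolution H lam L ε φ g (H.nlsSolution hL lam ε φ hg) where
  initial x := by
    refine (H.isWavepacketSum_nlsSolution hL lam ε φ hg 0 x).congr_fun fun m => ?_
    rw [profileSolution_zero, smul_smul]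
    have h : initialAmplitude φ ε (ε • x) (wavenumber L m) = φ (ε • x, wavenumber L m) := by
      unfold initialAmplitude
      split_ifs with h
      · rw [h, zero_smul]
      · rfl
    rw [h]
    simp only [mul_zero, zero_div, sub_zero]
    congr 1
    ring
  differentiable n :=
    ((H.isSmoothField_fieldSolution hL lam ε φ hg n).smul _).differentiable
  equation t x n := by
    have h1 := (H.isSmoothField_fieldSolution hL lam ε φ hg n).schrodingerOp_smul (b := 0)
      (c := 1 / (4 * Real.pi)) ((1 / L ^ ((d : ℝ) / 2) : ℝ) : ℂ) t x
    rw [schrodingerOp_fieldSolution, schrodingerOp, map_zero, smul_zero, add_zero] at h1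
    rw [Pi.smul_apply, nlsSolution, wick_wick_conj_smul, Pi.smul_apply, smul_smul]
    rw [smul_smul] at h1
    -- the square of the normalization is the coupling factor `L⁻ᵈ` of the profile system
    have hs : ((1 / L ^ ((d : ℝ) / 2) : ℝ) : ℂ) * (1 / L ^ ((d : ℝ) / 2) : ℝ) = 1 / (L : ℂ) ^ d := by
      rw [← Complex.ofReal_mul, div_mul_div_comm, one_mul, ← Real.rpow_add hL, add_halves,
        Real.rpow_natCast]
      push_cast
      rfl
    rw [Complex.conj_ofReal, hs]
    have hc : ((1 / (4 * Real.pi) : ℝ) : ℂ) = 1 / (4 * Real.pi) := by push_cast; rfl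
    rw [hc] at h1
    refine h1.trans ?_
    congr 1
    ring
  regular n := by
    have h := H.isSmoothField_fieldSolution hL lam ε φ hg n
    refine ⟨(h.smul _).contDiff, fun j T => ?_⟩
    obtain ⟨C, hC⟩ := H.exists_bound_fieldSolution hL lam ε φ hg n j T
    refine ⟨‖((1 / L ^ ((d : ℝ) / 2) : ℝ) : ℂ)‖ * C, fun t x ht => ?_⟩
    exact (h.norm_iteratedFDeriv_smul_le _ j t x).trans
      (mul_le_mul_of_nonneg_left (hC t x ht) (norm_nonneg _))

theorem _root_.IsWickNLSSolution.isCubicFlow {u : ℝ → EuclideanSpace ℝ (Fin d) → H.Formal}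
    (hu : IsWickNLSSolution H lam L ε φ g u) :
    H.IsCubicFlow (K := Unit) (Q := fun _ => Unit) (fun _ _ => ()) (fun _ _ => ()) (fun _ _ => ())
      (fun _ _ _ => -(lam : ℂ)) (fun _ => 0) (1 / (4 * Real.pi)) (fun _ => u) where
  smooth _ n := ⟨hu.differentiable n, (hu.regular n).1⟩
  bounded n j T := by
    obtain ⟨C, hC⟩ := (hu.regular n).2 j T
    exact ⟨fun _ => C, Summable.of_finite, fun _ => hC⟩
  equation _ t x n := by
    have h := hu.equation t x n
    rw [schrodingerOp, map_zero, smul_zero, add_zero]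
    have hc : ((1 / (4 * Real.pi) : ℝ) : ℂ) = 1 / (4 * Real.pi) := by push_cast; rfl
    rw [hc, h]
    exact hasSum_unique _

theorem _root_.IsWickNLSSolution.unique {u v : ℝ → EuclideanSpace ℝ (Fin d) → H.Formal}
    (hu : IsWickNLSSolution H lam L ε φ g u) (hv : IsWickNLSSolution H lam L ε φ g v) : u = v := by
  refine congrFun ((hu.isCubicFlow H lam ε φ).unique (hv.isCubicFlow H lam ε φ) (fun _ x => ?_)
    (fun _ x => (hu.initial x).unique (hv.initial x)) (M := ‖(lam : ℂ)‖) (fun _ _ _ => ?_) ?_) ()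
  · refine (Pi.hasSum.1 (hu.initial x) 0).unique (hasSum_zero.congr_fun fun m => ?_)
    rw [Pi.smul_apply, ofFirst, Pi.single_eq_of_ne zero_ne_one, smul_zero]
  · rw [norm_neg]
  · rintro ⟨_, _⟩ ⟨_, _⟩ _
    rfl

end GaussianHilbertSpace

theorem theorem1 {Ω : Type*} [MeasurableSpace Ω] (P : Measure Ω) [IsProbabilityMeasure P]
    (H : GaussianHilbertSpace P) (d : ℕ) (hd : 1 ≤ d) (lam L ε : ℝ)
    (hlam : 0 < lam) (hL : 0 < L) (hε : 0 ≤ ε)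
    (φ : 𝓢(EuclideanSpace ℝ (Fin d) × EuclideanSpace ℝ (Fin d), ℂ))
    (g : (Fin d → ℤ) → H.chaos 1)
    (hg_law : ∀ m, P.map ((g m : Lp ℂ 2 P) : Ω → ℂ) = stdComplexGaussian)
    (hg_indep : iIndepFun (fun m => ((g m : Lp ℂ 2 P) : Ω → ℂ)) P) :
    ∃ A : (Fin d → ℤ) → ℝ → EuclideanSpace ℝ (Fin d) → H.Formal,
      IsProfileSolution H lam L ε φ g A ∧
      (∀ B, IsProfileSolution H lam L ε φ g B → B = A) ∧
      (∀ m n t x, A m t x (2 * n) = 0) ∧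
      (∀ n m n' m', (n, m) ≠ (n', m') → ∀ t t' x x',
        ∫ ω, (A m t x n : Lp ℂ 2 P) ω *
          (starRingEnd ℂ) ((A m' t' x' n' : Lp ℂ 2 P) ω) ∂P = 0) ∧
      ∃ u : ℝ → EuclideanSpace ℝ (Fin d) → H.Formal,
        IsWavepacketSum H L ε A u ∧
        IsWickNLSSolution H lam L ε φ g u ∧
        ∀ v, IsWickNLSSolution H lam L ε φ g v → v = u := by
  have hg : ∀ m, ‖g m‖ ≤ 1 := fun m =>
    ((H.orthonormal_gaussianFamily g hg_law hg_indep).1 (m, false)).le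
  have hA := H.isProfileSolution_profileSolution hL lam ε φ hg
  have hu := H.isWickNLSSolution_nlsSolution hL lam ε φ hg
  exact ⟨H.profileSolution hL lam ε φ hg, hA, fun B hB => hB.unique H lam ε φ hA,
    fun m n t x => H.profileSolution_even hL lam ε φ hg m n t x,
    fun n m n' m' h t t' x x' =>
      H.integral_profileSolution_mul_conj_eq_zero hL lam ε φ hg hg_law hg_indep h t t' x x',
    H.nlsSolution hL lam ε φ hg, H.isWavepacketSum_nlsSolution hL lam ε φ hg, hu,
    fun v hv => hv.unique H lam ε φ hu⟩
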